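/- Conventions. Let $R$ be a commutative ring. Graded modules are $\mathbb Z$-graded, differentials have degree $-1$, the Koszul sign rule is used throughout, $\tau$ is the Koszul-signed symmetry, and $(s^{r}M)_k=M_{k-r}$. A coaugmented DG-coalgebra $(C,d,\nabla_C,\epsilon,\eta)$ has reduced coalgebra $\overline C=\ker\epsilon$ with reduced coproduct $\overline\nabla(c)=\nabla_C(c)-c\otimes1-1\otimes c$. It is *connected* if $C_k=0$ for $k<0$ and $C_0=R$, and *$i$-reduced* if moreover $C_k=0$ for $1\le k\le i$; connected algebras are defined in the same way. The cobar construction is the augmented DG-algebra $\Omega C=T(\widetilde C)$, $\widetilde C=s^{-1}\overline C$, whose differential is the derivation with $d_\Omega(s^{-1}c)=-s^{-1}dc+\sum(-1)^{|c^1|}s^{-1}c^1\otimes s^{-1}c^2$, where $\overline\nabla(c)=\sum c^1\otimes c^2$. A *homotopy G-coalgebra* is a $1$-reduced coaugmented DG-coalgebra $C$ together with a coproduct $\nabla:\Omega C\to\Omega C\otimes\Omega C$ making $\Omega C$ a coassociative counital DG-bialgebra, such that the components $E^{p,q}:\widetilde C\to\widetilde C^{\otimes p}\otimes\widetilde C^{\otimes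 q}$ ($p,q\ge1$) of $\nabla$ vanish for $q\ge2$. Put $F^1=-\mathrm{id}_{\widetilde C}$ and, for $m\ge2$, $$F^m=\sum_{\substack{1\le s\le m-1\\ n_1+\dots+n_s=m-1,\ n_j\ge1}}(-1)^{s+1}(1^{\otimes n_1+\dots+n_{s-1}}\otimes E^{n_s,1})\cdots(1^{\otimes n_1}\otimes E^{n_2,1})E^{n_1,1}:\widetilde C\to\widetilde C^{\otimes m},$$ $$O_m=\sum_{s=1}^m\ \sum_{\substack{n_1+\dots+n_s=m\\ n_j\ge1}}\mu^{(s)}_{(12)}(F^{n_1}\otimes\dots\otimes F^{n_s})F^s:\widetilde C\to\widetilde C^{\otimes m}\qquad(m\ge2),$$ where $\mu^{(s)}_{(12)}$ is the $s$-fold product for the opposite multiplication $a\otimes b\mapsto(-1)^{|a||b|}ba$ of $\Omega C$. A *homotopy G-algebra* is a connected augmented DG-algebra $\Lambda$, with augmentation ideal $\overline\Lambda$, together with a product on its bar construction $\mathrm B\Lambda=T^c(s\overline\Lambda)$ (with deconcatenation, and the coderivation with components $sa\mapsto-s\,da$ and $sa\otimes sb\mapsto(-1)^{|a|+1}s(ab)$),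 which makes $\mathrm B\Lambda$ an associative DG-bialgebra with unit the empty word, and whose components $E_{p,q}(a_1,\dots,a_p;b_1,\dots,b_q)$, the projections to $s\overline\Lambda\cong\overline\Lambda$ of the products $(sa_1\otimes\dots\otimes sa_p)\cdot(sb_1\otimes\dots\otimes sb_q)$, vanish for $p\ge2$, $q\ge1$. A *homotopy BV-algebra* is a homotopy G-algebra $\Lambda$ with a linear map $\Delta:\Lambda\to\Lambda$ of degree $1$ such that $d\Delta=-\Delta d$, $\Delta^2=0$ and such that, for some linear map $H:\Lambda\otimes\Lambda\to\Lambda$ of degree $2$ and all homogeneous $a,b\in\Lambda$, $$\{a;b\}=(-1)^{|a|}\bigl(\Delta(ab)-\Delta(a)b-(-1)^{|a|}a\Delta(b)\bigr)+dH(a;b)+H(da;b)-(-1)^{|a|}H(a;db),$$ where $\{a;b\}=E_{1,1}(a;b)-(-1)^{(|a|+1)(|b|+1)}E_{1,1}(b;a)$ and $E_{1,1}$ is extended by zero when an argument lies in $R$. For a DG-bialgebra $B$, $a\in B$ and $\overline b=s^{-1}b_1\otimes\dots\otimes s^{-1}b_m\in\Omega B$, put $a\diamond\overline b=\sum\pm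 s^{-1}(a^1b_1)\otimes\dots\otimes s^{-1}(a^mb_m)$, where $\sum a^1\otimes\dots\otimes a^m$ is the iterated coproduct of $a$ and the sign is the Koszul sign of moving each $a^j$ across $s^{-1}b_1,\dots,s^{-1}b_{j-1}$ (for $m=0$: $a\diamond1=\epsilon(a)$). **Proposition.** Let $C$ be an $i$-reduced homotopy G-coalgebra, $i\ge2$, and let $n\ge0$ be an integer such that $O_k=0$ for all $k\ge2$ with $ki\le n-1$. Let $C_{\le n}\subseteq C$ be the submodule of elements of degree $\le n$. Then the homotopy G-coalgebra structure of $C$ restricts to $C_{\le n}$, the DG-bialgebra $\Omega(C_{\le n})$ has an antipode $S$ with $S^2=\mathrm{id}$, and the double cobar construction $\Omega^2(C_{\le n})=\Omega(\Omega(C_{\le n}))$ is a homotopy BV-algebra. More precisely, with $B=\Omega(C_{\le n})$, it is a homotopy BV-algebra for the operations $$E_{1,k}(s^{-1}a_1\otimes\dots\otimes s^{-1}a_m;\overline b_1,\dots,\overline b_k)=\sum_{1\le i_1<\dots<i_k\le m}\pm\, s^{-1}a_1\otimes\dots\otimes(a_{i_1}\diamond\overline b_1)\otimes\dots\otimes(a_{i_k}\diamond\overline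 b_k)\otimes\dots\otimes s^{-1}a_m,$$ the sign being the Koszul sign of moving each $s\overline b_j$ across the $s^{-1}a_l$ with $l>i_j$, and for the Connes–Moscovici operator $$\Delta(s^{-1}a_1\otimes\dots\otimes s^{-1}a_m)=\sum_{k=1}^{m}\pm\,(-1)^{|a_k|}\,S(a_k)\diamond\bigl(s^{-1}a_{k+1}\otimes\dots\otimes s^{-1}a_m\otimes s^{-1}a_1\otimes\dots\otimes s^{-1}a_{k-1}\bigr),$$ the sign $\pm$ being the Koszul sign of the cyclic permutation of the $s^{-1}a_j$. -/

import Mathlib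

open scoped TensorProduct DirectSum

universe u v

noncomputable section

namespace DoubleCobar

/-! ### Graded modules and Koszul signs

A graded `R`-module is a module `M` with a family of submodules `𝒜 : ℤ → Submodule R M` and a
`DirectSum.Decomposition 𝒜`. -/

section Graded

variable {R : Type*} [CommRing R]
variable {M : Type*} [AddCommGroup M] [Module R M]
variable {N : Type*} [AddCommGroup N] [Module R N]
variable {P : Type*} [AddCommGroup P] [Module R P]
variable {Q : Type*} [AddCommGroup Q] [Module R Q]
variable (𝒜 : ℤ → Submodule R M) [DirectSum.Decomposition 𝒜]
variable (ℬ : ℤ → Submodule R N) [DirectSum.Decomposition ℬ]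

/-- The sign operator `x ↦ (-1)^|x| x`. -/
def parity : M →ₗ[R] M :=
  DirectSum.toModule R ℤ M (fun k => ((Int.negOnePow k : ℤˣ) : ℤ) • (𝒜 k).subtype) ∘ₗ
    (DirectSum.decomposeLinearEquiv 𝒜).toLinearMap

theorem parity_of_mem {k : ℤ} {x : M} (hx : x ∈ 𝒜 k) :
    parity 𝒜 x = ((Int.negOnePow k : ℤˣ) : ℤ) • x := by
  simp only [parity, LinearMap.comp_apply, LinearEquiv.coe_coe,
    DirectSum.decomposeLinearEquiv_apply, DirectSum.decompose_of_mem 𝒜 hx,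
    ← DirectSum.lof_eq_of R, DirectSum.toModule_lof]
  rfl

/-- The Koszul symmetry `x ⊗ y ↦ (-1)^(|x||y|) y ⊗ x`. -/
def koszulSwap : M ⊗[R] N →ₗ[R] N ⊗[R] M :=
  (TensorProduct.congr (DirectSum.decomposeLinearEquiv ℬ)
      (DirectSum.decomposeLinearEquiv 𝒜)).symm.toLinearMap ∘ₗ
    (TensorProduct.gradedComm R (fun k => 𝒜 k) (fun k => ℬ k)).toLinearMap ∘ₗ
    (TensorProduct.congr (DirectSum.decomposeLinearEquiv 𝒜)
      (DirectSum.decomposeLinearEquiv ℬ)).toLinearMap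

theorem koszulSwap_of_mem {p q : ℤ} {x : M} {y : N} (hx : x ∈ 𝒜 p) (hy : y ∈ ℬ q) :
    koszulSwap 𝒜 ℬ (x ⊗ₜ[R] y) = ((-1 : ℤˣ) ^ (q * p) : ℤˣ) • (y ⊗ₜ[R] x) := by
  simp only [koszulSwap, LinearMap.comp_apply, LinearEquiv.coe_coe, TensorProduct.congr_tmul,
    DirectSum.decomposeLinearEquiv_apply, DirectSum.decompose_of_mem 𝒜 hx,
    DirectSum.decompose_of_mem ℬ hy, ← DirectSum.lof_eq_of R]
  rw [TensorProduct.gradedComm_of_tmul_of]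
  rw [@Units.smul_def _ _ (_) (_), ← Int.cast_smul_eq_zsmul R, LinearEquiv.map_smul,
    Int.cast_smul_eq_zsmul R, ← @Units.smul_def _ _ (_) (_)]
  simp only [TensorProduct.congr_symm_tmul, DirectSum.lof_eq_of,
    DirectSum.decomposeLinearEquiv_symm_apply, DirectSum.decompose_symm_of]

/-- The Koszul sign `x ⊗ y ↦ (-1)^(|x||y|) x ⊗ y`. -/
def koszulSign : M ⊗[R] N →ₗ[R] M ⊗[R] N :=
  (TensorProduct.comm R N M).toLinearMap ∘ₗ koszulSwap 𝒜 ℬ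

/-- `m ⊗ x ⊗ y ⊗ n ↦ (-1)^(|x||y|) m ⊗ y ⊗ x ⊗ n`. -/
def middleSwap : (P ⊗[R] M) ⊗[R] (N ⊗[R] Q) →ₗ[R] (P ⊗[R] N) ⊗[R] (M ⊗[R] Q) :=
  (TensorProduct.assoc R P N (M ⊗[R] Q)).symm.toLinearMap ∘ₗ
    (((TensorProduct.assoc R N M Q).toLinearMap ∘ₗ
      (koszulSwap 𝒜 ℬ).rTensor Q ∘ₗ
      (TensorProduct.assoc R M N Q).symm.toLinearMap).lTensor P) ∘ₗ
    (TensorProduct.assoc R P M (N ⊗[R] Q)).toLinearMap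

/-- The degree `k` part of the tensor product of two graded modules. -/
def prodGr (𝒜 : ℤ → Submodule R M) (ℬ : ℤ → Submodule R N) (k : ℤ) :
    Submodule R (M ⊗[R] N) :=
  ⨆ p : ℤ, LinearMap.range (TensorProduct.map (𝒜 p).subtype (ℬ (k - p)).subtype)

/-- The suspension `s^r`: an element of degree `k` of `M` has degree `k + r` in `s^r M`. -/
def shiftGr (𝒜 : ℤ → Submodule R M) (r : ℤ) (k : ℤ) : Submodule R M := 𝒜 (k - r)

instance shiftDecomposition (r : ℤ) : DirectSum.Decomposition (shiftGr 𝒜 r) :=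
  DirectSum.Decomposition.ofLinearMap (shiftGr 𝒜 r)
    (DirectSum.toModule R ℤ _ (fun k =>
        DirectSum.lof R ℤ (fun j => shiftGr 𝒜 r j) (k + r) ∘ₗ
          Submodule.inclusion (le_of_eq (by simp [shiftGr]))) ∘ₗ
      (DirectSum.decomposeLinearEquiv 𝒜).toLinearMap)
    (by
      refine DirectSum.decompose_lhom_ext 𝒜 fun k => ?_
      ext x
      simp [DirectSum.toModule_lof, DirectSum.coeLinearMap_lof])
    (by
      refine DirectSum.linearMap_ext R fun k => ?_
      ext1 x
      have hx : (x : M) ∈ 𝒜 (k - r) := x.2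
      simp only [LinearMap.comp_apply, DirectSum.coeLinearMap_lof, LinearEquiv.coe_coe,
        DirectSum.decomposeLinearEquiv_apply, DirectSum.decompose_of_mem 𝒜 hx,
        ← DirectSum.lof_eq_of R, DirectSum.toModule_lof, LinearMap.id_apply]
      simp only [DirectSum.lof_eq_of]
      exact DirectSum.of_eq_of_gradedMonoid_eq
        (Sigma.subtype_ext (show k - r + r = k by ring) rfl))

/-- A homogeneous submodule is graded by its intersections with the graded pieces. -/
theorem sub_isInternal (S : Submodule R M)
    (hS : ∀ x ∈ S, ∀ k : ℤ, (DirectSum.decompose 𝒜 x k : M) ∈ S) :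
    DirectSum.IsInternal (fun k => (𝒜 k).comap S.subtype) := by
  constructor
  · intro x y hxy
    ext k
    have key : ∀ z : (⨁ k, ((𝒜 k).comap S.subtype : Submodule R S)), ∀ k,
        ((z k : S) : M) = (DirectSum.decompose 𝒜
          ((DirectSum.coeAddMonoidHom (fun k => (𝒜 k).comap S.subtype) z : S) : M) k : M) := by
      intro z k
      induction z using DirectSum.induction_on with
      | zero => simp
      | of i z =>
        have hz : ((z : S) : M) ∈ 𝒜 i := z.2
        rw [DirectSum.coeAddMonoidHom_of, DirectSum.decompose_of_mem 𝒜 hz]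
        by_cases h : i = k
        · subst h; simp
        · rw [DirectSum.of_eq_of_ne _ _ _ (Ne.symm h), DirectSum.of_eq_of_ne _ _ _ (Ne.symm h)]; rfl
      | add z w hz hw =>
        rw [map_add, Submodule.coe_add, DirectSum.decompose_add, DirectSum.add_apply,
          DirectSum.add_apply, Submodule.coe_add, Submodule.coe_add, Submodule.coe_add, hz, hw]
    rw [key x k, key y k, hxy]
  · intro x
    classical
    refine ⟨∑ k ∈ (DirectSum.decompose 𝒜 (x : M)).support,
      DirectSum.of (fun k => ((𝒜 k).comap S.subtype : Submodule R S)) k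
        ⟨⟨DirectSum.decompose 𝒜 (x : M) k, hS x x.2 k⟩, (DirectSum.decompose 𝒜 (x : M) k).2⟩, ?_⟩
    rw [map_sum]
    simp only [DirectSum.coeAddMonoidHom_of]
    apply Subtype.ext
    rw [AddSubmonoidClass.coe_finsetSum]
    exact DirectSum.sum_support_decompose 𝒜 (x : M)

/-- The grading of a homogeneous submodule. -/
@[reducible]
def subDecomposition (S : Submodule R M)
    (hS : ∀ x ∈ S, ∀ k : ℤ, (DirectSum.decompose 𝒜 x k : M) ∈ S) :
    DirectSum.Decomposition (fun k => (𝒜 k).comap S.subtype) :=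
  (sub_isInternal 𝒜 S hS).chooseDecomposition

theorem ker_homogeneous (φ : M →ₗ[R] R) (hφ : ∀ k : ℤ, k ≠ 0 → ∀ x ∈ 𝒜 k, φ x = 0) :
    ∀ x ∈ LinearMap.ker φ, ∀ k : ℤ, (DirectSum.decompose 𝒜 x k : M) ∈ LinearMap.ker φ := by
  classical
  intro x hx k
  have h0 : ∀ j : ℤ, j ≠ 0 → φ (DirectSum.decompose 𝒜 x j : M) = 0 :=
    fun j hj => hφ j hj _ (DirectSum.decompose 𝒜 x j).2
  by_cases hk : k = 0
  · subst hk
    have h1 : φ x = φ (DirectSum.decompose 𝒜 x 0 : M) := by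
      conv_lhs => rw [← DirectSum.sum_support_decompose 𝒜 x, map_sum]
      apply Finset.sum_eq_single (0 : ℤ)
      · intro j _ hj
        exact h0 j hj
      · intro h
        simp only [DFinsupp.mem_support_toFun, not_not] at h
        simp [h]
    rw [LinearMap.mem_ker, ← h1]
    exact hx
  · exact h0 k hk

end Graded

/-! ### Tensor algebras of graded modules -/

section Tensor

variable {R : Type*} [CommRing R]
variable {M : Type*} [AddCommGroup M] [Module R M]
variable (𝒜 : ℤ → Submodule R M)

/-- The degree `k` part of `T(M)`: the span of the words `x₁ ⋯ x_m` in homogeneous letters whose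
degrees add up to `k`. -/
def tensorGr (k : ℤ) : Submodule R (TensorAlgebra R M) :=
  Submodule.span R
    { t | ∃ l : List (ℤ × M), (∀ p ∈ l, p.2 ∈ 𝒜 p.1) ∧ (l.map Prod.fst).sum = k ∧
        (l.map fun p : ℤ × M => TensorAlgebra.ι R p.2).prod = t }

theorem ι_mem_tensorGr {k : ℤ} {x : M} (hx : x ∈ 𝒜 k) : TensorAlgebra.ι R x ∈ tensorGr 𝒜 k :=
  Submodule.subset_span ⟨[(k, x)], by simpa using hx, by simp, by simp⟩

instance tensorGradedMonoid : SetLike.GradedMonoid (tensorGr (R := R) 𝒜) where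
  one_mem := Submodule.subset_span ⟨[], by simp, by simp, by simp⟩
  mul_mem := by
    intro i j x y hx hy
    induction hx, hy using Submodule.span_induction₂ with
    | mem_mem x y hx hy =>
      obtain ⟨l, h1, h2, rfl⟩ := hx
      obtain ⟨l', h1', h2', rfl⟩ := hy
      refine Submodule.subset_span ⟨l ++ l', ?_, by simp [h2, h2'], by simp⟩
      intro p hp
      rcases List.mem_append.1 hp with h | h
      exacts [h1 p h, h1' p h]
    | zero_left => simp
    | zero_right => simp
    | add_left x y z _ _ _ h1 h2 => rw [add_mul]; exact add_mem h1 h2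
    | add_right x y z _ _ _ h1 h2 => rw [mul_add]; exact add_mem h1 h2
    | smul_left r x y _ _ h => rw [smul_mul_assoc]; exact Submodule.smul_mem _ _ h
    | smul_right r x y _ _ h => rw [mul_smul_comm]; exact Submodule.smul_mem _ _ h

theorem algebraMapInv_tensorGr {k : ℤ} (hk : k ≠ 0) {t : TensorAlgebra R M}
    (ht : t ∈ tensorGr 𝒜 k) : TensorAlgebra.algebraMapInv t = (0 : R) := by
  induction ht using Submodule.span_induction with
  | mem t h =>
    obtain ⟨l, h1, h2, rfl⟩ := h
    cases l with
    | nil => exact absurd h2.symm hk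
    | cons p l => simp [TensorAlgebra.algebraMapInv]
  | zero => simp
  | add x y _ _ h1 h2 => rw [map_add, h1, h2, add_zero]
  | smul r x _ h => rw [map_smul, h, smul_zero]

variable [DirectSum.Decomposition 𝒜]

/-- The inclusion of the generators, landing in the direct sum of the graded pieces. -/
def gradedι : M →ₗ[R] ⨁ k, tensorGr 𝒜 k :=
  DirectSum.toModule R ℤ _ (fun k =>
      DirectSum.lof R ℤ (fun j => tensorGr 𝒜 j) k ∘ₗ
        ((TensorAlgebra.ι R ∘ₗ (𝒜 k).subtype).codRestrict (tensorGr 𝒜 k)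
          fun x => ι_mem_tensorGr 𝒜 x.2)) ∘ₗ
    (DirectSum.decomposeLinearEquiv 𝒜).toLinearMap

theorem gradedι_of_mem {k : ℤ} {x : M} (hx : x ∈ 𝒜 k) :
    gradedι 𝒜 x = DirectSum.of (fun j => tensorGr 𝒜 j) k
      ⟨TensorAlgebra.ι R x, ι_mem_tensorGr 𝒜 hx⟩ := by
  simp only [gradedι, LinearMap.comp_apply, LinearEquiv.coe_coe,
    DirectSum.decomposeLinearEquiv_apply, DirectSum.decompose_of_mem 𝒜 hx,
    ← DirectSum.lof_eq_of R, DirectSum.toModule_lof]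
  rfl

theorem lift_gradedι_word (l : List (ℤ × M)) (h1 : ∀ p ∈ l, p.2 ∈ 𝒜 p.1)
    (hm : ∃ l' : List (ℤ × M), (∀ p ∈ l', p.2 ∈ 𝒜 p.1) ∧
      (l'.map Prod.fst).sum = (l.map Prod.fst).sum ∧
      (l'.map fun p => TensorAlgebra.ι R p.2).prod = (l.map fun p : ℤ × M => TensorAlgebra.ι R p.2).prod) :
    TensorAlgebra.lift R (gradedι 𝒜) (l.map fun p : ℤ × M => TensorAlgebra.ι R p.2).prod =
      DirectSum.of (fun j => tensorGr (R := R) 𝒜 j) (l.map Prod.fst).sum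
        ⟨(l.map fun p : ℤ × M => TensorAlgebra.ι R p.2).prod, Submodule.subset_span hm⟩ := by
  induction l with
  | nil =>
    simp only [List.map_nil, List.prod_nil, map_one]
    rfl
  | cons p l ih =>
    have hl : ∀ q ∈ l, q.2 ∈ 𝒜 q.1 := fun q hq => h1 q (by simp [hq])
    have hp : p.2 ∈ 𝒜 p.1 := h1 p (by simp)
    simp only [List.map_cons, List.prod_cons, map_mul, TensorAlgebra.lift_ι_apply]
    rw [ih hl ⟨l, hl, rfl, rfl⟩, gradedι_of_mem 𝒜 hp, DirectSum.of_mul_of]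
    exact DirectSum.of_eq_of_gradedMonoid_eq (Sigma.subtype_ext
      (show p.1 + (l.map Prod.fst).sum = ((p :: l).map Prod.fst).sum by simp) rfl)

/-- The tensor algebra of a graded module is graded by total degree. -/
instance tensorGradedAlgebra : GradedAlgebra (tensorGr (R := R) 𝒜) :=
  GradedAlgebra.ofAlgHom _ (TensorAlgebra.lift R (gradedι 𝒜))
    (by
      apply TensorAlgebra.hom_ext
      refine DirectSum.decompose_lhom_ext 𝒜 fun k => ?_
      ext x
      simp [gradedι_of_mem 𝒜 x.2])
    (by
      rintro k ⟨t, ht⟩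
      have key : ∀ t, ∀ ht : t ∈ tensorGr 𝒜 k, TensorAlgebra.lift R (gradedι 𝒜) t =
          DirectSum.of (fun j => tensorGr 𝒜 j) k ⟨t, ht⟩ := by
        intro t ht
        induction ht using Submodule.span_induction with
        | mem t h =>
          obtain ⟨l, h1, h2, h3⟩ := h
          have h4 := lift_gradedι_word 𝒜 l h1 ⟨l, h1, rfl, rfl⟩
          subst h2
          subst h3
          exact h4
        | zero => rw [map_zero]; exact (map_zero _).symm
        | add x y hx hy h1 h2 => rw [map_add, h1, h2, ← map_add]; rfl
        | smul r x hx h =>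
          rw [map_smul, h, ← DirectSum.lof_eq_of R, ← map_smul]; rfl
      exact key t ht)

/-- The step `(t, z) ↦ (x t, 1 ⊗ x t + (x ⊗ 1) z)` of the recursion defining `deconc`. -/
def deconcStep (R M : Type*) [CommRing R] [AddCommGroup M] [Module R M] :
    M →ₗ[R] Module.End R
      (TensorAlgebra R M × (TensorAlgebra R M ⊗[R] TensorAlgebra R M)) where
  toFun x :=
    LinearMap.prod
      (LinearMap.mulLeft R (TensorAlgebra.ι R x) ∘ₗ LinearMap.fst R _ _)
      (TensorProduct.mk R _ _ 1 ∘ₗ LinearMap.mulLeft R (TensorAlgebra.ι R x) ∘ₗ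
          LinearMap.fst R _ _ +
        (LinearMap.mulLeft R (TensorAlgebra.ι R x)).rTensor (TensorAlgebra R M) ∘ₗ
          LinearMap.snd R _ _)
  map_add' x y := by
    ext <;> simp [add_mul, TensorProduct.add_tmul, TensorProduct.tmul_add]
  map_smul' r x := by
    ext <;> simp [TensorProduct.smul_tmul']

/-- The deconcatenation coproduct of `T(M)`, namely
`x₁ ⋯ x_n ↦ ∑_j (x₁ ⋯ x_j) ⊗ (x_{j+1} ⋯ x_n)`. It is built from the recursion
`δ 1 = 1 ⊗ 1`, `δ (x t) = 1 ⊗ x t + (x ⊗ 1) δ t`, see `deconc_one` and `deconc_ι_mul`. -/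
def deconc (R M : Type*) [CommRing R] [AddCommGroup M] [Module R M] :
    TensorAlgebra R M →ₗ[R] TensorAlgebra R M ⊗[R] TensorAlgebra R M :=
  LinearMap.snd R (TensorAlgebra R M) (TensorAlgebra R M ⊗[R] TensorAlgebra R M) ∘ₗ
    LinearMap.applyₗ
      ((1, 1 ⊗ₜ[R] 1) : TensorAlgebra R M × (TensorAlgebra R M ⊗[R] TensorAlgebra R M)) ∘ₗ
    (TensorAlgebra.lift R (deconcStep R M)).toLinearMap

theorem deconcStep_snd {R M : Type*} [CommRing R] [AddCommGroup M] [Module R M] (x : M)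
    (w : TensorAlgebra R M × (TensorAlgebra R M ⊗[R] TensorAlgebra R M)) :
    (deconcStep R M x w).2 = 1 ⊗ₜ[R] (TensorAlgebra.ι R x * w.1) +
      (LinearMap.mulLeft R (TensorAlgebra.ι R x)).rTensor _ w.2 := rfl

theorem deconc_one {R M : Type*} [CommRing R] [AddCommGroup M] [Module R M] :
    deconc R M 1 = 1 ⊗ₜ[R] 1 := by
  simp [deconc]

theorem lift_deconcStep_fst {R M : Type*} [CommRing R] [AddCommGroup M] [Module R M]
    (t : TensorAlgebra R M) :
    ((TensorAlgebra.lift R (deconcStep R M)) t (1, 1 ⊗ₜ[R] 1)).1 = t := by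
  have : ∀ w, ((TensorAlgebra.lift R (deconcStep R M)) t w).1 = t * w.1 := by
    induction t using TensorAlgebra.induction with
    | algebraMap r => intro w; simp [Algebra.smul_def]
    | ι x => intro w; simp [deconcStep]
    | mul a b ha hb => intro w; simp [ha, hb, mul_assoc]
    | add a b ha hb => intro w; simp [ha, hb, add_mul]
  simpa using this (1, 1 ⊗ₜ[R] 1)

theorem deconc_ι_mul {R M : Type*} [CommRing R] [AddCommGroup M] [Module R M] (x : M)
    (t : TensorAlgebra R M) :
    deconc R M (TensorAlgebra.ι R x * t) = 1 ⊗ₜ[R] (TensorAlgebra.ι R x * t) +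
      (LinearMap.mulLeft R (TensorAlgebra.ι R x)).rTensor _ (deconc R M t) := by
  simp only [deconc, LinearMap.comp_apply, AlgHom.toLinearMap_apply, map_mul,
    TensorAlgebra.lift_ι_apply, LinearMap.applyₗ_apply_apply, Module.End.mul_apply,
    LinearMap.snd_apply, deconcStep_snd, lift_deconcStep_fst]

/-- The projection of `T(M)` onto the words of length `k`. -/
def weightProj (R M : Type*) [CommRing R] [AddCommGroup M] [Module R M] (k : ℕ) :
    TensorAlgebra R M →ₗ[R] TensorAlgebra R M :=
  GradedAlgebra.proj
    (fun j : ℕ => (LinearMap.range (TensorAlgebra.ι R : M →ₗ[R] TensorAlgebra R M)) ^ j) k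

/-- The upper triangular matrix `[[(-1)^|x| x, f x], [0, x]]`. -/
def derivationMatrix (f : M →ₗ[R] TensorAlgebra R M) :
    M →ₗ[R] Matrix (Fin 2) (Fin 2) (TensorAlgebra R M) where
  toFun x := !![TensorAlgebra.ι R (parity 𝒜 x), f x; 0, TensorAlgebra.ι R x]
  map_add' x y := by
    ext i j; fin_cases i <;> fin_cases j <;> simp
  map_smul' r x := by
    ext i j; fin_cases i <;> fin_cases j <;> simp

theorem derivationMatrix_apply (f : M →ₗ[R] TensorAlgebra R M) (x : M) :
    derivationMatrix 𝒜 f x =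
      !![TensorAlgebra.ι R (parity 𝒜 x), f x; 0, TensorAlgebra.ι R x] := rfl

/-- The unique linear map `D` on `T(M)` with `D (x t) = f(x) t + (-1)^|x| x D(t)` for `x ∈ M` and
`D 1 = 0`, i.e. the derivation of odd degree which extends `f`; see `gradedDerivation_one` and
`gradedDerivation_ι_mul`. It is the corner entry of the algebra map extending
`x ↦ [[(-1)^|x| x, f x], [0, x]]`. -/
def gradedDerivation (f : M →ₗ[R] TensorAlgebra R M) :
    TensorAlgebra R M →ₗ[R] TensorAlgebra R M where
  toFun t := TensorAlgebra.lift R (derivationMatrix 𝒜 f) t 0 1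
  map_add' x y := by simp
  map_smul' r x := by simp

theorem gradedDerivation_one (f : M →ₗ[R] TensorAlgebra R M) : gradedDerivation 𝒜 f 1 = 0 := by
  simp [gradedDerivation]

theorem gradedDerivation_ι_mul (f : M →ₗ[R] TensorAlgebra R M) (x : M) (t : TensorAlgebra R M) :
    gradedDerivation 𝒜 f (TensorAlgebra.ι R x * t) =
      f x * t + TensorAlgebra.ι R (parity 𝒜 x) * gradedDerivation 𝒜 f t := by
  have h : ∀ t, (TensorAlgebra.lift R (derivationMatrix 𝒜 f)) t 1 1 = t ∧
      (TensorAlgebra.lift R (derivationMatrix 𝒜 f)) t 1 0 = 0 := by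
    intro t
    induction t using TensorAlgebra.induction with
    | algebraMap r => simp [Matrix.algebraMap_matrix_apply]
    | ι x => simp [derivationMatrix_apply]
    | mul a b ha hb => simp [Matrix.mul_apply, ha, hb]
    | add a b ha hb => simp [ha, hb]
  simp [gradedDerivation, Matrix.mul_apply, (h t).1, derivationMatrix_apply, add_comm]

end Tensor

/-! ### Coaugmented differential graded coalgebras -/

/-- The data of a coaugmented DG-coalgebra: a graded module with a differential, a coproduct, a
counit and a coaugmentation `1 ↦ one`, where the counit is homogeneous and splits the
coaugmentation. The remaining axioms are in `DGCoalgData.IsDGCoalgebra`. -/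
structure DGCoalgData (R : Type u) [CommRing R] where
  carrier : Type v
  [acg : AddCommGroup carrier]
  [mod : Module R carrier]
  gr : ℤ → Submodule R carrier
  [dec : DirectSum.Decomposition gr]
  d : carrier →ₗ[R] carrier
  comul : carrier →ₗ[R] carrier ⊗[R] carrier
  counit : carrier →ₗ[R] R
  one : carrier
  one_mem : one ∈ gr 0
  counit_one : counit one = 1
  counit_gr : ∀ k : ℤ, k ≠ 0 → ∀ x ∈ gr k, counit x = 0

attribute [instance] DGCoalgData.acg DGCoalgData.mod DGCoalgData.dec

namespace DGCoalgData

variable {R : Type u} [CommRing R] (C : DGCoalgData.{u, v} R)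

/-- The axioms of a coaugmented (coassociative, counital) DG-coalgebra, with a differential of
degree `-1`. -/
structure IsDGCoalgebra : Prop where
  d_mem : ∀ k, ∀ x ∈ C.gr k, C.d x ∈ C.gr (k - 1)
  d_d : ∀ x, C.d (C.d x) = 0
  comul_mem : ∀ k, ∀ x ∈ C.gr k, C.comul x ∈ prodGr C.gr C.gr k
  coassoc : (TensorProduct.assoc R C.carrier C.carrier C.carrier).toLinearMap ∘ₗ
    C.comul.rTensor C.carrier ∘ₗ C.comul = C.comul.lTensor C.carrier ∘ₗ C.comul
  counit_left : ∀ x, TensorProduct.lid R C.carrier (C.counit.rTensor C.carrier (C.comul x)) = x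
  counit_right : ∀ x, TensorProduct.rid R C.carrier (C.counit.lTensor C.carrier (C.comul x)) = x
  /-- `∇ d = (d ⊗ 1 + 1 ⊗ d) ∇`, where `(1 ⊗ d)(x ⊗ y) = (-1)^|x| x ⊗ d y`. -/
  coderivation : C.comul ∘ₗ C.d =
    (TensorProduct.map C.d LinearMap.id + TensorProduct.map (parity C.gr) C.d) ∘ₗ C.comul
  counit_d : ∀ x, C.counit (C.d x) = 0
  d_one : C.d C.one = 0
  comul_one : C.comul C.one = C.one ⊗ₜ[R] C.one

/-- `C` is `i`-reduced: it is connected (`C_k = 0` for `k < 0` and `C_0 = R`) and `C_k = 0` for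
`1 ≤ k ≤ i`. -/
structure IsReduced (i : ℕ) : Prop where
  neg : ∀ k : ℤ, k < 0 → C.gr k = ⊥
  zero : C.gr 0 = Submodule.span R {C.one}
  pos : ∀ k : ℤ, 1 ≤ k → k ≤ i → C.gr k = ⊥

/-- The reduced coalgebra `ker ε`. -/
abbrev Red : Submodule R C.carrier := LinearMap.ker C.counit

theorem red_homogeneous :
    ∀ x ∈ C.Red, ∀ k : ℤ, (DirectSum.decompose C.gr x k : C.carrier) ∈ C.Red :=
  ker_homogeneous C.gr C.counit C.counit_gr

/-- The grading of `ker ε`. -/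
def redGr (k : ℤ) : Submodule R C.Red := (C.gr k).comap C.Red.subtype

instance redDecomposition : DirectSum.Decomposition C.redGr :=
  subDecomposition C.gr C.Red C.red_homogeneous

/-- The grading of the desuspension `s⁻¹ (ker ε)`. -/
abbrev sgr : ℤ → Submodule R C.Red := shiftGr C.redGr (-1)

/-- The projection `x ↦ x - ε(x) 1` onto `ker ε`. -/
def toRed : C.carrier →ₗ[R] C.Red :=
  (LinearMap.id - C.counit.smulRight C.one).codRestrict C.Red fun x => by
    simp [LinearMap.mem_ker, C.counit_one]

/-- The differential of `ker ε`. -/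
def redD : C.Red →ₗ[R] C.Red := C.toRed ∘ₗ C.d ∘ₗ C.Red.subtype

/-- The reduced coproduct `x ↦ ∇ x - x ⊗ 1 - 1 ⊗ x` of `ker ε`. -/
def redComul : C.Red →ₗ[R] C.Red ⊗[R] C.Red :=
  TensorProduct.map C.toRed C.toRed ∘ₗ C.comul ∘ₗ C.Red.subtype

/-! ### The cobar construction -/

/-- The underlying algebra `T(s⁻¹ (ker ε))` of the cobar construction. A letter `s⁻¹ c` is written
`TensorAlgebra.ι R c`; only the grading records the desuspension. -/
abbrev Cobar : Type (max u v) := TensorAlgebra R C.Red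

/-- The grading of the cobar construction. -/
abbrev cobarGr : ℤ → Submodule R C.Cobar := tensorGr C.sgr

/-- The differential of the cobar construction: the derivation with
`s⁻¹ c ↦ - s⁻¹ (d c) + ∑ (-1)^|c¹| s⁻¹ c¹ ⊗ s⁻¹ c²`, where `∑ c¹ ⊗ c²` is the reduced
coproduct. -/
def cobarD : C.Cobar →ₗ[R] C.Cobar :=
  gradedDerivation C.sgr
    (-(TensorAlgebra.ι R ∘ₗ C.redD) +
      LinearMap.mul' R C.Cobar ∘ₗ
        TensorProduct.map (TensorAlgebra.ι R ∘ₗ parity C.redGr) (TensorAlgebra.ι R) ∘ₗ C.redComul)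

/-- An algebra map `ΩC → ΩC ⊗ ΩC`, where the target carries the Koszul signed product
`(a ⊗ b)(a' ⊗ b') = (-1)^(|b||a'|) a a' ⊗ b b'`. -/
abbrev CobarCoproduct : Type (max u v) := C.Cobar →ₐ[R] GradedTensorProduct R C.cobarGr C.cobarGr

variable {C}

/-- The linear map underlying a coproduct on the cobar construction. -/
def CobarCoproduct.toLin (nabla : C.CobarCoproduct) : C.Cobar →ₗ[R] C.Cobar ⊗[R] C.Cobar :=
  (GradedTensorProduct.of R C.cobarGr C.cobarGr).symm.toLinearMap ∘ₗ nabla.toLinearMap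

variable (C)

/-- The cobar construction `ΩC` with its differential, its standard (co)augmentation and the
coproduct `nabla`. -/
def cobarCoalg (nabla : C.CobarCoproduct) : DGCoalgData.{u, max u v} R where
  carrier := C.Cobar
  gr := C.cobarGr
  d := C.cobarD
  comul := nabla.toLin
  counit := (TensorAlgebra.algebraMapInv : C.Cobar →ₐ[R] R).toLinearMap
  one := 1
  one_mem := SetLike.GradedOne.one_mem
  counit_one := map_one (TensorAlgebra.algebraMapInv : C.Cobar →ₐ[R] R)
  counit_gr := fun _ hk _ hx => algebraMapInv_tensorGr C.sgr hk hx

/-! ### Homotopy G-coalgebras and the obstructions -/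

/-- A Hirsch coalgebra: a `1`-reduced DG-coalgebra `C` with a coproduct on `ΩC` (an algebra map)
which makes `ΩC` a coassociative counital DG-bialgebra. -/
structure IsHirsch (nabla : C.CobarCoproduct) : Prop where
  dgCoalgebra : C.IsDGCoalgebra
  reduced : C.IsReduced 1
  bialgebra : (C.cobarCoalg nabla).IsDGCoalgebra

variable {C}

/-- The component `E^{i,j} : s⁻¹ C̄ → (s⁻¹ C̄)^{⊗ i} ⊗ (s⁻¹ C̄)^{⊗ j}` of the coproduct. -/
def CobarCoproduct.E (nabla : C.CobarCoproduct) (i j : ℕ) : C.Red →ₗ[R] C.Cobar ⊗[R] C.Cobar :=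
  TensorProduct.map (weightProj R C.Red i) (weightProj R C.Red j) ∘ₗ nabla.toLin ∘ₗ
    TensorAlgebra.ι R

variable (C)

/-- A homotopy G-coalgebra: a Hirsch coalgebra with `E^{i,j} = 0` for `j ≥ 2`. -/
structure IsHomotopyGCoalgebra (nabla : C.CobarCoproduct) : Prop extends C.IsHirsch nabla where
  E_eq_zero : ∀ i j : ℕ, 1 ≤ i → 2 ≤ j → nabla.E i j = 0

variable {C}

namespace CobarCoproduct

variable (nabla : C.CobarCoproduct)

/-- For `L = [n₁, …, n_s]`, the composite
`(1^{⊗ n₁+…+n_{s-1}} ⊗ E^{n_s,1}) ⋯ (1^{⊗ n₁} ⊗ E^{n₂,1}) E^{n₁,1}`, with values in words of length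
`n₁ + … + n_s + 1`. -/
def iterE : List ℕ → (C.Red →ₗ[R] C.Cobar)
  | [] => TensorAlgebra.ι R
  | k :: L => LinearMap.mul' R C.Cobar ∘ₗ
      TensorProduct.map LinearMap.id (iterE L ∘ₗ TensorAlgebra.ιInv) ∘ₗ nabla.E k 1

/-- The component `F^n : s⁻¹ C̄ → (s⁻¹ C̄)^{⊗ n}` (`n ≥ 1`) of the antipode:
`F^n = ∑_{n₁+…+n_s=n-1} (-1)^(s+1) (1 ⊗ E^{n_s,1}) ⋯ (1 ⊗ E^{n₂,1}) E^{n₁,1}`; the empty composition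
gives `F^1 = -id`. -/
def F (n : ℕ) : C.Red →ₗ[R] C.Cobar :=
  ∑ c : Composition (n - 1), (-1 : ℤ) ^ (c.length + 1) • nabla.iterE c.blocks

/-- The opposite product `a ⊗ b ↦ (-1)^(|a||b|) b a` of `ΩC`. -/
def opMul (C : DGCoalgData.{u, v} R) : C.Cobar ⊗[R] C.Cobar →ₗ[R] C.Cobar :=
  LinearMap.mul' R C.Cobar ∘ₗ koszulSwap C.cobarGr C.cobarGr

/-- For `L = [n₁, …, n_s]`, the map sending a word `x₁ ⋯ x_s` to the product of
`F^{n₁}(x₁), …, F^{n_s}(x_s)` for `opMul`; it is zero on words of length other than `s`. -/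
def blockF : List ℕ → (C.Cobar →ₗ[R] C.Cobar)
  | [] => Algebra.linearMap R C.Cobar ∘ₗ TensorAlgebra.algebraMapInv.toLinearMap
  | m :: L => opMul C ∘ₗ TensorProduct.map (nabla.F m ∘ₗ TensorAlgebra.ιInv) (blockF L) ∘ₗ
      deconc R C.Red

/-- The obstruction `O_n = ∑_s ∑_{n₁+…+n_s=n} μ₍₁₂₎ (F^{n₁} ⊗ ⋯ ⊗ F^{n_s}) F^s`. -/
def obstruction (n : ℕ) : C.Red →ₗ[R] C.Cobar :=
  ∑ c : Composition n, nabla.blockF c.blocks ∘ₗ nabla.F c.length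

end CobarCoproduct

/-! ### Truncation -/

variable (C)

/-- The submodule `C_{≤ n}`. -/
def le (n : ℕ) : Submodule R C.carrier := ⨆ k : {k : ℤ // k ≤ n}, C.gr k

theorem gr_le {n : ℕ} {k : ℤ} (hk : k ≤ n) : C.gr k ≤ C.le n :=
  le_iSup (fun k : {k : ℤ // k ≤ n} => C.gr k) ⟨k, hk⟩

theorem le_homogeneous (n : ℕ) :
    ∀ x ∈ C.le n, ∀ k : ℤ, (DirectSum.decompose C.gr x k : C.carrier) ∈ C.le n := by
  intro x hx k
  induction hx using Submodule.iSup_induction' with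
  | mem j y hy =>
    by_cases h : (j : ℤ) = k
    · subst h
      rw [DirectSum.decompose_of_mem_same C.gr hy]
      exact C.gr_le j.2 hy
    · rw [DirectSum.decompose_of_mem_ne C.gr hy h]
      exact zero_mem _
  | zero => simp
  | add y z _ _ hy hz =>
    rw [DirectSum.decompose_add, DirectSum.add_apply, Submodule.coe_add]
    exact add_mem hy hz

/-- The projection onto `C_{≤ n}` which kills the elements of degree `> n`. -/
def leProj (n : ℕ) : C.carrier →ₗ[R] C.le n :=
  DirectSum.toModule R ℤ _ (fun k =>
      if h : k ≤ n then Submodule.inclusion (C.gr_le h) else 0) ∘ₗ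
    (DirectSum.decomposeLinearEquiv C.gr).toLinearMap

instance leDecomposition (n : ℕ) :
    DirectSum.Decomposition (fun k => (C.gr k).comap (C.le n).subtype) :=
  subDecomposition C.gr (C.le n) (C.le_homogeneous n)

/-- `C_{≤ n}` with the structure maps of `C`, restricted to `C_{≤ n}` and corestricted along the
projection (no information is lost, since the structure maps of a connected DG-coalgebra preserve
`C_{≤ n}`). -/
def trunc (n : ℕ) : DGCoalgData.{u, v} R where
  carrier := C.le n
  gr := fun k => (C.gr k).comap (C.le n).subtype
  d := C.leProj n ∘ₗ C.d ∘ₗ (C.le n).subtype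
  comul := TensorProduct.map (C.leProj n) (C.leProj n) ∘ₗ C.comul ∘ₗ (C.le n).subtype
  counit := C.counit ∘ₗ (C.le n).subtype
  one := ⟨C.one, C.gr_le (by simp) C.one_mem⟩
  one_mem := C.one_mem
  counit_one := C.counit_one
  counit_gr := fun k hk x hx => C.counit_gr k hk x hx

/-- The inclusion `C_{≤ n} → C`. -/
def truncIncl (n : ℕ) : (C.trunc n).carrier →ₗ[R] C.carrier := (C.le n).subtype

/-- The algebra map `Ω(C_{≤ n}) → ΩC` induced by the inclusion. -/
def cobarIncl (n : ℕ) : (C.trunc n).Cobar →ₐ[R] C.Cobar :=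
  TensorAlgebra.lift R
    (TensorAlgebra.ι R ∘ₗ C.toRed ∘ₗ C.truncIncl n ∘ₗ (C.trunc n).Red.subtype)

/-- The algebra map `ΩC → Ω(C_{≤ n})` induced by the projection. -/
def cobarProj (n : ℕ) : C.Cobar →ₐ[R] (C.trunc n).Cobar :=
  TensorAlgebra.lift R
    (TensorAlgebra.ι R ∘ₗ (C.trunc n).toRed ∘ₗ C.leProj n ∘ₗ C.Red.subtype)

variable {C}

/-- The coproduct of `ΩC` restricted to `Ω(C_{≤ n})`: the algebra map which on the letters is the
restriction of `nabla`, corestricted along the projection. -/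
def CobarCoproduct.trunc (nabla : C.CobarCoproduct) (n : ℕ) : (C.trunc n).CobarCoproduct :=
  TensorAlgebra.lift R
    ((GradedTensorProduct.of R (C.trunc n).cobarGr (C.trunc n).cobarGr).toLinearMap ∘ₗ
      TensorProduct.map (C.cobarProj n).toLinearMap (C.cobarProj n).toLinearMap ∘ₗ
      nabla.toLin ∘ₗ (C.cobarIncl n).toLinearMap ∘ₗ TensorAlgebra.ι R)

variable (C)

/-- The inclusion `C_{≤ n} → C` is compatible with all structure maps, i.e. the homotopy
G-coalgebra structure of `C` preserves `C_{≤ n}`, and `C_{≤ n}` carries the restricted structure. -/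
structure PreservesTrunc (nabla : C.CobarCoproduct) (n : ℕ) : Prop where
  d : C.d ∘ₗ C.truncIncl n = C.truncIncl n ∘ₗ (C.trunc n).d
  comul : C.comul ∘ₗ C.truncIncl n =
    TensorProduct.map (C.truncIncl n) (C.truncIncl n) ∘ₗ (C.trunc n).comul
  nabla : nabla.toLin ∘ₗ (C.cobarIncl n).toLinearMap =
    TensorProduct.map (C.cobarIncl n).toLinearMap (C.cobarIncl n).toLinearMap ∘ₗ
      (nabla.trunc n).toLin

end DGCoalgData

/-! ### Augmented differential graded algebras and the bar construction -/

/-- The data of an augmented DG-algebra. The axioms on the differential are in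
`AugDGAlgData.IsDGAlgebra`. -/
structure AugDGAlgData (R : Type u) [CommRing R] where
  carrier : Type v
  [ring : Ring carrier]
  [alg : Algebra R carrier]
  gr : ℤ → Submodule R carrier
  [gradedAlg : GradedAlgebra gr]
  d : carrier →ₗ[R] carrier
  aug : carrier →ₐ[R] R
  aug_gr : ∀ k : ℤ, k ≠ 0 → ∀ x ∈ gr k, aug x = 0

attribute [instance] AugDGAlgData.ring AugDGAlgData.alg AugDGAlgData.gradedAlg

namespace AugDGAlgData

variable {R : Type u} [CommRing R] (A : AugDGAlgData.{u, v} R)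

/-- The axioms of an augmented DG-algebra, with a differential of degree `-1`. -/
structure IsDGAlgebra : Prop where
  d_mem : ∀ k, ∀ x ∈ A.gr k, A.d x ∈ A.gr (k - 1)
  d_d : ∀ x, A.d (A.d x) = 0
  leibniz : ∀ x y, A.d (x * y) = A.d x * y + parity A.gr x * A.d y
  aug_d : ∀ x, A.aug (A.d x) = 0

/-- Connectedness: `A_k = 0` for `k < 0` and `A_0 = R`. -/
structure IsConnected : Prop where
  neg : ∀ k : ℤ, k < 0 → A.gr k = ⊥
  zero : A.gr 0 = Submodule.span R {1}

/-- The augmentation ideal. -/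
abbrev Red : Submodule R A.carrier := LinearMap.ker A.aug.toLinearMap

/-- The grading of the augmentation ideal. -/
def redGr (k : ℤ) : Submodule R A.Red := (A.gr k).comap A.Red.subtype

instance redDecomposition : DirectSum.Decomposition A.redGr :=
  subDecomposition A.gr A.Red (ker_homogeneous A.gr A.aug.toLinearMap A.aug_gr)

/-- The projection `x ↦ x - ε(x) 1` onto the augmentation ideal. -/
def toRed : A.carrier →ₗ[R] A.Red :=
  (LinearMap.id - A.aug.toLinearMap.smulRight 1).codRestrict A.Red fun x => by
    simp [LinearMap.mem_ker]

/-- The underlying module `T(s Ā)` of the bar construction. A letter `s a` is written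
`TensorAlgebra.ι R a`; only the grading records the suspension. Its coproduct is `deconc`; the
concatenation product of `TensorAlgebra` is not part of the structure of the bar construction. -/
abbrev Bar : Type (max u v) := TensorAlgebra R A.Red

/-- The grading of the bar construction. -/
abbrev barGr : ℤ → Submodule R A.Bar := tensorGr (shiftGr A.redGr 1)

/-- The projection to the letters of the differential of the bar construction: it is
`s a ↦ - s (d a)` on words of length one, `s a ⊗ s b ↦ (-1)^(|a|+1) s (a b)` on words of length two,
and zero on the other words. -/
def barDProj : A.Bar →ₗ[R] A.Red :=
  -(A.toRed ∘ₗ A.d ∘ₗ A.Red.subtype ∘ₗ TensorAlgebra.ιInv) -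
    A.toRed ∘ₗ LinearMap.mul' R A.carrier ∘ₗ
      TensorProduct.map (A.Red.subtype ∘ₗ parity A.redGr ∘ₗ TensorAlgebra.ιInv)
        (A.Red.subtype ∘ₗ TensorAlgebra.ιInv) ∘ₗ
      deconc R A.Red

/-- The differential of the bar construction: the coderivation for `deconc` with projection
`barDProj`, i.e. `w ↦ ∑ (-1)^|w¹| w¹ ⊗ barDProj(w²) ⊗ w³`. -/
def barD : A.Bar →ₗ[R] A.Bar :=
  LinearMap.mul' R A.Bar ∘ₗ
    TensorProduct.map (parity A.barGr)
      (LinearMap.mul' R A.Bar ∘ₗ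
        (TensorAlgebra.ι R ∘ₗ A.barDProj).rTensor A.Bar ∘ₗ deconc R A.Red) ∘ₗ
    deconc R A.Red

/-! ### Homotopy G-algebras and homotopy BV-algebras -/

/-- A Hirsch algebra: a connected DG-algebra `A` with a product `mu` of degree `0` on the bar
construction, which makes it an associative unital DG-bialgebra with unit the empty word. -/
structure IsHirsch (mu : A.Bar →ₗ[R] A.Bar →ₗ[R] A.Bar) : Prop where
  dgAlgebra : A.IsDGAlgebra
  connected : A.IsConnected
  mem : ∀ p q, ∀ x ∈ A.barGr p, ∀ y ∈ A.barGr q, mu x y ∈ A.barGr (p + q)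
  one_mu : ∀ x, mu 1 x = x
  mu_one : ∀ x, mu x 1 = x
  assoc : ∀ x y z, mu (mu x y) z = mu x (mu y z)
  /-- `mu` is a morphism of coalgebras. -/
  comul : deconc R A.Red ∘ₗ TensorProduct.lift mu =
    TensorProduct.map (TensorProduct.lift mu) (TensorProduct.lift mu) ∘ₗ
      middleSwap A.barGr A.barGr ∘ₗ TensorProduct.map (deconc R A.Red) (deconc R A.Red)
  counit : ∀ x y, (TensorAlgebra.algebraMapInv (mu x y) : R) =
    TensorAlgebra.algebraMapInv x * TensorAlgebra.algebraMapInv y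
  /-- `mu` is a chain map. -/
  d_mu : ∀ x y, A.barD (mu x y) = mu (A.barD x) y + mu (parity A.barGr x) (A.barD y)

/-- A homotopy G-algebra: a Hirsch algebra whose operations `E_{i,j}`, i.e. the components
`(s Ā)^{⊗ i} ⊗ (s Ā)^{⊗ j} → s Ā` of `mu`, vanish for `i ≥ 2`, `j ≥ 1`. -/
structure IsHomotopyGAlgebra (mu : A.Bar →ₗ[R] A.Bar →ₗ[R] A.Bar) : Prop
    extends A.IsHirsch mu where
  E_eq_zero : ∀ i j : ℕ, 2 ≤ i → 1 ≤ j →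
    ∀ x ∈ (LinearMap.range (TensorAlgebra.ι R : A.Red →ₗ[R] A.Bar)) ^ i,
    ∀ y ∈ (LinearMap.range (TensorAlgebra.ι R : A.Red →ₗ[R] A.Bar)) ^ j,
      TensorAlgebra.ιInv (mu x y) = 0

/-- The operation `E_{1,1}(a; b)`, extended by zero when `a` or `b` is in `R`. -/
def E11 (mu : A.Bar →ₗ[R] A.Bar →ₗ[R] A.Bar) (a b : A.carrier) : A.carrier :=
  ((TensorAlgebra.ιInv
    (mu (TensorAlgebra.ι R (A.toRed a)) (TensorAlgebra.ι R (A.toRed b))) : A.Red) : A.carrier)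

/-- A homotopy BV-algebra: a homotopy G-algebra with an operator `Δ` of degree `1` which
anticommutes with the differential (a DG-operator of odd degree) and has square zero, and with a
homotopy `H` of degree `2` between the bracket
`{a;b} = E_{1,1}(a;b) - (-1)^((|a|+1)(|b|+1)) E_{1,1}(b;a)` and the deviation of `Δ` from being a
derivation. -/
structure IsHomotopyBVAlgebra (mu : A.Bar →ₗ[R] A.Bar →ₗ[R] A.Bar)
    (Δ : A.carrier →ₗ[R] A.carrier) (H : A.carrier →ₗ[R] A.carrier →ₗ[R] A.carrier) : Prop
    extends A.IsHomotopyGAlgebra mu where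
  Δ_mem : ∀ k, ∀ x ∈ A.gr k, Δ x ∈ A.gr (k + 1)
  d_Δ : ∀ x, A.d (Δ x) = -Δ (A.d x)
  Δ_Δ : ∀ x, Δ (Δ x) = 0
  H_mem : ∀ p q, ∀ x ∈ A.gr p, ∀ y ∈ A.gr q, H x y ∈ A.gr (p + q + 2)
  bracket : ∀ p q : ℤ, ∀ a ∈ A.gr p, ∀ b ∈ A.gr q,
    A.E11 mu a b - Int.negOnePow ((p + 1) * (q + 1)) • A.E11 mu b a =
      Int.negOnePow p • (Δ (a * b) - Δ a * b - Int.negOnePow p • (a * Δ b)) +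
        (A.d (H a b) + H (A.d a) b - Int.negOnePow p • H a (A.d b))

end AugDGAlgData

/-! ### The structure on the cobar construction of a bialgebra -/

namespace DGCoalgData

variable {R : Type u} [CommRing R]

/-- The cobar construction as an augmented DG-algebra. -/
def cobar (B : DGCoalgData.{u, v} R) : AugDGAlgData.{u, max u v} R where
  carrier := B.Cobar
  gr := B.cobarGr
  d := B.cobarD
  aug := TensorAlgebra.algebraMapInv
  aug_gr := fun _ hk _ hx => algebraMapInv_tensorGr B.sgr hk hx

/-- `S` is the antipode of the DG-bialgebra `B` with product `m`: a chain map (of degree `0`) which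
is inverse to the identity for the convolution product. -/
structure IsAntipode (B : DGCoalgData.{u, v} R)
    (m : B.carrier ⊗[R] B.carrier →ₗ[R] B.carrier) (S : B.carrier →ₗ[R] B.carrier) : Prop where
  mem : ∀ k, ∀ x ∈ B.gr k, S x ∈ B.gr k
  d_S : ∀ x, B.d (S x) = S (B.d x)
  left : ∀ x, m (S.rTensor B.carrier (B.comul x)) = B.counit x • B.one
  right : ∀ x, m (S.lTensor B.carrier (B.comul x)) = B.counit x • B.one

variable (B : DGCoalgData.{u, v} R) (m : B.carrier ⊗[R] B.carrier →ₗ[R] B.carrier)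

/-- The step `f ↦ (a ↦ ∑ (-1)^(|a²||s⁻¹ b|) s⁻¹ (a¹ b) · f(a²))` of the recursion for `diamond`,
where `∑ a¹ ⊗ a²` is the (unreduced) coproduct. -/
def diamondStep : B.Red →ₗ[R] Module.End R (B.carrier →ₗ[R] B.Cobar) :=
  LinearMap.mk₂ R
    (fun b f => LinearMap.mul' R B.Cobar ∘ₗ
      TensorProduct.map (TensorAlgebra.ι R ∘ₗ B.toRed ∘ₗ m ∘ₗ B.Red.subtype.lTensor B.carrier) f ∘ₗ
      (TensorProduct.assoc R B.carrier B.Red B.carrier).symm.toLinearMap ∘ₗ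
      (koszulSwap B.gr B.sgr).lTensor B.carrier ∘ₗ
      (TensorProduct.assoc R B.carrier B.carrier B.Red).toLinearMap ∘ₗ
      (TensorProduct.mk R (B.carrier ⊗[R] B.carrier) B.Red).flip b ∘ₗ B.comul)
    (by intros; ext; simp)
    (by intros; ext; simp)
    (by intros; ext; simp [TensorProduct.map_add_right])
    (by intros; ext; simp [TensorProduct.map_smul_right])

/-- The action `a ⋄ (s⁻¹ b₁ ⊗ ⋯ ⊗ s⁻¹ b_n) = ∑ ± s⁻¹ (a¹ b₁) ⊗ ⋯ ⊗ s⁻¹ (aⁿ b_n)` of `B` on its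
cobar construction, through the iterated coproduct of `a`; the sign is the Koszul sign of moving
each `aʲ` across `s⁻¹ b₁, …, s⁻¹ b_{j-1}`. On the empty word `a ⋄ 1 = ε(a)`. -/
def diamond : B.carrier →ₗ[R] B.Cobar →ₗ[R] B.Cobar :=
  (LinearMap.applyₗ (Algebra.linearMap R B.Cobar ∘ₗ B.counit) ∘ₗ
    (TensorAlgebra.lift R (B.diamondStep m)).toLinearMap).flip

/-- The projection of the bar construction of `ΩB` onto the words `s y` of length one, as a map
`s y ↦ y` to `ΩB`. -/
def singleLetter : B.cobar.Bar →ₗ[R] B.Cobar := B.cobar.Red.subtype ∘ₗ TensorAlgebra.ιInv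

/-- The operations on a single letter `x = s⁻¹ a`: `x{} = x`, `x{y} = a ⋄ y` and
`x{y₁, …, y_k} = 0` for `k ≥ 2`. -/
def letterBrace : B.Red →ₗ[R] B.cobar.Bar →ₗ[R] B.Cobar :=
  LinearMap.mk₂ R
    (fun a w => (TensorAlgebra.algebraMapInv w : R) • TensorAlgebra.ι R a +
      B.diamond m (a : B.carrier) (B.singleLetter w))
    (by intros; simp only [map_add, smul_add, Submodule.coe_add, LinearMap.add_apply]; abel)
    (by
      intro r a w
      simp only [map_smul, smul_add, Submodule.coe_smul, LinearMap.smul_apply]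
      rw [smul_comm])
    (by intros; simp only [map_add, add_smul]; abel)
    (by intros; simp only [map_smul, smul_add, smul_assoc])

/-- The step `f ↦ (w ↦ ∑ (-1)^(|w¹||x|) f(w¹) · x{w²})`, `x = s⁻¹ a`, of the recursion for `brace`,
where `∑ w¹ ⊗ w²` is the deconcatenation. -/
def braceStep : B.Red →ₗ[R] Module.End R (B.cobar.Bar →ₗ[R] B.Cobar) :=
  LinearMap.mk₂ R
    (fun a f => LinearMap.mul' R B.Cobar ∘ₗ
      TensorProduct.map f (TensorProduct.lift (B.letterBrace m)) ∘ₗ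
      (TensorProduct.assoc R B.cobar.Bar B.Red B.cobar.Bar).toLinearMap ∘ₗ
      (koszulSign B.cobar.barGr B.sgr ∘ₗ
        (TensorProduct.mk R B.cobar.Bar B.Red).flip a).rTensor B.cobar.Bar ∘ₗ
      deconc R B.cobar.Red)
    (by intros; ext; simp [LinearMap.comp_add, LinearMap.rTensor_add, LinearMap.add_comp])
    (by intros; ext; simp [LinearMap.comp_smul, LinearMap.rTensor_smul, LinearMap.smul_comp])
    (by intros; ext; simp [TensorProduct.map_add_left])
    (by intros; ext; simp [TensorProduct.map_smul_left])

/-- The operations `E_{1,k}` on `ΩB`: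
`E_{1,k}(s⁻¹ a₁ ⊗ ⋯ ⊗ s⁻¹ a_n; y₁, …, y_k) = ∑_{i₁ < ⋯ < i_k}
  ± s⁻¹ a₁ ⊗ ⋯ ⊗ (a_{i₁} ⋄ y₁) ⊗ ⋯ ⊗ (a_{i_k} ⋄ y_k) ⊗ ⋯ ⊗ s⁻¹ a_n`,
as a map of `x = s⁻¹ a₁ ⊗ ⋯ ⊗ s⁻¹ a_n` and of the word `w = s y₁ ⊗ ⋯ ⊗ s y_k` of the bar construction.
The sign is the Koszul sign of moving each `s y_j` across `s⁻¹ a_l`, `l > i_j`. It is given by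
`1{w} = ε(w)` and the recursion `(x · s⁻¹ a){w} = ∑ (-1)^(|w¹||s⁻¹ a|) x{w¹} · s⁻¹ a{w²}`. -/
def brace : B.Cobar →ₗ[R] B.cobar.Bar →ₗ[R] B.Cobar :=
  LinearMap.applyₗ
      (Algebra.linearMap R B.Cobar ∘ₗ
        (TensorAlgebra.algebraMapInv : B.cobar.Bar →ₐ[R] R).toLinearMap) ∘ₗ
    (MulOpposite.opLinearEquiv R).symm.toLinearMap ∘ₗ
    (TensorAlgebra.lift R
      ((MulOpposite.opLinearEquiv R).toLinearMap ∘ₗ B.braceStep m)).toLinearMap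

/-- The signed cyclic permutation `x₁ x₂ ⋯ x_n ↦ (-1)^(|x₁|(|x₂|+⋯+|x_n|)) x₂ ⋯ x_n x₁` of the
letters `x_j = s⁻¹ a_j`, with `|x_j| = |a_j| - 1`. -/
def rotate : B.Cobar →ₗ[R] B.Cobar :=
  LinearMap.mul' R B.Cobar ∘ₗ koszulSwap B.cobarGr B.cobarGr ∘ₗ
    (TensorAlgebra.ι R ∘ₗ TensorAlgebra.ιInv).rTensor B.Cobar ∘ₗ deconc R B.Red

/-- The map `s⁻¹ a · y ↦ (-1)^|a| S(a) ⋄ y`. As `S` reverses the coproduct, this is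
`s⁻¹ a₁ ⊗ ⋯ ⊗ s⁻¹ a_n ↦ ∑ ± s⁻¹ (S(a₁^{n-1}) a₂) ⊗ ⋯ ⊗ s⁻¹ (S(a₁^1) a_n)`. -/
def absorbFirst (S : B.carrier →ₗ[R] B.carrier) : B.Cobar →ₗ[R] B.Cobar :=
  TensorProduct.lift (B.diamond m) ∘ₗ
    (S ∘ₗ parity B.gr ∘ₗ B.Red.subtype ∘ₗ TensorAlgebra.ιInv).rTensor B.Cobar ∘ₗ deconc R B.Red

/-- The Connes-Moscovici operator: on words of length `n` it is the sum over the `n` cyclic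
permutations of the word, followed by `absorbFirst`. -/
def connesMoscovici (S : B.carrier →ₗ[R] B.carrier) : B.Cobar →ₗ[R] B.Cobar :=
  DirectSum.toModule R ℕ B.Cobar (fun n =>
      B.absorbFirst m S ∘ₗ (∑ i ∈ Finset.range n, B.rotate ^ i) ∘ₗ
        ((LinearMap.range (TensorAlgebra.ι R : B.Red →ₗ[R] B.Cobar)) ^ n).subtype) ∘ₗ
    (DirectSum.decomposeLinearEquiv
      (fun n : ℕ => (LinearMap.range (TensorAlgebra.ι R : B.Red →ₗ[R] B.Cobar)) ^ n)).toLinearMap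

/-- For a DG-bialgebra `B` with product `m` and antipode `S`: the cobar construction `ΩB`, with the
homotopy G-algebra structure whose operations `E_{1,k}` are given by `brace`, is a homotopy
BV-algebra with BV-operator the Connes-Moscovici operator. -/
def CobarIsHomotopyBVAlgebra (S : B.carrier →ₗ[R] B.carrier) : Prop :=
  ∃ (mu : B.cobar.Bar →ₗ[R] B.cobar.Bar →ₗ[R] B.cobar.Bar)
    (H : B.cobar.carrier →ₗ[R] B.cobar.carrier →ₗ[R] B.cobar.carrier),
    (∀ (x : B.cobar.Red) (w : B.cobar.Bar),
      B.singleLetter (mu (TensorAlgebra.ι R x) w) = B.brace m (B.cobar.Red.subtype x) w) ∧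
    B.cobar.IsHomotopyBVAlgebra mu (B.connesMoscovici m S) H

end DGCoalgData

end DoubleCobar

-- The proof has two halves, joined by the notion `IsInvolutiveDGHopf`. Put `B = Ω(C_{≤n})`.
--
-- The antipode. All modules vanish in negative degrees, so the structure maps of `C` and of `ΩC`
-- cannot leave `C_{≤n}`. The inclusion and the projection make everything for `C_{≤n}` a retract of
-- the same thing for `C` (`IsDGCoalgebra.of_retract`, `nabla_trunc_compat`,
-- `isHomotopyGCoalgebra_trunc`). As `B` is connected, the identity has at most one convolution
-- inverse. On letters, since `E^{p,q} = 0` for `q ≥ 2`, the equation `id * S = ηε` is a recursion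
-- on word length, and its solution is `S = ∑ F^m` (`F_add_two`, `antipode_right_ι`); the sum is
-- finite because degrees in `C_{≤n}` are bounded. Extending `S` anti-multiplicatively gives the
-- antipode (`isAntipode`). The word-length-`m` component of `S²` on letters is exactly `O_m`
-- (`weightProj_antipode_antipode_ι`). On a letter of `B` the degree is at most `n - 1`, while words
-- of length `m` have degree at least `m i`; so each component with `m ≥ 2` vanishes either by the
-- hypothesis on `O_m` or for degree reasons, and `S² = id` (`trunc_obstruction`).
--
-- The second half holds for any DG-Hopf algebra `B` as in `IsInvolutiveDGHopf`. The action `⋄`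
-- makes `ΩB` a module algebra over `B`, but not a DG-module: the differential of `h ⋄ x` has two
-- extra boundary terms `s⁻¹h¹ · (h² ⋄ x)` and `(h¹ ⋄ x) · s⁻¹h²` (`cobarD_comp_diamond_flip`).
--
-- Homotopy G-structure. A product on a tensor coalgebra which is a coalgebra map is determined by
-- its projection to letters. Hence associativity and the chain map property only have to be checked
-- after that projection (`braceMul_assoc`, `braceMul_coder`), where they become `x{w}{u} = x{w u}`
-- (`brace_brace`) and the Hirsch formula (`brace_hirsch`). The boundary terms above are what the
-- Hirsch formula asks for.
--
-- BV-structure. The computation takes place in `End(ΩB)`, with left and right multiplications `L`,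
-- `R`. The operator `cyc x` sends `z` to the sum over those rotations of `x z` which start with a
-- letter of `x`; then `Δ x = cyc x 1` (`connesMoscovici_apply`). Up to signs, three identities
-- carry everything: `cyc (x y) = cyc x L_y + cyc y R_x` (`cyc_mul`), `d cyc x + cyc (d x) + cyc x d
-- = R_x - L_x` (`cobarD_cyc`), and `cyc (h ⋄ x) 1 = ε(h) cyc x 1` (`cyc_diamond_one`). At `1` the
-- second gives `dΔ = -Δd`. The third gives `Δ² = 0`, because `Δ x` is a sum of elements `S(a) ⋄ w`
-- with `ε(a) = 0`. Involutivity is what lets one operator `S` serve both sides: `S` is an antipode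
-- for the coproduct, paired with `L`, and, as `S² = id`, also for the opposite coproduct, paired
-- with `R` (`isSide_left`, `isSide_right`).
--
-- For the bracket, `insCyc` refines `cyc` by inserting a second argument into one of the remaining
-- letters. Its boundary (`cobarD_insCyc`) consists of `x{y}`, `y Δ(x)` and `cyc x y`. Combined for
-- both orders of the arguments, with the boundary of `Δ(a){b}`, it gives the homotopy `H`
-- (`bracket_eq`).

universe w

namespace DoubleCobar

/-! ### Signs and twists -/

section Signs

variable {R : Type*} [CommRing R]

/-- The sign `(-1)^e` as a scalar. -/
def sg (R : Type*) [CommRing R] (e : ℤ) : R := (((Int.negOnePow e : ℤˣ) : ℤ) : R)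

theorem sg_even {e : ℤ} (h : Even e) : sg R e = 1 := by simp [sg, Int.negOnePow_even e h]
theorem sg_odd {e : ℤ} (h : ¬ Even e) : sg R e = -1 := by
  simp [sg, Int.negOnePow_odd e (Int.not_even_iff_odd.1 h)]
theorem sg_ite (e : ℤ) : sg R e = if Even e then 1 else -1 := by
  split_ifs with h
  exacts [sg_even h, sg_odd h]
@[simp] theorem sg_zero : sg R 0 = 1 := sg_even (by simp)
@[simp] theorem sg_one : sg R 1 = -1 := sg_odd (by decide)
theorem sg_add (a b : ℤ) : sg R (a + b) = sg R a * sg R b := by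
  simp [sg, Int.negOnePow_add]
-- Sign verifications end here: collected exponents are compared by parity, which is left to
-- `grind`.
theorem sg_congr {a b : ℤ} (h : Even (a + b)) : sg R a = sg R b := by
  rw [sg_ite, sg_ite]
  simp only [Int.even_add] at h
  simp [h]
@[simp] theorem sg_neg (a : ℤ) : sg R (-a) = sg R a := sg_congr (by simp)
theorem sg_sub (a b : ℤ) : sg R (a - b) = sg R a * sg R b := by
  rw [sub_eq_add_neg, sg_add, sg_neg]
@[simp] theorem sg_mul_self (a : ℤ) : sg R a * sg R a = 1 := by
  rw [← sg_add]; exact sg_even (by simp)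
@[simp] theorem sg_smul_sg_smul {M : Type*} [AddCommGroup M] [Module R M] (a : ℤ) (x : M) :
    sg R a • sg R a • x = x := by
  rw [smul_smul, sg_mul_self, one_smul]

variable {M : Type*} [AddCommGroup M] [Module R M]

theorem zsmul_eq_sg (e : ℤ) (x : M) : ((Int.negOnePow e : ℤˣ) : ℤ) • x = sg R e • x := by
  rw [sg, Int.cast_smul_eq_zsmul]
theorem units_smul_eq_sg (e : ℤ) (x : M) : (Int.negOnePow e : ℤˣ) • x = sg R e • x := by
  rw [← zsmul_eq_sg]; rfl

end Signs

section Twist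

variable {R : Type*} [CommRing R]
variable {M : Type*} [AddCommGroup M] [Module R M]
variable {N : Type*} [AddCommGroup N] [Module R N]
variable {P : Type*} [AddCommGroup P] [Module R P]
variable {Q : Type*} [AddCommGroup Q] [Module R Q]
variable (𝒜 : ℤ → Submodule R M) [DirectSum.Decomposition 𝒜]
variable (ℬ : ℤ → Submodule R N) [DirectSum.Decomposition ℬ]

/-- The operator `x ↦ (-1)^(k|x|) x`. -/
def twist (k : ℤ) : M →ₗ[R] M :=
  DirectSum.toModule R ℤ M (fun j => sg R (k * j) • (𝒜 j).subtype) ∘ₗ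
    (DirectSum.decomposeLinearEquiv 𝒜).toLinearMap

theorem twist_of_mem (k : ℤ) {j : ℤ} {x : M} (hx : x ∈ 𝒜 j) :
    twist 𝒜 k x = sg R (k * j) • x := by
  simp only [twist, LinearMap.comp_apply, LinearEquiv.coe_coe,
    DirectSum.decomposeLinearEquiv_apply, DirectSum.decompose_of_mem 𝒜 hx,
    ← DirectSum.lof_eq_of R, DirectSum.toModule_lof]
  rfl

variable {𝒜} in
theorem hom_ext {f g : M →ₗ[R] P} (h : ∀ k, ∀ x ∈ 𝒜 k, f x = g x) : f = g := by
  refine DirectSum.decompose_lhom_ext 𝒜 fun k => ?_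
  ext x
  exact h k x x.2

variable {𝒜} in
theorem induction_homogeneous {p : M → Prop} (h0 : p 0) (hadd : ∀ x y, p x → p y → p (x + y))
    (h : ∀ k, ∀ x ∈ 𝒜 k, p x) (x : M) : p x := by
  classical
  rw [← DirectSum.sum_support_decompose 𝒜 x]
  exact Finset.sum_induction _ p hadd h0 fun i _ => h i _ (DirectSum.decompose 𝒜 x i).2

theorem parity_eq_twist : parity 𝒜 = twist 𝒜 1 :=
  hom_ext (𝒜 := 𝒜) fun k x hx => by
    rw [parity_of_mem 𝒜 hx, twist_of_mem 𝒜 1 hx, one_mul, zsmul_eq_sg (R := R)]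

theorem twist_zero : twist 𝒜 0 = LinearMap.id :=
  hom_ext (𝒜 := 𝒜) fun k x hx => by simp [twist_of_mem 𝒜 0 hx]

theorem twist_mem {k j : ℤ} {x : M} (hx : x ∈ 𝒜 j) : twist 𝒜 k x ∈ 𝒜 j := by
  rw [twist_of_mem 𝒜 k hx]; exact Submodule.smul_mem _ _ hx

theorem twist_comp (k l : ℤ) : twist 𝒜 k ∘ₗ twist 𝒜 l = twist 𝒜 (k + l) :=
  hom_ext (𝒜 := 𝒜) fun j x hx => by
    rw [LinearMap.comp_apply, twist_of_mem 𝒜 l hx, map_smul, twist_of_mem 𝒜 k hx,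
      twist_of_mem 𝒜 _ hx, smul_smul, add_mul, sg_add, mul_comm]

theorem twist_twist (k l : ℤ) (x : M) : twist 𝒜 k (twist 𝒜 l x) = twist 𝒜 (k + l) x :=
  LinearMap.congr_fun (twist_comp 𝒜 k l) x

theorem twist_congr {k l : ℤ} (h : Even (k + l)) : twist 𝒜 k = twist 𝒜 l :=
  hom_ext (𝒜 := 𝒜) fun j x hx => by
    rw [twist_of_mem 𝒜 k hx, twist_of_mem 𝒜 l hx, sg_congr]
    rw [← add_mul]; exact h.mul_right j

/-- A map of degree `c` commutes with twists up to sign. -/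
theorem map_twist {f : M →ₗ[R] N} {c : ℤ} (hf : ∀ k, ∀ x ∈ 𝒜 k, f x ∈ ℬ (k + c)) (k : ℤ) (x : M) :
    f (twist 𝒜 k x) = sg R (k * c) • twist ℬ k (f x) := by
  induction x using induction_homogeneous (𝒜 := 𝒜) with
  | h0 => simp
  | hadd x y hx hy => simp only [map_add, hx, hy, smul_add]
  | h j x hx =>
    rw [twist_of_mem 𝒜 k hx, twist_of_mem ℬ k (hf j x hx), map_smul, smul_smul, ← sg_add]
    congr 1
    exact sg_congr (by ring_nf; simp [Int.even_add])

theorem map_twist_zero {f : M →ₗ[R] N} (hf : ∀ k, ∀ x ∈ 𝒜 k, f x ∈ ℬ k) (k : ℤ) (x : M) :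
    f (twist 𝒜 k x) = twist ℬ k (f x) := by
  simpa using map_twist 𝒜 ℬ (c := 0) (by simpa using hf) k x

theorem scalar_twist {f : M →ₗ[R] P} (hf : ∀ k, k ≠ 0 → ∀ x ∈ 𝒜 k, f x = 0) (k : ℤ) (x : M) :
    f (twist 𝒜 k x) = f x := by
  induction x using induction_homogeneous (𝒜 := 𝒜) with
  | h0 => simp
  | hadd x y hx hy => simp only [map_add, hx, hy]
  | h j x hx =>
    rw [twist_of_mem 𝒜 k hx, map_smul]
    by_cases hj : j = 0
    · simp [hj]
    · simp [hf j hj x hx]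

/-- Only one factor needs to be homogeneous if the Koszul sign is an operator on the other. This
turns signs into maps which can be composed inside convolutions. -/
theorem koszulSwap_tmul {q : ℤ} (x : M) {y : N} (hy : y ∈ ℬ q) :
    koszulSwap 𝒜 ℬ (x ⊗ₜ[R] y) = y ⊗ₜ[R] twist 𝒜 q x := by
  induction x using induction_homogeneous (𝒜 := 𝒜) with
  | h0 => simp
  | hadd x y hx hy => simp only [TensorProduct.add_tmul, map_add, hx, hy, TensorProduct.tmul_add]
  | h j x hx =>
    rw [koszulSwap_of_mem 𝒜 ℬ hx hy, twist_of_mem 𝒜 q hx, TensorProduct.tmul_smul,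
      ← Int.negOnePow_def, units_smul_eq_sg (R := R)]

theorem koszulSwap_tmul_left {p : ℤ} {x : M} (hx : x ∈ 𝒜 p) (y : N) :
    koszulSwap 𝒜 ℬ (x ⊗ₜ[R] y) = twist ℬ p y ⊗ₜ[R] x := by
  induction y using induction_homogeneous (𝒜 := ℬ) with
  | h0 => simp
  | hadd x y hx hy => simp only [TensorProduct.add_tmul, map_add, hx, hy, TensorProduct.tmul_add]
  | h j y hy =>
    rw [koszulSwap_tmul 𝒜 ℬ x hy, twist_of_mem 𝒜 j hx, twist_of_mem ℬ p hy, mul_comm,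
      TensorProduct.tmul_smul, TensorProduct.smul_tmul']

theorem koszulSwap_hom {p q : ℤ} {x : M} {y : N} (hx : x ∈ 𝒜 p) (hy : y ∈ ℬ q) :
    koszulSwap 𝒜 ℬ (x ⊗ₜ[R] y) = sg R (p * q) • (y ⊗ₜ[R] x) := by
  rw [koszulSwap_tmul 𝒜 ℬ x hy, twist_of_mem 𝒜 q hx, TensorProduct.tmul_smul, mul_comm]

theorem koszulSign_tmul {q : ℤ} (x : M) {y : N} (hy : y ∈ ℬ q) :
    koszulSign 𝒜 ℬ (x ⊗ₜ[R] y) = twist 𝒜 q x ⊗ₜ[R] y := by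
  simp [koszulSign, koszulSwap_tmul 𝒜 ℬ x hy]

theorem middleSwap_tmul (a : P) {p q : ℤ} {x : M} {y : N} (hx : x ∈ 𝒜 p) (hy : y ∈ ℬ q) (b : Q) :
    middleSwap 𝒜 ℬ ((a ⊗ₜ[R] x) ⊗ₜ[R] (y ⊗ₜ[R] b)) =
      sg R (p * q) • ((a ⊗ₜ[R] y) ⊗ₜ[R] (x ⊗ₜ[R] b)) := by
  simp [middleSwap, koszulSwap_hom 𝒜 ℬ hx hy, ← TensorProduct.smul_tmul']

end Twist

/-! ### Homogeneous tensors: induction principles and finite expansions. -/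

section Expansion

variable {R : Type*} [CommRing R]
variable {M : Type*} [AddCommGroup M] [Module R M]
variable {N : Type*} [AddCommGroup N] [Module R N]
variable {P : Type*} [AddCommGroup P] [Module R P]
variable {𝒜 : ℤ → Submodule R M} {ℬ : ℤ → Submodule R N}

theorem tmul_mem_prodGr {p q k : ℤ} (h : p + q = k) {x : M} {y : N} (hx : x ∈ 𝒜 p) (hy : y ∈ ℬ q) :
    x ⊗ₜ[R] y ∈ prodGr 𝒜 ℬ k := by
  refine Submodule.mem_iSup_of_mem p ?_
  exact ⟨(⟨x, hx⟩ : 𝒜 p) ⊗ₜ[R] (⟨y, by rwa [← h, add_sub_cancel_left]⟩ : ℬ (k - p)), by simp⟩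

theorem prodGr_induction {k : ℤ} {P : M ⊗[R] N → Prop} (h0 : P 0)
    (hadd : ∀ x y, P x → P y → P (x + y))
    (h : ∀ p q, p + q = k → ∀ x ∈ 𝒜 p, ∀ y ∈ ℬ q, P (x ⊗ₜ[R] y)) {z : M ⊗[R] N}
    (hz : z ∈ prodGr 𝒜 ℬ k) : P z := by
  unfold prodGr at hz
  induction hz using Submodule.iSup_induction' with
  | mem p z hz =>
    obtain ⟨w, rfl⟩ := hz
    induction w with
    | zero => simpa
    | tmul x y => exact h p (k - p) (by ring) x x.2 y y.2
    | add x y hx hy => rw [map_add]; exact hadd _ _ hx hy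
  | zero => exact h0
  | add x y _ _ hx hy => exact hadd _ _ hx hy

theorem tensor_induction [DirectSum.Decomposition 𝒜] [DirectSum.Decomposition ℬ]
    {P : M ⊗[R] N → Prop} (h0 : P 0)
    (hadd : ∀ x y, P x → P y → P (x + y))
    (h : ∀ p q, ∀ x ∈ 𝒜 p, ∀ y ∈ ℬ q, P (x ⊗ₜ[R] y)) (z : M ⊗[R] N) : P z := by
  induction z with
  | zero => exact h0
  | add x y hx hy => exact hadd _ _ hx hy
  | tmul x y =>
    induction x using induction_homogeneous (𝒜 := 𝒜) with
    | h0 => simpa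
    | hadd x x' hx hx' => rw [TensorProduct.add_tmul]; exact hadd _ _ hx hx'
    | h p x hx =>
      induction y using induction_homogeneous (𝒜 := ℬ) with
      | h0 => simpa
      | hadd x x' hx hx' => rw [TensorProduct.tmul_add]; exact hadd _ _ hx hx'
      | h q y hy => exact h p q x hx y hy

theorem tensor_hom_ext [DirectSum.Decomposition 𝒜] [DirectSum.Decomposition ℬ]
    {f g : M ⊗[R] N →ₗ[R] P}
    (h : ∀ p q, ∀ x ∈ 𝒜 p, ∀ y ∈ ℬ q, f (x ⊗ₜ[R] y) = g (x ⊗ₜ[R] y)) : f = g := by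
  refine LinearMap.ext fun z => ?_
  induction z using tensor_induction (𝒜 := 𝒜) (ℬ := ℬ) with
  | h0 => simp
  | hadd x y hx hy => simp only [map_add, hx, hy]
  | h p q x hx y hy => exact h p q x hx y hy

/-- For coproducts of homogeneous elements this keeps the relation `p + q = k`, which plain
induction on tensors forgets and the sign checks need. -/
theorem prodGr_eq {k : ℤ} {f g : M ⊗[R] N →ₗ[R] P}
    (h : ∀ p q, p + q = k → ∀ x ∈ 𝒜 p, ∀ y ∈ ℬ q, f (x ⊗ₜ[R] y) = g (x ⊗ₜ[R] y)) {z : M ⊗[R] N}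
    (hz : z ∈ prodGr 𝒜 ℬ k) : f z = g z := by
  refine prodGr_induction (P := fun z => f z = g z) (by simp) ?_ h hz
  intro x y hx hy
  simp only [map_add, hx, hy]

theorem prodGr_map {P' Q' : Type*} [AddCommGroup P'] [Module R P'] [AddCommGroup Q'] [Module R Q']
    {𝒞 : ℤ → Submodule R P'} {𝒟 : ℤ → Submodule R Q'} {f : M →ₗ[R] P'} {g : N →ₗ[R] Q'}
    {c d k l : ℤ} (hl : k + c + d = l) (hf : ∀ k, ∀ x ∈ 𝒜 k, f x ∈ 𝒞 (k + c))
    (hg : ∀ k, ∀ x ∈ ℬ k, g x ∈ 𝒟 (k + d)) {z : M ⊗[R] N} (hz : z ∈ prodGr 𝒜 ℬ k) :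
    TensorProduct.map f g z ∈ prodGr 𝒞 𝒟 l := by
  refine prodGr_induction (P := fun z => TensorProduct.map f g z ∈ prodGr 𝒞 𝒟 l) (by simp) ?_ ?_ hz
  · intro x y hx hy
    rw [map_add]; exact add_mem hx hy
  · intro p q hpq x hx y hy
    rw [TensorProduct.map_tmul]
    refine Submodule.mem_iSup_of_mem (p + c) ?_
    exact ⟨(⟨f x, hf p x hx⟩ : 𝒞 (p + c)) ⊗ₜ[R] (⟨g y, by
      convert hg q y hy using 2; omega⟩ : 𝒟 (l - (p + c))), by simp⟩

/-- A homogeneous expansion of an element of a tensor product. -/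
theorem exists_expansion {k : ℤ} {z : M ⊗[R] N} (hz : z ∈ prodGr 𝒜 ℬ k) :
    ∃ (n : ℕ) (x : Fin n → M) (y : Fin n → N) (p q : Fin n → ℤ), (∀ i, p i + q i = k) ∧
      (∀ i, x i ∈ 𝒜 (p i)) ∧ (∀ i, y i ∈ ℬ (q i)) ∧ z = ∑ i, x i ⊗ₜ[R] y i := by
  refine prodGr_induction (P := fun z => ∃ (n : ℕ) (x : Fin n → M) (y : Fin n → N)
      (p q : Fin n → ℤ), (∀ i, p i + q i = k) ∧
      (∀ i, x i ∈ 𝒜 (p i)) ∧ (∀ i, y i ∈ ℬ (q i)) ∧ z = ∑ i, x i ⊗ₜ[R] y i) ?_ ?_ ?_ hz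
  · exact ⟨0, Fin.elim0, Fin.elim0, Fin.elim0, Fin.elim0, by simp, by simp, by simp, by simp⟩
  · intro x y hx hy
    obtain ⟨n, x, y, p, q, h1, h2, h3, rfl⟩ := hx
    obtain ⟨n', x', y', p', q', h1', h2', h3', rfl⟩ := hy
    refine ⟨n + n', Fin.append x x', Fin.append y y', Fin.append p p', Fin.append q q', ?_, ?_, ?_, ?_⟩
    · intro i; refine Fin.addCases (fun i => ?_) (fun i => ?_) i <;> simp [h1, h1']
    · intro i; refine Fin.addCases (fun i => ?_) (fun i => ?_) i <;> simp [h2, h2']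
    · intro i; refine Fin.addCases (fun i => ?_) (fun i => ?_) i <;> simp [h3, h3']
    · simp [Fin.sum_univ_add]
  · intro p q hpq x hx y hy
    exact ⟨1, fun _ => x, fun _ => y, fun _ => p, fun _ => q, by simpa, by simpa, by simpa, by simp⟩

end Expansion

/-! ### Convolution -/

section Conv

variable {R : Type*} [CommRing R]
variable {C : Type*} [AddCommGroup C] [Module R C]
variable {C' : Type*} [AddCommGroup C'] [Module R C']
variable {A : Type*} [Ring A] [Algebra R A]
variable {A' : Type*} [Ring A'] [Algebra R A']

/-- The (unsigned) convolution product of linear maps. -/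
def conv (δ : C →ₗ[R] C ⊗[R] C) (f g : C →ₗ[R] A) : C →ₗ[R] A :=
  LinearMap.mul' R A ∘ₗ TensorProduct.map f g ∘ₗ δ

variable (δ : C →ₗ[R] C ⊗[R] C)

theorem conv_apply (f g : C →ₗ[R] A) (x : C) :
    conv δ f g x = LinearMap.mul' R A (TensorProduct.map f g (δ x)) := rfl

theorem conv_add_left (f f' g : C →ₗ[R] A) : conv δ (f + f') g = conv δ f g + conv δ f' g := by
  simp [conv, TensorProduct.map_add_left, LinearMap.comp_add, LinearMap.add_comp]
theorem conv_add_right (f g g' : C →ₗ[R] A) : conv δ f (g + g') = conv δ f g + conv δ f g' := by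
  simp [conv, TensorProduct.map_add_right, LinearMap.comp_add, LinearMap.add_comp]
theorem conv_smul_left (r : R) (f g : C →ₗ[R] A) : conv δ (r • f) g = r • conv δ f g := by
  simp [conv, TensorProduct.map_smul_left, LinearMap.comp_smul, LinearMap.smul_comp]
theorem conv_smul_right (r : R) (f g : C →ₗ[R] A) : conv δ f (r • g) = r • conv δ f g := by
  simp [conv, TensorProduct.map_smul_right, LinearMap.comp_smul, LinearMap.smul_comp]
@[simp] theorem conv_zero_left (g : C →ₗ[R] A) : conv δ 0 g = 0 := by
  simpa using conv_smul_left δ (0 : R) (0 : C →ₗ[R] A) g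
@[simp] theorem conv_zero_right (g : C →ₗ[R] A) : conv δ g 0 = 0 := by
  simpa using conv_smul_right δ (0 : R) g (0 : C →ₗ[R] A)

theorem conv_neg_left (f g : C →ₗ[R] A) : conv δ (-f) g = -conv δ f g := by
  rw [eq_neg_iff_add_eq_zero, ← conv_add_left, neg_add_cancel, conv_zero_left]
theorem conv_neg_right (f g : C →ₗ[R] A) : conv δ f (-g) = -conv δ f g := by
  rw [eq_neg_iff_add_eq_zero, ← conv_add_right, neg_add_cancel, conv_zero_right]
theorem conv_sub_left (f f' g : C →ₗ[R] A) : conv δ (f - f') g = conv δ f g - conv δ f' g := by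
  rw [sub_eq_add_neg, conv_add_left, conv_neg_left, sub_eq_add_neg]
theorem conv_sub_right (f g g' : C →ₗ[R] A) : conv δ f (g - g') = conv δ f g - conv δ f g' := by
  rw [sub_eq_add_neg, conv_add_right, conv_neg_right, sub_eq_add_neg]
variable {δ}

theorem conv_assoc (hδ : (TensorProduct.assoc R C C C).toLinearMap ∘ₗ δ.rTensor C ∘ₗ δ =
      δ.lTensor C ∘ₗ δ) (f g h : C →ₗ[R] A) :
    conv δ (conv δ f g) h = conv δ f (conv δ g h) := by
  have e : conv δ f (conv δ g h) = (LinearMap.mul' R A ∘ₗ (LinearMap.mul' R A).lTensor A ∘ₗ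
      TensorProduct.map f (TensorProduct.map g h)) ∘ₗ δ.lTensor C ∘ₗ δ := by
    refine LinearMap.ext fun x => ?_
    simp only [conv, LinearMap.comp_apply]
    induction δ x with
    | zero => simp
    | add x y hx hy => simp only [map_add, hx, hy]
    | tmul x y => simp
  rw [e, ← hδ]
  refine LinearMap.ext fun x => ?_
  simp only [conv, LinearMap.comp_apply, LinearEquiv.coe_coe]
  induction δ x with
  | zero => simp
  | add x y hx hy => simp only [map_add, hx, hy]
  | tmul x y =>
    simp only [TensorProduct.map_tmul, LinearMap.comp_apply, LinearMap.mul'_apply,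
      LinearMap.rTensor_tmul]
    induction δ x with
    | zero => simp
    | add x y hx hy => simp only [map_add, add_mul, TensorProduct.add_tmul, hx, hy]
    | tmul x y => simp [mul_assoc]

theorem conv_comp {δ' : C' →ₗ[R] C' ⊗[R] C'} {φ : C' →ₗ[R] C}
    (hφ : δ ∘ₗ φ = TensorProduct.map φ φ ∘ₗ δ') (f g : C →ₗ[R] A) :
    conv δ f g ∘ₗ φ = conv δ' (f ∘ₗ φ) (g ∘ₗ φ) := by
  simp only [conv, LinearMap.comp_assoc, hφ, TensorProduct.map_comp]

/-- Convolutions and coderivations. -/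
theorem conv_comp_coder {D : C →ₗ[R] C} {σ : C →ₗ[R] C}
    (hD : δ ∘ₗ D = (TensorProduct.map D LinearMap.id + TensorProduct.map σ D) ∘ₗ δ)
    (f g : C →ₗ[R] A) :
    conv δ f g ∘ₗ D = conv δ (f ∘ₗ D) g + conv δ (f ∘ₗ σ) (g ∘ₗ D) := by
  simp only [conv, LinearMap.comp_assoc, hD, LinearMap.add_comp, LinearMap.comp_add,
    TensorProduct.map_comp]
  congr 2
  simp only [← LinearMap.comp_assoc, ← TensorProduct.map_comp, LinearMap.comp_id]

theorem comp_conv (φ : A →ₐ[R] A') (f g : C →ₗ[R] A) :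
    φ.toLinearMap ∘ₗ conv δ f g = conv δ (φ.toLinearMap ∘ₗ f) (φ.toLinearMap ∘ₗ g) := by
  refine LinearMap.ext fun x => ?_
  simp only [conv, LinearMap.comp_apply]
  induction δ x with
  | zero => simp
  | add x y hx hy => simp only [map_add, hx, hy]
  | tmul x y => simp

/-- Convolutions and derivations. -/
theorem der_comp_conv {D σ : A →ₗ[R] A} (hD : ∀ x y, D (x * y) = D x * y + σ x * D y)
    (f g : C →ₗ[R] A) :
    D ∘ₗ conv δ f g = conv δ (D ∘ₗ f) g + conv δ (σ ∘ₗ f) (D ∘ₗ g) := by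
  refine LinearMap.ext fun x => ?_
  simp only [conv, LinearMap.comp_apply, LinearMap.add_apply]
  induction δ x with
  | zero => simp
  | add x y hx hy => simp only [map_add, hx, hy]; abel
  | tmul x y => simp [hD]

/-- With `a = 1` this is the unit law of the convolution algebra. The general `a` occurs when an
operator-valued convolution has collapsed to a constant. -/
theorem conv_one_left {ε : C →ₗ[R] R}
    (hε : ∀ x, TensorProduct.lid R C (ε.rTensor C (δ x)) = x) (a : A) (f : C →ₗ[R] A) :
    conv δ (ε.smulRight a) f = LinearMap.mulLeft R a ∘ₗ f := by
  refine LinearMap.ext fun x => ?_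
  conv_rhs => rw [← hε x]
  simp only [conv, LinearMap.comp_apply]
  induction δ x with
  | zero => simp
  | add x y hx hy => simp only [map_add, hx, hy]
  | tmul x y => simp

theorem conv_one_right {ε : C →ₗ[R] R}
    (hε : ∀ x, TensorProduct.rid R C (ε.lTensor C (δ x)) = x) (a : A) (f : C →ₗ[R] A) :
    conv δ f (ε.smulRight a) = LinearMap.mulRight R a ∘ₗ f := by
  refine LinearMap.ext fun x => ?_
  conv_rhs => rw [← hε x]
  simp only [conv, LinearMap.comp_apply]
  induction δ x with
  | zero => simp
  | add x y hx hy => simp only [map_add, hx, hy]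
  | tmul x y => simp

variable (δ) in
theorem conv_mulLeft (a : A) (f g : C →ₗ[R] A) :
    conv δ (LinearMap.mulLeft R a ∘ₗ f) g = LinearMap.mulLeft R a ∘ₗ conv δ f g := by
  refine LinearMap.ext fun x => ?_
  simp only [conv, LinearMap.comp_apply]
  induction δ x with
  | zero => simp
  | add x y hx hy => simp only [map_add, hx, hy]
  | tmul x y => simp [mul_assoc]

variable (δ) in
theorem conv_mulRight (a : A) (f g : C →ₗ[R] A) :
    conv δ f (LinearMap.mulRight R a ∘ₗ g) = LinearMap.mulRight R a ∘ₗ conv δ f g := by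
  refine LinearMap.ext fun x => ?_
  simp only [conv, LinearMap.comp_apply]
  induction δ x with
  | zero => simp
  | add x y hx hy => simp only [map_add, hx, hy]
  | tmul x y => simp [mul_assoc]

end Conv

/-! ### Tensor algebras: words, weights and deconcatenation -/

section Words

variable {R : Type*} [CommRing R]
variable {M : Type*} [AddCommGroup M] [Module R M]
variable {N : Type*} [AddCommGroup N] [Module R N]

open TensorAlgebra

@[simp] theorem ιInv_ι (x : M) : ιInv (ι R x) = x := ι_leftInverse x

theorem ιInv_mul (x y : TensorAlgebra R M) :
    ιInv (x * y) = (algebraMapInv x : R) • ιInv y + (algebraMapInv y : R) • ιInv x := by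
  -- `ιInv` is the second component of the algebra map to the trivial square-zero extension `R ⊕ M`,
  -- hence a derivation over the augmentation. The bimodule structure has to be the one in the
  -- definition of `ιInv` for the identification `h1` to hold by `rfl`.
  let _ : Module Rᵐᵒᵖ M := Module.compHom _ ((RingHom.id R).fromOpposite mul_comm)
  have : IsCentralScalar R M := ⟨fun r m => rfl⟩
  have h1 : ∀ t : TensorAlgebra R M, (ιInv t : M) = (toTrivSqZeroExt t).snd := fun t => rfl
  have h2 : (TrivSqZeroExt.fstHom R R M).comp (toTrivSqZeroExt : TensorAlgebra R M →ₐ[R] _) =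
      algebraMapInv := by
    apply TensorAlgebra.hom_ext
    ext x
    simp [algebraMapInv]
  have h3 : ∀ t : TensorAlgebra R M, (toTrivSqZeroExt t).fst = (algebraMapInv t : R) :=
    fun t => AlgHom.congr_fun h2 t
  simp only [h1, map_mul, TrivSqZeroExt.snd_mul, h3, op_smul_eq_smul]

@[simp] theorem ιInv_one : (ιInv (1 : TensorAlgebra R M) : M) = 0 := by
  simpa using ιInv_mul (1 : TensorAlgebra R M) 1

@[simp] theorem algebraMapInv_ι (x : M) : (algebraMapInv (ι R x) : R) = 0 := by
  simp [algebraMapInv]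

theorem ιInv_ι_mul (x : M) (t : TensorAlgebra R M) :
    ιInv (ι R x * t) = (algebraMapInv t : R) • x := by
  simp [ιInv_mul]

theorem ιInv_mul_ι (x : M) (t : TensorAlgebra R M) :
    ιInv (t * ι R x) = (algebraMapInv t : R) • x := by
  simp [ιInv_mul]

theorem words_induction {p : TensorAlgebra R M → Prop} (h1 : p 1)
    (hadd : ∀ x y, p x → p y → p (x + y)) (hsmul : ∀ (r : R) x, p x → p (r • x))
    (hι : ∀ x t, p t → p (ι R x * t)) (t : TensorAlgebra R M) : p t := by
  have key : ∀ s t : TensorAlgebra R M, p t → p (s * t) := by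
    intro s
    induction s using TensorAlgebra.induction with
    | algebraMap r => intro t ht; rw [← Algebra.smul_def]; exact hsmul r t ht
    | ι x => exact hι x
    | mul a b ha hb => intro t ht; rw [mul_assoc]; exact ha _ (hb _ ht)
    | add a b ha hb => intro t ht; rw [add_mul]; exact hadd _ _ (ha _ ht) (hb _ ht)
  simpa using key t 1 h1

/-- Maps which commute with the left multiplications by letters are determined at `1`. -/
theorem words_hom_ext {f g : TensorAlgebra R M →ₗ[R] N} (h1 : f 1 = g 1)
    (hι : ∀ x t, f t = g t → f (ι R x * t) = g (ι R x * t)) : f = g := by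
  refine LinearMap.ext fun t => ?_
  induction t using words_induction with
  | h1 => exact h1
  | hadd x y hx hy => simp only [map_add, hx, hy]
  | hsmul r x hx => simp only [map_smul, hx]
  | hι x t ht => exact hι x t ht

theorem deconc_ι (x : M) :
    deconc R M (ι R x) = 1 ⊗ₜ[R] ι R x + ι R x ⊗ₜ[R] 1 := by
  simpa [deconc_one] using deconc_ι_mul x (1 : TensorAlgebra R M)

/-- A cut of the word `x y` lies in `x` or in `y`. The cut between them is counted twice on the
right, which the extra term `x ⊗ y` on the left compensates. -/
theorem deconc_mul (x y : TensorAlgebra R M) :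
    deconc R M (x * y) + x ⊗ₜ[R] y = (LinearMap.mulRight R y).lTensor _ (deconc R M x) +
      (LinearMap.mulLeft R x).rTensor _ (deconc R M y) := by
  induction x using words_induction with
  | h1 => simp [deconc_one, add_comm]
  | hadd x x' hx hx' =>
    have h : LinearMap.mulLeft R (x + x') = LinearMap.mulLeft R x + LinearMap.mulLeft R x' := by
      ext; simp [add_mul]
    simp only [add_mul, map_add, TensorProduct.add_tmul, h, LinearMap.rTensor_add,
      LinearMap.add_apply]
    rw [add_add_add_comm, hx, hx']
    abel
  | hsmul r x hx =>
    have h : LinearMap.mulLeft R (r • x) = r • LinearMap.mulLeft R x := by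
      ext; simp
    simp only [smul_mul_assoc, map_smul, ← TensorProduct.smul_tmul', h, LinearMap.rTensor_smul,
      LinearMap.smul_apply, ← smul_add, hx]
  | hι a x hx =>
    have h : (LinearMap.mulLeft R (ι R a * x)).rTensor (TensorAlgebra R M) =
        (LinearMap.mulLeft R (ι R a)).rTensor _ ∘ₗ (LinearMap.mulLeft R x).rTensor _ := by
      rw [← LinearMap.rTensor_comp]; congr 1; ext; simp
    have h' : (LinearMap.mulRight R y).lTensor _ ∘ₗ (LinearMap.mulLeft R (ι R a)).rTensor _ =
      (LinearMap.mulLeft R (ι R a)).rTensor _ ∘ₗ (LinearMap.mulRight R y).lTensor _ := by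
        rw [LinearMap.lTensor_comp_rTensor, LinearMap.rTensor_comp_lTensor]
    have h'' := LinearMap.congr_fun h' (deconc R M x)
    simp only [LinearMap.comp_apply] at h''
    rw [h, LinearMap.comp_apply, mul_assoc, deconc_ι_mul, deconc_ι_mul, map_add, h'']
    rw [← eq_sub_iff_add_eq] at hx
    rw [hx, map_sub, map_add]
    simp [mul_assoc]
    abel

theorem deconc_mul_ι (x : TensorAlgebra R M) (b : M) :
    deconc R M (x * ι R b) = (LinearMap.mulRight R (ι R b)).lTensor _ (deconc R M x) +
      (x * ι R b) ⊗ₜ[R] 1 := by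
  have h := deconc_mul x (ι R b)
  rw [deconc_ι, map_add, LinearMap.rTensor_tmul, LinearMap.rTensor_tmul, ← add_assoc,
    LinearMap.mulLeft_apply, LinearMap.mulLeft_apply, mul_one] at h
  rw [← sub_eq_zero] at h ⊢
  rw [← h]; abel

/-- A cut lies before the letter `b` or after it, never both, so nothing is counted twice. -/
theorem deconc_mul_ι_mul (x y : TensorAlgebra R M) (b : M) :
    deconc R M (x * ι R b * y) = (LinearMap.mulRight R (ι R b * y)).lTensor _ (deconc R M x) +
      (LinearMap.mulLeft R (x * ι R b)).rTensor _ (deconc R M y) := by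
  have h := deconc_mul (x * ι R b) y
  rw [deconc_mul_ι, map_add, LinearMap.lTensor_tmul, LinearMap.mulRight_apply, one_mul,
    add_right_comm] at h
  rw [add_right_cancel h, ← LinearMap.comp_apply, ← LinearMap.lTensor_comp]
  congr 4
  ext; simp

theorem deconc_counit_left (x : TensorAlgebra R M) :
    TensorProduct.lid R _ ((algebraMapInv : TensorAlgebra R M →ₐ[R] R).toLinearMap.rTensor _
      (deconc R M x)) = x := by
  induction x using words_induction with
  | h1 => simp [deconc_one]
  | hadd x y hx hy => simp only [map_add, hx, hy]
  | hsmul r x hx => simp only [map_smul, hx]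
  | hι a t _ =>
    have h : (algebraMapInv : TensorAlgebra R M →ₐ[R] R).toLinearMap ∘ₗ
        LinearMap.mulLeft R (ι R a) = 0 := by ext; simp
    rw [deconc_ι_mul, map_add, ← LinearMap.comp_apply (LinearMap.rTensor (TensorAlgebra R M) _),
      ← LinearMap.rTensor_comp, h]
    simp

theorem deconc_counit_right (x : TensorAlgebra R M) :
    TensorProduct.rid R _ ((algebraMapInv : TensorAlgebra R M →ₐ[R] R).toLinearMap.lTensor _
      (deconc R M x)) = x := by
  induction x using words_induction with
  | h1 => simp [deconc_one]
  | hadd x y hx hy => simp only [map_add, hx, hy]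
  | hsmul r x hx => simp only [map_smul, hx]
  | hι a t ht =>
    rw [deconc_ι_mul, map_add, map_add]
    conv_rhs => rw [← ht]
    simp only [LinearMap.lTensor_tmul, AlgHom.toLinearMap_apply, map_mul, algebraMapInv_ι, zero_mul,
      TensorProduct.tmul_zero, map_zero, zero_add]
    induction deconc R M t with
    | zero => simp
    | add x y hx hy => simp only [map_add, mul_add, hx, hy]
    | tmul x y => simp

theorem deconc_coassoc :
    (TensorProduct.assoc R (TensorAlgebra R M) (TensorAlgebra R M) (TensorAlgebra R M)).toLinearMap ∘ₗ (deconc R M).rTensor (TensorAlgebra R M) ∘ₗ deconc R M =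
      (deconc R M).lTensor (TensorAlgebra R M) ∘ₗ deconc R M := by
  refine words_hom_ext ?_ ?_
  · simp [deconc_one]
  · intro a t ht
    simp only [LinearMap.comp_apply, LinearEquiv.coe_coe] at ht ⊢
    rw [deconc_ι_mul, map_add, map_add, map_add, LinearMap.lTensor_tmul, deconc_ι_mul,
      LinearMap.rTensor_tmul, deconc_one]
    have h1 : ∀ z, (deconc R M).rTensor (TensorAlgebra R M) ((LinearMap.mulLeft R (ι R a)).rTensor _ z) =
        TensorProduct.map (TensorProduct.mk R (TensorAlgebra R M) (TensorAlgebra R M) 1 ∘ₗ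
          LinearMap.mulLeft R (ι R a)) LinearMap.id z +
        ((LinearMap.mulLeft R (ι R a)).rTensor (TensorAlgebra R M)).rTensor (TensorAlgebra R M)
          ((deconc R M).rTensor (TensorAlgebra R M) z) := by
      intro z
      induction z with
      | zero => simp
      | add x y hx hy => simp only [map_add, hx, hy]; abel
      | tmul x y => simp [deconc_ι_mul, TensorProduct.add_tmul]
    have h2 : ∀ z, (TensorProduct.assoc R _ _ _) (((LinearMap.mulLeft R (ι R a)).rTensor
        (TensorAlgebra R M)).rTensor (TensorAlgebra R M) z) =
        (LinearMap.mulLeft R (ι R a)).rTensor _ (TensorProduct.assoc R _ _ _ z) := by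
      intro z
      refine LinearMap.congr_fun (f := (TensorProduct.assoc R _ _ _).toLinearMap ∘ₗ
        ((LinearMap.mulLeft R (ι R a)).rTensor _).rTensor _)
        (g := (LinearMap.mulLeft R (ι R a)).rTensor _ ∘ₗ (TensorProduct.assoc R _ _ _).toLinearMap)
        ?_ z
      ext; simp
    have h3 : ∀ z, (deconc R M).lTensor _ ((LinearMap.mulLeft R (ι R a)).rTensor _ z) =
        (LinearMap.mulLeft R (ι R a)).rTensor _ ((deconc R M).lTensor _ z) := by
      intro z
      simp only [← LinearMap.comp_apply, LinearMap.lTensor_comp_rTensor,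
        LinearMap.rTensor_comp_lTensor]
    have h4 : ∀ z, (TensorProduct.assoc R _ _ _) (TensorProduct.map
        (TensorProduct.mk R (TensorAlgebra R M) (TensorAlgebra R M) 1 ∘ₗ
          LinearMap.mulLeft R (ι R a)) LinearMap.id z) =
        1 ⊗ₜ[R] ((LinearMap.mulLeft R (ι R a)).rTensor (TensorAlgebra R M) z) := by
      intro z
      induction z with
      | zero => simp
      | add x y hx hy => simp only [map_add, hx, hy, TensorProduct.tmul_add]
      | tmul x y => simp
    rw [h1, h3, map_add, h2, h4, ht]
    simp [TensorProduct.tmul_add, add_assoc]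

/-! Weights. -/

theorem weightProj_of_mem {k : ℕ} {t : TensorAlgebra R M}
    (ht : t ∈ LinearMap.range (ι R : M →ₗ[R] TensorAlgebra R M) ^ k) (n : ℕ) :
    weightProj R M n t = if k = n then t else 0 := by
  rw [weightProj, GradedAlgebra.proj_apply]
  split_ifs with h
  · subst h; exact DirectSum.decompose_of_mem_same _ ht
  · exact DirectSum.decompose_of_mem_ne _ ht h

theorem weightProj_mem (n : ℕ) (t : TensorAlgebra R M) :
    weightProj R M n t ∈ LinearMap.range (ι R : M →ₗ[R] TensorAlgebra R M) ^ n := by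
  rw [weightProj, GradedAlgebra.proj_apply]; exact SetLike.coe_mem _

theorem weight_ext {x y : TensorAlgebra R M} (h : ∀ n, weightProj R M n x = weightProj R M n y) :
    x = y := by
  refine (DirectSum.decompose
    (fun j : ℕ => (LinearMap.range (ι R : M →ₗ[R] TensorAlgebra R M)) ^ j)).injective ?_
  ext n
  exact h n

theorem weightProj_weightProj (n k : ℕ) (t : TensorAlgebra R M) :
    weightProj R M n (weightProj R M k t) = if k = n then weightProj R M k t else 0 :=
  weightProj_of_mem (weightProj_mem k t) n

theorem one_mem_weight : (1 : TensorAlgebra R M) ∈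
    LinearMap.range (ι R : M →ₗ[R] TensorAlgebra R M) ^ 0 := by
  rw [pow_zero]; exact Submodule.one_le.1 le_rfl

theorem ι_mem_weight (x : M) : ι R x ∈
    LinearMap.range (ι R : M →ₗ[R] TensorAlgebra R M) ^ 1 := by
  rw [pow_one]; exact ⟨x, rfl⟩

theorem weightProj_one (n : ℕ) :
    weightProj R M n 1 = if n = 0 then 1 else 0 := by
  rw [weightProj_of_mem one_mem_weight]; simp [eq_comm]

theorem weightProj_ι_mul_succ (n : ℕ) (x : M) (t : TensorAlgebra R M) :
    weightProj R M (n + 1) (ι R x * t) = ι R x * weightProj R M n t := by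
  rw [weightProj, GradedAlgebra.proj_apply, add_comm, DirectSum.coe_decompose_mul_add_of_left_mem _
    (ι_mem_weight x)]
  rfl

theorem weightProj_ι_mul_zero (x : M) (t : TensorAlgebra R M) :
    weightProj R M 0 (ι R x * t) = 0 := by
  rw [weightProj, GradedAlgebra.proj_apply]
  exact DirectSum.coe_decompose_mul_of_left_mem_of_not_le _ (ι_mem_weight x) (by simp)

theorem weightProj_zero (t : TensorAlgebra R M) :
    weightProj R M 0 t = algebraMap R _ (algebraMapInv t) := by
  induction t using words_induction with
  | h1 => simp [weightProj_one]
  | hadd x y hx hy => simp only [map_add, hx, hy]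
  | hsmul r x hx => rw [map_smul, hx, map_smul, smul_eq_mul, map_mul, Algebra.smul_def]
  | hι a t _ => simp [weightProj_ι_mul_zero]

theorem weightProj_one_eq (t : TensorAlgebra R M) : weightProj R M 1 t = ι R (ιInv t) := by
  induction t using words_induction with
  | h1 => simp [weightProj_one]
  | hadd x y hx hy => simp only [map_add, hx, hy]
  | hsmul r x hx => simp [hx]
  | hι a t _ =>
    rw [weightProj_ι_mul_succ, weightProj_zero, ιInv_ι_mul, map_smul, Algebra.smul_def,
      Algebra.commutes]

theorem algebraMapInv_of_weight {n : ℕ} (hn : n ≠ 0) {t : TensorAlgebra R M}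
    (ht : t ∈ LinearMap.range (ι R : M →ₗ[R] TensorAlgebra R M) ^ n) :
    (algebraMapInv t : R) = 0 := by
  have h := weightProj_zero t
  rw [weightProj_of_mem ht, if_neg hn] at h
  exact (TensorAlgebra.algebraMap_eq_zero_iff (M := M) _).1 h.symm

theorem ιInv_of_weight {n : ℕ} (hn : n ≠ 1) {t : TensorAlgebra R M}
    (ht : t ∈ LinearMap.range (ι R : M →ₗ[R] TensorAlgebra R M) ^ n) :
    (ιInv t : M) = 0 := by
  have h := weightProj_one_eq t
  rw [weightProj_of_mem ht, if_neg hn] at h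
  exact (ι_eq_zero_iff R _).1 h.symm

/-- A word of length `n + 1` is a letter followed by a word of length `n`. This recursion reduces
statements about coalgebra maps and coderivations on `T(M)` to their projections to letters. -/
theorem weightProj_succ (n : ℕ) :
    weightProj R M (n + 1) = conv (deconc R M) (ι R ∘ₗ ιInv) (weightProj R M n) := by
  refine words_hom_ext ?_ fun x t _ => ?_
  · simp [weightProj_one, conv_apply, deconc_one]
  · rw [weightProj_ι_mul_succ, conv_apply, deconc_ι_mul, map_add, map_add]
    conv_lhs => rw [← deconc_counit_left t]
    simp only [TensorProduct.map_tmul, LinearMap.comp_apply, ιInv_one, map_zero,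
      LinearMap.mul'_apply, zero_mul, zero_add]
    induction deconc R M t with
    | zero => simp
    | add x y hx hy => simp only [map_add, mul_add, hx, hy]
    | tmul y z => simp [ιInv_ι_mul]

end Words

/-! ### Tensor algebras of graded modules -/

section GradedWords

variable {R : Type*} [CommRing R]
variable {M : Type*} [AddCommGroup M] [Module R M]
variable {N : Type*} [AddCommGroup N] [Module R N]
variable {𝒜 : ℤ → Submodule R M} {ℬ : ℤ → Submodule R N}

open TensorAlgebra

/-- Induction on words with homogeneous letters. -/
theorem tensorGr_induction {p : ℤ → TensorAlgebra R M → Prop} (h1 : p 0 1) (h0 : ∀ k, p k 0)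
    (hadd : ∀ k, ∀ x ∈ tensorGr 𝒜 k, ∀ y ∈ tensorGr 𝒜 k, p k x → p k y → p k (x + y))
    (hsmul : ∀ k, ∀ r : R, ∀ x ∈ tensorGr 𝒜 k, p k x → p k (r • x))
    (hι : ∀ j k, ∀ x ∈ 𝒜 j, ∀ t ∈ tensorGr 𝒜 k, p k t → p (j + k) (ι R x * t))
    {k : ℤ} {t : TensorAlgebra R M} (ht : t ∈ tensorGr 𝒜 k) : p k t := by
  unfold tensorGr at ht
  induction ht using Submodule.span_induction with
  | mem t h =>
    obtain ⟨l, h1', rfl, rfl⟩ := h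
    induction l with
    | nil => simpa
    | cons a l ih =>
      simp only [List.map_cons, List.sum_cons, List.prod_cons]
      have hl : ∀ q ∈ l, q.2 ∈ 𝒜 q.1 := fun q hq => h1' q (by simp [hq])
      exact hι _ _ _ (h1' a (by simp)) _ (Submodule.subset_span ⟨l, hl, rfl, rfl⟩) (ih hl)
  | zero => exact h0 k
  | add x y hx hy h1 h2 => exact hadd k x hx y hy h1 h2
  | smul r x hx h => exact hsmul k r x hx h

/-- Induction on words with homogeneous letters, from the right. -/
theorem tensorGr_induction_right {p : ℤ → TensorAlgebra R M → Prop} (h1 : p 0 1) (h0 : ∀ k, p k 0)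
    (hadd : ∀ k, ∀ x ∈ tensorGr 𝒜 k, ∀ y ∈ tensorGr 𝒜 k, p k x → p k y → p k (x + y))
    (hsmul : ∀ k, ∀ r : R, ∀ x ∈ tensorGr 𝒜 k, p k x → p k (r • x))
    (hι : ∀ j k, ∀ x ∈ 𝒜 j, ∀ t ∈ tensorGr 𝒜 k, p k t → p (k + j) (t * ι R x))
    {k : ℤ} {t : TensorAlgebra R M} (ht : t ∈ tensorGr 𝒜 k) : p k t := by
  unfold tensorGr at ht
  induction ht using Submodule.span_induction with
  | mem t h =>
    obtain ⟨l, h1', rfl, rfl⟩ := h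
    induction l using List.reverseRecOn with
    | nil => simpa
    | append_singleton l a ih =>
      simp only [List.map_append, List.sum_append, List.prod_append, List.map_cons, List.map_nil,
        List.sum_singleton, List.prod_singleton]
      have hl : ∀ q ∈ l, q.2 ∈ 𝒜 q.1 := fun q hq => h1' q (by simp [hq])
      exact hι _ _ _ (h1' a (by simp)) _ (Submodule.subset_span ⟨l, hl, rfl, rfl⟩) (ih hl)
  | zero => exact h0 k
  | add x y hx hy h1 h2 => exact hadd k x hx y hy h1 h2
  | smul r x hx h => exact hsmul k r x hx h

theorem one_mem_tensorGr : (1 : TensorAlgebra R M) ∈ tensorGr 𝒜 0 := SetLike.GradedOne.one_mem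

theorem mul_mem_tensorGr {i j k : ℤ} (h : i + j = k) {x y : TensorAlgebra R M}
    (hx : x ∈ tensorGr 𝒜 i) (hy : y ∈ tensorGr 𝒜 j) : x * y ∈ tensorGr 𝒜 k :=
  h ▸ SetLike.GradedMul.mul_mem hx hy

theorem deconc_mem {k : ℤ} {t : TensorAlgebra R M} (ht : t ∈ tensorGr 𝒜 k) :
    deconc R M t ∈ prodGr (tensorGr 𝒜) (tensorGr 𝒜) k := by
  refine tensorGr_induction (𝒜 := 𝒜)
    (p := fun k t => deconc R M t ∈ prodGr (tensorGr 𝒜) (tensorGr 𝒜) k) ?_ ?_ ?_ ?_ ?_ ht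
  · rw [deconc_one]; exact tmul_mem_prodGr (by simp) one_mem_tensorGr one_mem_tensorGr
  · simp
  · intro k x _ y _ h h'; rw [map_add]; exact add_mem h h'
  · intro k r x _ h; rw [map_smul]; exact Submodule.smul_mem _ _ h
  · intro j k x hx t ht h
    rw [deconc_ι_mul]
    refine add_mem (tmul_mem_prodGr (by simp) one_mem_tensorGr
      (mul_mem_tensorGr rfl (ι_mem_tensorGr 𝒜 hx) ht)) ?_
    refine prodGr_map (c := j) (d := 0) (by ring) ?_ ?_ h
    · intro l y hy
      exact mul_mem_tensorGr (add_comm _ _) (ι_mem_tensorGr 𝒜 hx) hy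
    · intro l y hy; simpa using hy

theorem weightProj_mem_tensorGr (n : ℕ) {k : ℤ} {t : TensorAlgebra R M} (ht : t ∈ tensorGr 𝒜 k) :
    weightProj R M n t ∈ tensorGr 𝒜 k := by
  refine tensorGr_induction (𝒜 := 𝒜)
    (p := fun k t => ∀ n, weightProj R M n t ∈ tensorGr 𝒜 k) ?_ ?_ ?_ ?_ ?_ ht n
  · intro n; rw [weightProj_one]; split_ifs; exacts [one_mem_tensorGr, zero_mem _]
  · simp
  · intro k x _ y _ h h' n; rw [map_add]; exact add_mem (h n) (h' n)
  · intro k r x _ h n; rw [map_smul]; exact Submodule.smul_mem _ _ (h n)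
  · intro j k x hx t ht h n
    cases n with
    | zero => rw [weightProj_ι_mul_zero]; exact zero_mem _
    | succ n =>
      rw [weightProj_ι_mul_succ]
      exact mul_mem_tensorGr rfl (ι_mem_tensorGr 𝒜 hx) (h n)

/-- The map `ι` is injective and carries the homogeneous components of `x` to those of `ι x`. -/
theorem ι_mem_tensorGr_iff [DirectSum.Decomposition 𝒜] {k : ℤ} {x : M} :
    ι R x ∈ tensorGr 𝒜 k ↔ x ∈ 𝒜 k := by
  refine ⟨fun h => ?_, ι_mem_tensorGr 𝒜⟩
  have key : ∀ j, j ≠ k → (DirectSum.decompose 𝒜 x j : M) = 0 := by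
    intro j hj
    have h1 : (DirectSum.decompose (tensorGr 𝒜) (ι R x) j : TensorAlgebra R M) =
        ι R (DirectSum.decompose 𝒜 x j : M) := by
      clear h
      induction x using induction_homogeneous (𝒜 := 𝒜) with
      | h0 => simp
      | hadd x y hx hy => simp [hx, hy, DirectSum.decompose_add]
      | h l x hx =>
        by_cases hlj : l = j
        · subst hlj
          rw [DirectSum.decompose_of_mem_same _ hx,
            DirectSum.decompose_of_mem_same _ (ι_mem_tensorGr 𝒜 hx)]
        · rw [DirectSum.decompose_of_mem_ne _ hx hlj,
            DirectSum.decompose_of_mem_ne _ (ι_mem_tensorGr 𝒜 hx) hlj, map_zero]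
    rw [DirectSum.decompose_of_mem_ne _ h (Ne.symm hj)] at h1
    exact (ι_eq_zero_iff R _).1 h1.symm
  classical
  rw [← DirectSum.sum_support_decompose 𝒜 x]
  refine Submodule.sum_mem _ fun j _ => ?_
  by_cases hj : j = k
  · subst hj; exact SetLike.coe_mem _
  · rw [key j hj]; exact zero_mem _

theorem ιInv_mem [DirectSum.Decomposition 𝒜] {k : ℤ} {t : TensorAlgebra R M}
    (ht : t ∈ tensorGr 𝒜 k) : ιInv t ∈ 𝒜 k := by
  rw [← ι_mem_tensorGr_iff (𝒜 := 𝒜), ← weightProj_one_eq]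
  exact weightProj_mem_tensorGr 1 ht

/-! Degree bounds. -/

/-- Each letter has degree at least `c`, so a word of `k` letters has degree at least `c k`. All
vanishing statements for degree reasons rest on this bound. -/
theorem weightProj_eq_zero_of_lt {c : ℤ} (hc : ∀ j, j < c → 𝒜 j = ⊥) {m : ℤ}
    {t : TensorAlgebra R M} (ht : t ∈ tensorGr 𝒜 m) {k : ℕ} (hk : m < c * k) :
    weightProj R M k t = 0 := by
  refine tensorGr_induction (𝒜 := 𝒜)
    (p := fun m t => ∀ k : ℕ, m < c * k → weightProj R M k t = 0) ?_ ?_ ?_ ?_ ?_ ht k hk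
  · intro k hk
    rw [weightProj_one, if_neg]
    rintro rfl
    simp at hk
  · simp
  · intro k x _ y _ h h' n hn; rw [map_add, h n hn, h' n hn, add_zero]
  · intro k r x _ h n hn; rw [map_smul, h n hn, smul_zero]
  · intro j l x hx t ht h n hn
    cases n with
    | zero => rw [weightProj_ι_mul_zero]
    | succ n =>
      rw [weightProj_ι_mul_succ]
      by_cases hj : j < c
      · rw [hc j hj, Submodule.mem_bot] at hx
        simp [hx]
      · rw [h n (by push_cast at hn; linarith), mul_zero]

theorem tensorGr_eq_bot_of_neg {c : ℤ} (hc : ∀ j, j < c → 𝒜 j = ⊥) (hc0 : 0 ≤ c) {m : ℤ} (hm : m < 0) :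
    tensorGr (R := R) 𝒜 m = ⊥ := by
  rw [eq_bot_iff]
  intro t ht
  refine weight_ext fun n => ?_
  rw [weightProj_eq_zero_of_lt hc ht (lt_of_lt_of_le hm (by positivity)), map_zero]

theorem tensorGr_zero_eq {c : ℤ} (hc : ∀ j, j < c → 𝒜 j = ⊥) (hc0 : 0 < c) :
    tensorGr (R := R) 𝒜 0 = Submodule.span R {1} := by
  apply le_antisymm
  · intro t ht
    have h : t = (algebraMapInv t : R) • 1 := by
      refine weight_ext fun n => ?_
      rcases Nat.eq_zero_or_pos n with rfl | hn
      · simp [weightProj_zero, Algebra.smul_def]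
      · rw [weightProj_eq_zero_of_lt hc ht (by positivity), map_smul, weightProj_one,
          if_neg hn.ne', smul_zero]
    rw [h]
    exact Submodule.smul_mem _ _ (Submodule.subset_span rfl)
  · rw [Submodule.span_singleton_le_iff_mem]
    exact one_mem_tensorGr

theorem tensorGr_eq_bot_of_pos {c : ℤ} (hc : ∀ j, j < c → 𝒜 j = ⊥) {m : ℤ} (hm : 0 < m)
    (hmc : m < c) : tensorGr (R := R) 𝒜 m = ⊥ := by
  rw [eq_bot_iff]
  intro t ht
  refine weight_ext fun n => ?_
  rw [map_zero]
  rcases Nat.eq_zero_or_pos n with rfl | hn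
  · rw [weightProj_zero, algebraMapInv_tensorGr 𝒜 hm.ne' ht, map_zero]
  · refine weightProj_eq_zero_of_lt hc ht (hmc.trans_le ?_)
    nlinarith [show (1 : ℤ) ≤ n by exact_mod_cast hn]

/-! Functoriality. -/

/-- The algebra map of tensor algebras induced by a linear map. -/
def wordMap (f : M →ₗ[R] N) : TensorAlgebra R M →ₐ[R] TensorAlgebra R N :=
  TensorAlgebra.lift R (ι R ∘ₗ f)

@[simp] theorem wordMap_ι (f : M →ₗ[R] N) (x : M) : wordMap f (ι R x) = ι R (f x) := by
  simp [wordMap]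

theorem wordMap_mem {f : M →ₗ[R] N} (hf : ∀ k, ∀ x ∈ 𝒜 k, f x ∈ ℬ k) {k : ℤ}
    {t : TensorAlgebra R M} (ht : t ∈ tensorGr 𝒜 k) : wordMap f t ∈ tensorGr ℬ k := by
  refine tensorGr_induction (𝒜 := 𝒜) (p := fun k t => wordMap f t ∈ tensorGr ℬ k)
    ?_ ?_ ?_ ?_ ?_ ht
  · simpa using one_mem_tensorGr
  · simp
  · intro k x _ y _ h h'; rw [map_add]; exact add_mem h h'
  · intro k r x _ h; rw [map_smul]; exact Submodule.smul_mem _ _ h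
  · intro j k x hx t ht h
    rw [map_mul, wordMap_ι]
    exact mul_mem_tensorGr rfl (ι_mem_tensorGr ℬ (hf j x hx)) h

theorem algebraMapInv_wordMap (f : M →ₗ[R] N) (t : TensorAlgebra R M) :
    (algebraMapInv (wordMap f t) : R) = algebraMapInv t := by
  have : (algebraMapInv.comp (wordMap f) : TensorAlgebra R M →ₐ[R] R) = algebraMapInv := by
    apply TensorAlgebra.hom_ext
    ext x; simp
  exact AlgHom.congr_fun this t

theorem ιInv_wordMap (f : M →ₗ[R] N) (t : TensorAlgebra R M) :
    ιInv (wordMap f t) = f (ιInv t) := by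
  induction t using words_induction with
  | h1 => simp
  | hadd x y hx hy => simp only [map_add, hx, hy]
  | hsmul r x hx => simp [hx]
  | hι a t _ => simp [ιInv_ι_mul, algebraMapInv_wordMap]

theorem weightProj_wordMap (f : M →ₗ[R] N) (n : ℕ) (t : TensorAlgebra R M) :
    weightProj R N n (wordMap f t) = wordMap f (weightProj R M n t) := by
  induction t using words_induction generalizing n with
  | h1 => simp only [map_one, weightProj_one]; split_ifs <;> simp
  | hadd x y hx hy => simp only [map_add, hx, hy]
  | hsmul r x hx => simp [hx]
  | hι a t ih =>
    cases n with
    | zero => simp [weightProj_ι_mul_zero]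
    | succ n => simp [weightProj_ι_mul_succ, ih]

theorem deconc_wordMap (f : M →ₗ[R] N) (t : TensorAlgebra R M) :
    deconc R N (wordMap f t) =
      TensorProduct.map (wordMap f).toLinearMap (wordMap f).toLinearMap (deconc R M t) := by
  induction t using words_induction with
  | h1 => simp [deconc_one]
  | hadd x y hx hy => simp only [map_add, hx, hy]
  | hsmul r x hx => simp only [map_smul, hx]
  | hι a t ih =>
    rw [map_mul, wordMap_ι, deconc_ι_mul, deconc_ι_mul, ih, map_add]
    congr 1
    · simp
    · induction deconc R M t with
      | zero => simp
      | add x y hx hy => simp only [map_add, hx, hy]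
      | tmul x y => simp

theorem wordMap_comp_of_leftInverse {f : M →ₗ[R] N} {g : N →ₗ[R] M} (h : ∀ x, g (f x) = x)
    (t : TensorAlgebra R M) : wordMap g (wordMap f t) = t := by
  have : (wordMap g).comp (wordMap f) = AlgHom.id R _ := by
    apply TensorAlgebra.hom_ext
    ext x; simp [h]
  exact AlgHom.congr_fun this t

/-! Derivations. -/

variable [DirectSum.Decomposition 𝒜] [DirectSum.Decomposition ℬ]

theorem twist_mul (k : ℤ) (x y : TensorAlgebra R M) :
    twist (tensorGr 𝒜) k (x * y) = twist (tensorGr 𝒜) k x * twist (tensorGr 𝒜) k y := by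
  induction x using induction_homogeneous (𝒜 := tensorGr 𝒜) with
  | h0 => simp
  | hadd x x' hx hx' => simp only [add_mul, map_add, hx, hx']
  | h p x hx =>
    induction y using induction_homogeneous (𝒜 := tensorGr 𝒜) with
    | h0 => simp
    | hadd x x' hx hx' => simp only [mul_add, map_add, hx, hx']
    | h q y hy =>
      rw [twist_of_mem _ _ hx, twist_of_mem _ _ hy, twist_of_mem _ _ (mul_mem_tensorGr rfl hx hy),
        mul_add, sg_add, smul_mul_smul_comm]

theorem twist_one (k : ℤ) : twist (tensorGr (R := R) 𝒜) k 1 = 1 := by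
  rw [twist_of_mem _ _ one_mem_tensorGr]; simp

theorem twist_ι (k : ℤ) (x : M) : twist (tensorGr (R := R) 𝒜) k (ι R x) = ι R (twist 𝒜 k x) := by
  induction x using induction_homogeneous (𝒜 := 𝒜) with
  | h0 => simp
  | hadd x y hx hy => simp only [map_add, hx, hy]
  | h j x hx => rw [twist_of_mem _ _ hx, twist_of_mem _ _ (ι_mem_tensorGr 𝒜 hx), map_smul]

theorem gradedDerivation_mul (f : M →ₗ[R] TensorAlgebra R M) (x y : TensorAlgebra R M) :
    gradedDerivation 𝒜 f (x * y) =
      gradedDerivation 𝒜 f x * y + twist (tensorGr 𝒜) 1 x * gradedDerivation 𝒜 f y := by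
  induction x using words_induction with
  | h1 => simp [gradedDerivation_one, twist_one]
  | hadd x x' hx hx' => simp only [add_mul, map_add, hx, hx']; abel
  | hsmul r x hx => simp only [smul_mul_assoc, map_smul, hx, smul_add]
  | hι a t ih =>
    rw [mul_assoc, gradedDerivation_ι_mul, gradedDerivation_ι_mul, ih, twist_mul, twist_ι,
      parity_eq_twist]
    simp only [add_mul, mul_add, mul_assoc]
    abel

theorem gradedDerivation_ι (f : M →ₗ[R] TensorAlgebra R M) (x : M) :
    gradedDerivation 𝒜 f (ι R x) = f x := by
  simpa [gradedDerivation_one] using gradedDerivation_ι_mul 𝒜 f x 1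

theorem gradedDerivation_mem {f : M →ₗ[R] TensorAlgebra R M} {c : ℤ}
    (hf : ∀ k, ∀ x ∈ 𝒜 k, f x ∈ tensorGr 𝒜 (k + c)) {k : ℤ} {t : TensorAlgebra R M}
    (ht : t ∈ tensorGr 𝒜 k) : gradedDerivation 𝒜 f t ∈ tensorGr 𝒜 (k + c) := by
  refine tensorGr_induction (𝒜 := 𝒜)
    (p := fun k t => gradedDerivation 𝒜 f t ∈ tensorGr 𝒜 (k + c)) ?_ ?_ ?_ ?_ ?_ ht
  · rw [gradedDerivation_one]; exact zero_mem _
  · simp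
  · intro k x _ y _ h h'; rw [map_add]; exact add_mem h h'
  · intro k r x _ h; rw [map_smul]; exact Submodule.smul_mem _ _ h
  · intro j k x hx t ht h
    rw [gradedDerivation_ι_mul, parity_eq_twist]
    exact add_mem (mul_mem_tensorGr (by ring) (hf j x hx) ht)
      (mul_mem_tensorGr (by ring) (ι_mem_tensorGr 𝒜 (twist_mem 𝒜 hx)) h)

end GradedWords


/-! ### Transfer along retractions and truncation -/

namespace DGCoalgData

variable {R : Type u} [CommRing R]

/-- The axioms are pulled back along `j`, `j ⊗ j` and `j ⊗ j ⊗ j`. Over a general ring, tensor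
powers of an injection need not be injective; the retraction `r` makes them so. It only has to
preserve degrees and need not respect the structure. -/
theorem IsDGCoalgebra.of_retract {D : DGCoalgData.{u, v} R} {C : DGCoalgData.{u, w} R}
    (hC : C.IsDGCoalgebra) (j : D.carrier →ₗ[R] C.carrier) (r : C.carrier →ₗ[R] D.carrier)
    (hr : ∀ x, r (j x) = x) (hj : ∀ k, ∀ x ∈ D.gr k, j x ∈ C.gr k)
    (hrg : ∀ k, ∀ x ∈ C.gr k, r x ∈ D.gr k) (hd : ∀ x, j (D.d x) = C.d (j x))
    (hcomul : ∀ x, C.comul (j x) = TensorProduct.map j j (D.comul x))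
    (hcounit : ∀ x, C.counit (j x) = D.counit x) (hone : j D.one = C.one) : D.IsDGCoalgebra := by
  have inj : Function.Injective j := Function.LeftInverse.injective hr
  have hrj : r ∘ₗ j = LinearMap.id := LinearMap.ext hr
  have inj2 : Function.Injective (TensorProduct.map j j) := by
    refine Function.LeftInverse.injective (g := TensorProduct.map r r) fun z => ?_
    rw [← LinearMap.comp_apply, ← TensorProduct.map_comp, hrj, TensorProduct.map_id,
      LinearMap.id_apply]
  have inj3 : Function.Injective (TensorProduct.map j (TensorProduct.map j j)) := by
    refine Function.LeftInverse.injective (g := TensorProduct.map r (TensorProduct.map r r))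
      fun z => ?_
    rw [← LinearMap.comp_apply, ← TensorProduct.map_comp, ← TensorProduct.map_comp, hrj,
      TensorProduct.map_id, TensorProduct.map_id, LinearMap.id_apply]
  have hcomul' : D.comul = TensorProduct.map r r ∘ₗ C.comul ∘ₗ j := by
    ext x
    apply inj2
    rw [LinearMap.comp_apply, LinearMap.comp_apply, hcomul, ← LinearMap.comp_apply
      (TensorProduct.map r r), ← TensorProduct.map_comp, hrj, TensorProduct.map_id,
      LinearMap.id_apply]
  have hpar : ∀ x, j (parity D.gr x) = parity C.gr (j x) := fun x => by
    rw [parity_eq_twist, parity_eq_twist, map_twist_zero D.gr C.gr hj]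
  refine ⟨?_, ?_, ?_, ?_, ?_, ?_, ?_, ?_, ?_, ?_⟩
  · intro k x hx
    rw [← hr (D.d x), hd]
    exact hrg _ _ (hC.d_mem _ _ (hj _ _ hx))
  · intro x
    apply inj
    rw [hd, hd, hC.d_d, map_zero]
  · intro k x hx
    rw [hcomul', LinearMap.comp_apply, LinearMap.comp_apply]
    exact prodGr_map (c := 0) (d := 0) (by ring) (by simpa using hrg) (by simpa using hrg)
      (hC.comul_mem _ _ (hj _ _ hx))
  · ext x
    apply inj3
    have h := LinearMap.congr_fun hC.coassoc (j x)
    simp only [LinearMap.comp_apply, LinearEquiv.coe_coe] at h ⊢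
    rw [hcomul] at h
    have h1 : ∀ z, TensorProduct.assoc R _ _ _ (C.comul.rTensor _ (TensorProduct.map j j z)) =
        TensorProduct.map j (TensorProduct.map j j)
          (TensorProduct.assoc R _ _ _ (D.comul.rTensor _ z)) := by
      intro z
      induction z with
      | zero => simp
      | add x y hx hy => simp only [map_add, hx, hy]
      | tmul x y =>
        simp only [TensorProduct.map_tmul, LinearMap.rTensor_tmul, hcomul]
        induction D.comul x with
        | zero => simp
        | add x y hx hy => simp only [map_add, TensorProduct.add_tmul, hx, hy]
        | tmul x y => simp
    have h2 : ∀ z, C.comul.lTensor _ (TensorProduct.map j j z) =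
        TensorProduct.map j (TensorProduct.map j j) (D.comul.lTensor _ z) := by
      intro z
      induction z with
      | zero => simp
      | add x y hx hy => simp only [map_add, hx, hy]
      | tmul x y => simp [hcomul]
    rw [h1, h2] at h
    exact h
  · intro x
    apply inj
    rw [← hC.counit_left (j x), hcomul]
    induction D.comul x with
    | zero => simp
    | add x y hx hy => simp only [map_add, hx, hy]
    | tmul x y => simp [hcounit]
  · intro x
    apply inj
    rw [← hC.counit_right (j x), hcomul]
    induction D.comul x with
    | zero => simp
    | add x y hx hy => simp only [map_add, hx, hy]
    | tmul x y => simp [hcounit]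
  · ext x
    apply inj2
    have h := LinearMap.congr_fun hC.coderivation (j x)
    simp only [LinearMap.comp_apply, LinearMap.add_apply] at h ⊢
    rw [← hcomul, hd, h, hcomul]
    induction D.comul x with
    | zero => simp
    | add x y hx hy =>
      simp only [map_add] at hx hy ⊢
      rw [add_add_add_comm, hx, hy, add_add_add_comm]
    | tmul x y => simp [hd, hpar]
  · intro x
    rw [← hcounit, hd, hC.counit_d]
  · apply inj
    rw [hd, hone, hC.d_one, map_zero]
  · apply inj2
    rw [← hcomul, hone, hC.comul_one, TensorProduct.map_tmul, hone]

theorem coe_toRed (C : DGCoalgData.{u, v} R) (x : C.carrier) :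
    (C.toRed x : C.carrier) = x - C.counit x • C.one := rfl

theorem toRed_coe (C : DGCoalgData.{u, v} R) (x : C.Red) : C.toRed x = x := by
  apply Subtype.ext
  rw [coe_toRed, LinearMap.mem_ker.1 x.2, zero_smul, sub_zero]

theorem toRed_one (C : DGCoalgData.{u, v} R) : C.toRed C.one = 0 := by
  apply Subtype.ext
  rw [coe_toRed, C.counit_one, one_smul, sub_self]; rfl

theorem toRed_mem (C : DGCoalgData.{u, v} R) {k : ℤ} {x : C.carrier} (hx : x ∈ C.gr k) :
    C.toRed x ∈ C.redGr k := by
  change (C.toRed x : C.carrier) ∈ C.gr k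
  rw [coe_toRed]
  refine sub_mem hx ?_
  by_cases hk : k = 0
  · subst hk; exact Submodule.smul_mem _ _ C.one_mem
  · rw [C.counit_gr k hk x hx, zero_smul]; exact zero_mem _

theorem mem_sgr (C : DGCoalgData.{u, v} R) {k : ℤ} {x : C.Red} :
    x ∈ C.sgr k ↔ (x : C.carrier) ∈ C.gr (k + 1) := by
  change (x : C.carrier) ∈ C.gr (k - -1) ↔ _
  rw [sub_neg_eq_add]

theorem cobarD_ι (C : DGCoalgData.{u, v} R) (x : C.Red) :
    C.cobarD (TensorAlgebra.ι R x) = -TensorAlgebra.ι R (C.redD x) +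
      LinearMap.mul' R C.Cobar (TensorProduct.map (TensorAlgebra.ι R ∘ₗ parity C.redGr)
        (TensorAlgebra.ι R) (C.redComul x)) := by
  rw [cobarD, gradedDerivation_ι]; rfl

theorem cobarD_one (C : DGCoalgData.{u, v} R) : C.cobarD 1 = 0 := gradedDerivation_one _ _

theorem cobarD_mul (C : DGCoalgData.{u, v} R) (x y : C.Cobar) :
    C.cobarD (x * y) = C.cobarD x * y + twist C.cobarGr 1 x * C.cobarD y :=
  gradedDerivation_mul _ x y

/-- A map compatible with the differential and the coproduct induces a chain map of cobar
constructions. -/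
theorem wordMap_cobarD {D : DGCoalgData.{u, v} R} {C : DGCoalgData.{u, w} R} (f : D.Red →ₗ[R] C.Red)
    (hf : ∀ k, ∀ x ∈ D.redGr k, f x ∈ C.redGr k) (hd : ∀ x, f (D.redD x) = C.redD (f x))
    (hc : ∀ x, C.redComul (f x) = TensorProduct.map f f (D.redComul x)) (t : D.Cobar) :
    wordMap f (D.cobarD t) = C.cobarD (wordMap f t) := by
  have hpar : ∀ x, f (parity D.redGr x) = parity C.redGr (f x) := fun x => by
    rw [parity_eq_twist, parity_eq_twist, map_twist_zero D.redGr C.redGr hf]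
  have hpar' : ∀ x, f (parity D.sgr x) = parity C.sgr (f x) := fun x => by
    rw [parity_eq_twist, parity_eq_twist, map_twist_zero D.sgr C.sgr fun k => hf _]
  have hι : ∀ x, wordMap f (D.cobarD (TensorAlgebra.ι R x)) = C.cobarD (TensorAlgebra.ι R (f x)) := by
    intro x
    rw [cobarD_ι, cobarD_ι, map_add, map_neg, wordMap_ι, hd, hc]
    congr 1
    induction D.redComul x with
    | zero => simp
    | add x y hx hy => simp only [map_add, hx, hy]
    | tmul x y => simp [hpar]
  induction t using words_induction with
  | h1 => simp [cobarD_one]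
  | hadd x y hx hy => simp only [map_add, hx, hy]
  | hsmul r x hx => simp only [map_smul, hx]
  | hι a t ih =>
    rw [cobarD_mul, map_add, map_mul, map_mul, hι, ih, map_mul, wordMap_ι, cobarD_mul, twist_ι,
      twist_ι, wordMap_ι, ← parity_eq_twist, ← parity_eq_twist, hpar']

/-! ### The coproduct of the cobar construction as a multiplicative map. -/

section Bialgebra

variable {C : DGCoalgData.{u, v} R}

/-- Translates the multiplication of the graded tensor product into `middleSwap`, the form in which
the bialgebra axiom `comul_m` is used later. -/
theorem of_mul_of (X Y : C.Cobar ⊗[R] C.Cobar) :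
    (GradedTensorProduct.of R C.cobarGr C.cobarGr).symm
      (GradedTensorProduct.of R C.cobarGr C.cobarGr X *
        GradedTensorProduct.of R C.cobarGr C.cobarGr Y) =
      TensorProduct.map (LinearMap.mul' R C.Cobar) (LinearMap.mul' R C.Cobar)
        (middleSwap C.cobarGr C.cobarGr (X ⊗ₜ[R] Y)) := by
  induction X using tensor_induction (𝒜 := C.cobarGr) (ℬ := C.cobarGr) with
  | h0 => simp
  | hadd x y hx hy => simp only [map_add, add_mul, TensorProduct.add_tmul, hx, hy]
  | h p q a ha b hb =>
    induction Y using tensor_induction (𝒜 := C.cobarGr) (ℬ := C.cobarGr) with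
    | h0 => simp
    | hadd x y hx hy => simp only [map_add, mul_add, TensorProduct.tmul_add, hx, hy]
    | h p' q' a' ha' b' hb' =>
      rw [middleSwap_tmul _ _ _ hb ha', map_smul, TensorProduct.map_tmul]
      have h := GradedTensorProduct.tmul_coe_mul_coe_tmul C.cobarGr C.cobarGr a
        (⟨b, hb⟩ : C.cobarGr q) (⟨a', ha'⟩ : C.cobarGr p') b'
      rw [← Int.negOnePow_def] at h
      exact h.trans (units_smul_eq_sg (R := R) _ _)

theorem toLin_mul (nabla : C.CobarCoproduct) (x y : C.Cobar) :
    nabla.toLin (x * y) =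
      TensorProduct.map (LinearMap.mul' R C.Cobar) (LinearMap.mul' R C.Cobar)
        (middleSwap C.cobarGr C.cobarGr (nabla.toLin x ⊗ₜ[R] nabla.toLin y)) := by
  rw [← of_mul_of]
  simp only [CobarCoproduct.toLin, LinearMap.comp_apply, AlgHom.toLinearMap_apply, map_mul]
  rfl

theorem toLin_one (nabla : C.CobarCoproduct) : nabla.toLin 1 = 1 ⊗ₜ[R] 1 := by
  simp only [CobarCoproduct.toLin, LinearMap.comp_apply, AlgHom.toLinearMap_apply, map_one]
  rfl

end Bialgebra


/-! ### Restriction of the structure to `C_{≤ n}` -/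

variable {R : Type u} [CommRing R] (C : DGCoalgData.{u, v} R) (n : ℕ)

theorem leProj_of_le {k : ℤ} (hk : k ≤ n) {x : C.carrier} (hx : x ∈ C.gr k) :
    C.leProj n x = ⟨x, C.gr_le hk hx⟩ := by
  simp only [leProj, LinearMap.comp_apply, LinearEquiv.coe_coe,
    DirectSum.decomposeLinearEquiv_apply, DirectSum.decompose_of_mem C.gr hx,
    ← DirectSum.lof_eq_of R, DirectSum.toModule_lof, dif_pos hk]
  rfl

theorem leProj_of_lt {k : ℤ} (hk : ¬ k ≤ n) {x : C.carrier} (hx : x ∈ C.gr k) :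
    C.leProj n x = 0 := by
  simp only [leProj, LinearMap.comp_apply, LinearEquiv.coe_coe,
    DirectSum.decomposeLinearEquiv_apply, DirectSum.decompose_of_mem C.gr hx,
    ← DirectSum.lof_eq_of R, DirectSum.toModule_lof, dif_neg hk]
  rfl

/-- The projection onto `C_{≤ n}`, as a map to the carrier of `C.trunc n`. -/
def truncProj : C.carrier →ₗ[R] (C.trunc n).carrier := C.leProj n

theorem truncIncl_mem {k : ℤ} {x : (C.trunc n).carrier} (hx : x ∈ (C.trunc n).gr k) :
    C.truncIncl n x ∈ C.gr k := hx

theorem truncProj_mem {k : ℤ} {x : C.carrier} (hx : x ∈ C.gr k) :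
    C.truncProj n x ∈ (C.trunc n).gr k := by
  by_cases hk : k ≤ n
  · have h : C.truncProj n x = ⟨x, C.gr_le hk hx⟩ := C.leProj_of_le n hk hx
    rw [h]; exact hx
  · have h : C.truncProj n x = 0 := C.leProj_of_lt n hk hx
    rw [h]; exact zero_mem _

theorem trunc_gr_eq_bot {k : ℤ} (hk : ¬ k ≤ n) : (C.trunc n).gr k = ⊥ := by
  rw [eq_bot_iff]
  intro x hx
  have h : ∀ y ∈ C.le n, (DirectSum.decompose C.gr y k : C.carrier) = 0 := by
    intro y hy
    induction hy using Submodule.iSup_induction' with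
    | mem j y hy => exact DirectSum.decompose_of_mem_ne C.gr hy fun h => hk (h ▸ j.2)
    | zero => simp
    | add y z _ _ hy hz =>
      rw [DirectSum.decompose_add, DirectSum.add_apply, Submodule.coe_add, hy, hz, add_zero]
  have h' := h (C.truncIncl n x) (show C.le n from x).2
  rw [DirectSum.decompose_of_mem_same C.gr (C.truncIncl_mem n hx)] at h'
  exact Subtype.ext h'

theorem truncIncl_truncProj_of_le {k : ℤ} (hk : k ≤ n) {x : C.carrier} (hx : x ∈ C.gr k) :
    C.truncIncl n (C.truncProj n x) = x :=
  congrArg Subtype.val (C.leProj_of_le n hk hx)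

theorem truncProj_truncIncl (x : (C.trunc n).carrier) : C.truncProj n (C.truncIncl n x) = x := by
  induction x using induction_homogeneous (𝒜 := (C.trunc n).gr) with
  | h0 => simp
  | hadd x y hx hy => simp only [map_add, hx, hy]
  | h k x hx =>
    by_cases hk : k ≤ n
    · exact Subtype.ext (C.truncIncl_truncProj_of_le n hk hx)
    · rw [trunc_gr_eq_bot C n hk, Submodule.mem_bot] at hx
      simp [hx]

/-- The inclusion of reduced parts. -/
def redIncl : (C.trunc n).Red →ₗ[R] C.Red := C.toRed ∘ₗ C.truncIncl n ∘ₗ (C.trunc n).Red.subtype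

/-- The projection of reduced parts. -/
def redProj : C.Red →ₗ[R] (C.trunc n).Red := (C.trunc n).toRed ∘ₗ C.truncProj n ∘ₗ C.Red.subtype

theorem cobarIncl_eq : C.cobarIncl n = wordMap (C.redIncl n) := rfl
theorem cobarProj_eq : C.cobarProj n = wordMap (C.redProj n) := rfl

theorem counit_truncIncl (x : (C.trunc n).carrier) :
    C.counit (C.truncIncl n x) = (C.trunc n).counit x := rfl
theorem truncIncl_one : C.truncIncl n (C.trunc n).one = C.one := rfl

theorem coe_redIncl (x : (C.trunc n).Red) :
    (C.redIncl n x : C.carrier) = C.truncIncl n (x : (C.trunc n).carrier) := by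
  have h : C.counit (C.truncIncl n (x : (C.trunc n).carrier)) = 0 := LinearMap.mem_ker.1 x.2
  simp only [redIncl, LinearMap.comp_apply, coe_toRed, Submodule.subtype_apply, h, zero_smul,
    sub_zero]

theorem counit_truncProj (x : C.carrier) : (C.trunc n).counit (C.truncProj n x) = C.counit x := by
  induction x using induction_homogeneous (𝒜 := C.gr) with
  | h0 => simp
  | hadd x y hx hy => simp only [map_add, hx, hy]
  | h k x hx =>
    by_cases hk : k ≤ n
    · rw [← counit_truncIncl, C.truncIncl_truncProj_of_le n hk hx]
    · have h : C.truncProj n x = 0 := C.leProj_of_lt n hk hx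
      rw [h, map_zero, C.counit_gr k (fun h => hk (by simp [h])) x hx]

theorem coe_redProj (x : C.Red) :
    (C.redProj n x : (C.trunc n).carrier) = C.truncProj n (x : C.carrier) := by
  have h : (C.trunc n).counit (C.truncProj n (x : C.carrier)) = 0 := by
    rw [counit_truncProj]; exact LinearMap.mem_ker.1 x.2
  simp only [redProj, LinearMap.comp_apply, coe_toRed, Submodule.subtype_apply, h, zero_smul,
    sub_zero]

theorem redProj_redIncl (x : (C.trunc n).Red) : C.redProj n (C.redIncl n x) = x := by
  apply Subtype.ext
  rw [coe_redProj, coe_redIncl, truncProj_truncIncl]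

theorem redIncl_redProj {k : ℤ} (hk : k ≤ n) {x : C.Red} (hx : x ∈ C.redGr k) :
    C.redIncl n (C.redProj n x) = x := by
  apply Subtype.ext
  rw [coe_redIncl, coe_redProj]
  exact C.truncIncl_truncProj_of_le n hk hx

theorem redIncl_mem {k : ℤ} {x : (C.trunc n).Red} (hx : x ∈ (C.trunc n).redGr k) :
    C.redIncl n x ∈ C.redGr k := by
  change (C.redIncl n x : C.carrier) ∈ C.gr k
  rw [coe_redIncl]; exact hx

theorem redProj_mem {k : ℤ} {x : C.Red} (hx : x ∈ C.redGr k) :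
    C.redProj n x ∈ (C.trunc n).redGr k := by
  change (C.redProj n x : (C.trunc n).carrier) ∈ (C.trunc n).gr k
  rw [coe_redProj]; exact C.truncProj_mem n hx

theorem cobarIncl_mem {k : ℤ} {t : (C.trunc n).Cobar} (ht : t ∈ (C.trunc n).cobarGr k) :
    C.cobarIncl n t ∈ C.cobarGr k :=
  wordMap_mem (fun _ _ hx => C.redIncl_mem n hx) ht

theorem cobarProj_mem {k : ℤ} {t : C.Cobar} (ht : t ∈ C.cobarGr k) :
    C.cobarProj n t ∈ (C.trunc n).cobarGr k :=
  wordMap_mem (fun _ _ hx => C.redProj_mem n hx) ht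

theorem cobarProj_cobarIncl (t : (C.trunc n).Cobar) : C.cobarProj n (C.cobarIncl n t) = t :=
  wordMap_comp_of_leftInverse (C.redProj_redIncl n) t

theorem map_cobarProj_map_cobarIncl (z : (C.trunc n).Cobar ⊗[R] (C.trunc n).Cobar) :
    TensorProduct.map (C.cobarProj n).toLinearMap (C.cobarProj n).toLinearMap
      (TensorProduct.map (C.cobarIncl n).toLinearMap (C.cobarIncl n).toLinearMap z) = z := by
  induction z with
  | zero => simp
  | add x y hx hy => simp only [map_add, hx, hy]
  | tmul x y => simp [cobarProj_cobarIncl]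

variable {C} {n}

/-- The letters of the cobar construction of an `i`-reduced coalgebra have degree at least `i`. -/
theorem IsReduced.sgr_eq_bot {i : ℕ} (h : C.IsReduced i) {j : ℤ} (hj : j < i) : C.sgr j = ⊥ := by
  rw [eq_bot_iff]
  intro x hx
  rw [mem_sgr] at hx
  rcases lt_trichotomy (j + 1) 0 with h0 | h0 | h0
  · rw [h.neg _ h0, Submodule.mem_bot] at hx
    exact Subtype.ext hx
  · rw [h0, h.zero, Submodule.mem_span_singleton] at hx
    obtain ⟨r, hr⟩ := hx
    have h1 : C.counit (x : C.carrier) = 0 := LinearMap.mem_ker.1 x.2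
    rw [← hr, map_smul, C.counit_one, smul_eq_mul, mul_one] at h1
    exact Subtype.ext (by rw [← hr, h1, zero_smul]; rfl)
  · rw [h.pos _ (by omega) (by omega), Submodule.mem_bot] at hx
    exact Subtype.ext hx

theorem IsReduced.trunc {i : ℕ} (h : C.IsReduced i) (n : ℕ) : (C.trunc n).IsReduced i := by
  refine ⟨fun k hk => ?_, ?_, fun k h1 h2 => ?_⟩
  · rw [eq_bot_iff]
    intro x hx
    have hx' := C.truncIncl_mem n hx
    rw [h.neg k hk, Submodule.mem_bot] at hx'
    exact Subtype.ext hx'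
  · apply le_antisymm
    · intro x hx
      have hx' := C.truncIncl_mem n hx
      rw [h.zero, Submodule.mem_span_singleton] at hx'
      obtain ⟨r, hr⟩ := hx'
      rw [Submodule.mem_span_singleton]
      exact ⟨r, Subtype.ext hr⟩
    · rw [Submodule.span_singleton_le_iff_mem]
      exact (C.trunc n).one_mem
  · rw [eq_bot_iff]
    intro x hx
    have hx' := C.truncIncl_mem n hx
    rw [h.pos k h1 h2, Submodule.mem_bot] at hx'
    exact Subtype.ext hx'

section

variable (hC : C.IsDGCoalgebra) {i : ℕ} (hred : C.IsReduced i)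
include hC

theorem truncIncl_d (x : (C.trunc n).carrier) :
    C.truncIncl n ((C.trunc n).d x) = C.d (C.truncIncl n x) := by
  induction x using induction_homogeneous (𝒜 := (C.trunc n).gr) with
  | h0 => simp
  | hadd x y hx hy => simp only [map_add, hx, hy]
  | h k x hx =>
    by_cases hk : k ≤ n
    · exact C.truncIncl_truncProj_of_le n (k := k - 1) (by omega) (hC.d_mem _ _ hx)
    · rw [trunc_gr_eq_bot C n hk, Submodule.mem_bot] at hx
      simp [hx]

include hred

/-- For `x` of degree `k ≤ n` the factors of the coproduct have degrees `p + q = k` with `p, q ≥ 0`,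
hence both are at most `n`. -/
theorem truncIncl_comul (x : (C.trunc n).carrier) :
    C.comul (C.truncIncl n x) =
      TensorProduct.map (C.truncIncl n) (C.truncIncl n) ((C.trunc n).comul x) := by
  induction x using induction_homogeneous (𝒜 := (C.trunc n).gr) with
  | h0 => simp
  | hadd x y hx hy => simp only [map_add, hx, hy]
  | h k x hx =>
    by_cases hk : k ≤ n
    · have h : ∀ z ∈ prodGr C.gr C.gr k, (LinearMap.id : C.carrier ⊗[R] C.carrier →ₗ[R] _) z =
          (TensorProduct.map (C.truncIncl n) (C.truncIncl n) ∘ₗ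
            TensorProduct.map (C.truncProj n) (C.truncProj n)) z := by
        intro z hz
        refine prodGr_eq (fun p q hpq a ha b hb => ?_) hz
        rw [LinearMap.comp_apply, TensorProduct.map_tmul, TensorProduct.map_tmul]
        by_cases hp : p < 0
        · rw [hred.neg p hp, Submodule.mem_bot] at ha
          simp [ha]
        by_cases hq : q < 0
        · rw [hred.neg q hq, Submodule.mem_bot] at hb
          simp [hb]
        rw [C.truncIncl_truncProj_of_le n (by omega) ha,
          C.truncIncl_truncProj_of_le n (by omega) hb]
        rfl
      exact h _ (hC.comul_mem k _ hx)
    · rw [trunc_gr_eq_bot C n hk, Submodule.mem_bot] at hx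
      simp [hx]

theorem isDGCoalgebra_trunc (n : ℕ) : (C.trunc n).IsDGCoalgebra :=
  hC.of_retract (C.truncIncl n) (C.truncProj n) (C.truncProj_truncIncl n)
    (fun _ _ hx => C.truncIncl_mem n hx) (fun _ _ hx => C.truncProj_mem n hx)
    (truncIncl_d hC) (truncIncl_comul hC hred) (C.counit_truncIncl n) (C.truncIncl_one n)

theorem cobarIncl_cobarD (t : (C.trunc n).Cobar) :
    C.cobarIncl n ((C.trunc n).cobarD t) = C.cobarD (C.cobarIncl n t) := by
  have hto : ∀ x, C.redIncl n ((C.trunc n).toRed x) = C.toRed (C.truncIncl n x) := by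
    intro x
    apply Subtype.ext
    rw [coe_redIncl, coe_toRed, coe_toRed, map_sub, map_smul, truncIncl_one, counit_truncIncl]
  refine wordMap_cobarD (C.redIncl n) (fun _ _ hx => C.redIncl_mem n hx) ?_ ?_ t
  · intro x
    simp only [redD, LinearMap.comp_apply, Submodule.subtype_apply]
    rw [hto, truncIncl_d hC, coe_redIncl]
  · intro x
    simp only [redComul, LinearMap.comp_apply, Submodule.subtype_apply]
    rw [coe_redIncl, truncIncl_comul hC hred]
    induction (C.trunc n).comul (x : (C.trunc n).carrier) with
    | zero => simp
    | add x y hx hy => simp only [map_add, hx, hy]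
    | tmul x y => simp [hto]

-- In a nonzero word no letter has negative degree, so no letter exceeds the total degree `k`. A
-- letter of degree `j` comes from an element of `C` of degree `j + 1`, which explains the bound `k
-- + 1 ≤ n`.
omit hC in
theorem cobarIncl_cobarProj {k : ℤ} (hi : 1 ≤ i) (hk : k + 1 ≤ n) {t : C.Cobar}
    (ht : t ∈ C.cobarGr k) : C.cobarIncl n (C.cobarProj n t) = t := by
  rw [cobarIncl_eq, cobarProj_eq]
  refine tensorGr_induction (𝒜 := C.sgr)
    (p := fun k t => k + 1 ≤ n → wordMap (C.redIncl n) (wordMap (C.redProj n) t) = t)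
    ?_ ?_ ?_ ?_ ?_ ht hk
  · simp
  · simp
  · intro k x _ y _ h h' hk; rw [map_add, map_add, h hk, h' hk]
  · intro k r x _ h hk; rw [map_smul, map_smul, h hk]
  · intro j k x hx t ht h hk
    have hc : ∀ j : ℤ, j < i → C.sgr j = ⊥ := fun j => hred.sgr_eq_bot
    by_cases hj : j < i
    · rw [hc j hj, Submodule.mem_bot] at hx
      simp [hx]
    by_cases hk0 : k < 0
    · rw [tensorGr_eq_bot_of_neg hc (by omega) hk0, Submodule.mem_bot] at ht
      simp [ht]
    rw [map_mul, map_mul, wordMap_ι, wordMap_ι, h (by omega),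
      C.redIncl_redProj n (k := j - -1) (by omega) hx]

end

/-- On a letter the coproduct has tensor factors of degree at most that of the letter, so projecting
them to `Ω(C_{≤n})` loses nothing. Both sides are multiplicative, so letters suffice. -/
theorem nabla_trunc_compat {nabla : C.CobarCoproduct} (hC : C.IsHirsch nabla)
    (t : (C.trunc n).Cobar) :
    nabla.toLin (C.cobarIncl n t) =
      TensorProduct.map (C.cobarIncl n).toLinearMap (C.cobarIncl n).toLinearMap
        ((nabla.trunc n).toLin t) := by
  have hι : ∀ x : (C.trunc n).Red, nabla.toLin (C.cobarIncl n (TensorAlgebra.ι R x)) =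
      TensorProduct.map (C.cobarIncl n).toLinearMap (C.cobarIncl n).toLinearMap
        ((nabla.trunc n).toLin (TensorAlgebra.ι R x)) := by
    intro x
    induction x using induction_homogeneous (𝒜 := (C.trunc n).redGr) with
    | h0 => simp
    | hadd x y hx hy => simp only [map_add, hx, hy]
    | h k x hx =>
      by_cases hk : k ≤ n
      · have h1 : (nabla.trunc n).toLin (TensorAlgebra.ι R x) =
            TensorProduct.map (C.cobarProj n).toLinearMap (C.cobarProj n).toLinearMap
              (nabla.toLin (C.cobarIncl n (TensorAlgebra.ι R x))) := by
          simp only [CobarCoproduct.toLin, CobarCoproduct.trunc, LinearMap.comp_apply,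
            AlgHom.toLinearMap_apply, TensorAlgebra.lift_ι_apply, LinearEquiv.coe_coe,
            GradedTensorProduct.of_symm_of]
        have h2 : nabla.toLin (C.cobarIncl n (TensorAlgebra.ι R x)) ∈
            prodGr C.cobarGr C.cobarGr (k - 1) := by
          refine hC.bialgebra.comul_mem (k - 1) _ (C.cobarIncl_mem n (ι_mem_tensorGr _ ?_))
          rw [mem_sgr, sub_add_cancel]; exact hx
        rw [h1]
        refine prodGr_eq (f := LinearMap.id) (g :=
          TensorProduct.map (C.cobarIncl n).toLinearMap (C.cobarIncl n).toLinearMap ∘ₗ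
          TensorProduct.map (C.cobarProj n).toLinearMap (C.cobarProj n).toLinearMap)
          (fun p q hpq a ha b hb => ?_) h2
        have hc : ∀ j : ℤ, j < (1 : ℕ) → C.sgr j = ⊥ := fun j => hC.reduced.sgr_eq_bot
        by_cases hp : p < 0
        · have h0 := tensorGr_eq_bot_of_neg (R := R) hc (by simp) hp
          have h0' := (Submodule.mem_bot R).1 (h0.le ha)
          simp [h0']
        by_cases hq : q < 0
        · have h0 := tensorGr_eq_bot_of_neg (R := R) hc (by simp) hq
          have h0' := (Submodule.mem_bot R).1 (h0.le hb)
          simp [h0']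
        simp only [LinearMap.comp_apply, TensorProduct.map_tmul, AlgHom.toLinearMap_apply]
        rw [cobarIncl_cobarProj hC.reduced le_rfl (by omega) ha,
          cobarIncl_cobarProj hC.reduced le_rfl (by omega) hb, LinearMap.id_apply]
      · have : x = 0 := by
          have hx' : (x : (C.trunc n).carrier) ∈ (C.trunc n).gr k := hx
          rw [trunc_gr_eq_bot C n hk, Submodule.mem_bot] at hx'
          exact Subtype.ext hx'
        simp [this]
  induction t using words_induction with
  | h1 => rw [map_one, toLin_one, toLin_one, TensorProduct.map_tmul]; simp
  | hadd x y hx hy => simp only [map_add, hx, hy]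
  | hsmul r x hx => simp only [map_smul, hx]
  | hι a t ih =>
    rw [map_mul, toLin_mul, toLin_mul, hι, ih]
    induction (nabla.trunc n).toLin (TensorAlgebra.ι R a)
      using tensor_induction (𝒜 := (C.trunc n).cobarGr) (ℬ := (C.trunc n).cobarGr) with
    | h0 => simp
    | hadd x y hx hy => simp only [map_add, TensorProduct.add_tmul, hx, hy]
    | h p q a ha b hb =>
      induction (nabla.trunc n).toLin t
        using tensor_induction (𝒜 := (C.trunc n).cobarGr) (ℬ := (C.trunc n).cobarGr) with
      | h0 => simp
      | hadd x y hx hy => simp only [map_add, TensorProduct.tmul_add, hx, hy]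
      | h p' q' a' ha' b' hb' =>
        simp only [TensorProduct.map_tmul, AlgHom.toLinearMap_apply]
        rw [middleSwap_tmul _ _ _ hb ha',
          middleSwap_tmul _ _ _ (C.cobarIncl_mem n hb) (C.cobarIncl_mem n ha')]
        simp

theorem algebraMapInv_cobarIncl (t : (C.trunc n).Cobar) :
    (TensorAlgebra.algebraMapInv (C.cobarIncl n t) : R) = TensorAlgebra.algebraMapInv t :=
  algebraMapInv_wordMap _ t

theorem E_trunc {nabla : C.CobarCoproduct} (hC : C.IsHirsch nabla) (p q : ℕ) (x : (C.trunc n).Red) :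
    nabla.E p q (C.redIncl n x) =
      TensorProduct.map (C.cobarIncl n).toLinearMap (C.cobarIncl n).toLinearMap
        ((nabla.trunc n).E p q x) := by
  simp only [CobarCoproduct.E, LinearMap.comp_apply]
  rw [← wordMap_ι, ← cobarIncl_eq, nabla_trunc_compat hC]
  induction (nabla.trunc n).toLin (TensorAlgebra.ι R x) with
  | zero => simp
  | add x y hx hy => simp only [map_add, hx, hy]
  | tmul x y => simp [cobarIncl_eq, weightProj_wordMap]

theorem isHomotopyGCoalgebra_trunc {nabla : C.CobarCoproduct} (hC : C.IsHomotopyGCoalgebra nabla)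
    (n : ℕ) : (C.trunc n).IsHomotopyGCoalgebra (nabla.trunc n) where
  dgCoalgebra := isDGCoalgebra_trunc hC.dgCoalgebra hC.reduced n
  reduced := hC.reduced.trunc n
  bialgebra := hC.bialgebra.of_retract (C.cobarIncl n).toLinearMap (C.cobarProj n).toLinearMap
    (C.cobarProj_cobarIncl n) (fun _ _ hx => C.cobarIncl_mem n hx)
    (fun _ _ hx => C.cobarProj_mem n hx) (cobarIncl_cobarD hC.dgCoalgebra hC.reduced)
    (nabla_trunc_compat hC.toIsHirsch) algebraMapInv_cobarIncl (map_one (C.cobarIncl n))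
  E_eq_zero := by
    intro i j hi hj
    ext1 x
    have h := E_trunc hC.toIsHirsch (n := n) i j x
    rw [hC.E_eq_zero i j hi hj, LinearMap.zero_apply] at h
    -- The components of the restricted coproduct are recovered from those of `C` by the left
    -- inverse of the tensor square of the inclusion.
    rw [LinearMap.zero_apply, ← C.map_cobarProj_map_cobarIncl n ((nabla.trunc n).E i j x), ← h,
      map_zero]

theorem preservesTrunc {nabla : C.CobarCoproduct} (hC : C.IsHirsch nabla) (n : ℕ) :
    C.PreservesTrunc nabla n where
  d := LinearMap.ext fun x => (truncIncl_d hC.dgCoalgebra x).symm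
  comul := LinearMap.ext fun x => truncIncl_comul hC.dgCoalgebra hC.reduced x
  nabla := LinearMap.ext fun x => nabla_trunc_compat hC x

/-! The antipode components and the obstructions restrict. -/

theorem iterE_trunc {nabla : C.CobarCoproduct} (hC : C.IsHirsch nabla) (L : List ℕ)
    (x : (C.trunc n).Red) :
    nabla.iterE L (C.redIncl n x) = C.cobarIncl n ((nabla.trunc n).iterE L x) := by
  induction L generalizing x with
  | nil => simp [CobarCoproduct.iterE, cobarIncl_eq]
  | cons k L ih =>
    simp only [CobarCoproduct.iterE, LinearMap.comp_apply]
    rw [E_trunc hC]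
    induction (nabla.trunc n).E k 1 x with
    | zero => simp
    | add x y hx hy => simp only [map_add, hx, hy]
    | tmul x y =>
      simp only [TensorProduct.map_tmul, AlgHom.toLinearMap_apply, LinearMap.comp_apply,
        LinearMap.mul'_apply, LinearMap.id_apply, map_mul]
      rw [cobarIncl_eq, ιInv_wordMap, ih, cobarIncl_eq]

theorem F_trunc {nabla : C.CobarCoproduct} (hC : C.IsHirsch nabla) (m : ℕ) (x : (C.trunc n).Red) :
    nabla.F m (C.redIncl n x) = C.cobarIncl n ((nabla.trunc n).F m x) := by
  simp only [CobarCoproduct.F, LinearMap.sum_apply, LinearMap.smul_apply, map_sum, map_zsmul,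
    iterE_trunc hC]

theorem opMul_cobarIncl (z : (C.trunc n).Cobar ⊗[R] (C.trunc n).Cobar) :
    CobarCoproduct.opMul C
      (TensorProduct.map (C.cobarIncl n).toLinearMap (C.cobarIncl n).toLinearMap z) =
      C.cobarIncl n (CobarCoproduct.opMul (C.trunc n) z) := by
  induction z using tensor_induction (𝒜 := (C.trunc n).cobarGr) (ℬ := (C.trunc n).cobarGr) with
  | h0 => simp
  | hadd x y hx hy => simp only [map_add, hx, hy]
  | h p q a ha b hb =>
    rw [TensorProduct.map_tmul]
    simp only [CobarCoproduct.opMul, LinearMap.comp_apply, AlgHom.toLinearMap_apply]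
    rw [koszulSwap_hom _ _ ha hb, koszulSwap_hom _ _ (C.cobarIncl_mem n ha) (C.cobarIncl_mem n hb)]
    simp

theorem blockF_trunc {nabla : C.CobarCoproduct} (hC : C.IsHirsch nabla) (L : List ℕ)
    (t : (C.trunc n).Cobar) :
    nabla.blockF L (C.cobarIncl n t) = C.cobarIncl n ((nabla.trunc n).blockF L t) := by
  induction L generalizing t with
  | nil =>
    simp only [CobarCoproduct.blockF, LinearMap.comp_apply, AlgHom.toLinearMap_apply,
      Algebra.linearMap_apply, algebraMapInv_cobarIncl, AlgHom.commutes]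
  | cons k L ih =>
    simp only [CobarCoproduct.blockF, LinearMap.comp_apply]
    rw [← opMul_cobarIncl, cobarIncl_eq, deconc_wordMap, ← cobarIncl_eq]
    congr 1
    induction deconc R (C.trunc n).Red t with
    | zero => simp
    | add x y hx hy => simp only [map_add, hx, hy]
    | tmul x y =>
      simp only [TensorProduct.map_tmul, AlgHom.toLinearMap_apply, LinearMap.comp_apply, ih]
      rw [cobarIncl_eq, ιInv_wordMap, F_trunc hC, cobarIncl_eq]

theorem obstruction_trunc {nabla : C.CobarCoproduct} (hC : C.IsHirsch nabla) (m : ℕ)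
    (x : (C.trunc n).Red) :
    nabla.obstruction m (C.redIncl n x) =
      C.cobarIncl n ((nabla.trunc n).obstruction m x) := by
  simp only [CobarCoproduct.obstruction, LinearMap.sum_apply, LinearMap.comp_apply, map_sum,
    F_trunc hC, blockF_trunc hC]

end DGCoalgData

/-! ### Sums over compositions -/

theorem composition_heq {n k : ℕ} {a : Composition n} {b : Composition k}
    (h : a.blocks = b.blocks) : a ≍ b := by
  obtain rfl : n = k := by rw [← a.blocks_sum, h, b.blocks_sum]
  exact heq_of_eq (Composition.ext h)

/-- Splitting off the first block of a composition. -/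
theorem sum_composition_succ {V : Type*} [AddCommMonoid V] (g : List ℕ → V) (m : ℕ) :
    ∑ c : Composition (m + 1), g c.blocks =
      ∑ p ∈ Finset.HasAntidiagonal.antidiagonal m, ∑ c : Composition p.2, g ((p.1 + 1) :: c.blocks) := by
  classical
  rw [Finset.sum_sigma']
  symm
  refine Finset.sum_bij'
    (i := fun x _ => if h : x.1.1 + x.1.2 = m then
      (⟨(x.1.1 + 1) :: x.2.blocks, by
        intro i hi
        rcases List.mem_cons.1 hi with rfl | hi
        · omega
        · exact x.2.blocks_pos hi, by
        rw [List.sum_cons, x.2.blocks_sum]; omega⟩ : Composition (m + 1))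
      else Composition.ones _)
    (j := fun c _ => ⟨(c.blocks.head (by
        intro h; have := c.blocks_sum; rw [h] at this; simp at this) - 1, c.blocks.tail.sum),
      ⟨c.blocks.tail, fun hi => c.blocks_pos (List.mem_of_mem_tail hi), rfl⟩⟩) ?_ ?_ ?_ ?_ ?_
  · intro x _; exact Finset.mem_univ _
  · intro c _
    simp only [Finset.mem_sigma, Finset.HasAntidiagonal.mem_antidiagonal, Finset.mem_univ, and_true]
    have h1 := c.blocks_sum
    have hne : c.blocks ≠ [] := by intro h; rw [h] at h1; simp at h1
    have h2 := c.blocks_pos (List.head_mem hne)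
    rw [← List.cons_head_tail hne, List.sum_cons] at h1
    omega
  · rintro ⟨⟨p, q⟩, ⟨bl, hpos, hs⟩⟩ hx
    have h : p + q = m := by simpa using hx
    dsimp only at hs
    subst hs
    subst h
    exact Sigma.ext (by simp) (composition_heq (by simp))
  · intro c _
    have h1 := c.blocks_sum
    have hne : c.blocks ≠ [] := by intro h; rw [h] at h1; simp at h1
    have h2 := c.blocks_pos (List.head_mem hne)
    have h3 := h1
    rw [← List.cons_head_tail hne, List.sum_cons] at h3
    apply Composition.ext
    rw [dif_pos (by dsimp only; omega)]
    dsimp only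
    rw [Nat.sub_add_cancel h2, List.cons_head_tail]
  · rintro ⟨⟨p, q⟩, c⟩ hx
    have h : p + q = m := by simpa using hx
    simp only [h, dif_pos]

theorem sum_composition_zero {V : Type*} [AddCommMonoid V] (g : List ℕ → V) :
    ∑ c : Composition 0, g c.blocks = g [] := by
  have h : ∀ c : Composition 0, c.blocks = [] := fun c => by
    have h1 := c.blocks_sum
    by_contra hne
    have h2 := c.blocks_pos (List.head_mem hne)
    rw [← List.cons_head_tail hne, List.sum_cons] at h1
    omega
  rw [Fintype.sum_eq_single (Composition.ones 0)
    (fun c hc => absurd (Composition.ext (by rw [h, h])) hc), h]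

/-! ### Word length of products and of tensors. -/

section

open TensorAlgebra

variable {R : Type*} [CommRing R] {M : Type*} [AddCommGroup M] [Module R M]

theorem weightProj_mul (m : ℕ) (x y : TensorAlgebra R M) :
    weightProj R M m (x * y) =
      ∑ p ∈ Finset.HasAntidiagonal.antidiagonal m, weightProj R M p.1 x * weightProj R M p.2 y := by
  induction x using words_induction generalizing m with
  | h1 =>
    rw [one_mul, Finset.sum_eq_single (0, m)]
    · simp [weightProj_one]
    · rintro ⟨a, b⟩ hab hne
      have : a ≠ 0 := by
        rintro rfl; apply hne; simpa using hab
      simp [weightProj_one, this]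
    · intro h; simp at h
  | hadd x y hx hy => simp only [add_mul, map_add, hx, hy, Finset.sum_add_distrib]
  | hsmul r x hx => simp only [smul_mul_assoc, map_smul, hx, Finset.smul_sum]
  | hι a t ih =>
    rw [mul_assoc]
    cases m with
    | zero => simp [weightProj_ι_mul_zero]
    | succ m =>
      rw [Finset.Nat.sum_antidiagonal_succ, weightProj_ι_mul_succ, ih]
      simp only [weightProj_ι_mul_zero, zero_mul, zero_add, weightProj_ι_mul_succ, Finset.mul_sum,
        mul_assoc]

/-- Components of a tensor with respect to the word length of the second factor. -/
theorem eq_add_of_lTensor_weightProj {P : Type*} [AddCommGroup P] [Module R P]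
    {z : P ⊗[R] TensorAlgebra R M}
    (h : ∀ q, 2 ≤ q → (weightProj R M q).lTensor P z = 0) :
    z = (weightProj R M 0).lTensor P z + (weightProj R M 1).lTensor P z := by
  -- A tensor involves only finitely many word lengths, so it is the sum of its components.
  have key : ∀ z : P ⊗[R] TensorAlgebra R M, ∃ N, ∀ n, N ≤ n →
      z = ∑ q ∈ Finset.range n, (weightProj R M q).lTensor P z := by
    intro z
    induction z with
    | zero => exact ⟨0, by simp⟩
    | add x y hx hy =>
      obtain ⟨n, hn⟩ := hx
      obtain ⟨k, hk⟩ := hy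
      refine ⟨max n k, fun j hj => ?_⟩
      simp only [map_add, Finset.sum_add_distrib]
      rw [← hn j (by omega), ← hk j (by omega)]
    | tmul a t =>
      have : ∃ N, ∀ n, N ≤ n → t = ∑ q ∈ Finset.range n, weightProj R M q t := by
        induction t using words_induction with
        | h1 =>
          refine ⟨1, fun n hn => ?_⟩
          simp only [weightProj_one, Finset.sum_ite_eq', Finset.mem_range]
          rw [if_pos (by omega)]
        | hadd x y hx hy =>
          obtain ⟨n, hn⟩ := hx
          obtain ⟨k, hk⟩ := hy
          refine ⟨max n k, fun j hj => ?_⟩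
          simp only [map_add, Finset.sum_add_distrib]
          rw [← hn j (by omega), ← hk j (by omega)]
        | hsmul r x hx =>
          obtain ⟨n, hn⟩ := hx
          refine ⟨n, fun j hj => ?_⟩
          simp only [map_smul, ← Finset.smul_sum]
          rw [← hn j hj]
        | hι x t ih =>
          obtain ⟨n, hn⟩ := ih
          refine ⟨n + 1, fun j hj => ?_⟩
          obtain ⟨j, rfl⟩ : ∃ i, j = i + 1 := ⟨j - 1, by omega⟩
          rw [Finset.sum_range_succ']
          simp only [weightProj_ι_mul_succ, weightProj_ι_mul_zero, add_zero, ← Finset.mul_sum]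
          rw [← hn j (by omega)]
      obtain ⟨N, hN⟩ := this
      refine ⟨N, fun n hn => ?_⟩
      simp only [LinearMap.lTensor_tmul, ← TensorProduct.tmul_sum]
      rw [← hN n hn]
  obtain ⟨N, hN⟩ := key z
  conv_lhs => rw [hN (N + 2) (by omega), Finset.sum_range_succ', Finset.sum_range_succ']
  rw [Finset.sum_eq_zero fun q _ => h (q + 1 + 1) (by omega), zero_add, add_comm]

theorem eq_zero_of_rTensor_weightProj {P : Type*} [AddCommGroup P] [Module R P]
    {z : TensorAlgebra R M ⊗[R] P} (h : ∀ q, (weightProj R M q).rTensor P z = 0) : z = 0 := by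
  have h' : ∀ q, (weightProj R M q).lTensor P (TensorProduct.comm R _ _ z) = 0 := by
    intro q
    have : (weightProj R M q).lTensor P (TensorProduct.comm R _ _ z) =
        TensorProduct.comm R _ _ ((weightProj R M q).rTensor P z) := by
      clear h
      induction z with
      | zero => simp
      | add x y hx hy => simp only [map_add, hx, hy]
      | tmul x y => simp
    rw [this, h, map_zero]
  have h2 := eq_add_of_lTensor_weightProj (fun q _ => h' q)
  rw [h', h', add_zero] at h2
  exact (TensorProduct.comm R _ _).map_eq_zero_iff.1 h2

end

namespace DGCoalgData

variable {R : Type u} [CommRing R] {D : DGCoalgData.{u, v} R}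

/-! ### The antipode of the cobar construction of a homotopy G-coalgebra -/

namespace CobarCoproduct

variable (nabla : D.CobarCoproduct)

theorem F_one : nabla.F 1 = -TensorAlgebra.ι R := by
  change ∑ c : Composition 0, (-1 : ℤ) ^ (c.blocks.length + 1) • nabla.iterE c.blocks = _
  rw [sum_composition_zero (fun L => (-1 : ℤ) ^ (L.length + 1) • nabla.iterE L)]
  simp [iterE]

/-- Splitting off the first block `n₁ = p.1 + 1` of the composition turns the explicit sum into a
recursion. This recursion is the component of word length `m + 2` of the right antipode identity. -/
theorem F_add_two (m : ℕ) : nabla.F (m + 2) = -∑ p ∈ Finset.HasAntidiagonal.antidiagonal m,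
    LinearMap.mul' R D.Cobar ∘ₗ
      TensorProduct.map LinearMap.id (nabla.F (p.2 + 1) ∘ₗ TensorAlgebra.ιInv) ∘ₗ
      nabla.E (p.1 + 1) 1 := by
  change ∑ c : Composition (m + 1), (-1 : ℤ) ^ (c.blocks.length + 1) • nabla.iterE c.blocks = _
  rw [sum_composition_succ (fun L => (-1 : ℤ) ^ (L.length + 1) • nabla.iterE L),
    ← Finset.sum_neg_distrib]
  refine Finset.sum_congr rfl fun p _ => ?_
  ext1 x
  simp only [F, LinearMap.sum_apply, LinearMap.smul_apply, iterE,
    LinearMap.comp_apply, LinearMap.neg_apply, Composition.length]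
  generalize nabla.E (p.1 + 1) 1 x = z
  induction z with
  | zero => simp
  | add x y hx hy =>
    simp only [map_add, neg_add, ← hx, ← hy, smul_add, Finset.sum_add_distrib]
  | tmul a b =>
    simp only [TensorProduct.map_tmul, LinearMap.comp_apply, LinearMap.sum_apply,
      LinearMap.smul_apply, LinearMap.mul'_apply, LinearMap.id_apply, Finset.mul_sum,
      mul_smul_comm, ← Finset.sum_neg_distrib, List.length_cons]
    refine Finset.sum_congr rfl fun c _ => ?_
    rw [pow_succ (-1 : ℤ) (c.blocks.length + 1), mul_neg_one, neg_smul]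

theorem iterE_weight (L : List ℕ) (x : D.Red) : nabla.iterE L x ∈
    LinearMap.range (TensorAlgebra.ι R : D.Red →ₗ[R] D.Cobar) ^ (L.sum + 1) := by
  induction L generalizing x with
  | nil => exact ι_mem_weight x
  | cons k L ih =>
    simp only [iterE, E, LinearMap.comp_apply, List.sum_cons, add_assoc]
    generalize nabla.toLin (TensorAlgebra.ι R x) = z
    rw [pow_add]
    induction z with
    | zero => simp
    | add x y hx hy => simp only [map_add]; exact add_mem hx hy
    | tmul a b =>
      simp only [TensorProduct.map_tmul, LinearMap.mul'_apply, LinearMap.id_apply,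
        LinearMap.comp_apply]
      exact Submodule.mul_mem_mul (weightProj_mem _ _) (ih _)

theorem F_weight (m : ℕ) (x : D.Red) : nabla.F (m + 1) x ∈
    LinearMap.range (TensorAlgebra.ι R : D.Red →ₗ[R] D.Cobar) ^ (m + 1) := by
  simp only [F, LinearMap.sum_apply, LinearMap.smul_apply]
  refine Submodule.sum_mem _ fun c _ => ?_
  have h := nabla.iterE_weight c.blocks x
  rw [c.blocks_sum] at h
  rw [← Int.cast_smul_eq_zsmul R]
  exact Submodule.smul_mem _ _ h

variable {nabla} in
theorem E_mem (hD : D.IsHirsch nabla) (p q : ℕ) {k : ℤ} {x : D.Red} (hx : x ∈ D.sgr k) :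
    nabla.E p q x ∈ prodGr D.cobarGr D.cobarGr k :=
  prodGr_map (c := 0) (d := 0) (by simp)
    (fun k _ h => (add_zero k).symm ▸ weightProj_mem_tensorGr p h)
    (fun k _ h => (add_zero k).symm ▸ weightProj_mem_tensorGr q h)
    (hD.bialgebra.comul_mem k _ (ι_mem_tensorGr _ hx))

theorem mul_map_mem {f g : D.Cobar →ₗ[R] D.Cobar} (hf : ∀ k, ∀ x ∈ D.cobarGr k, f x ∈ D.cobarGr k)
    (hg : ∀ k, ∀ x ∈ D.cobarGr k, g x ∈ D.cobarGr k) {k : ℤ} {z : D.Cobar ⊗[R] D.Cobar}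
    (hz : z ∈ prodGr D.cobarGr D.cobarGr k) :
    LinearMap.mul' R D.Cobar (TensorProduct.map f g z) ∈ D.cobarGr k := by
  refine prodGr_induction (P := fun z => LinearMap.mul' R D.Cobar (TensorProduct.map f g z) ∈
    D.cobarGr k) (by simp) (fun x y hx hy => ?_) (fun p q hpq x hx y hy => ?_) hz
  · rw [map_add, map_add]; exact add_mem hx hy
  · exact mul_mem_tensorGr hpq (hf _ _ hx) (hg _ _ hy)

variable {nabla} in
theorem iterE_mem (hD : D.IsHirsch nabla) (L : List ℕ) {k : ℤ} {x : D.Red} (hx : x ∈ D.sgr k) :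
    nabla.iterE L x ∈ D.cobarGr k := by
  induction L generalizing x k with
  | nil => exact ι_mem_tensorGr _ hx
  | cons j L ih =>
    exact mul_map_mem (fun _ _ h => h) (fun _ _ h => ih (ιInv_mem h)) (E_mem hD _ _ hx)

variable {nabla} in
theorem F_mem (hD : D.IsHirsch nabla) (m : ℕ) {k : ℤ} {x : D.Red} (hx : x ∈ D.sgr k) :
    nabla.F m x ∈ D.cobarGr k := by
  simp only [F, LinearMap.sum_apply, LinearMap.smul_apply]
  refine Submodule.sum_mem _ fun c _ => ?_
  rw [← Int.cast_smul_eq_zsmul R]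
  exact Submodule.smul_mem _ _ (iterE_mem hD _ hx)

theorem opMul_tmul (a : D.Cobar) {q : ℤ} {b : D.Cobar} (hb : b ∈ D.cobarGr q) :
    opMul D (a ⊗ₜ[R] b) = b * twist D.cobarGr q a := by
  simp only [opMul, LinearMap.comp_apply]
  rw [koszulSwap_tmul _ _ _ hb]
  rfl

theorem opMul_one (a : D.Cobar) : opMul D (a ⊗ₜ[R] 1) = a := by
  rw [opMul_tmul a (one_mem_tensorGr (𝒜 := D.sgr)), one_mul, twist_zero]; rfl

/-- The antipode on the letters, for a bound `N` of the word lengths. -/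
def antipodeLetter (N : ℕ) : D.Red →ₗ[R] D.Cobar := ∑ m ∈ Finset.range N, nabla.F (m + 1)

/-- The anti-multiplicative extension of `antipodeLetter`. -/
def antipode (N : ℕ) : D.Cobar →ₗ[R] D.Cobar :=
  LinearMap.applyₗ (1 : D.Cobar) ∘ₗ (TensorAlgebra.lift R
    (TensorProduct.lcurry (.id R) D.Cobar D.Cobar D.Cobar (opMul D) ∘ₗ nabla.antipodeLetter N :
      D.Red →ₗ[R] Module.End R D.Cobar)).toLinearMap

variable (N : ℕ)

theorem antipode_one : nabla.antipode N 1 = 1 := by simp [antipode]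

theorem antipode_ι_mul (x : D.Red) (t : D.Cobar) :
    nabla.antipode N (TensorAlgebra.ι R x * t) =
      opMul D (nabla.antipodeLetter N x ⊗ₜ[R] nabla.antipode N t) := by
  simp only [antipode, LinearMap.comp_apply, AlgHom.toLinearMap_apply, map_mul,
    LinearMap.applyₗ_apply_apply, Module.End.mul_apply, TensorAlgebra.lift_ι_apply]
  rfl

theorem antipode_ι (x : D.Red) :
    nabla.antipode N (TensorAlgebra.ι R x) = nabla.antipodeLetter N x := by
  rw [← mul_one (TensorAlgebra.ι R x), antipode_ι_mul, antipode_one, opMul_one]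

variable {nabla N}

theorem antipodeLetter_mem (hD : D.IsHirsch nabla) {k : ℤ} {x : D.Red} (hx : x ∈ D.sgr k) :
    nabla.antipodeLetter N x ∈ D.cobarGr k := by
  simp only [antipodeLetter, LinearMap.sum_apply]
  exact Submodule.sum_mem _ fun m _ => F_mem hD _ hx

theorem antipode_mem (hD : D.IsHirsch nabla) {k : ℤ} {t : D.Cobar} (ht : t ∈ D.cobarGr k) :
    nabla.antipode N t ∈ D.cobarGr k := by
  refine tensorGr_induction (𝒜 := D.sgr) (p := fun k t => nabla.antipode N t ∈ D.cobarGr k)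
    ?_ ?_ ?_ ?_ ?_ ht
  · rw [antipode_one]; exact one_mem_tensorGr
  · intro k; simp
  · intro k x _ y _ hx hy; rw [map_add]; exact add_mem hx hy
  · intro k r x _ hx; rw [map_smul]; exact Submodule.smul_mem _ _ hx
  · intro j k x hx t _ h
    rw [antipode_ι_mul, opMul_tmul _ h]
    exact mul_mem_tensorGr (add_comm k j) h (twist_mem _ (antipodeLetter_mem hD hx))

/-- The antipode is anti-multiplicative. -/
theorem antipode_mul (hD : D.IsHirsch nabla) {k : ℤ} (x : D.Cobar) {y : D.Cobar}
    (hy : y ∈ D.cobarGr k) : nabla.antipode N (x * y) =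
      nabla.antipode N y * twist D.cobarGr k (nabla.antipode N x) := by
  induction x using induction_homogeneous (𝒜 := D.cobarGr) with
  | h0 => simp
  | hadd x x' hx hx' => simp only [add_mul, map_add, hx, hx', mul_add]
  | h j x hx =>
    refine tensorGr_induction (𝒜 := D.sgr) (p := fun j x => nabla.antipode N (x * y) =
      nabla.antipode N y * twist D.cobarGr k (nabla.antipode N x)) ?_ ?_ ?_ ?_ ?_ hx
    · rw [one_mul, antipode_one, twist_one, mul_one]
    · intro k; simp
    · intro k x _ y _ hx hy; simp only [add_mul, map_add, hx, hy, mul_add]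
    · intro k r x _ hx; simp only [smul_mul_assoc, map_smul, hx, mul_smul_comm]
    · intro i j a ha x hx h
      have hx' : x * y ∈ D.cobarGr (j + k) := mul_mem_tensorGr rfl hx hy
      rw [mul_assoc, antipode_ι_mul, antipode_ι_mul, opMul_tmul _ (antipode_mem hD hx'),
        opMul_tmul _ (antipode_mem hD hx), h, twist_mul, twist_twist, mul_assoc, add_comm k j]

/-- The finite sum up to `N` already contains every nonzero `F^m`, and `F^m` takes values in words
of length `m`. -/
theorem weightProj_antipodeLetter (hF : ∀ m, N < m → nabla.F m = 0) (m : ℕ) (x : D.Red) :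
    weightProj R D.Red m (nabla.antipodeLetter N x) = if m = 0 then 0 else nabla.F m x := by
  simp only [antipodeLetter, LinearMap.sum_apply, map_sum]
  cases m with
  | zero =>
    rw [if_pos rfl]
    refine Finset.sum_eq_zero fun j _ => ?_
    rw [weightProj_of_mem (nabla.F_weight j x), if_neg (by omega)]
  | succ m =>
    rw [if_neg (by omega), Finset.sum_congr rfl (fun j _ => weightProj_of_mem (nabla.F_weight j x) _)]
    by_cases h : m < N
    · rw [Finset.sum_eq_single_of_mem m (Finset.mem_range.2 h)
        (fun j _ hj => if_neg (by omega)), if_pos rfl]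
    · rw [hF (m + 1) (by omega), LinearMap.zero_apply]
      exact Finset.sum_eq_zero fun j hj => if_neg (by have := Finset.mem_range.1 hj; omega)

theorem lTensor_counit_toLin (hD : D.IsHirsch nabla) (t : D.Cobar) :
    (weightProj R D.Red 0).lTensor D.Cobar (nabla.toLin t) = t ⊗ₜ[R] 1 := by
  have h := hD.bialgebra.counit_right t
  have h2 : (weightProj R D.Red 0).lTensor D.Cobar (nabla.toLin t) =
      (TensorProduct.rid R D.Cobar ((TensorAlgebra.algebraMapInv :
        D.Cobar →ₐ[R] R).toLinearMap.lTensor D.Cobar (nabla.toLin t))) ⊗ₜ[R] 1 := by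
    induction nabla.toLin t with
    | zero => simp
    | add x y hx hy => simp only [map_add, hx, hy, TensorProduct.add_tmul]
    | tmul a b =>
      simp only [LinearMap.lTensor_tmul, weightProj_zero, TensorProduct.rid_tmul,
        AlgHom.toLinearMap_apply, Algebra.algebraMap_eq_smul_one, TensorProduct.smul_tmul]
  rw [h2]
  exact congrArg (· ⊗ₜ[R] (1 : D.Cobar)) h

theorem rTensor_counit_toLin (hD : D.IsHirsch nabla) (t : D.Cobar) :
    (weightProj R D.Red 0).rTensor D.Cobar (nabla.toLin t) = 1 ⊗ₜ[R] t := by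
  have h := hD.bialgebra.counit_left t
  have h2 : (weightProj R D.Red 0).rTensor D.Cobar (nabla.toLin t) =
      1 ⊗ₜ[R] (TensorProduct.lid R D.Cobar ((TensorAlgebra.algebraMapInv :
        D.Cobar →ₐ[R] R).toLinearMap.rTensor D.Cobar (nabla.toLin t))) := by
    induction nabla.toLin t with
    | zero => simp
    | add x y hx hy => simp only [map_add, hx, hy, TensorProduct.tmul_add]
    | tmul a b =>
      simp only [LinearMap.rTensor_tmul, weightProj_zero, TensorProduct.lid_tmul,
        AlgHom.toLinearMap_apply, Algebra.algebraMap_eq_smul_one, TensorProduct.smul_tmul]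
  rw [h2]
  exact congrArg ((1 : D.Cobar) ⊗ₜ[R] ·) h

/-- The counit axioms determine the components with an empty word on one side; the defining
condition on `E^{p,q}` kills the others with `q ≥ 2`. So the second factor is always empty or a
single letter, and knowing the antipode on letters is enough to evaluate `id * S` on a letter. -/
theorem toLin_ι_eq (hD : D.IsHomotopyGCoalgebra nabla) (x : D.Red) :
    nabla.toLin (TensorAlgebra.ι R x) = TensorAlgebra.ι R x ⊗ₜ[R] 1 +
      (weightProj R D.Red 1).lTensor D.Cobar (nabla.toLin (TensorAlgebra.ι R x)) := by
  rw [← lTensor_counit_toLin hD.toIsHirsch]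
  refine eq_add_of_lTensor_weightProj fun q hq => eq_zero_of_rTensor_weightProj fun p => ?_
  have hE : (weightProj R D.Red p).rTensor D.Cobar
      ((weightProj R D.Red q).lTensor D.Cobar (nabla.toLin (TensorAlgebra.ι R x))) =
        nabla.E p q x := by
    rw [← LinearMap.comp_apply, LinearMap.rTensor_comp_lTensor]; rfl
  rw [hE]
  cases p with
  | zero =>
    have : nabla.E 0 q x = (weightProj R D.Red q).lTensor D.Cobar
        ((weightProj R D.Red 0).rTensor D.Cobar (nabla.toLin (TensorAlgebra.ι R x))) := by
      rw [← LinearMap.comp_apply, LinearMap.lTensor_comp_rTensor]; rfl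
    rw [this, rTensor_counit_toLin hD.toIsHirsch, LinearMap.lTensor_tmul,
      weightProj_of_mem (ι_mem_weight x), if_neg (by omega), TensorProduct.tmul_zero]
  | succ p => rw [hD.E_eq_zero (p + 1) q (by omega) hq, LinearMap.zero_apply]

theorem E_zero_one (hD : D.IsHirsch nabla) (x : D.Red) :
    nabla.E 0 1 x = 1 ⊗ₜ[R] TensorAlgebra.ι R x := by
  have : nabla.E 0 1 x = (weightProj R D.Red 1).lTensor D.Cobar
      ((weightProj R D.Red 0).rTensor D.Cobar (nabla.toLin (TensorAlgebra.ι R x))) := by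
    rw [← LinearMap.comp_apply, LinearMap.lTensor_comp_rTensor]; rfl
  rw [this, rTensor_counit_toLin hD, LinearMap.lTensor_tmul,
    weightProj_of_mem (ι_mem_weight x), if_pos rfl]

/-- The right antipode identity on the letters. -/
theorem antipode_right_ι (hD : D.IsHomotopyGCoalgebra nabla) (hF : ∀ m, N < m → nabla.F m = 0)
    (x : D.Red) : LinearMap.mul' R D.Cobar ((nabla.antipode N).lTensor D.Cobar
      (nabla.toLin (TensorAlgebra.ι R x))) = 0 := by
  refine weight_ext fun m => ?_
  rw [toLin_ι_eq hD, map_add, map_add, map_add, map_zero, LinearMap.lTensor_tmul, antipode_one,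
    LinearMap.mul'_apply, mul_one, weightProj_of_mem (ι_mem_weight x)]
  have key : ∀ z : D.Cobar ⊗[R] D.Cobar, weightProj R D.Red m (LinearMap.mul' R D.Cobar
      ((nabla.antipode N).lTensor D.Cobar ((weightProj R D.Red 1).lTensor D.Cobar z))) =
      ∑ p ∈ Finset.HasAntidiagonal.antidiagonal m, LinearMap.mul' R D.Cobar
        (TensorProduct.map LinearMap.id
          ((if p.2 = 0 then 0 else nabla.F p.2) ∘ₗ TensorAlgebra.ιInv)
          (TensorProduct.map (weightProj R D.Red p.1) (weightProj R D.Red 1) z)) := by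
    intro z
    induction z with
    | zero => simp
    | add x y hx hy => simp only [map_add, hx, hy, Finset.sum_add_distrib]
    | tmul a b =>
      simp only [LinearMap.lTensor_tmul, LinearMap.mul'_apply, TensorProduct.map_tmul,
        weightProj_mul, weightProj_one_eq, antipode_ι, LinearMap.id_apply, LinearMap.comp_apply,
        weightProj_antipodeLetter hF]
      refine Finset.sum_congr rfl fun p _ => ?_
      split_ifs <;> simp
  rw [key]
  change _ + ∑ p ∈ Finset.HasAntidiagonal.antidiagonal m, LinearMap.mul' R D.Cobar
    (TensorProduct.map LinearMap.id ((if p.2 = 0 then 0 else nabla.F p.2) ∘ₗ TensorAlgebra.ιInv)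
      (nabla.E p.1 1 x)) = 0
  cases m with
  | zero => simp
  | succ m =>
    rw [Finset.Nat.sum_antidiagonal_succ', if_pos rfl, LinearMap.zero_comp,
      TensorProduct.map_zero_right, LinearMap.zero_apply, map_zero, zero_add]
    cases m with
    | zero => simp [E_zero_one hD.toIsHirsch, F_one, ιInv_ι]
    | succ m =>
      -- The summand with `E^{0,1} = 1 ⊗ x` contributes `F^{m+2}(x)`; by `F_add_two` the others add
      -- up to its negative.
      rw [Finset.Nat.sum_antidiagonal_succ, E_zero_one hD.toIsHirsch]
      have hrec := congrArg (fun f : D.Red →ₗ[R] D.Cobar => f x) (nabla.F_add_two m)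
      simp only [LinearMap.neg_apply, LinearMap.sum_apply, LinearMap.comp_apply] at hrec
      simp [ιInv_ι, hrec]

end CobarCoproduct

variable {R : Type u} [CommRing R] {D : DGCoalgData.{u, v} R}

namespace CobarCoproduct

variable {nabla : D.CobarCoproduct} {N : ℕ}

/-- Anti-multiplicativity nests the factors: up to sign `∑ (x y)¹ S((x y)²)` is `∑ x¹ (y¹ S(y²))
S(x²)`, so the inner convolution can be evaluated first. -/
theorem antipode_right_mul (hD : D.IsHirsch nabla) {k : ℤ} (z : D.Cobar ⊗[R] D.Cobar)
    {w : D.Cobar ⊗[R] D.Cobar} (hw : w ∈ prodGr D.cobarGr D.cobarGr k) :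
    LinearMap.mul' R D.Cobar ((nabla.antipode N).lTensor D.Cobar
      (TensorProduct.map (LinearMap.mul' R D.Cobar) (LinearMap.mul' R D.Cobar)
        (middleSwap D.cobarGr D.cobarGr (z ⊗ₜ[R] w)))) =
    LinearMap.mul' R D.Cobar (TensorProduct.map
      (LinearMap.mulRight R (LinearMap.mul' R D.Cobar ((nabla.antipode N).lTensor D.Cobar w)))
      (twist D.cobarGr k ∘ₗ nabla.antipode N) z) := by
  induction z using tensor_induction (𝒜 := D.cobarGr) (ℬ := D.cobarGr) with
  | h0 => simp
  | hadd x y hx hy => simp only [map_add, TensorProduct.add_tmul, hx, hy]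
  | h p q a ha b hb =>
    refine prodGr_induction (P := fun w => LinearMap.mul' R D.Cobar ((nabla.antipode N).lTensor
      D.Cobar (TensorProduct.map (LinearMap.mul' R D.Cobar) (LinearMap.mul' R D.Cobar)
        (middleSwap D.cobarGr D.cobarGr ((a ⊗ₜ[R] b) ⊗ₜ[R] w)))) =
      LinearMap.mul' R D.Cobar (TensorProduct.map
      (LinearMap.mulRight R (LinearMap.mul' R D.Cobar ((nabla.antipode N).lTensor D.Cobar w)))
      (twist D.cobarGr k ∘ₗ nabla.antipode N) (a ⊗ₜ[R] b))) ?_ ?_ ?_ hw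
    · simp
    · intro x y hx hy
      rw [TensorProduct.tmul_add, map_add, map_add, map_add, map_add, hx, hy]
      simp [mul_add, add_mul]
    · intro p' q' hk c hc e he
      rw [middleSwap_tmul _ _ _ hb hc]
      simp only [map_smul, TensorProduct.map_tmul, LinearMap.mul'_apply, LinearMap.lTensor_tmul,
        LinearMap.mulRight_apply, LinearMap.comp_apply]
      rw [antipode_mul hD b he, twist_of_mem _ _ (antipode_mem hD hb),
        twist_of_mem _ _ (antipode_mem hD hb)]
      simp only [mul_smul_comm, smul_smul, mul_assoc]
      rw [← sg_add]
      congr 1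
      apply sg_congr
      subst hk
      grind

/-- Induction on words: the inner factor is the scalar `ε(t)`, zero unless `t` has degree `0`, and
then the identity on the first letter finishes. -/
theorem antipode_right (hD : D.IsHomotopyGCoalgebra nabla) (hF : ∀ m, N < m → nabla.F m = 0)
    (t : D.Cobar) : LinearMap.mul' R D.Cobar ((nabla.antipode N).lTensor D.Cobar
      (nabla.toLin t)) = algebraMap R D.Cobar (TensorAlgebra.algebraMapInv t) := by
  induction t using induction_homogeneous (𝒜 := D.cobarGr) with
  | h0 => simp
  | hadd x y hx hy => simp only [map_add, hx, hy]
  | h k t ht =>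
    refine tensorGr_induction (𝒜 := D.sgr) (p := fun k t => LinearMap.mul' R D.Cobar
      ((nabla.antipode N).lTensor D.Cobar (nabla.toLin t)) =
      algebraMap R D.Cobar (TensorAlgebra.algebraMapInv t)) ?_ ?_ ?_ ?_ ?_ ht
    · rw [toLin_one]; simp [antipode_one]
    · intro k; simp
    · intro k x _ y _ hx hy; simp only [map_add, hx, hy]
    · intro k r x _ hx
      simp only [map_smul, hx, Algebra.algebraMap_eq_smul_one, smul_smul, smul_eq_mul]
    · intro j k a ha t ht ih
      have hw : nabla.toLin t ∈ prodGr D.cobarGr D.cobarGr k := hD.bialgebra.comul_mem k _ ht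
      rw [toLin_mul, map_mul TensorAlgebra.algebraMapInv, algebraMapInv_ι, zero_mul, map_zero,
        antipode_right_mul hD.toIsHirsch _ hw, ih]
      by_cases hk : k = 0
      · subst hk
        rw [twist_zero, LinearMap.id_comp, Algebra.algebraMap_eq_smul_one]
        have h := antipode_right_ι hD hF a
        have h2 : ∀ z : D.Cobar ⊗[R] D.Cobar, LinearMap.mul' R D.Cobar (TensorProduct.map
            (LinearMap.mulRight R ((TensorAlgebra.algebraMapInv t : R) • (1 : D.Cobar)))
            (nabla.antipode N) z) = (TensorAlgebra.algebraMapInv t : R) •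
            LinearMap.mul' R D.Cobar ((nabla.antipode N).lTensor D.Cobar z) := by
          intro z
          induction z with
          | zero => simp
          | add x y hx hy => simp only [map_add, hx, hy, smul_add]
          | tmul x y => simp
        rw [h2, h, smul_zero]
      · rw [algebraMapInv_tensorGr D.sgr hk ht, map_zero, LinearMap.mulRight_zero_eq_zero,
          TensorProduct.map_zero_left, LinearMap.zero_apply, map_zero]

end CobarCoproduct

/-! ### Convolution on connected coalgebras -/

/-- On a connected coalgebra a map normalised at the unit is left cancellable for convolution. In
degree `k`, terms of `∑ f(x¹) T(x²)` with `|x¹| > 0` vanish by induction on the degree, and the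
terms with `|x¹| = 0` give `T(x)`. -/
theorem eq_zero_of_conv_eq_zero {M : Type*} [AddCommGroup M] [Module R M]
    {𝒜 : ℤ → Submodule R M} [DirectSum.Decomposition 𝒜] {δ : M →ₗ[R] M ⊗[R] M} {ε : M →ₗ[R] R}
    {one : M} (hδ : ∀ k, ∀ x ∈ 𝒜 k, δ x ∈ prodGr 𝒜 𝒜 k)
    (hε : ∀ x, TensorProduct.lid R M (ε.rTensor M (δ x)) = x) (hε1 : ε one = 1)
    (hεgr : ∀ k, k ≠ 0 → ∀ x ∈ 𝒜 k, ε x = 0)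
    (hneg : ∀ k : ℤ, k < 0 → 𝒜 k = ⊥) (hzero : 𝒜 0 = Submodule.span R {one})
    {A : Type*} [Ring A] [Algebra R A] {f T : M →ₗ[R] A} (hf : f one = 1)
    (h : conv δ f T = 0) : T = 0 := by
  have key : ∀ n : ℕ, ∀ k : ℤ, k < n → ∀ x ∈ 𝒜 k, T x = 0 := by
    intro n
    induction n with
    | zero =>
      intro k hk x hx
      rw [hneg k (by exact_mod_cast hk), Submodule.mem_bot] at hx
      rw [hx, map_zero]
    | succ n ih =>
      intro k hk x hx
      have e := prodGr_eq (𝒜 := 𝒜) (ℬ := 𝒜) (f := LinearMap.mul' R A ∘ₗ TensorProduct.map f T)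
        (g := T ∘ₗ (TensorProduct.lid R M).toLinearMap ∘ₗ ε.rTensor M)
        (fun p q hpq a ha b hb => by
          simp only [LinearMap.comp_apply, TensorProduct.map_tmul, LinearMap.mul'_apply,
            LinearMap.rTensor_tmul, LinearEquiv.coe_coe, TensorProduct.lid_tmul]
          rcases lt_trichotomy p 0 with hp | hp | hp
          · rw [hneg p hp, Submodule.mem_bot] at ha
            simp [ha]
          · subst hp
            rw [hzero, Submodule.mem_span_singleton] at ha
            obtain ⟨r, rfl⟩ := ha
            simp [hf, hε1]
          · rw [ih q (by push_cast at hk; omega) b hb, mul_zero, hεgr p (by omega) a ha,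
              zero_smul, map_zero]) (hδ k x hx)
      have h1 := congrArg (fun φ : M →ₗ[R] A => φ x) h
      simp only [conv, LinearMap.comp_apply, LinearMap.zero_apply, LinearEquiv.coe_coe] at h1 e
      rw [h1, hε] at e
      exact e.symm
  refine hom_ext (𝒜 := 𝒜) fun k x hx => ?_
  rw [key (k + 1).toNat k (by omega) x hx, LinearMap.zero_apply]

theorem cobarD_mem {B : DGCoalgData.{u, v} R} (hB : B.IsDGCoalgebra) {k : ℤ} {t : B.Cobar}
    (ht : t ∈ B.cobarGr k) : B.cobarD t ∈ B.cobarGr (k - 1) := by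
  refine gradedDerivation_mem (c := -1) (fun j x hx => ?_) ht
  have hx' : (x : B.carrier) ∈ B.gr (j + 1) := B.mem_sgr.1 hx
  simp only [LinearMap.add_apply, LinearMap.neg_apply, LinearMap.comp_apply]
  refine add_mem (neg_mem (ι_mem_tensorGr _ ?_)) ?_
  · rw [mem_sgr, redD, LinearMap.comp_apply, LinearMap.comp_apply]
    have := B.toRed_mem (hB.d_mem _ _ hx')
    rw [show j + 1 - 1 = j + -1 + 1 by ring] at this
    exact this
  · have hz : B.redComul x ∈ prodGr B.redGr B.redGr (j + 1) :=
      prodGr_map (c := 0) (d := 0) (by simp)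
        (fun k _ h => (add_zero k).symm ▸ B.toRed_mem h)
        (fun k _ h => (add_zero k).symm ▸ B.toRed_mem h) (hB.comul_mem _ _ hx')
    refine prodGr_induction (P := fun z => LinearMap.mul' R B.Cobar (TensorProduct.map
      (TensorAlgebra.ι R ∘ₗ parity B.redGr) (TensorAlgebra.ι R) z) ∈ B.cobarGr (j + -1))
      (by simp) (fun x y hx hy => ?_) (fun p q hpq a ha b hb => ?_) hz
    · rw [map_add, map_add]; exact add_mem hx hy
    · refine mul_mem_tensorGr (i := p - 1) (j := q - 1) (by omega) (ι_mem_tensorGr _ ?_)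
        (ι_mem_tensorGr _ ?_)
      · rw [parity_eq_twist]
        have := twist_mem B.redGr (k := 1) ha
        simpa [shiftGr] using this
      · simpa [shiftGr] using hb

/-! ### The antipode axioms and the components of the square of the antipode. -/

namespace CobarCoproduct

variable {nabla : D.CobarCoproduct} {N : ℕ}

theorem IsReduced.cobarGr_neg {i : ℕ} (h : D.IsReduced i) {k : ℤ} (hk : k < 0) :
    D.cobarGr k = ⊥ :=
  tensorGr_eq_bot_of_neg (c := (i : ℤ)) (fun _ => h.sgr_eq_bot) (by simp) hk

theorem IsReduced.cobarGr_zero {i : ℕ} (hi : 1 ≤ i) (h : D.IsReduced i) :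
    D.cobarGr 0 = Submodule.span R {1} :=
  tensorGr_zero_eq (c := (i : ℤ)) (fun _ => h.sgr_eq_bot) (by omega)

theorem IsReduced.cobarGr_pos {i : ℕ} (h : D.IsReduced i) {k : ℤ} (hk : 0 < k) (hki : k < i) :
    D.cobarGr k = ⊥ :=
  tensorGr_eq_bot_of_pos (c := (i : ℤ)) (fun _ => h.sgr_eq_bot) hk hki

/-- Only the right identity is computed. The left one and the compatibility with `d` follow from it
by cancellation in the convolution algebra of a connected coalgebra. -/
theorem isAntipode (hD : D.IsHomotopyGCoalgebra nabla) (hF : ∀ m, N < m → nabla.F m = 0) :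
    (D.cobarCoalg nabla).IsAntipode (LinearMap.mul' R D.Cobar) (nabla.antipode N) := by
  have hB := hD.bialgebra
  have hassoc : (TensorProduct.assoc R D.Cobar D.Cobar D.Cobar).toLinearMap ∘ₗ
    nabla.toLin.rTensor D.Cobar ∘ₗ nabla.toLin = nabla.toLin.lTensor D.Cobar ∘ₗ nabla.toLin :=
    hB.coassoc
  have hcoder : nabla.toLin ∘ₗ D.cobarD = (TensorProduct.map D.cobarD LinearMap.id +
    TensorProduct.map (parity D.cobarGr) D.cobarD) ∘ₗ nabla.toLin := hB.coderivation
  have hl1 : ∀ x, TensorProduct.lid R D.Cobar ((TensorAlgebra.algebraMapInv :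
    D.Cobar →ₐ[R] R).toLinearMap.rTensor D.Cobar (nabla.toLin x)) = x := hB.counit_left
  have hr1 : ∀ x, TensorProduct.rid R D.Cobar ((TensorAlgebra.algebraMapInv :
    D.Cobar →ₐ[R] R).toLinearMap.lTensor D.Cobar (nabla.toLin x)) = x := hB.counit_right
  have hinj : ∀ f T : D.Cobar →ₗ[R] D.Cobar, f 1 = 1 → conv nabla.toLin f T = 0 → T = 0 :=
    fun f T => eq_zero_of_conv_eq_zero (𝒜 := D.cobarGr) hB.comul_mem hl1
      (map_one (TensorAlgebra.algebraMapInv : D.Cobar →ₐ[R] R))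
      (fun _ hk _ hx => algebraMapInv_tensorGr D.sgr hk hx)
      (fun k hk => IsReduced.cobarGr_neg hD.reduced hk)
      (IsReduced.cobarGr_zero le_rfl hD.reduced)
  have hr : conv nabla.toLin LinearMap.id (nabla.antipode N) =
      (TensorAlgebra.algebraMapInv : D.Cobar →ₐ[R] R).toLinearMap.smulRight 1 := by
    refine LinearMap.ext fun x => ?_
    rw [LinearMap.smulRight_apply, AlgHom.toLinearMap_apply, ← Algebra.algebraMap_eq_smul_one]
    exact antipode_right hD hF x
  have hl : conv nabla.toLin (nabla.antipode N) LinearMap.id =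
      (TensorAlgebra.algebraMapInv : D.Cobar →ₐ[R] R).toLinearMap.smulRight 1 := by
    rw [← sub_eq_zero]
    -- By associativity `id * (S * id) = (id * S) * id = id = id * ηε`, so `S * id` and `ηε` agree
    -- after cancelling `id`.
    refine hinj LinearMap.id _ rfl ?_
    rw [conv_sub_right, ← conv_assoc hassoc, hr, conv_one_left hl1, conv_one_right hr1]
    ext1 x
    simp
  refine ⟨fun k x hx => antipode_mem hD.toIsHirsch hx, fun x => ?_, fun x => ?_, fun x => ?_⟩
  · have h0 : D.cobarD ∘ₗ nabla.antipode N - nabla.antipode N ∘ₗ D.cobarD = 0 := by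
      -- Differentiating `id * S = ηε` before and after evaluation gives the same first term `d *
      -- S`. What remains is `σ * (d S) = σ * (S d)` with the sign operator `σ`, which is normalised
      -- at `1` and can be cancelled.
      refine hinj (twist D.cobarGr 1) _ (twist_one 1) ?_
      have h1 : D.cobarD ∘ₗ conv nabla.toLin LinearMap.id (nabla.antipode N) = 0 := by
        rw [hr]; ext1 x; simp [cobarD_one]
      have h2 : conv nabla.toLin LinearMap.id (nabla.antipode N) ∘ₗ D.cobarD = 0 := by
        rw [hr]; ext1 x
        have := hB.counit_d x
        change TensorAlgebra.algebraMapInv (D.cobarD x) • (1 : D.Cobar) = 0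
        rw [show (TensorAlgebra.algebraMapInv (D.cobarD x) : R) = 0 from this, zero_smul]
      rw [der_comp_conv (σ := twist D.cobarGr 1) D.cobarD_mul] at h1
      rw [conv_comp_coder hcoder, parity_eq_twist] at h2
      rw [conv_sub_right, sub_eq_zero]
      simp only [LinearMap.comp_id, LinearMap.id_comp] at h1 h2
      exact add_left_cancel (h1.trans h2.symm)
    exact sub_eq_zero.1 (congrArg (fun φ : D.Cobar →ₗ[R] D.Cobar => φ x) h0)
  · exact congrArg (fun φ : D.Cobar →ₗ[R] D.Cobar => φ x) hl
  · exact congrArg (fun φ : D.Cobar →ₗ[R] D.Cobar => φ x) hr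

/-! ### Involutivity -/

theorem blockF_cons_ι_mul (p : ℕ) (L : List ℕ) (a : D.Red) (t : D.Cobar) :
    nabla.blockF (p :: L) (TensorAlgebra.ι R a * t) =
      opMul D (nabla.F p a ⊗ₜ[R] nabla.blockF L t) := by
  simp only [blockF, LinearMap.comp_apply, deconc_ι_mul, map_add, TensorProduct.map_tmul,
    ιInv_one, map_zero, TensorProduct.zero_tmul, zero_add]
  conv_rhs => rw [← deconc_counit_left t]
  induction deconc R D.Red t with
  | zero => simp
  | add x y hx hy => simp only [map_add, hx, hy, TensorProduct.tmul_add]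
  | tmul x y => simp [ιInv_ι_mul, TensorProduct.smul_tmul]

theorem blockF_cons_one (p : ℕ) (L : List ℕ) : nabla.blockF (p :: L) 1 = 0 := by
  simp [blockF, deconc_one, ιInv_one]

/-- `blockF L` sees only words with as many letters as `L` has blocks. Applied to `S(x)` it
therefore selects the summand `F^s` with `s` the number of blocks. -/
theorem blockF_weightProj (L : List ℕ) (t : D.Cobar) :
    nabla.blockF L (weightProj R D.Red L.length t) = nabla.blockF L t := by
  induction L generalizing t with
  | nil => simp [blockF, weightProj_zero]
  | cons p L ih =>
    induction t using words_induction with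
    | h1 => simp [weightProj_one, blockF_cons_one]
    | hadd x y hx hy => simp only [map_add, hx, hy]
    | hsmul r x hx => simp only [map_smul, hx]
    | hι a t _ => rw [List.length_cons, weightProj_ι_mul_succ, blockF_cons_ι_mul,
        blockF_cons_ι_mul, ih]

theorem weightProj_opMul (m : ℕ) (a b : D.Cobar) :
    weightProj R D.Red m (opMul D (a ⊗ₜ[R] b)) = ∑ p ∈ Finset.HasAntidiagonal.antidiagonal m,
      opMul D (weightProj R D.Red p.1 a ⊗ₜ[R] weightProj R D.Red p.2 b) := by
  induction b using induction_homogeneous (𝒜 := D.cobarGr) with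
  | h0 => simp
  | hadd x y hx hy => simp only [TensorProduct.tmul_add, map_add, hx, hy, Finset.sum_add_distrib]
  | h k b hb =>
    rw [opMul_tmul _ hb, weightProj_mul, ← Finset.Nat.sum_antidiagonal_swap]
    refine Finset.sum_congr rfl fun p _ => ?_
    rw [opMul_tmul _ (weightProj_mem_tensorGr _ hb)]
    rw [map_twist_zero (𝒜 := D.cobarGr) (ℬ := D.cobarGr)
      (fun _ _ h => weightProj_mem_tensorGr _ h)]
    rfl

/-- The antipode of a word is the opposite product of the sums `∑ F^{n_j}` over its letters;
collecting words of total length `m` gives a sum over compositions of `m`. -/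
theorem weightProj_antipode (hF : ∀ m, N < m → nabla.F m = 0) (m : ℕ)
    (t : D.Cobar) : weightProj R D.Red m (nabla.antipode N t) =
      ∑ c : Composition m, nabla.blockF c.blocks t := by
  induction t using words_induction generalizing m with
  | h1 =>
    rw [antipode_one, weightProj_one]
    cases m with
    | zero => rw [sum_composition_zero (fun L => nabla.blockF L 1)]; simp [blockF]
    | succ m =>
      rw [sum_composition_succ (fun L => nabla.blockF L 1)]
      simp [blockF_cons_one]
  | hadd x y hx hy => simp only [map_add, hx, hy, Finset.sum_add_distrib]
  | hsmul r x hx => simp only [map_smul, hx, Finset.smul_sum]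
  | hι a t ih =>
    rw [antipode_ι_mul, weightProj_opMul]
    simp only [weightProj_antipodeLetter hF]
    cases m with
    | zero =>
      rw [sum_composition_zero (fun L => nabla.blockF L (TensorAlgebra.ι R a * t))]
      simp [blockF, algebraMapInv_ι]
    | succ m =>
      rw [sum_composition_succ (fun L => nabla.blockF L (TensorAlgebra.ι R a * t)),
        Finset.Nat.sum_antidiagonal_succ, if_pos rfl, TensorProduct.zero_tmul, map_zero, zero_add]
      refine Finset.sum_congr rfl fun p _ => ?_
      rw [if_neg (by omega), ih]
      simp only [blockF_cons_ι_mul, TensorProduct.tmul_sum, map_sum]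

/-- This is where the obstructions come from: substituting `S(x) = ∑ F^s(x)` in the formula for the
antipode of a word reproduces the definition of `O_{m+1}` term by term. -/
theorem weightProj_antipode_antipode_ι (hF : ∀ m, N < m → nabla.F m = 0) (m : ℕ) (x : D.Red) :
    weightProj R D.Red (m + 1) (nabla.antipode N (nabla.antipode N (TensorAlgebra.ι R x))) =
      nabla.obstruction (m + 1) x := by
  rw [weightProj_antipode hF, antipode_ι, obstruction, LinearMap.sum_apply]
  refine Finset.sum_congr rfl fun c _ => ?_
  rw [← blockF_weightProj, weightProj_antipodeLetter hF, LinearMap.comp_apply]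
  refine congrArg _ (if_neg fun h => ?_)
  have h1 := c.blocks_sum
  rw [List.length_eq_zero_iff.1 h] at h1
  simp at h1

theorem obstruction_one (x : D.Red) : nabla.obstruction 1 x = TensorAlgebra.ι R x := by
  change (∑ c : Composition (0 + 1), nabla.blockF c.blocks ∘ₗ nabla.F c.blocks.length) x = _
  rw [sum_composition_succ (fun L => nabla.blockF L ∘ₗ nabla.F L.length)]
  rw [Finset.Nat.antidiagonal_zero, Finset.sum_singleton]
  rw [sum_composition_zero (fun L => nabla.blockF ((((0, 0) : ℕ × ℕ).1 + 1) :: L) ∘ₗ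
    nabla.F ((((0, 0) : ℕ × ℕ).1 + 1) :: L).length)]
  simp only [List.length_singleton, zero_add, LinearMap.comp_apply, F_one, LinearMap.neg_apply,
    map_neg]
  rw [← mul_one (TensorAlgebra.ι R x), blockF_cons_ι_mul, F_one]
  simp [blockF, opMul_one, ← map_neg]

/-- Comparison by word length: length `0` contributes nothing, length `1` gives `(F^1)² = id`, and
the longer components are the obstructions. -/
theorem antipode_antipode_ι (hF : ∀ m, N < m → nabla.F m = 0) (x : D.Red)
    (hO : ∀ m, 2 ≤ m → weightProj R D.Red m (nabla.obstruction m x) = 0) :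
    nabla.antipode N (nabla.antipode N (TensorAlgebra.ι R x)) = TensorAlgebra.ι R x := by
  refine weight_ext fun m => ?_
  match m with
  | 0 =>
    rw [weightProj_antipode hF, sum_composition_zero (fun L => nabla.blockF L _), antipode_ι,
      ← blockF_weightProj, List.length_nil, weightProj_antipodeLetter hF, if_pos rfl, map_zero,
      weightProj_of_mem (ι_mem_weight x), if_neg (by omega)]
  | 1 =>
    rw [weightProj_antipode_antipode_ι hF 0, obstruction_one,
      weightProj_of_mem (ι_mem_weight x), if_pos rfl]
  | m + 2 =>
    rw [weightProj_of_mem (ι_mem_weight x), if_neg (by omega), ← hO (m + 2) (by omega),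
      ← weightProj_antipode_antipode_ι hF (m + 1), weightProj_weightProj, if_pos rfl]

/-- The square of an anti-multiplicative map is multiplicative, as the two Koszul signs cancel, so
it is determined by its values on letters. -/
theorem antipode_antipode (hD : D.IsHirsch nabla)
    (h : ∀ x, nabla.antipode N (nabla.antipode N (TensorAlgebra.ι R x)) = TensorAlgebra.ι R x)
    (t : D.Cobar) : nabla.antipode N (nabla.antipode N t) = t := by
  induction t using induction_homogeneous (𝒜 := D.cobarGr) with
  | h0 => simp
  | hadd x y hx hy => simp only [map_add, hx, hy]
  | h k t ht =>
    refine tensorGr_induction (𝒜 := D.sgr) (p := fun k t =>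
      nabla.antipode N (nabla.antipode N t) = t) ?_ ?_ ?_ ?_ ?_ ht
    · rw [antipode_one, antipode_one]
    · intro k; simp
    · intro k x _ y _ hx hy; simp only [map_add, hx, hy]
    · intro k r x _ hx; simp only [map_smul, hx]
    · intro j k a ha t ht ih
      have hs := antipode_mem hD (N := N) (ι_mem_tensorGr _ ha)
      rw [antipode_mul hD _ ht, antipode_mul hD _ (twist_mem _ hs), ih,
        map_twist_zero (𝒜 := D.cobarGr) (ℬ := D.cobarGr) (fun _ _ h => antipode_mem hD h), h,
        twist_of_mem _ _ (ι_mem_tensorGr _ ha), twist_of_mem _ _ ht, smul_mul_smul_comm, ← sg_add,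
        sg_even (by grind), one_smul]

end CobarCoproduct

/-! ### The truncation -/

/-- A nonzero homogeneous letter has degree at most `N - 1`, and so has its image under `F^m`.
Letters have degree at least `1`, so no nonzero element of that degree is a sum of words of length
`m > N`. -/
theorem F_eq_zero_of_bounded {nabla : D.CobarCoproduct} (hD : D.IsHirsch nabla) {N : ℕ}
    (hN : ∀ k : ℤ, ¬ k ≤ N → D.gr k = ⊥) (m : ℕ) (hm : N < m) : nabla.F m = 0 := by
  refine hom_ext (𝒜 := D.sgr) fun k x hx => ?_
  obtain ⟨m, rfl⟩ : ∃ j, m = j + 1 := ⟨m - 1, by omega⟩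
  by_cases hk : k + 1 ≤ N
  · have h1 := weightProj_of_mem (nabla.F_weight m x) (m + 1)
    rw [if_pos rfl] at h1
    rw [← h1, LinearMap.zero_apply]
    exact weightProj_eq_zero_of_lt (c := 1) (fun j hj => hD.reduced.sgr_eq_bot (by exact_mod_cast hj))
      (CobarCoproduct.F_mem hD _ hx) (by push_cast; omega)
  · have hx' := D.mem_sgr.1 hx
    rw [hN _ hk, Submodule.mem_bot] at hx'
    rw [show x = 0 from Subtype.ext hx', map_zero, map_zero]

/-- The bound in the hypothesis on `O_k` is exactly what is needed: the component of word length `m`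
of `S²` on a letter lies in degree at most `n - 1`, where words of length `m` exist only if `m i ≤ n
- 1`. -/
theorem trunc_obstruction {C : DGCoalgData.{u, v} R} {nabla : C.CobarCoproduct}
    (hC : C.IsHomotopyGCoalgebra nabla) {i : ℕ} (hred : C.IsReduced i) (n : ℕ)
    (hO : ∀ k : ℕ, 2 ≤ k → (k : ℤ) * (i : ℤ) ≤ (n : ℤ) - 1 → nabla.obstruction k = 0)
    (x : (C.trunc n).Red) : (nabla.trunc n).antipode n ((nabla.trunc n).antipode n
      (TensorAlgebra.ι R x)) = TensorAlgebra.ι R x := by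
  have hT := isHomotopyGCoalgebra_trunc hC n
  have hF := F_eq_zero_of_bounded hT.toIsHirsch (N := n) fun k hk => trunc_gr_eq_bot C n hk
  induction x using induction_homogeneous (𝒜 := (C.trunc n).sgr) with
  | h0 => simp
  | hadd x y hx hy => simp only [map_add, hx, hy]
  | h k x hx =>
    refine CobarCoproduct.antipode_antipode_ι hF x fun m hm => ?_
    -- If the bound holds, the obstruction of `C` vanishes and restricts to that of `C_{≤n}`.
    -- Otherwise words with `m` letters of degree at least `i` do not fit in the degree of `x`.
    by_cases hmi : (m : ℤ) * i ≤ (n : ℤ) - 1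
    · have h := obstruction_trunc hC.toIsHirsch m x
      rw [hO m hm hmi, LinearMap.zero_apply] at h
      rw [← C.cobarProj_cobarIncl n ((nabla.trunc n).obstruction m x), ← h, map_zero, map_zero]
    · obtain ⟨m, rfl⟩ : ∃ j, m = j + 1 := ⟨m - 1, by omega⟩
      rw [← CobarCoproduct.weightProj_antipode_antipode_ι hF, weightProj_weightProj,
        if_pos rfl]
      by_cases hk : k + 1 ≤ n
      · exact weightProj_eq_zero_of_lt (c := (i : ℤ)) (fun j hj => (hred.trunc n).sgr_eq_bot hj)
          (CobarCoproduct.antipode_mem hT.toIsHirsch (CobarCoproduct.antipode_mem hT.toIsHirsch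
            (ι_mem_tensorGr _ hx))) (by rw [mul_comm]; omega)
      · have hx' := (C.trunc n).mem_sgr.1 hx
        rw [trunc_gr_eq_bot C n hk, Submodule.mem_bot] at hx'
        rw [show x = 0 from Subtype.ext hx']
        simp

end DGCoalgData

/-! ### The opposite of a graded coproduct. -/

section

variable {R : Type*} [CommRing R] {M : Type*} [AddCommGroup M] [Module R M]
variable {𝒜 : ℤ → Submodule R M} [DirectSum.Decomposition 𝒜]

theorem comp_twist_of_mem {δ : M →ₗ[R] M ⊗[R] M} (hδ : ∀ k, ∀ x ∈ 𝒜 k, δ x ∈ prodGr 𝒜 𝒜 k)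
    (j : ℤ) : δ ∘ₗ twist 𝒜 j = TensorProduct.map (twist 𝒜 j) (twist 𝒜 j) ∘ₗ δ := by
  refine hom_ext (𝒜 := 𝒜) fun k x hx => ?_
  rw [LinearMap.comp_apply, LinearMap.comp_apply, twist_of_mem _ _ hx, map_smul]
  refine prodGr_eq (f := sg R (j * k) • LinearMap.id) (fun p q hpq a ha b hb => ?_) (hδ k x hx)
  rw [TensorProduct.map_tmul, twist_of_mem _ _ ha, twist_of_mem _ _ hb, TensorProduct.smul_tmul_smul,
    ← sg_add, ← mul_add, hpq]
  rfl

theorem conv_comp_twist {A : Type*} [Ring A] [Algebra R A] {δ : M →ₗ[R] M ⊗[R] M}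
    (hδ : ∀ k, ∀ x ∈ 𝒜 k, δ x ∈ prodGr 𝒜 𝒜 k) (j : ℤ) (f g : M →ₗ[R] A) :
    conv δ f g ∘ₗ twist 𝒜 j = conv δ (f ∘ₗ twist 𝒜 j) (g ∘ₗ twist 𝒜 j) :=
  conv_comp (comp_twist_of_mem hδ j) f g

/-- The opposite of a graded coproduct. -/
def coop (𝒜 : ℤ → Submodule R M) [DirectSum.Decomposition 𝒜] (δ : M →ₗ[R] M ⊗[R] M) :
    M →ₗ[R] M ⊗[R] M := koszulSwap 𝒜 𝒜 ∘ₗ δ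

variable {δ : M →ₗ[R] M ⊗[R] M}

theorem koszulSwap_mem {N : Type*} [AddCommGroup N] [Module R N] {ℬ : ℤ → Submodule R N}
    [DirectSum.Decomposition ℬ] {k : ℤ} {z : M ⊗[R] N} (hz : z ∈ prodGr 𝒜 ℬ k) :
    koszulSwap 𝒜 ℬ z ∈ prodGr ℬ 𝒜 k := by
  refine prodGr_induction (P := fun z => koszulSwap 𝒜 ℬ z ∈ prodGr ℬ 𝒜 k) (by simp)
    (fun x y hx hy => ?_) (fun p q hpq a ha b hb => ?_) hz
  · rw [map_add]; exact add_mem hx hy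
  · rw [koszulSwap_hom _ _ ha hb]
    exact Submodule.smul_mem _ _ (tmul_mem_prodGr (by omega) hb ha)

theorem coop_mem (hδ : ∀ k, ∀ x ∈ 𝒜 k, δ x ∈ prodGr 𝒜 𝒜 k) (k : ℤ) (x : M) (hx : x ∈ 𝒜 k) :
    coop 𝒜 δ x ∈ prodGr 𝒜 𝒜 k := koszulSwap_mem (hδ k x hx)

theorem coop_counit_left {ε : M →ₗ[R] R} (hε : ∀ k, k ≠ 0 → ∀ x ∈ 𝒜 k, ε x = 0)
    (hr : ∀ x, TensorProduct.rid R M (ε.lTensor M (δ x)) = x) (x : M) :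
    TensorProduct.lid R M (ε.rTensor M (coop 𝒜 δ x)) = x := by
  conv_rhs => rw [← hr x]
  rw [coop, LinearMap.comp_apply]
  generalize δ x = z
  induction z using tensor_induction (𝒜 := 𝒜) (ℬ := 𝒜) with
  | h0 => simp
  | hadd x y hx hy => simp only [map_add, hx, hy]
  | h p q a ha b hb =>
    rw [koszulSwap_hom _ _ ha hb]
    by_cases hq : q = 0
    · subst hq; simp
    · simp [hε q hq b hb]

theorem coop_counit_right {ε : M →ₗ[R] R} (hε : ∀ k, k ≠ 0 → ∀ x ∈ 𝒜 k, ε x = 0)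
    (hl : ∀ x, TensorProduct.lid R M (ε.rTensor M (δ x)) = x) (x : M) :
    TensorProduct.rid R M (ε.lTensor M (coop 𝒜 δ x)) = x := by
  conv_rhs => rw [← hl x]
  rw [coop, LinearMap.comp_apply]
  generalize δ x = z
  induction z using tensor_induction (𝒜 := 𝒜) (ℬ := 𝒜) with
  | h0 => simp
  | hadd x y hx hy => simp only [map_add, hx, hy]
  | h p q a ha b hb =>
    rw [koszulSwap_hom _ _ ha hb]
    by_cases hp : p = 0
    · subst hp; simp
    · simp [hε p hp a ha]

/-- Both iterated opposite coproducts are the iterated coproduct followed by the signed reversal of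
three factors, written as a composite of three adjacent swaps. The auxiliary identities `e1` and
`e2` say this for the two bracketings. -/
theorem coop_coassoc (hδ : ∀ k, ∀ x ∈ 𝒜 k, δ x ∈ prodGr 𝒜 𝒜 k)
    (h : (TensorProduct.assoc R M M M).toLinearMap ∘ₗ δ.rTensor M ∘ₗ δ = δ.lTensor M ∘ₗ δ) :
    (TensorProduct.assoc R M M M).toLinearMap ∘ₗ (coop 𝒜 δ).rTensor M ∘ₗ coop 𝒜 δ =
      (coop 𝒜 δ).lTensor M ∘ₗ coop 𝒜 δ := by
  have e1 : (TensorProduct.assoc R M M M).toLinearMap ∘ₗ (coop 𝒜 δ).rTensor M ∘ₗ koszulSwap 𝒜 𝒜 =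
      ((TensorProduct.assoc R M M M).toLinearMap ∘ₗ (koszulSwap 𝒜 𝒜).rTensor M ∘ₗ
        (TensorProduct.assoc R M M M).symm.toLinearMap ∘ₗ (koszulSwap 𝒜 𝒜).lTensor M ∘ₗ
        (TensorProduct.assoc R M M M).toLinearMap ∘ₗ (koszulSwap 𝒜 𝒜).rTensor M ∘ₗ
        (TensorProduct.assoc R M M M).symm.toLinearMap) ∘ₗ δ.lTensor M := by
    refine tensor_hom_ext (𝒜 := 𝒜) (ℬ := 𝒜) fun p q a ha b hb => ?_
    simp only [LinearMap.comp_apply, LinearMap.lTensor_tmul]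
    rw [koszulSwap_hom _ _ ha hb, map_smul, map_smul, LinearMap.rTensor_tmul, coop,
      LinearMap.comp_apply]
    refine prodGr_eq (𝒜 := 𝒜) (ℬ := 𝒜) (f := sg R (p * q) •
      ((TensorProduct.assoc R M M M).toLinearMap ∘ₗ (TensorProduct.mk R _ _).flip a ∘ₗ
        koszulSwap 𝒜 𝒜)) (g := ((TensorProduct.assoc R M M M).toLinearMap ∘ₗ
        (koszulSwap 𝒜 𝒜).rTensor M ∘ₗ
        (TensorProduct.assoc R M M M).symm.toLinearMap ∘ₗ (koszulSwap 𝒜 𝒜).lTensor M ∘ₗ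
        (TensorProduct.assoc R M M M).toLinearMap ∘ₗ (koszulSwap 𝒜 𝒜).rTensor M ∘ₗ
        (TensorProduct.assoc R M M M).symm.toLinearMap) ∘ₗ TensorProduct.mk R _ _ a)
      (fun r s hrs c hc e he => ?_) (hδ q b hb)
    simp only [LinearMap.smul_apply, LinearMap.comp_apply, LinearEquiv.coe_coe,
      TensorProduct.mk_apply, TensorProduct.assoc_symm_tmul, LinearMap.rTensor_tmul,
      LinearMap.flip_apply]
    simp only [koszulSwap_hom 𝒜 𝒜 ha hc, koszulSwap_hom 𝒜 𝒜 hc he, koszulSwap_hom 𝒜 𝒜 ha he,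
      ← TensorProduct.smul_tmul', TensorProduct.tmul_smul, map_smul, TensorProduct.assoc_tmul,
      LinearMap.lTensor_tmul, TensorProduct.assoc_symm_tmul, LinearMap.rTensor_tmul]
    simp only [smul_smul, ← sg_add]
    congr 1
    apply sg_congr
    subst hrs
    grind
  have e2 : (coop 𝒜 δ).lTensor M ∘ₗ koszulSwap 𝒜 𝒜 =
      ((TensorProduct.assoc R M M M).toLinearMap ∘ₗ (koszulSwap 𝒜 𝒜).rTensor M ∘ₗ
        (TensorProduct.assoc R M M M).symm.toLinearMap ∘ₗ (koszulSwap 𝒜 𝒜).lTensor M ∘ₗ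
        (TensorProduct.assoc R M M M).toLinearMap ∘ₗ (koszulSwap 𝒜 𝒜).rTensor M ∘ₗ
        (TensorProduct.assoc R M M M).symm.toLinearMap) ∘ₗ
        (TensorProduct.assoc R M M M).toLinearMap ∘ₗ δ.rTensor M := by
    refine tensor_hom_ext (𝒜 := 𝒜) (ℬ := 𝒜) fun p q a ha b hb => ?_
    simp only [LinearMap.comp_apply, LinearMap.rTensor_tmul]
    rw [koszulSwap_hom _ _ ha hb, map_smul, LinearMap.lTensor_tmul, coop,
      LinearMap.comp_apply]
    refine prodGr_eq (𝒜 := 𝒜) (ℬ := 𝒜) (f := sg R (p * q) •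
      (TensorProduct.mk R _ _ b ∘ₗ koszulSwap 𝒜 𝒜)) (g := ((TensorProduct.assoc R M M M).toLinearMap ∘ₗ
        (koszulSwap 𝒜 𝒜).rTensor M ∘ₗ
        (TensorProduct.assoc R M M M).symm.toLinearMap ∘ₗ (koszulSwap 𝒜 𝒜).lTensor M ∘ₗ
        (TensorProduct.assoc R M M M).toLinearMap ∘ₗ (koszulSwap 𝒜 𝒜).rTensor M ∘ₗ
        (TensorProduct.assoc R M M M).symm.toLinearMap) ∘ₗ
        (TensorProduct.assoc R M M M).toLinearMap ∘ₗ (TensorProduct.mk R _ _).flip b)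
      (fun r s hrs c hc e he => ?_) (hδ p a ha)
    simp only [LinearMap.smul_apply, LinearMap.comp_apply, LinearEquiv.coe_coe,
      TensorProduct.mk_apply, TensorProduct.assoc_symm_tmul, LinearMap.rTensor_tmul,
      LinearMap.flip_apply, TensorProduct.assoc_tmul]
    simp only [koszulSwap_hom 𝒜 𝒜 hc he, koszulSwap_hom 𝒜 𝒜 hc hb, koszulSwap_hom 𝒜 𝒜 he hb,
      ← TensorProduct.smul_tmul', TensorProduct.tmul_smul, map_smul, TensorProduct.assoc_tmul,
      LinearMap.lTensor_tmul, TensorProduct.assoc_symm_tmul, LinearMap.rTensor_tmul]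
    simp only [smul_smul, ← sg_add]
    congr 1
    apply sg_congr
    subst hrs
    grind
  have e1' := congrArg (fun φ => φ ∘ₗ δ) e1
  have e2' := congrArg (fun φ => φ ∘ₗ δ) e2
  simp only [LinearMap.comp_assoc] at e1' e2'
  rw [h] at e2'
  exact e1'.trans e2'.symm

end

namespace DGCoalgData

variable {R : Type u} [CommRing R] {B : DGCoalgData.{u, v} R}
  {m : B.carrier ⊗[R] B.carrier →ₗ[R] B.carrier} {S : B.carrier →ₗ[R] B.carrier}

/-! ### Connected DG-Hopf algebras with involutive antipode -/

/-- A DG-bialgebra, connected and without elements of degree `1`, whose antipode is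
anti-multiplicative and involutive. -/
structure IsInvolutiveDGHopf (B : DGCoalgData.{u, v} R)
    (m : B.carrier ⊗[R] B.carrier →ₗ[R] B.carrier) (S : B.carrier →ₗ[R] B.carrier) : Prop where
  coalg : B.IsDGCoalgebra
  reduced : B.IsReduced 1
  m_mem : ∀ p q, ∀ a ∈ B.gr p, ∀ b ∈ B.gr q, m (a ⊗ₜ[R] b) ∈ B.gr (p + q)
  m_assoc : ∀ a b c, m (m (a ⊗ₜ[R] b) ⊗ₜ[R] c) = m (a ⊗ₜ[R] m (b ⊗ₜ[R] c))
  one_m : ∀ a, m (B.one ⊗ₜ[R] a) = a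
  m_one : ∀ a, m (a ⊗ₜ[R] B.one) = a
  counit_m : ∀ a b, B.counit (m (a ⊗ₜ[R] b)) = B.counit a * B.counit b
  comul_m : ∀ a b, B.comul (m (a ⊗ₜ[R] b)) =
    TensorProduct.map m m (middleSwap B.gr B.gr (B.comul a ⊗ₜ[R] B.comul b))
  d_m : ∀ a b, B.d (m (a ⊗ₜ[R] b)) = m (B.d a ⊗ₜ[R] b) + m (twist B.gr 1 a ⊗ₜ[R] B.d b)
  antipode : B.IsAntipode m S
  S_m : ∀ p q, ∀ a ∈ B.gr p, ∀ b ∈ B.gr q,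
    S (m (a ⊗ₜ[R] b)) = sg R (p * q) • m (S b ⊗ₜ[R] S a)
  S_S : ∀ a, S (S a) = a

variable (B) in
/-- The map `b ↦ s⁻¹ (b - ε(b))`. -/
def letter : B.carrier →ₗ[R] B.Cobar := TensorAlgebra.ι R ∘ₗ B.toRed

theorem letter_coe (y : B.Red) : B.letter y = TensorAlgebra.ι R y := by
  rw [letter, LinearMap.comp_apply, toRed_coe]

theorem letter_one : B.letter B.one = 0 := by
  rw [letter, LinearMap.comp_apply, toRed_one, map_zero]

theorem letter_mem {k : ℤ} {b : B.carrier} (hb : b ∈ B.gr k) : B.letter b ∈ B.cobarGr (k - 1) := by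
  refine ι_mem_tensorGr _ (B.mem_sgr.2 ?_)
  rw [sub_add_cancel]
  exact B.toRed_mem hb

variable (m) in
/-- The right multiplication. -/
def mulR (y : B.carrier) : B.carrier →ₗ[R] B.carrier := m ∘ₗ (TensorProduct.mk R _ _).flip y

theorem mulR_apply (y h : B.carrier) : mulR m y h = m (h ⊗ₜ[R] y) := rfl

theorem diamond_one (h : B.carrier) :
    B.diamond m h 1 = B.counit h • 1 := by
  simp [diamond, Algebra.algebraMap_eq_smul_one]

/-- The word is fixed and the element of `B` is the variable. In this form the action is a
convolution of maps on `B`, and coassociativity, counits and antipodes apply without expanding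
coproducts. -/
theorem diamond_ι_mul {q : ℤ} {y : B.Red} (hy : y ∈ B.sgr q) (x : B.Cobar) :
    (B.diamond m).flip (TensorAlgebra.ι R y * x) = conv B.comul (B.letter ∘ₗ mulR m y)
      ((B.diamond m).flip x ∘ₗ twist B.gr q) := by
  ext1 h
  simp only [diamond, LinearMap.flip_flip, LinearMap.comp_apply, AlgHom.toLinearMap_apply, map_mul,
    LinearMap.applyₗ_apply_apply, Module.End.mul_apply, TensorAlgebra.lift_ι_apply]
  rw [conv]
  generalize (TensorAlgebra.lift R (B.diamondStep m)) x
    (Algebra.linearMap R B.Cobar ∘ₗ B.counit) = f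
  simp only [diamondStep, LinearMap.mk₂_apply, LinearMap.comp_apply]
  congr 1
  generalize B.comul h = z
  induction z with
  | zero => simp
  | add x y hx hy => simp only [map_add, hx, hy]
  | tmul a b =>
    simp only [LinearMap.flip_apply, TensorProduct.mk_apply, LinearEquiv.coe_coe,
      TensorProduct.assoc_tmul, LinearMap.lTensor_tmul]
    rw [koszulSwap_tmul _ _ _ hy]
    simp [letter, mulR]

theorem diamond_flip_one :
    (B.diamond m).flip 1 = B.counit.smulRight (1 : B.Cobar) :=
  LinearMap.ext fun h => diamond_one h

namespace IsInvolutiveDGHopf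

variable (hB : B.IsInvolutiveDGHopf m S)
include hB

theorem diamond_ι (h : B.carrier) (y : B.Red) :
    B.diamond m h (TensorAlgebra.ι R y) = B.letter (m (h ⊗ₜ[R] y)) := by
  induction y using induction_homogeneous (𝒜 := B.sgr) with
  | h0 => simp
  | hadd x y hx hy => simp only [map_add, hx, hy, Submodule.coe_add, TensorProduct.tmul_add]
  | h k y hy =>
    have e := congrArg (fun φ : B.carrier →ₗ[R] B.Cobar => φ h) (diamond_ι_mul (m := m) hy 1)
    simp only [mul_one, LinearMap.flip_apply] at e
    have e2 : (B.diamond m).flip 1 ∘ₗ twist B.gr k = B.counit.smulRight (1 : B.Cobar) := by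
      rw [diamond_flip_one]; ext1 x
      simp [scalar_twist B.gr B.counit_gr]
    rw [e, e2, conv_one_right hB.coalg.counit_right]
    simp [mulR]

/-- Extension of `diamond_ι` to all of `B`. -/
theorem letter_m (h k : B.carrier) :
    B.letter (m (h ⊗ₜ[R] k)) = B.diamond m h (B.letter k) + B.counit k • B.letter h := by
  have e : k = (B.toRed k : B.carrier) + B.counit k • B.one := by rw [coe_toRed]; abel
  rw [letter, LinearMap.comp_apply _ _ k, hB.diamond_ι]
  conv_lhs => rw [e]
  rw [TensorProduct.tmul_add, map_add, map_add, TensorProduct.tmul_smul, map_smul, map_smul,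
    hB.m_one]
  rfl

theorem diamond_mem {p q : ℤ} {h : B.carrier} (hh : h ∈ B.gr p) {x : B.Cobar}
    (hx : x ∈ B.cobarGr q) : B.diamond m h x ∈ B.cobarGr (p + q) := by
  have key : ∀ p, ∀ h ∈ B.gr p, B.diamond m h x ∈ B.cobarGr (p + q) := by
    refine tensorGr_induction (𝒜 := B.sgr) (p := fun q x => ∀ p, ∀ h ∈ B.gr p,
      B.diamond m h x ∈ B.cobarGr (p + q)) ?_ ?_ ?_ ?_ ?_ hx
    · intro p h hh
      rw [diamond_one]
      by_cases hp : p = 0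
      · subst hp; exact Submodule.smul_mem _ _ one_mem_tensorGr
      · rw [B.counit_gr p hp h hh, zero_smul]; exact zero_mem _
    · intro k p h _; rw [map_zero]; exact zero_mem _
    · intro k x _ y _ hx hy p h hh; rw [map_add]; exact add_mem (hx p h hh) (hy p h hh)
    · intro k r x _ hx p h hh; rw [map_smul]; exact Submodule.smul_mem _ _ (hx p h hh)
    · intro j k y hy x hx ih p h hh
      rw [← LinearMap.flip_apply, diamond_ι_mul hy, conv_apply]
      refine prodGr_induction (P := fun z => LinearMap.mul' R B.Cobar (TensorProduct.map
        (B.letter ∘ₗ mulR m y) ((B.diamond m).flip x ∘ₗ twist B.gr j) z) ∈ B.cobarGr (p + (j + k)))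
        (by simp) (fun x y hx hy => ?_) (fun r s hrs a ha b hb => ?_) (hB.coalg.comul_mem p h hh)
      · rw [map_add, map_add]; exact add_mem hx hy
      · refine mul_mem_tensorGr (i := r + (j + 1) - 1) (by omega)
          (letter_mem (hB.m_mem r (j + 1) a ha y (B.mem_sgr.1 hy))) (ih s _ (twist_mem _ hb))
  exact key p h hh

/-- `ΩB` is a module algebra over `B`. -/
theorem diamond_flip_mul {k : ℤ} {x : B.Cobar} (hx : x ∈ B.cobarGr k) (y : B.Cobar) :
    (B.diamond m).flip (x * y) = conv B.comul ((B.diamond m).flip x)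
      ((B.diamond m).flip y ∘ₗ twist B.gr k) := by
  refine tensorGr_induction (𝒜 := B.sgr) (p := fun k x => (B.diamond m).flip (x * y) =
    conv B.comul ((B.diamond m).flip x) ((B.diamond m).flip y ∘ₗ twist B.gr k)) ?_ ?_ ?_ ?_ ?_ hx
  · rw [one_mul, diamond_flip_one, conv_one_left hB.coalg.counit_left, twist_zero]
    ext1; simp
  · intro k; rw [zero_mul, map_zero, conv_zero_left]
  · intro k x _ x' _ h h'; rw [add_mul, map_add, map_add, conv_add_left, h, h']
  · intro k r x _ h; rw [smul_mul_assoc, map_smul, map_smul, conv_smul_left, h]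
  · intro j k a ha x hx h
    rw [mul_assoc, diamond_ι_mul ha, diamond_ι_mul ha, h, conv_comp_twist hB.coalg.comul_mem,
      LinearMap.comp_assoc, twist_comp, conv_assoc hB.coalg.coassoc, add_comm k j]

/-- The action is associative. -/
theorem diamond_m (h k : B.carrier) (x : B.Cobar) :
    B.diamond m (m (h ⊗ₜ[R] k)) x = B.diamond m h (B.diamond m k x) := by
  have key : ∀ j, ∀ x ∈ B.cobarGr j, ∀ h k, B.diamond m (m (h ⊗ₜ[R] k)) x =
      B.diamond m h (B.diamond m k x) := by
    intro j x hx
    refine tensorGr_induction (𝒜 := B.sgr) (p := fun j x => ∀ h k, B.diamond m (m (h ⊗ₜ[R] k)) x =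
      B.diamond m h (B.diamond m k x)) ?_ ?_ ?_ ?_ ?_ hx
    · intro h k
      rw [diamond_one, diamond_one, map_smul, diamond_one, hB.counit_m, smul_smul, mul_comm]
    · intro j h k; simp
    · intro j x _ y _ hx hy h k; simp only [map_add, hx, hy]
    · intro j r x _ hx h k; simp only [map_smul, hx]
    · intro j l y hy x hx ih h k
      rw [← LinearMap.flip_apply (B.diamond m) k, diamond_ι_mul hy,
        ← LinearMap.flip_apply (B.diamond m) (m _), diamond_ι_mul hy, conv_apply, hB.comul_m,
        conv_apply]
      generalize B.comul k = w
      induction w using tensor_induction (𝒜 := B.gr) (ℬ := B.gr) with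
      | h0 => simp
      | hadd w w' hw hw' => simp only [TensorProduct.tmul_add, map_add, hw, hw']
      | h r s c hc e he =>
        have hcy := letter_mem (hB.m_mem r (j + 1) c hc y (B.mem_sgr.1 hy))
        simp only [TensorProduct.map_tmul, LinearMap.mul'_apply, LinearMap.comp_apply,
          LinearMap.flip_apply, mulR_apply]
        rw [← LinearMap.flip_apply (B.diamond m) h, hB.diamond_flip_mul hcy, conv_apply]
        generalize B.comul h = z
        induction z using tensor_induction (𝒜 := B.gr) (ℬ := B.gr) with
        | h0 => simp
        | hadd w w' hw hw' => simp only [TensorProduct.add_tmul, map_add, hw, hw']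
        | h p q a ha b hb =>
          rw [middleSwap_tmul _ _ _ hb hc]
          simp only [map_smul, TensorProduct.map_tmul, LinearMap.mul'_apply, LinearMap.comp_apply,
            LinearMap.flip_apply, mulR_apply]
          -- The product `c y` is in `ker ε` because `y` is, so the correction term of `letter_m`
          -- disappears and associativity of `m` applies.
          have e1 : B.diamond m a (B.letter (m (c ⊗ₜ[R] (y : B.carrier)))) =
              B.letter (m (m (a ⊗ₜ[R] c) ⊗ₜ[R] (y : B.carrier))) := by
            have h1 := hB.letter_m a (m (c ⊗ₜ[R] (y : B.carrier)))
            rw [hB.counit_m, LinearMap.mem_ker.1 y.2, mul_zero, zero_smul, add_zero] at h1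
            rw [← h1, hB.m_assoc]
          rw [e1, twist_of_mem _ _ he, twist_of_mem _ _ hb, twist_of_mem _ _ (hB.m_mem q s b hb e he)]
          simp only [map_smul, LinearMap.smul_apply, mul_smul_comm, smul_smul, ← sg_add, ih]
          congr 1
          apply sg_congr
          grind
  induction x using induction_homogeneous (𝒜 := B.cobarGr) with
  | h0 => simp
  | hadd x y hx hy => simp only [map_add, hx, hy]
  | h j x hx => exact key j x hx h k

end IsInvolutiveDGHopf

variable {R : Type u} [CommRing R] {B : DGCoalgData.{u, v} R}
  {m : B.carrier ⊗[R] B.carrier →ₗ[R] B.carrier} {S : B.carrier →ₗ[R] B.carrier}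

/-! ### The action of `B` by operators on its cobar construction -/

variable (m) in
/-- The action of `B` on `ΩB`, with values in the algebra of endomorphisms. -/
def act : B.carrier →ₗ[R] Module.End R B.Cobar := B.diamond m

theorem act_apply (h : B.carrier) (x : B.Cobar) : act m h x = B.diamond m h x := rfl

variable (B) in
/-- Left multiplications. -/
def lmul : B.Cobar →ₗ[R] Module.End R B.Cobar := LinearMap.mul R B.Cobar

variable (B) in
/-- Right multiplications `y ↦ (x ↦ (-1)^(|x||y|) x y)`. -/
def rmul : B.Cobar →ₗ[R] Module.End R B.Cobar := TensorProduct.curry (CobarCoproduct.opMul B)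

theorem lmul_apply (x y : B.Cobar) : B.lmul x y = x * y := rfl

theorem rmul_apply (y : B.Cobar) {k : ℤ} {x : B.Cobar} (hx : x ∈ B.cobarGr k) :
    B.rmul y x = x * twist B.cobarGr k y := CobarCoproduct.opMul_tmul y hx

theorem rmul_apply_of_mem {k j : ℤ} {x y : B.Cobar} (hx : x ∈ B.cobarGr k) (hy : y ∈ B.cobarGr j) :
    B.rmul y x = sg R (k * j) • (x * y) := by
  rw [rmul_apply y hx, twist_of_mem _ _ hy, mul_smul_comm]

/-- A graded coproduct `δ` on `B` and multiplications `Λ` on `ΩB` which are compatible with the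
action of `B`. The two instances are the coproduct of `B` with the left multiplications and its
opposite with the right multiplications. -/
structure IsSide (m : B.carrier ⊗[R] B.carrier →ₗ[R] B.carrier) (S : B.carrier →ₗ[R] B.carrier)
    (δ : B.carrier →ₗ[R] B.carrier ⊗[R] B.carrier) (Λ : B.Cobar →ₗ[R] Module.End R B.Cobar) :
    Prop where
  mem : ∀ k, ∀ x ∈ B.gr k, δ x ∈ prodGr B.gr B.gr k
  coassoc : (TensorProduct.assoc R B.carrier B.carrier B.carrier).toLinearMap ∘ₗ
    δ.rTensor B.carrier ∘ₗ δ = δ.lTensor B.carrier ∘ₗ δ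
  counit_left : ∀ x, TensorProduct.lid R B.carrier (B.counit.rTensor B.carrier (δ x)) = x
  counit_right : ∀ x, TensorProduct.rid R B.carrier (B.counit.lTensor B.carrier (δ x)) = x
  one : δ B.one = B.one ⊗ₜ[R] B.one
  mul : ∀ a b, δ (m (a ⊗ₜ[R] b)) = TensorProduct.map m m (middleSwap B.gr B.gr (δ a ⊗ₜ[R] δ b))
  antipode_left : ∀ h, m (TensorProduct.map S LinearMap.id (δ h)) = B.counit h • B.one
  antipode_right : ∀ h, m (TensorProduct.map LinearMap.id S (δ h)) = B.counit h • B.one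
  act_mul : ∀ k, ∀ y ∈ B.cobarGr k, ∀ h, act m h * Λ y =
    conv δ (Λ ∘ₗ (B.diamond m).flip y) (act m ∘ₗ twist B.gr k) h

namespace IsInvolutiveDGHopf

variable (hB : B.IsInvolutiveDGHopf m S)
include hB

theorem act_m (h k : B.carrier) : act m (m (h ⊗ₜ[R] k)) = act m h * act m k :=
  LinearMap.ext fun x => hB.diamond_m h k x

theorem act_one : act m B.one = 1 := by
  refine words_hom_ext ?_ fun x t h => ?_
  · rw [act_apply, diamond_one, B.counit_one, one_smul]; rfl
  · have key : ∀ x : B.Red, (B.diamond m).flip (TensorAlgebra.ι R x * t) B.one =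
        TensorAlgebra.ι R x * t := by
      intro x
      induction x using induction_homogeneous (𝒜 := B.sgr) with
      | h0 => simp
      | hadd x y hx hy => simp only [map_add, add_mul, LinearMap.add_apply, hx, hy]
      | h k x hx =>
        have h' : B.diamond m B.one t = t := h
        rw [diamond_ι_mul hx, conv_apply, hB.coalg.comul_one]
        simp only [TensorProduct.map_tmul, LinearMap.mul'_apply, LinearMap.comp_apply, mulR_apply,
          LinearMap.flip_apply]
        rw [hB.one_m, twist_of_mem _ _ B.one_mem, mul_zero, sg_zero, one_smul, h', letter_coe]
    exact key x

/-- Apply the counit to `S(h¹) h² = ε(h)`. This is needed because the first letter acts through its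
antipode in the cyclic operators. -/
theorem counit_S (h : B.carrier) : B.counit (S h) = B.counit h := by
  have e := congrArg B.counit (hB.antipode.left h)
  rw [map_smul, B.counit_one, smul_eq_mul, mul_one] at e
  rw [← e]
  conv_lhs => rw [← hB.coalg.counit_right h]
  induction B.comul h with
  | zero => simp
  | add x y hx hy => simp only [map_add, hx, hy]
  | tmul a b => simp [hB.counit_m, mul_comm]

theorem S_one : S B.one = B.one := by
  have e := hB.antipode.left B.one
  rwa [hB.coalg.comul_one, LinearMap.rTensor_tmul, hB.m_one, B.counit_one, one_smul] at e

theorem isSide_left : IsSide m S B.comul B.lmul where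
  mem := hB.coalg.comul_mem
  coassoc := hB.coalg.coassoc
  counit_left := hB.coalg.counit_left
  counit_right := hB.coalg.counit_right
  one := hB.coalg.comul_one
  mul := hB.comul_m
  antipode_left := hB.antipode.left
  antipode_right := hB.antipode.right
  act_mul := by
    intro k y hy h
    refine LinearMap.ext fun x => ?_
    have e := congrArg (fun φ : B.carrier →ₗ[R] B.Cobar => φ h) (hB.diamond_flip_mul hy x)
    refine e.trans ?_
    simp only [conv_apply]
    induction B.comul h with
    | zero => simp
    | add x y hx hy => simp only [map_add, hx, hy, LinearMap.add_apply]
    | tmul a b => rfl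

/-- This is where involutivity enters. Applying `S` to `S(h¹) h² = ε(h)` gives `± S(h²) S(S(h¹)) =
ε(h)`, and `S² = id` makes `S` an antipode for the opposite coproduct; without it the inverse of `S`
would be required. The last field is the module algebra identity for `x y` read as an operator in
`x`. -/
theorem isSide_right : IsSide m S (coop B.gr B.comul) B.rmul where
  mem := coop_mem hB.coalg.comul_mem
  coassoc := coop_coassoc hB.coalg.comul_mem hB.coalg.coassoc
  counit_left := coop_counit_left B.counit_gr hB.coalg.counit_right
  counit_right := coop_counit_right B.counit_gr hB.coalg.counit_left
  one := by
    rw [coop, LinearMap.comp_apply, hB.coalg.comul_one, koszulSwap_hom _ _ B.one_mem B.one_mem,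
      mul_zero, sg_zero, one_smul]
  mul := by
    intro a b
    simp only [coop, LinearMap.comp_apply, hB.comul_m]
    generalize B.comul a = z
    generalize B.comul b = w
    induction z using tensor_induction (𝒜 := B.gr) (ℬ := B.gr) with
    | h0 => simp
    | hadd x y hx hy => simp only [map_add, TensorProduct.add_tmul, hx, hy]
    | h p q a ha b hb =>
      induction w using tensor_induction (𝒜 := B.gr) (ℬ := B.gr) with
      | h0 => simp
      | hadd x y hx hy => simp only [map_add, TensorProduct.tmul_add, hx, hy]
      | h r s c hc e he =>
        rw [middleSwap_tmul _ _ _ hb hc, map_smul, map_smul, TensorProduct.map_tmul,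
          koszulSwap_hom _ _ (hB.m_mem p r a ha c hc) (hB.m_mem q s b hb e he),
          koszulSwap_hom _ _ ha hb, koszulSwap_hom _ _ hc he, TensorProduct.smul_tmul_smul,
          map_smul, middleSwap_tmul _ _ _ ha he, map_smul, map_smul, TensorProduct.map_tmul]
        simp only [smul_smul, ← sg_add]
        congr 1
        apply sg_congr
        grind
  antipode_left := by
    intro h
    have e := congrArg S (hB.antipode.left h)
    rw [map_smul, hB.S_one] at e
    rw [← e, coop, LinearMap.comp_apply]
    generalize B.comul h = z
    induction z using tensor_induction (𝒜 := B.gr) (ℬ := B.gr) with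
    | h0 => simp
    | hadd x y hx hy => simp only [map_add, hx, hy]
    | h p q a ha b hb =>
      rw [koszulSwap_hom _ _ ha hb, LinearMap.rTensor_tmul, hB.S_m p q _ (hB.antipode.mem p a ha) b hb,
        hB.S_S, map_smul, map_smul]
      rfl
  antipode_right := by
    intro h
    have e := congrArg S (hB.antipode.right h)
    rw [map_smul, hB.S_one] at e
    rw [← e, coop, LinearMap.comp_apply]
    generalize B.comul h = z
    induction z using tensor_induction (𝒜 := B.gr) (ℬ := B.gr) with
    | h0 => simp
    | hadd x y hx hy => simp only [map_add, hx, hy]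
    | h p q a ha b hb =>
      rw [koszulSwap_hom _ _ ha hb, LinearMap.lTensor_tmul, hB.S_m p q a ha _ (hB.antipode.mem q b hb),
        hB.S_S, map_smul, map_smul]
      rfl
  act_mul := by
    intro k y hy h
    refine hom_ext (𝒜 := B.cobarGr) fun j x hx => ?_
    rw [Module.End.mul_apply, rmul_apply_of_mem hx hy, map_smul, act_apply, ← LinearMap.flip_apply,
      hB.diamond_flip_mul hx, conv_apply, conv_apply, coop, LinearMap.comp_apply]
    generalize B.comul h = z
    induction z using tensor_induction (𝒜 := B.gr) (ℬ := B.gr) with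
    | h0 => simp
    | hadd x y hx hy => simp only [map_add, smul_add, LinearMap.add_apply, hx, hy]
    | h p q a ha b hb =>
      rw [koszulSwap_hom _ _ ha hb]
      simp only [map_smul, TensorProduct.map_tmul, LinearMap.mul'_apply, LinearMap.comp_apply,
        LinearMap.flip_apply, LinearMap.smul_apply, Module.End.mul_apply]
      rw [twist_of_mem _ _ ha, twist_of_mem _ _ hb]
      simp only [map_smul, LinearMap.smul_apply]
      rw [act_apply, rmul_apply_of_mem (hB.diamond_mem ha hx) (hB.diamond_mem hb hy)]
      simp only [mul_smul_comm, smul_smul, ← sg_add]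
      congr 1
      apply sg_congr
      grind

variable {δ : B.carrier →ₗ[R] B.carrier ⊗[R] B.carrier}
  {Λ : B.Cobar →ₗ[R] Module.End R B.Cobar}

/-- Together with `conv_act_rho`: on either side, `act ∘ S` is the two-sided convolution inverse of
`act`. This replaces every explicit manipulation with the antipode below. -/
theorem conv_rho_act (hS : IsSide m S δ Λ) :
    conv δ (act m ∘ₗ S) (act m) = B.counit.smulRight (1 : Module.End R B.Cobar) := by
  refine LinearMap.ext fun h => ?_
  have e := congrArg (act m) (hS.antipode_left h)
  rw [map_smul, hB.act_one] at e
  rw [LinearMap.smulRight_apply, ← e, conv_apply]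
  induction δ h with
  | zero => simp
  | add x y hx hy => simp only [map_add, hx, hy]
  | tmul a b => simp [hB.act_m]

theorem conv_act_rho (hS : IsSide m S δ Λ) :
    conv δ (act m) (act m ∘ₗ S) = B.counit.smulRight (1 : Module.End R B.Cobar) := by
  refine LinearMap.ext fun h => ?_
  have e := congrArg (act m) (hS.antipode_right h)
  rw [map_smul, hB.act_one] at e
  rw [LinearMap.smulRight_apply, ← e, conv_apply]
  induction δ h with
  | zero => simp
  | add x y hx hy => simp only [map_add, hx, hy]
  | tmul a b => simp [hB.act_m]

/-- The operators `∑ (-1)^|h¹| Λ(s⁻¹ h¹) (h² ⋄ ·)`. -/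
theorem conv_letter_act_m (hS : IsSide m S δ Λ) {k : ℤ} {h : B.carrier} (hh : h ∈ B.gr k)
    (g : B.carrier) :
    conv δ (Λ ∘ₗ B.letter ∘ₗ twist B.gr 1) (act m) (m (h ⊗ₜ[R] g)) =
      conv δ (Λ ∘ₗ B.letter ∘ₗ twist B.gr 1) (act m) h * act m g +
      sg R k • (act m h * conv δ (Λ ∘ₗ B.letter ∘ₗ twist B.gr 1) (act m) g) := by
  -- The claim is that these operators form a derivation over the action. With `c ⊗ e` in place of
  -- the coproduct of `g`, the letter of `h¹ c` splits by `letter_m` into `h¹ ⋄ s⁻¹c` and `ε(c)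
  -- s⁻¹h¹`. The first part gives the second summand through `act_mul`; the other gives the first
  -- summand.
  have key : ∀ w, LinearMap.mul' R _ (TensorProduct.map (Λ ∘ₗ B.letter ∘ₗ twist B.gr 1) (act m)
      (TensorProduct.map m m (middleSwap B.gr B.gr (δ h ⊗ₜ[R] w)))) =
      conv δ (Λ ∘ₗ B.letter ∘ₗ twist B.gr 1) (act m) h *
        act m (TensorProduct.lid R B.carrier (B.counit.rTensor B.carrier w)) +
      sg R k • (act m h * LinearMap.mul' R _
        (TensorProduct.map (Λ ∘ₗ B.letter ∘ₗ twist B.gr 1) (act m) w)) := ?_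
  · have h1 := key (δ g)
    rwa [hS.counit_left, ← hS.mul] at h1
  intro w
  induction w using tensor_induction (𝒜 := B.gr) (ℬ := B.gr) with
  | h0 => simp
  | hadd x y hx hy =>
    simp only [TensorProduct.tmul_add, map_add, hx, hy, mul_add, smul_add]
    abel
  | h r s c hc e he =>
    simp only [TensorProduct.map_tmul, LinearMap.mul'_apply, LinearMap.comp_apply,
      LinearMap.rTensor_tmul, TensorProduct.lid_tmul]
    rw [← mul_assoc, twist_of_mem _ _ hc]
    simp only [map_smul, mul_smul_comm, smul_mul_assoc]
    rw [hS.act_mul _ _ (letter_mem hc), conv_apply, conv_apply]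
    refine prodGr_eq (𝒜 := B.gr) (ℬ := B.gr) (f := LinearMap.mul' R _ ∘ₗ TensorProduct.map
      (Λ ∘ₗ B.letter ∘ₗ twist B.gr 1) (act m) ∘ₗ TensorProduct.map m m ∘ₗ middleSwap B.gr B.gr ∘ₗ
      (TensorProduct.mk R _ _).flip (c ⊗ₜ[R] e))
      (g := B.counit c • (LinearMap.mulRight R (act m e) ∘ₗ LinearMap.mul' R _ ∘ₗ
        TensorProduct.map (Λ ∘ₗ B.letter ∘ₗ twist B.gr 1) (act m)) + sg R k • sg R (1 * r) •
        (LinearMap.mulRight R (act m e) ∘ₗ (LinearMap.mul' R _ ∘ₗ TensorProduct.map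
        (Λ ∘ₗ (B.diamond m).flip (B.letter c)) (act m ∘ₗ twist B.gr (r - 1)))))
      (fun p q hpq a ha b hb => ?_) (hS.mem k h hh)
    simp only [LinearMap.comp_apply, LinearMap.flip_apply, TensorProduct.mk_apply,
      LinearMap.add_apply, LinearMap.smul_apply, TensorProduct.map_tmul, LinearMap.mul'_apply,
      LinearMap.mulRight_apply]
    rw [middleSwap_tmul _ _ _ hb hc]
    simp only [map_smul, TensorProduct.map_tmul, LinearMap.mul'_apply, LinearMap.comp_apply]
    rw [twist_of_mem _ _ (hB.m_mem p r a ha c hc), twist_of_mem _ _ ha, twist_of_mem _ _ hb]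
    simp only [map_smul, hB.letter_m, hB.act_m, map_add, add_mul, smul_mul_assoc, mul_smul_comm,
      smul_add, smul_smul, ← sg_add, mul_assoc]
    rw [add_comm]
    congr 1
    · by_cases hr : r = 0
      · subst hr
        rw [← mul_assoc (sg R _), mul_comm _ (B.counit c), ← sg_add]
        congr 2
        apply sg_congr
        grind
      · rw [B.counit_gr r hr c hc]; simp
    · congr 1
      apply sg_congr
      subst hpq
      grind

/-- Write `X` for the operators of `conv_letter_act_m`. Applying the derivation `X` to `S(h¹) h² =
ε(h)`, and using `X(1) = 0`, gives a relation between `X ∘ S` and `X`. Convolving it on the right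
with the inverse of `act` isolates `X ∘ S`. -/
theorem conv_letter_act_S (hS : IsSide m S δ Λ) :
    conv δ (Λ ∘ₗ B.letter ∘ₗ twist B.gr 1) (act m) ∘ₗ S =
      -(conv δ (act m ∘ₗ S) (Λ ∘ₗ B.letter) ∘ₗ twist B.gr 1) := by
  set X := conv δ (Λ ∘ₗ B.letter ∘ₗ twist B.gr 1) (act m) with hX
  have hSt : ∀ k x, S (twist B.gr k x) = twist B.gr k (S x) := fun k x =>
    map_twist_zero (𝒜 := B.gr) (ℬ := B.gr) hB.antipode.mem k x
  have h1 : conv δ (X ∘ₗ S) (act m) + conv δ (act m ∘ₗ S ∘ₗ twist B.gr 1) X = 0 := by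
    refine LinearMap.ext fun h => ?_
    have e := congrArg X (hS.antipode_left h)
    have hX1 : X B.one = 0 := by
      rw [hX, conv_apply, hS.one]
      simp [twist_of_mem _ _ B.one_mem, letter_one]
    rw [map_smul, hX1, smul_zero] at e
    rw [LinearMap.add_apply, LinearMap.zero_apply, ← e, conv_apply, conv_apply]
    generalize δ h = z
    induction z using tensor_induction (𝒜 := B.gr) (ℬ := B.gr) with
    | h0 => simp
    | hadd x y hx hy =>
      simp only [map_add]
      rw [← hx, ← hy]; abel
    | h p q a ha b hb =>
      simp only [TensorProduct.map_tmul, LinearMap.mul'_apply, LinearMap.comp_apply,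
        LinearMap.id_apply]
      rw [hX, hB.conv_letter_act_m hS (hB.antipode.mem p a ha), twist_of_mem _ _ ha, map_smul,
        map_smul, smul_mul_assoc, one_mul]
  have h2 := congrArg (fun f => conv δ f (act m ∘ₗ S)) h1
  simp only [conv_zero_left, conv_add_left] at h2
  rw [conv_assoc hS.coassoc, hB.conv_act_rho hS, conv_one_right hS.counit_right,
    conv_assoc hS.coassoc, hX, conv_assoc hS.coassoc, hB.conv_act_rho hS,
    conv_one_right hS.counit_right, ← hX] at h2
  rw [conv_comp_twist hS.mem]
  refine LinearMap.ext fun h => ?_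
  have h3 := congrArg (fun f : B.carrier →ₗ[R] Module.End R B.Cobar => f h) h2
  simp only [LinearMap.add_apply, LinearMap.zero_apply, LinearMap.comp_apply,
    LinearMap.mulRight_apply, mul_one] at h3
  refine (eq_neg_of_add_eq_zero_left h3).trans (congrArg Neg.neg ?_)
  congr 2

end IsInvolutiveDGHopf

variable {R : Type u} [CommRing R] {B : DGCoalgData.{u, v} R}
  {m : B.carrier ⊗[R] B.carrier →ₗ[R] B.carrier} {S : B.carrier →ₗ[R] B.carrier}

/-! ### The differential of the action -/

theorem toRed_twist (k : ℤ) (b : B.carrier) :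
    B.toRed (twist B.gr k b) = twist B.redGr k (B.toRed b) :=
  map_twist_zero (𝒜 := B.gr) (ℬ := B.redGr) (fun _ _ h => B.toRed_mem h) k b

theorem comul_red (hB : B.IsDGCoalgebra) (y : B.Red) :
    B.comul y = (y : B.carrier) ⊗ₜ[R] B.one + B.one ⊗ₜ[R] (y : B.carrier) +
      TensorProduct.map B.Red.subtype B.Red.subtype (B.redComul y) := by
  have e : ∀ z : B.carrier ⊗[R] B.carrier,
      TensorProduct.map B.Red.subtype B.Red.subtype (TensorProduct.map B.toRed B.toRed z) =
      z - (TensorProduct.rid R _ (B.counit.lTensor B.carrier z)) ⊗ₜ[R] B.one -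
        B.one ⊗ₜ[R] (TensorProduct.lid R _ (B.counit.rTensor B.carrier z)) +
        B.counit (TensorProduct.rid R _ (B.counit.lTensor B.carrier z)) •
          (B.one ⊗ₜ[R] B.one) := by
    intro z
    induction z with
    | zero => simp
    | add x y hx hy =>
      simp only [map_add, hx, hy, TensorProduct.add_tmul, TensorProduct.tmul_add, add_smul]
      abel
    | tmul a b =>
      simp only [TensorProduct.map_tmul, Submodule.subtype_apply, coe_toRed,
        TensorProduct.sub_tmul, TensorProduct.tmul_sub, LinearMap.lTensor_tmul,
        LinearMap.rTensor_tmul, TensorProduct.rid_tmul, TensorProduct.lid_tmul, map_smul,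
        ← TensorProduct.smul_tmul', TensorProduct.tmul_smul, smul_sub, smul_smul, smul_eq_mul]
      rw [mul_comm (B.counit b)]
      abel
  simp only [redComul, LinearMap.comp_apply]
  rw [e, Submodule.subtype_apply, hB.counit_left, hB.counit_right, LinearMap.mem_ker.1 y.2,
    zero_smul]
  abel

/-- Since `letter` kills the unit, the reduced coproduct may be replaced by the full one, and the
formula is valid on all of `B`. The quadratic part of the differential thereby becomes a
convolution. -/
theorem cobarD_letter (hB : B.IsDGCoalgebra) (b : B.carrier) : B.cobarD (B.letter b) =
    -B.letter (B.d b) + conv B.comul (B.letter ∘ₗ twist B.gr 1) B.letter b := by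
  have key : ∀ y : B.Red, B.cobarD (B.letter y) =
      -B.letter (B.d y) + conv B.comul (B.letter ∘ₗ twist B.gr 1) B.letter y := by
    intro y
    rw [letter_coe, cobarD_ι]
    congr 1
    rw [conv_apply, redComul, LinearMap.comp_apply, LinearMap.comp_apply, Submodule.subtype_apply]
    induction B.comul y with
    | zero => simp
    | add x y hx hy => simp only [map_add, hx, hy]
    | tmul a b =>
      simp only [TensorProduct.map_tmul, LinearMap.comp_apply, parity_eq_twist, letter, toRed_twist]
  have e : b = (B.toRed b : B.carrier) + B.counit b • B.one := by rw [coe_toRed]; abel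
  have h1 : B.cobarD (B.letter b) = B.cobarD (B.letter (B.toRed b : B.carrier)) := by
    rw [letter_coe]; rfl
  rw [h1, key]
  conv_rhs => rw [e]
  have h2 : conv B.comul (B.letter ∘ₗ twist B.gr 1) B.letter B.one = 0 := by
    rw [conv_apply, hB.comul_one]; simp [letter_one]
  rw [map_add, map_add, map_add, map_smul, map_smul, map_smul, hB.d_one, map_zero, h2]
  simp

theorem cobarD_flip_mul (x y : B.Cobar) {k : ℤ} (hx : x ∈ B.cobarGr k) :
    B.cobarD (x * y) = B.cobarD x * y + sg R k • (x * B.cobarD y) := by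
  rw [cobarD_mul, twist_of_mem _ _ hx, one_mul, smul_mul_assoc]

theorem twist_comp_twist_d (hB : B.IsDGCoalgebra) (k : ℤ) :
    B.d ∘ₗ twist B.gr k = sg R k • (twist B.gr k ∘ₗ B.d) := by
  refine hom_ext (𝒜 := B.gr) fun j x hx => ?_
  simp only [LinearMap.comp_apply, LinearMap.smul_apply]
  rw [twist_of_mem _ _ hx, twist_of_mem _ _ (hB.d_mem j x hx), map_smul, smul_smul, ← sg_add]
  congr 1
  apply sg_congr
  grind

namespace IsInvolutiveDGHopf

variable (hB : B.IsInvolutiveDGHopf m S)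
include hB

/-- The quadratic part of `d s⁻¹(h y)` is computed from the product of the coproducts of `h` and
`y`. The summand `y ⊗ 1` gives the right boundary term (`f1`), `1 ⊗ y` the left one (`f2`), and the
reduced coproduct of `y` gives the action on the quadratic part of `d s⁻¹y` (`f3`). -/
theorem cobarD_flip_ι {p : ℤ} {y : B.Red} (hy : y ∈ B.sgr p) :
    B.cobarD ∘ₗ (B.diamond m).flip (TensorAlgebra.ι R y) =
      -((B.diamond m).flip (TensorAlgebra.ι R y) ∘ₗ B.d) +
      (B.diamond m).flip (B.cobarD (TensorAlgebra.ι R y)) ∘ₗ twist B.gr 1 +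
      conv B.comul (B.letter ∘ₗ twist B.gr 1) ((B.diamond m).flip (TensorAlgebra.ι R y)) -
      sg R p • (conv B.comul ((B.diamond m).flip (TensorAlgebra.ι R y))
        (B.letter ∘ₗ twist B.gr p) ∘ₗ twist B.gr 1) := by
  have hyd : (y : B.carrier) ∈ B.gr (p + 1) := B.mem_sgr.1 hy
  have hL : (B.diamond m).flip (TensorAlgebra.ι R y) = B.letter ∘ₗ mulR m y :=
    LinearMap.ext fun h => hB.diamond_ι h y
  have hdy : B.counit (B.d y) = 0 := hB.coalg.counit_d _
  have hLd : (B.diamond m).flip (B.letter (B.d y)) = B.letter ∘ₗ mulR m (B.d y) :=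
    LinearMap.ext fun h => by
      have := hB.letter_m h (B.d y)
      rw [hdy, zero_smul, add_zero] at this
      exact this.symm
  refine hom_ext (𝒜 := B.gr) fun k h hh => ?_
  have hz := hB.coalg.comul_mem k h hh
  have e1 : B.cobarD (TensorAlgebra.ι R y) = -B.letter (B.d y) +
      LinearMap.mul' R B.Cobar (TensorProduct.map (B.letter ∘ₗ twist B.gr 1) B.letter
        (TensorProduct.map B.Red.subtype B.Red.subtype (B.redComul y))) := by
    rw [← letter_coe, cobarD_letter hB.coalg, conv_apply, comul_red hB.coalg]
    simp [letter_one, twist_of_mem _ _ B.one_mem]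
  rw [e1, hL, map_add, map_neg, hLd]
  simp only [LinearMap.comp_apply, LinearMap.add_apply, LinearMap.sub_apply, LinearMap.neg_apply,
    LinearMap.smul_apply, mulR_apply]
  rw [cobarD_letter hB.coalg, hB.d_m, map_add, twist_of_mem _ _ hh, conv_apply, hB.comul_m,
    comul_red hB.coalg, TensorProduct.tmul_add, TensorProduct.tmul_add, map_add, map_add, map_add,
    map_add, map_add, map_add, map_add, map_add]
  have f1 : LinearMap.mul' R B.Cobar (TensorProduct.map (B.letter ∘ₗ twist B.gr 1) B.letter
      (TensorProduct.map m m (middleSwap B.gr B.gr (B.comul h ⊗ₜ[R] ((y : B.carrier) ⊗ₜ[R] B.one))))) =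
      -(sg R p • conv B.comul (B.letter ∘ₗ mulR m y) (B.letter ∘ₗ twist B.gr p)
        (sg R (1 * k) • h)) := by
    rw [map_smul, conv_apply]
    refine prodGr_eq (𝒜 := B.gr) (ℬ := B.gr) (f := LinearMap.mul' R B.Cobar ∘ₗ TensorProduct.map
      (B.letter ∘ₗ twist B.gr 1) B.letter ∘ₗ TensorProduct.map m m ∘ₗ middleSwap B.gr B.gr ∘ₗ
      (TensorProduct.mk R _ _).flip ((y : B.carrier) ⊗ₜ[R] B.one))
      (g := -(sg R p • sg R (1 * k) • LinearMap.mul' R B.Cobar ∘ₗ TensorProduct.map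
        (B.letter ∘ₗ mulR m y) (B.letter ∘ₗ twist B.gr p))) (fun q r hqr a ha b hb => ?_) hz
    simp only [LinearMap.comp_apply, LinearMap.flip_apply, TensorProduct.mk_apply,
      LinearMap.neg_apply, LinearMap.smul_apply, TensorProduct.map_tmul, LinearMap.mul'_apply]
    rw [middleSwap_tmul _ _ _ hb hyd]
    simp only [map_smul, TensorProduct.map_tmul, LinearMap.mul'_apply, LinearMap.comp_apply,
      mulR_apply, hB.m_one]
    rw [twist_of_mem _ _ (hB.m_mem q (p + 1) a ha y hyd), twist_of_mem _ _ hb]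
    simp only [map_smul, smul_mul_assoc, mul_smul_comm, smul_smul, ← sg_add]
    rw [← neg_smul, ← neg_one_mul, ← sg_one, ← sg_add]
    congr 1
    apply sg_congr
    subst hqr
    grind
  have f2 : LinearMap.mul' R B.Cobar (TensorProduct.map (B.letter ∘ₗ twist B.gr 1) B.letter
      (TensorProduct.map m m (middleSwap B.gr B.gr (B.comul h ⊗ₜ[R] (B.one ⊗ₜ[R] (y : B.carrier)))))) =
      conv B.comul (B.letter ∘ₗ twist B.gr 1) (B.letter ∘ₗ mulR m y) h := by
    rw [conv_apply]
    generalize B.comul h = z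
    induction z using tensor_induction (𝒜 := B.gr) (ℬ := B.gr) with
    | h0 => simp
    | hadd x y hx hy => simp only [map_add, TensorProduct.add_tmul, hx, hy]
    | h q r a ha b hb =>
      rw [middleSwap_tmul _ _ _ hb B.one_mem, mul_zero, sg_zero, one_smul, TensorProduct.map_tmul,
        hB.m_one]
      rfl
  have f3 : ∀ r ∈ prodGr B.redGr B.redGr (p + 1), LinearMap.mul' R B.Cobar (TensorProduct.map (B.letter ∘ₗ twist B.gr 1) B.letter
      (TensorProduct.map m m (middleSwap B.gr B.gr (B.comul h ⊗ₜ[R]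
        (TensorProduct.map B.Red.subtype B.Red.subtype r))))) =
      (B.diamond m).flip (LinearMap.mul' R B.Cobar (TensorProduct.map (B.letter ∘ₗ twist B.gr 1)
        B.letter (TensorProduct.map B.Red.subtype B.Red.subtype r))) (sg R (1 * k) • h) := by
    intro r hr
    refine prodGr_induction (𝒜 := B.redGr) (ℬ := B.redGr)
      (P := fun r => LinearMap.mul' R B.Cobar (TensorProduct.map (B.letter ∘ₗ twist B.gr 1) B.letter
      (TensorProduct.map m m (middleSwap B.gr B.gr (B.comul h ⊗ₜ[R]
        (TensorProduct.map B.Red.subtype B.Red.subtype r))))) =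
      (B.diamond m).flip (LinearMap.mul' R B.Cobar (TensorProduct.map (B.letter ∘ₗ twist B.gr 1)
        B.letter (TensorProduct.map B.Red.subtype B.Red.subtype r))) (sg R (1 * k) • h))
      (by simp) (fun x y hx hy => ?_) (fun s t hst c hc e he => ?_) hr
    · rw [map_add, TensorProduct.tmul_add, map_add, map_add, map_add, map_add, hx, hy, map_add,
        map_add, map_add, LinearMap.add_apply]
    · have hc' : (c : B.carrier) ∈ B.gr s := hc
      simp only [TensorProduct.map_tmul, LinearMap.mul'_apply, LinearMap.comp_apply,
        Submodule.subtype_apply]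
      rw [twist_of_mem _ _ hc']
      simp only [map_smul, smul_mul_assoc, LinearMap.smul_apply]
      rw [hB.diamond_flip_mul (letter_mem hc'), conv_apply]
      refine prodGr_eq (𝒜 := B.gr) (ℬ := B.gr) (f := LinearMap.mul' R B.Cobar ∘ₗ TensorProduct.map
        (B.letter ∘ₗ twist B.gr 1) B.letter ∘ₗ TensorProduct.map m m ∘ₗ middleSwap B.gr B.gr ∘ₗ
        (TensorProduct.mk R _ _).flip ((c : B.carrier) ⊗ₜ[R] (e : B.carrier)))
        (g := sg R (1 * k) • sg R (1 * s) • LinearMap.mul' R B.Cobar ∘ₗ TensorProduct.map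
          ((B.diamond m).flip (B.letter c)) ((B.diamond m).flip (B.letter e) ∘ₗ twist B.gr (s - 1)))
          (fun q r hqr a ha b hb => ?_) hz
      simp only [LinearMap.comp_apply, LinearMap.flip_apply, TensorProduct.mk_apply,
        LinearMap.smul_apply, TensorProduct.map_tmul, LinearMap.mul'_apply]
      rw [middleSwap_tmul _ _ _ hb hc']
      simp only [map_smul, TensorProduct.map_tmul, LinearMap.mul'_apply, LinearMap.comp_apply]
      rw [twist_of_mem _ _ (hB.m_mem q s a ha c hc'), twist_of_mem _ _ hb, letter_coe e,
        letter_coe c]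
      simp only [map_smul, LinearMap.smul_apply, hB.diamond_ι, smul_mul_assoc, mul_smul_comm,
        smul_smul, ← sg_add]
      congr 1
      apply sg_congr
      subst hqr
      grind
  have hr : B.redComul y ∈ prodGr B.redGr B.redGr (p + 1) :=
    prodGr_map (c := 0) (d := 0) (by simp)
      (fun k _ h => (add_zero k).symm ▸ B.toRed_mem h)
      (fun k _ h => (add_zero k).symm ▸ B.toRed_mem h) (hB.coalg.comul_mem _ _ hyd)
  rw [f1, f2, f3 _ hr]
  simp only [map_smul]
  abel

end IsInvolutiveDGHopf

variable {R : Type u} [CommRing R] {B : DGCoalgData.{u, v} R}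
  {m : B.carrier ⊗[R] B.carrier →ₗ[R] B.carrier} {S : B.carrier →ₗ[R] B.carrier}

theorem d_conv (f g : B.carrier →ₗ[R] B.Cobar) : B.cobarD ∘ₗ conv B.comul f g =
    conv B.comul (B.cobarD ∘ₗ f) g + conv B.comul (twist B.cobarGr 1 ∘ₗ f) (B.cobarD ∘ₗ g) :=
  der_comp_conv (σ := twist B.cobarGr 1) (fun x y => B.cobarD_mul x y) f g

theorem conv_comp_d (hB : B.IsDGCoalgebra) {A : Type*} [Ring A] [Algebra R A]
    (f g : B.carrier →ₗ[R] A) : conv B.comul f g ∘ₗ B.d =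
    conv B.comul (f ∘ₗ B.d) g + conv B.comul (f ∘ₗ twist B.gr 1) (g ∘ₗ B.d) := by
  refine conv_comp_coder ?_ f g
  rw [← parity_eq_twist]
  exact hB.coderivation

namespace IsInvolutiveDGHopf

variable (hB : B.IsInvolutiveDGHopf m S)
include hB

theorem twist_comp_diamond_flip (j : ℤ) {p : ℤ} {x : B.Cobar} (hx : x ∈ B.cobarGr p) :
    twist B.cobarGr j ∘ₗ (B.diamond m).flip x =
      sg R (j * p) • ((B.diamond m).flip x ∘ₗ twist B.gr j) := by
  refine LinearMap.ext fun h => ?_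
  have e := map_twist (𝒜 := B.gr) (ℬ := B.cobarGr) (f := (B.diamond m).flip x) (c := p)
    (fun k h hh => hB.diamond_mem hh hx) j h
  rw [LinearMap.smul_apply, LinearMap.comp_apply, LinearMap.comp_apply, e, sg_smul_sg_smul]

/-- Measures how far the action is from a chain map. By induction on words: in `d((h¹ ⋄ a)(h² ⋄ y))`
the right boundary term of the first factor and the left boundary term of the second are both `(h¹ ⋄
a) · s⁻¹h² · (h³ ⋄ y)`, with opposite signs, so only the outer ones survive. -/
theorem cobarD_comp_diamond_flip {p : ℤ} {x : B.Cobar} (hx : x ∈ B.cobarGr p) :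
    B.cobarD ∘ₗ (B.diamond m).flip x =
      -((B.diamond m).flip x ∘ₗ B.d) + (B.diamond m).flip (B.cobarD x) ∘ₗ twist B.gr 1 +
      conv B.comul (B.letter ∘ₗ twist B.gr 1) ((B.diamond m).flip x) -
      sg R p • (conv B.comul ((B.diamond m).flip x) (B.letter ∘ₗ twist B.gr p) ∘ₗ
        twist B.gr 1) := by
  refine tensorGr_induction (𝒜 := B.sgr) (p := fun p x => B.cobarD ∘ₗ (B.diamond m).flip x =
      -((B.diamond m).flip x ∘ₗ B.d) + (B.diamond m).flip (B.cobarD x) ∘ₗ twist B.gr 1 +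
      conv B.comul (B.letter ∘ₗ twist B.gr 1) ((B.diamond m).flip x) -
      sg R p • (conv B.comul ((B.diamond m).flip x) (B.letter ∘ₗ twist B.gr p) ∘ₗ
        twist B.gr 1)) ?_ ?_ ?_ ?_ ?_ hx
  · rw [diamond_flip_one, conv_one_left hB.coalg.counit_left,
      conv_one_right hB.coalg.counit_right, cobarD_one, twist_zero]
    ext1 h
    simp [cobarD_one, hB.coalg.counit_d]
  · intro k; simp
  · intro k x _ y _ hx hy
    simp only [map_add, LinearMap.comp_add, LinearMap.add_comp, conv_add_left, conv_add_right,
      smul_add, hx, hy]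
    abel
  · intro k r x _ hx
    simp only [map_smul, LinearMap.comp_smul, LinearMap.smul_comp, conv_smul_left, conv_smul_right,
      hx, smul_add, smul_sub, smul_neg]
    rw [smul_comm r]
  · intro p q a ha y hy ih
    have ha' := ι_mem_tensorGr B.sgr ha
    have hda : B.cobarD (TensorAlgebra.ι R a) ∈ B.cobarGr (p - 1) := cobarD_mem hB.coalg ha'
    rw [hB.diamond_flip_mul ha', d_conv, hB.cobarD_flip_ι ha, cobarD_flip_mul _ _ ha', map_add,
      map_smul, hB.diamond_flip_mul hda, hB.diamond_flip_mul ha', conv_comp_d hB.coalg,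
      hB.twist_comp_diamond_flip 1 ha', ← LinearMap.comp_assoc, ih]
    simp only [LinearMap.add_comp, LinearMap.sub_comp, LinearMap.neg_comp, LinearMap.smul_comp,
      conv_comp_twist hB.coalg.comul_mem, conv_add_left, conv_add_right, conv_sub_left,
      conv_sub_right, conv_neg_left, conv_neg_right, conv_smul_left, conv_smul_right,
      LinearMap.comp_assoc, twist_comp, twist_comp_twist_d hB.coalg, LinearMap.comp_smul,
      conv_assoc hB.coalg.coassoc, smul_smul, ← sg_add]
    rw [show p - 1 + 1 = p by ring, one_mul, show q + 1 + p = p + q + 1 by ring,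
      add_comm 1 p, add_comm q p, sg_even (e := p + p) (by simp), one_smul]
    abel

theorem cobarD_mul_act {k : ℤ} {h : B.carrier} (hh : h ∈ B.gr k) :
    (B.cobarD : Module.End R B.Cobar) * act m h = -act m (B.d h) + sg R k • (act m h * B.cobarD) +
      conv B.comul (B.lmul ∘ₗ B.letter ∘ₗ twist B.gr 1) (act m) h -
      conv (coop B.gr B.comul) (B.rmul ∘ₗ B.letter ∘ₗ twist B.gr 1) (act m) h := by
  refine hom_ext (𝒜 := B.cobarGr) fun p x hx => ?_
  have e := LinearMap.congr_fun (hB.cobarD_comp_diamond_flip hx) h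
  have e1 : conv B.comul (B.lmul ∘ₗ B.letter ∘ₗ twist B.gr 1) (act m) h x =
      conv B.comul (B.letter ∘ₗ twist B.gr 1) ((B.diamond m).flip x) h := by
    simp only [conv_apply]
    induction B.comul h with
    | zero => simp
    | add x y hx hy => simp only [map_add, LinearMap.add_apply, hx, hy]
    | tmul a b => rfl
  have e2 : conv (coop B.gr B.comul) (B.rmul ∘ₗ B.letter ∘ₗ twist B.gr 1) (act m) h x =
      sg R p • (conv B.comul ((B.diamond m).flip x) (B.letter ∘ₗ twist B.gr p) ∘ₗ
        twist B.gr 1) h := by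
    rw [LinearMap.comp_apply, twist_of_mem _ _ hh, map_smul]
    simp only [conv_apply, coop, LinearMap.comp_apply]
    refine prodGr_eq (𝒜 := B.gr) (ℬ := B.gr) (f := LinearMap.applyₗ x ∘ₗ LinearMap.mul' R _ ∘ₗ
      TensorProduct.map (B.rmul ∘ₗ B.letter ∘ₗ twist B.gr 1) (act m) ∘ₗ koszulSwap B.gr B.gr)
      (g := sg R p • sg R (1 * k) • LinearMap.mul' R _ ∘ₗ
        TensorProduct.map ((B.diamond m).flip x) (B.letter ∘ₗ twist B.gr p))
      (fun r s hrs a ha b hb => ?_) (hB.coalg.comul_mem k h hh)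
    simp only [LinearMap.comp_apply, LinearMap.smul_apply, TensorProduct.map_tmul,
      LinearMap.mul'_apply]
    rw [koszulSwap_hom _ _ ha hb, map_smul, TensorProduct.map_tmul]
    simp only [map_smul, LinearMap.applyₗ_apply_apply, LinearMap.mul'_apply, LinearMap.comp_apply,
      Module.End.mul_apply, LinearMap.flip_apply]
    rw [twist_of_mem _ _ hb, twist_of_mem _ _ hb, map_smul, map_smul, map_smul,
      LinearMap.smul_apply, act_apply, rmul_apply_of_mem (hB.diamond_mem ha hx) (letter_mem hb),
      mul_smul_comm]
    simp only [smul_smul, ← sg_add]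
    congr 1
    apply sg_congr
    subst hrs
    simp only [Int.even_add, Int.even_mul, Int.even_sub, Int.not_even_one]
    grind
  simp only [LinearMap.comp_apply, LinearMap.add_apply, LinearMap.sub_apply, LinearMap.neg_apply,
    LinearMap.smul_apply, LinearMap.flip_apply] at e
  simp only [LinearMap.add_apply, LinearMap.sub_apply, LinearMap.neg_apply,
    LinearMap.smul_apply, Module.End.mul_apply, act_apply]
  rw [e, e1, e2, LinearMap.comp_apply, twist_of_mem _ _ hh, map_smul (B.diamond m),
    LinearMap.smul_apply, one_mul]

/-- With `S h` for `h`, the boundary terms are rewritten by `conv_letter_act_S` on both sides; the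
multiplications now stand to the right of the action, as they do in the operators `cyc`. -/
theorem cobarD_mul_act_S {k : ℤ} {h : B.carrier} (hh : h ∈ B.gr k) :
    (B.cobarD : Module.End R B.Cobar) * act m (S h) =
      -act m (S (B.d h)) + sg R k • (act m (S h) * B.cobarD) -
      sg R k • (conv B.comul (act m ∘ₗ S) (B.lmul ∘ₗ B.letter) h -
      conv (coop B.gr B.comul) (act m ∘ₗ S) (B.rmul ∘ₗ B.letter) h) := by
  have e1 := LinearMap.congr_fun (hB.conv_letter_act_S hB.isSide_left) h
  have e2 := LinearMap.congr_fun (hB.conv_letter_act_S hB.isSide_right) h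
  rw [LinearMap.comp_apply, LinearMap.neg_apply, LinearMap.comp_apply, twist_of_mem _ _ hh,
    map_smul, one_mul] at e1 e2
  rw [hB.cobarD_mul_act (hB.antipode.mem k h hh), hB.antipode.d_S, e1, e2, smul_sub]
  abel

variable {δ : B.carrier →ₗ[R] B.carrier ⊗[R] B.carrier}
  {Λ : B.Cobar →ₗ[R] Module.End R B.Cobar}

/-- The identity `h · Λ(y) = ∑ ± Λ(h¹ ⋄ y) h²` is convolved on both sides with the inverse of `act`:
this removes `h` on the left and `h²` on the right. -/
theorem conv_act_S_mul (hS : IsSide m S δ Λ) {k : ℤ} {y : B.Cobar} (hy : y ∈ B.cobarGr k) :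
    conv δ (act m ∘ₗ S) (Λ ∘ₗ (B.diamond m).flip y) =
      LinearMap.mulLeft R (Λ y) ∘ₗ act m ∘ₗ S ∘ₗ twist B.gr k := by
  have h1 : LinearMap.mulRight R (Λ y) ∘ₗ act m =
      conv δ (Λ ∘ₗ (B.diamond m).flip y) (act m ∘ₗ twist B.gr k) :=
    LinearMap.ext fun h => hS.act_mul k y hy h
  have h2 := congrArg (fun f => conv δ (conv δ (act m ∘ₗ S) f) (act m ∘ₗ S ∘ₗ twist B.gr k)) h1
  have h3 : conv δ (act m ∘ₗ twist B.gr k) (act m ∘ₗ S ∘ₗ twist B.gr k) =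
      B.counit.smulRight (1 : Module.End R B.Cobar) := by
    have := conv_comp_twist hS.mem k (act m) (act m ∘ₗ S)
    rw [hB.conv_act_rho hS] at this
    rw [← LinearMap.comp_assoc, ← this]
    ext1 h
    simp [scalar_twist B.gr B.counit_gr]
  simp only [conv_mulRight, hB.conv_rho_act hS, conv_assoc hS.coassoc, h3,
    conv_one_right hS.counit_right] at h2
  have h4 : LinearMap.mulRight R (Λ y) ∘ₗ B.counit.smulRight (1 : Module.End R B.Cobar) =
      B.counit.smulRight (Λ y) := by ext1 h; simp
  rw [h4, conv_one_left hS.counit_left] at h2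
  rw [h2]
  ext1 h
  simp

end IsInvolutiveDGHopf

variable {R : Type u} [CommRing R] {B : DGCoalgData.{u, v} R}
  {m : B.carrier ⊗[R] B.carrier →ₗ[R] B.carrier} {S : B.carrier →ₗ[R] B.carrier}

/-! ### Multiplication operators -/

theorem lmul_one : B.lmul 1 = 1 := LinearMap.ext fun x => one_mul x

theorem lmul_mul (x y : B.Cobar) : B.lmul (x * y) = B.lmul x * B.lmul y :=
  LinearMap.ext fun z => mul_assoc x y z

theorem rmul_one : B.rmul 1 = 1 :=
  hom_ext (𝒜 := B.cobarGr) fun k x hx => by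
    rw [rmul_apply_of_mem hx one_mem_tensorGr, mul_zero, sg_zero, one_smul, mul_one]; rfl

theorem rmul_mul {p q : ℤ} {x y : B.Cobar} (hx : x ∈ B.cobarGr p) (hy : y ∈ B.cobarGr q) :
    B.rmul (x * y) = sg R (p * q) • (B.rmul y * B.rmul x) := by
  refine hom_ext (𝒜 := B.cobarGr) fun k z hz => ?_
  rw [LinearMap.smul_apply, Module.End.mul_apply, rmul_apply_of_mem hz hx, map_smul,
    rmul_apply_of_mem (mul_mem_tensorGr rfl hz hx) hy,
    rmul_apply_of_mem hz (mul_mem_tensorGr rfl hx hy), mul_assoc]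
  simp only [smul_smul, ← sg_add]
  congr 1
  apply sg_congr
  grind

theorem lmul_rmul {p q : ℤ} {x y : B.Cobar} (hx : x ∈ B.cobarGr p) (hy : y ∈ B.cobarGr q) :
    B.lmul x * B.rmul y = sg R (p * q) • (B.rmul y * B.lmul x) := by
  refine hom_ext (𝒜 := B.cobarGr) fun k z hz => ?_
  rw [LinearMap.smul_apply, Module.End.mul_apply, Module.End.mul_apply, lmul_apply, lmul_apply,
    rmul_apply_of_mem hz hy, rmul_apply_of_mem (mul_mem_tensorGr rfl hx hz) hy, mul_smul_comm,
    mul_assoc]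
  simp only [smul_smul, ← sg_add]
  congr 1
  apply sg_congr
  grind

theorem cobarD_lmul {p : ℤ} {x : B.Cobar} (hx : x ∈ B.cobarGr p) :
    (B.cobarD : Module.End R B.Cobar) * B.lmul x =
      B.lmul (B.cobarD x) + sg R p • (B.lmul x * B.cobarD) :=
  LinearMap.ext fun z => cobarD_flip_mul x z hx

theorem cobarD_rmul (hB : B.IsDGCoalgebra) {p : ℤ} {x : B.Cobar} (hx : x ∈ B.cobarGr p) :
    (B.cobarD : Module.End R B.Cobar) * B.rmul x =
      B.rmul (B.cobarD x) + sg R p • (B.rmul x * B.cobarD) := by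
  refine hom_ext (𝒜 := B.cobarGr) fun k z hz => ?_
  rw [LinearMap.add_apply, LinearMap.smul_apply, Module.End.mul_apply, Module.End.mul_apply,
    rmul_apply_of_mem hz hx, rmul_apply_of_mem hz (cobarD_mem hB hx),
    rmul_apply_of_mem (cobarD_mem hB hz) hx, map_smul, cobarD_flip_mul _ _ hz, smul_add, add_comm]
  simp only [smul_smul, ← sg_add]
  congr 2 <;>
  · apply sg_congr
    grind

/-! ### Cyclic operators -/

variable (m S) in
/-- The operators `x ↦ (-1)^|b| S(b) ⋄ x`. -/
def signedAct : B.carrier →ₗ[R] Module.End R B.Cobar := act m ∘ₗ S ∘ₗ twist B.gr 1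

theorem signedAct_of_mem {k : ℤ} {b : B.carrier} (hb : b ∈ B.gr k) :
    signedAct m S b = sg R k • act m (S b) := by
  simp only [signedAct, LinearMap.comp_apply, twist_of_mem _ _ hb, map_smul, one_mul]

variable (m S) in
/-- The sum over the cyclic permutations of a word `x z` which start with a letter of `x`,
where the first letter is absorbed by the action of its antipode, and the rest of `x` by `Φ`. The
words `z` have to be thought of as preceded by something of degree `k`. -/
def cyclicSum (Φ : B.Cobar →ₗ[R] Module.End R B.Cobar) (k : ℤ) :
    B.Cobar →ₗ[R] Module.End R B.Cobar :=
  conv (coop B.cobarGr (deconc R B.Red))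
    (conv (deconc R B.Red) (signedAct m S ∘ₗ B.Red.subtype ∘ₗ TensorAlgebra.ιInv) Φ)
    (B.rmul ∘ₗ twist B.cobarGr k)

variable (Φ : B.Cobar →ₗ[R] Module.End R B.Cobar) (k : ℤ)

theorem conv_coop_of_comul {N A : Type*} [AddCommGroup N] [Module R N] {𝒩 : ℤ → Submodule R N}
    [DirectSum.Decomposition 𝒩] [Ring A] [Algebra R A] {δ : N →ₗ[R] N ⊗[R] N} {e : N}
    (he : e ∈ 𝒩 0) (h : δ e = e ⊗ₜ[R] e) (f g : N →ₗ[R] A) :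
    conv (coop 𝒩 δ) f g e = f e * g e := by
  rw [conv_apply, coop, LinearMap.comp_apply, h, koszulSwap_hom _ _ he he, mul_zero, sg_zero,
    one_smul, TensorProduct.map_tmul, LinearMap.mul'_apply]

theorem cyclicSum_one : cyclicSum m S Φ k 1 = 0 := by
  have h : (1 : B.Cobar) ∈ B.cobarGr 0 := one_mem_tensorGr
  have h' : deconc R B.Red 1 = _ := deconc_one
  have h1 : (TensorAlgebra.ιInv (1 : B.Cobar) : B.Red) = 0 := ιInv_one
  generalize (1 : B.Cobar) = e at *
  rw [cyclicSum, conv_coop_of_comul h h', conv_apply, h', TensorProduct.map_tmul,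
    LinearMap.mul'_apply, LinearMap.comp_apply, LinearMap.comp_apply, h1, map_zero, map_zero,
    zero_mul, zero_mul]

theorem conv_deconc_ι_mul (P : B.Red →ₗ[R] Module.End R B.Cobar) (a : B.Red) (y : B.Cobar) :
    conv (deconc R B.Red) (P ∘ₗ TensorAlgebra.ιInv) Φ (TensorAlgebra.ι R a * y) = P a * Φ y := by
  rw [conv_apply, deconc_ι_mul, map_add, map_add, TensorProduct.map_tmul, LinearMap.mul'_apply,
    LinearMap.comp_apply, ιInv_one, map_zero, zero_mul, zero_add]
  conv_rhs => rw [← deconc_counit_left y]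
  induction deconc R B.Red y with
  | zero => simp
  | add x y hx hy => simp only [map_add, mul_add, hx, hy]
  | tmul s t => simp [ιInv_ι_mul]

/-- A rotation of `a y z` either starts with `a`, and then `y` is absorbed by `Φ`, or starts with a
letter of `y`, and then `a` has moved behind `z`, which is a right multiplication. -/
theorem cyclicSum_ι_mul {p : ℤ} {a : B.Red} (ha : a ∈ B.sgr p) (y : B.Cobar) :
    cyclicSum m S Φ k (TensorAlgebra.ι R a * y) = signedAct m S a * Φ y +
      sg R (p * k) • (cyclicSum m S Φ k (twist B.cobarGr p y) *
        B.rmul (TensorAlgebra.ι R a)) := by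
  have ha' := ι_mem_tensorGr B.sgr ha
  induction y using induction_homogeneous (𝒜 := B.cobarGr) with
  | h0 => simp
  | hadd x y hx hy =>
    simp only [mul_add, map_add, add_mul, smul_add, hx, hy]; abel
  | h q y hy =>
    rw [cyclicSum, conv_apply, coop, LinearMap.comp_apply, deconc_ι_mul, map_add, map_add, map_add,
      koszulSwap_hom _ _ one_mem_tensorGr (mul_mem_tensorGr rfl ha' hy), map_smul, map_smul,
      TensorProduct.map_tmul, LinearMap.mul'_apply, LinearMap.comp_apply B.rmul,
      twist_of_mem _ _ one_mem_tensorGr, zero_mul, mul_zero, sg_zero, one_smul, one_smul,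
      rmul_one, mul_one, ← LinearMap.comp_assoc, conv_deconc_ι_mul, LinearMap.comp_apply]
    congr 1
    rw [twist_of_mem _ _ hy, map_smul, smul_mul_assoc, conv_apply, LinearMap.comp_apply]
    refine prodGr_eq (𝒜 := B.cobarGr) (ℬ := B.cobarGr) (f := LinearMap.mul' R _ ∘ₗ
      TensorProduct.map (conv (deconc R B.Red) ((signedAct m S ∘ₗ B.Red.subtype) ∘ₗ
        TensorAlgebra.ιInv) Φ)
        (B.rmul ∘ₗ twist B.cobarGr k) ∘ₗ koszulSwap B.cobarGr B.cobarGr ∘ₗ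
        (LinearMap.mulLeft R (TensorAlgebra.ι R a)).rTensor _)
      (g := sg R (p * k) • sg R (p * q) • (LinearMap.mulRight R (B.rmul (TensorAlgebra.ι R a)) ∘ₗ
      LinearMap.mul' R _ ∘ₗ
      TensorProduct.map (conv (deconc R B.Red) ((signedAct m S ∘ₗ B.Red.subtype) ∘ₗ
        TensorAlgebra.ιInv) Φ)
        (B.rmul ∘ₗ twist B.cobarGr k) ∘ₗ koszulSwap B.cobarGr B.cobarGr))
      (fun r s hrs b hb c hc => ?_) (deconc_mem hy)
    simp only [LinearMap.comp_apply, LinearMap.smul_apply, LinearMap.rTensor_tmul,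
      LinearMap.mulLeft_apply, LinearMap.mulRight_apply]
    have hab := mul_mem_tensorGr rfl ha' hb
    rw [koszulSwap_hom _ _ hb hc, koszulSwap_hom _ _ hab hc]
    simp only [map_smul, TensorProduct.map_tmul, LinearMap.mul'_apply, LinearMap.comp_apply]
    rw [twist_of_mem _ _ hab, twist_of_mem _ _ hb, map_smul, map_smul, rmul_mul ha' hb]
    simp only [mul_smul_comm, smul_mul_assoc, smul_smul, ← sg_add, mul_assoc]
    congr 1
    apply sg_congr
    subst hrs
    grind

/-- The starting letter lies in `x` or in `y`. In the first case all of `y` follows it and is passed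
to `Φ`, so the letters of `x` rotated to the end cross it as well; this accounts for the shift of
`k` by `q`. -/
theorem cyclicSum_mul {p q : ℤ} {x y : B.Cobar} (hx : x ∈ B.cobarGr p) (hy : y ∈ B.cobarGr q) :
    cyclicSum m S Φ k (x * y) = cyclicSum m S (Φ ∘ₗ LinearMap.mulRight R y) (k + q) x +
      sg R (p * (q + k)) • (cyclicSum m S Φ k y * B.rmul x) := by
  refine tensorGr_induction (𝒜 := B.sgr) (p := fun p x => cyclicSum m S Φ k (x * y) =
    cyclicSum m S (Φ ∘ₗ LinearMap.mulRight R y) (k + q) x +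
      sg R (p * (q + k)) • (cyclicSum m S Φ k y * B.rmul x)) ?_ ?_ ?_ ?_ ?_ hx
  · simp [cyclicSum_one, rmul_one]
  · simp
  · intro p x _ x' _ hx hx'
    simp only [add_mul, map_add, mul_add, smul_add, hx, hx']; abel
  · intro p r x _ hx
    simp only [smul_mul_assoc, map_smul, mul_smul_comm, hx, smul_add]
    rw [smul_comm r]
  · intro i j a ha x hx ih
    rw [mul_assoc, cyclicSum_ι_mul _ _ ha, cyclicSum_ι_mul _ _ ha, twist_mul,
      twist_of_mem _ _ hx, twist_of_mem _ _ hy, smul_mul_smul_comm, map_smul, ih,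
      rmul_mul (ι_mem_tensorGr B.sgr ha) hx]
    simp only [LinearMap.comp_apply, LinearMap.mulRight_apply, map_smul, smul_mul_assoc,
      mul_smul_comm, smul_add, add_mul, smul_smul, ← sg_add, mul_assoc, add_assoc]
    congr 1
    congr 2 <;>
    · apply sg_congr
      grind

variable (m S) in
/-- The sum over the cyclic permutations of a word `x z` which start with a letter of `x`. -/
def cyc : B.Cobar →ₗ[R] Module.End R B.Cobar := cyclicSum m S B.lmul 0

theorem cyc_one : cyc m S (1 : B.Cobar) = 0 := cyclicSum_one _ _

theorem cyc_ι_mul {p : ℤ} {a : B.Red} (ha : a ∈ B.sgr p) (y : B.Cobar) :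
    cyc m S (TensorAlgebra.ι R a * y) = signedAct m S a * B.lmul y +
      cyc m S (twist B.cobarGr p y) * B.rmul (TensorAlgebra.ι R a) := by
  rw [cyc, cyclicSum_ι_mul _ _ ha, mul_zero, sg_zero, one_smul]

/-- The left multiplication by `y` is moved past the right multiplications by the rotated letters.
The signs so produced are the ones recorded by the shift of `k`. -/
theorem cyclicSum_comp_mulRight {p q : ℤ} {x y : B.Cobar} (hx : x ∈ B.cobarGr p)
    (hy : y ∈ B.cobarGr q) :
    cyclicSum m S (LinearMap.mulRight R (B.lmul y) ∘ₗ Φ) (k + q) x =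
      cyclicSum m S Φ k x * B.lmul y := by
  refine tensorGr_induction (𝒜 := B.sgr) (p := fun p x =>
    cyclicSum m S (LinearMap.mulRight R (B.lmul y) ∘ₗ Φ) (k + q) x =
      cyclicSum m S Φ k x * B.lmul y) ?_ ?_ ?_ ?_ ?_ hx
  · rw [cyclicSum_one, cyclicSum_one, zero_mul]
  · simp
  · intro p x _ x' _ hx hx'
    simp only [map_add, add_mul, hx, hx']
  · intro p r x _ hx
    simp only [map_smul, smul_mul_assoc, hx]
  · intro i j a ha x hx ih
    rw [cyclicSum_ι_mul _ _ ha, cyclicSum_ι_mul _ _ ha, twist_of_mem _ _ hx, map_smul, map_smul, ih,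
      LinearMap.comp_apply, LinearMap.mulRight_apply, add_mul, smul_mul_assoc, smul_mul_assoc,
      smul_mul_assoc, smul_mul_assoc, mul_assoc, mul_assoc, mul_assoc,
      lmul_rmul hy (ι_mem_tensorGr B.sgr ha), mul_smul_comm]
    simp only [smul_smul, ← sg_add]
    congr 2
    apply sg_congr
    grind

/-- The rotations of `x y z` are divided according to the word containing the starting letter. This
Leibniz-type rule extends identities for `cyc` from letters to words. -/
theorem cyc_mul {p q : ℤ} {x y : B.Cobar} (hx : x ∈ B.cobarGr p) (hy : y ∈ B.cobarGr q) :
    cyc m S (x * y) = cyc m S x * B.lmul y + sg R (p * q) • (cyc m S y * B.rmul x) := by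
  have e : B.lmul ∘ₗ LinearMap.mulRight R y = LinearMap.mulRight R (B.lmul y) ∘ₗ B.lmul :=
    LinearMap.ext fun z => lmul_mul z y
  rw [cyc, cyclicSum_mul _ _ hx hy, e, cyclicSum_comp_mulRight _ _ hx hy, add_zero]

namespace IsInvolutiveDGHopf

variable (hB : B.IsInvolutiveDGHopf m S)
include hB

theorem signedAct_one : signedAct m S B.one = 1 := by
  rw [signedAct_of_mem B.one_mem, hB.S_one, hB.act_one, sg_zero, one_smul]

/-- The correction by `ε(b)` is there because `letter` kills the unit while `signedAct` sends it to
the identity. Such corrections produce the multiplications in `cobarD_cyc_ι`. -/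
theorem cyc_letter (b : B.carrier) : cyc m S (B.letter b) = signedAct m S b - B.counit b • 1 := by
  have key : ∀ y : B.Red, cyc m S (TensorAlgebra.ι R y) = signedAct m S y := by
    intro y
    induction y using induction_homogeneous (𝒜 := B.sgr) with
    | h0 => simp
    | hadd x y hx hy => simp only [map_add, hx, hy, Submodule.coe_add]
    | h p a ha =>
      have := cyc_ι_mul (m := m) (S := S) ha 1
      rwa [mul_one, twist_one, cyc_one, zero_mul, add_zero, lmul_one, mul_one] at this
  rw [letter, LinearMap.comp_apply, key, coe_toRed, map_sub, map_smul, hB.signedAct_one]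

/-- On a letter `cyc` is the action of `± S(a)`, whose boundary terms are known from
`cobarD_mul_act_S`. They are cancelled by `cyc` of the quadratic part of `d s⁻¹a`, up to counit
corrections. -/
theorem cobarD_cyc_ι {p : ℤ} {a : B.Red} (ha : a ∈ B.sgr p) :
    (B.cobarD : Module.End R B.Cobar) * cyc m S (TensorAlgebra.ι R a) +
      cyc m S (B.cobarD (TensorAlgebra.ι R a)) +
      sg R p • (cyc m S (TensorAlgebra.ι R a) * B.cobarD) =
      B.rmul (TensorAlgebra.ι R a) - B.lmul (TensorAlgebra.ι R a) := by
  have ha' : (a : B.carrier) ∈ B.gr (p + 1) := B.mem_sgr.1 ha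
  have e0 : B.counit a = 0 := a.2
  have e1 : cyc m S (TensorAlgebra.ι R a) = sg R (p + 1) • act m (S a) := by
    rw [← letter_coe, hB.cyc_letter, e0, zero_smul, sub_zero, signedAct_of_mem ha']
  have e2 : cyc m S (B.letter (B.d a)) = sg R p • act m (S (B.d a)) := by
    rw [hB.cyc_letter, hB.coalg.counit_d, zero_smul, sub_zero,
      signedAct_of_mem (hB.coalg.d_mem _ _ ha'), add_sub_cancel_right]
  -- By `cyc_mul` each `s⁻¹a¹ · s⁻¹a²` gives a term with a left multiplication and one with a right
  -- multiplication. The corrections in `cyc_letter` are kept inside the counit maps, so that the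
  -- counit axioms later turn them into the multiplications by `a`.
  have e3 : cyc m S (conv B.comul (B.letter ∘ₗ twist B.gr 1) B.letter a) =
      conv B.comul (act m ∘ₗ S) (B.lmul ∘ₗ B.letter) a -
      B.lmul (B.letter (TensorProduct.lid R _ (B.counit.rTensor _ (B.comul a)))) -
      conv (coop B.gr B.comul) (act m ∘ₗ S) (B.rmul ∘ₗ B.letter) a +
      B.rmul (B.letter (TensorProduct.rid R _ (B.counit.lTensor _ (B.comul a)))) := by
    rw [conv_apply, conv_apply, conv_apply, coop, LinearMap.comp_apply]
    generalize B.comul a = z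
    induction z using tensor_induction (𝒜 := B.gr) (ℬ := B.gr) with
    | h0 => simp
    | hadd x y hx hy => simp only [map_add, hx, hy]; abel
    | h r s b hb c hc =>
      rw [koszulSwap_hom _ _ hb hc]
      simp only [map_smul, TensorProduct.map_tmul, LinearMap.mul'_apply, LinearMap.comp_apply,
        LinearMap.rTensor_tmul, LinearMap.lTensor_tmul, TensorProduct.lid_tmul,
        TensorProduct.rid_tmul]
      rw [twist_of_mem _ _ hb, map_smul, smul_mul_assoc, map_smul,
        cyc_mul (letter_mem hb) (letter_mem hc), hB.cyc_letter, hB.cyc_letter,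
        signedAct_of_mem hb, signedAct_of_mem hc]
      have fb : sg R (1 * r) * B.counit b = B.counit b := by
        by_cases hr : r = 0
        · subst hr; simp
        · rw [B.counit_gr r hr b hb, mul_zero]
      have fc : sg R (1 * r) * (sg R ((r - 1) * (s - 1)) * B.counit c) = -B.counit c := by
        by_cases hs : s = 0
        · subst hs
          rw [← mul_assoc, ← sg_add, sg_odd (by grind), neg_one_mul]
        · rw [B.counit_gr s hs c hc, mul_zero, mul_zero, neg_zero]
      have f1 : sg R (1 * r) * sg R r = 1 := by rw [one_mul, sg_mul_self]
      have f2 : sg R (1 * r) * (sg R ((r - 1) * (s - 1)) * sg R s) = -sg R (r * s) := by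
        rw [← sg_add, ← sg_add, ← neg_one_mul, ← sg_one, ← sg_add]
        apply sg_congr
        grind
      generalize (r - 1) * (s - 1) = t at *
      rw [sub_mul, sub_mul, smul_mul_assoc, smul_mul_assoc, smul_mul_assoc, smul_mul_assoc]
      simp only [one_mul (B.lmul _), one_mul (B.rmul _)]
      linear_combination (norm := module) f1 • (act m (S b) * B.lmul (B.letter c)) +
        f2 • (act m (S c) * B.rmul (B.letter b)) - fb • B.lmul (B.letter c) -
        fc • B.rmul (B.letter b)
  rw [← letter_coe, cobarD_letter hB.coalg, letter_coe, map_add, map_neg, e1, e2, e3,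
    hB.coalg.counit_left, hB.coalg.counit_right, mul_smul_comm, hB.cobarD_mul_act_S ha', letter_coe]
  simp only [smul_add, smul_sub, smul_neg, smul_mul_assoc, sg_smul_sg_smul]
  have e : sg R (p + 1) = -sg R p := by rw [sg_add, sg_one, mul_neg_one]
  simp only [e, smul_smul, neg_smul, mul_neg, neg_mul, sg_mul_self, one_smul]
  abel

/-- The operators `cyc` are a homotopy for the cyclic permutations. -/
theorem cobarD_cyc {p : ℤ} {x : B.Cobar} (hx : x ∈ B.cobarGr p) :
    (B.cobarD : Module.End R B.Cobar) * cyc m S x + cyc m S (B.cobarD x) +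
      sg R p • (cyc m S x * B.cobarD) = B.rmul x - B.lmul x := by
  refine tensorGr_induction (𝒜 := B.sgr) (p := fun p x =>
    (B.cobarD : Module.End R B.Cobar) * cyc m S x + cyc m S (B.cobarD x) +
      sg R p • (cyc m S x * B.cobarD) = B.rmul x - B.lmul x) ?_ ?_ ?_ ?_ ?_ hx
  · simp [cyc_one, cobarD_one, lmul_one, rmul_one]
  · intro k; simp
  · intro k x _ y _ hx hy
    have : ∀ a b c d : Module.End R B.Cobar, a + b - (c + d) = (a - c) + (b - d) := by
      intros; abel
    simp only [map_add, add_mul, mul_add, smul_add]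
    rw [this, ← hx, ← hy]
    abel
  · intro k r x _ hx
    simp only [map_smul, smul_mul_assoc, mul_smul_comm]
    have h := congrArg (fun z => r • z) hx
    simp only [smul_add, smul_sub] at h
    rw [← h, smul_comm r]
  · intro p q a ha y hy ih
    have ha' := ι_mem_tensorGr B.sgr ha
    have hda := cobarD_mem hB.coalg ha'
    have hdy := cobarD_mem hB.coalg hy
    have h1 := hB.cobarD_cyc_ι ha
    generalize TensorAlgebra.ι R a = x at *
    rw [cobarD_flip_mul _ _ ha', cyc_mul ha' hy, map_add, map_smul, cyc_mul hda hy, cyc_mul ha' hdy,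
      lmul_mul, rmul_mul ha' hy]
    -- The difference `R - L` satisfies the same rule as `cyc`: the mixed terms `R_x L_y` and `L_y
    -- R_x` cancel because left and right multiplications commute up to sign.
    have h2 : sg R (p * q) • (B.rmul y * B.rmul x) - B.lmul x * B.lmul y =
        (B.rmul x - B.lmul x) * B.lmul y + sg R (p * q) • ((B.rmul y - B.lmul y) * B.rmul x) := by
      rw [sub_mul, sub_mul, smul_sub, lmul_rmul hy ha', smul_smul, mul_comm q p, sg_mul_self,
        one_smul]
      abel
    rw [h2, ← ih, ← h1]
    simp only [add_mul, smul_add, smul_mul_assoc, mul_assoc, cobarD_lmul hy, cobarD_rmul hB.coalg ha', mul_add, mul_smul_comm, smul_smul, ← sg_add]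
    rw [sg_congr (a := (p - 1) * q) (b := p * q + q) (by grind),
      sg_congr (a := p + p * (q - 1)) (b := p * q) (by grind),
      sg_congr (a := p + q + p * q) (b := p * q + (q + p)) (by grind)]
    abel

end IsInvolutiveDGHopf

end DGCoalgData

/-! ### Invariance of the cyclic operators under the action of `B`. -/

section

variable {R : Type*} [CommRing R] {M : Type*} [AddCommGroup M] [Module R M]
variable {𝒜 : ℤ → Submodule R M} [DirectSum.Decomposition 𝒜]
variable {A : Type*} [Ring A] [Algebra R A] {δ : M →ₗ[R] M ⊗[R] M}

/-- In a convolution in which the coproduct and its opposite are mixed, commuting factors can be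
interchanged. -/
theorem conv_coop_conv (hδ : ∀ k, ∀ x ∈ 𝒜 k, δ x ∈ prodGr 𝒜 𝒜 k)
    (h : (TensorProduct.assoc R M M M).toLinearMap ∘ₗ δ.rTensor M ∘ₗ δ = δ.lTensor M ∘ₗ δ)
    (F F' U : M →ₗ[R] A) (f u : ℤ) (hc : ∀ p q, ∀ a ∈ 𝒜 p, ∀ b ∈ 𝒜 q,
      F' b * U a = sg R ((q + f) * (p + u)) • (U a * F' b)) :
    conv (coop 𝒜 δ) (conv δ F F') U =
      sg R (f * u) • conv δ (conv (coop 𝒜 δ) F (U ∘ₗ twist 𝒜 f)) (F' ∘ₗ twist 𝒜 u) := by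
  let Ψ : M ⊗[R] (M ⊗[R] M) →ₗ[R] A := LinearMap.mul' R A ∘ₗ
    TensorProduct.map (LinearMap.mul' R A ∘ₗ TensorProduct.map F (U ∘ₗ twist 𝒜 f) ∘ₗ
      koszulSwap 𝒜 𝒜) (F' ∘ₗ twist 𝒜 u) ∘ₗ (TensorProduct.assoc R M M M).symm.toLinearMap
  have e1 : conv δ (conv (coop 𝒜 δ) F (U ∘ₗ twist 𝒜 f)) (F' ∘ₗ twist 𝒜 u) =
      Ψ ∘ₗ (TensorProduct.assoc R M M M).toLinearMap ∘ₗ δ.rTensor M ∘ₗ δ := by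
    refine LinearMap.ext fun x => ?_
    simp only [conv, coop, Ψ, LinearMap.comp_apply]
    induction δ x with
    | zero => simp
    | add x y hx hy => simp only [map_add, hx, hy]
    | tmul a b => simp
  rw [e1, h]
  refine LinearMap.ext fun x => ?_
  change LinearMap.mul' R A (TensorProduct.map (conv δ F F') U (koszulSwap 𝒜 𝒜 (δ x))) =
    sg R (f * u) • Ψ (δ.lTensor M (δ x))
  induction δ x using tensor_induction (𝒜 := 𝒜) (ℬ := 𝒜) with
  | h0 => simp
  | hadd x y hx hy => simp only [map_add, smul_add, hx, hy]
  | h p q a ha b hb =>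
    rw [koszulSwap_hom _ _ ha hb, map_smul, map_smul, TensorProduct.map_tmul, LinearMap.mul'_apply,
      LinearMap.lTensor_tmul, conv_apply]
    refine prodGr_eq (𝒜 := 𝒜) (ℬ := 𝒜) (f := sg R (p * q) • (LinearMap.mulRight R (U a) ∘ₗ
      LinearMap.mul' R A ∘ₗ TensorProduct.map F F'))
      (g := sg R (f * u) • (Ψ ∘ₗ TensorProduct.mk R _ _ a)) (fun r s hrs c hc' d hd => ?_)
      (hδ q b hb)
    simp only [Ψ, LinearMap.smul_apply, LinearMap.comp_apply, TensorProduct.map_tmul,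
      LinearMap.mul'_apply, LinearMap.mulRight_apply, TensorProduct.mk_apply,
      LinearEquiv.coe_coe, TensorProduct.assoc_symm_tmul]
    rw [koszulSwap_hom _ _ ha hc', twist_of_mem _ _ hd, map_smul, map_smul, map_smul,
      TensorProduct.map_tmul, LinearMap.comp_apply, twist_of_mem _ _ ha, LinearMap.mul'_apply,
      mul_assoc, hc p s a ha d hd, map_smul]
    simp only [mul_smul_comm, smul_mul_assoc, smul_smul, ← sg_add, mul_assoc]
    congr 1
    apply sg_congr
    subst hrs
    simp only [Int.even_add, Int.even_mul]
    grind

end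

namespace DGCoalgData

variable {R : Type u} [CommRing R] {B : DGCoalgData.{u, v} R}
  {m : B.carrier ⊗[R] B.carrier →ₗ[R] B.carrier} {S : B.carrier →ₗ[R] B.carrier}

namespace IsInvolutiveDGHopf

variable (hB : B.IsInvolutiveDGHopf m S)
include hB

/-- The rule `cyc_mul` applied to `(h¹ ⋄ a)(h² ⋄ x)`. In the second term the later factor of the
coproduct stands first, hence the opposite coproduct. -/
theorem cyc_comp_diamond_flip_ι_mul {p q : ℤ} {a : B.Red} (ha : a ∈ B.sgr p) {x : B.Cobar}
    (hx : x ∈ B.cobarGr q) :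
    cyc m S ∘ₗ (B.diamond m).flip (TensorAlgebra.ι R a * x) =
      conv B.comul (signedAct m S ∘ₗ mulR m a) (B.lmul ∘ₗ (B.diamond m).flip x ∘ₗ twist B.gr p) +
      sg R (p * q) • conv (coop B.gr B.comul) (cyc m S ∘ₗ (B.diamond m).flip x)
        (B.rmul ∘ₗ (B.diamond m).flip (TensorAlgebra.ι R a) ∘ₗ twist B.gr q) := by
  have ha' := ι_mem_tensorGr B.sgr ha
  refine LinearMap.ext fun h => ?_
  rw [hB.diamond_flip_mul ha']
  simp only [LinearMap.comp_apply, LinearMap.add_apply, LinearMap.smul_apply, conv_apply, coop]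
  induction B.comul h using tensor_induction (𝒜 := B.gr) (ℬ := B.gr) with
  | h0 => simp
  | hadd x y hx hy => simp only [map_add, smul_add, hx, hy]; abel
  | h r s b hb c hc =>
    rw [koszulSwap_hom _ _ hb hc]
    simp only [map_smul, TensorProduct.map_tmul, LinearMap.mul'_apply, LinearMap.comp_apply,
      LinearMap.flip_apply]
    rw [twist_of_mem _ _ hc, twist_of_mem _ _ hb]
    simp only [map_smul, LinearMap.smul_apply, mul_smul_comm]
    rw [cyc_mul (hB.diamond_mem hb ha') (hB.diamond_mem hc hx), hB.diamond_ι, hB.cyc_letter,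
      hB.counit_m, LinearMap.mem_ker.1 a.2, mul_zero, zero_smul, sub_zero, smul_add, mulR_apply]
    simp only [smul_smul, ← sg_add]
    congr 2
    apply sg_congr
    grind

theorem conv_rmul_diamond {p q : ℤ} {x y : B.Cobar} (hx : x ∈ B.cobarGr p) (hy : y ∈ B.cobarGr q) :
    conv (coop B.gr B.comul) (B.rmul ∘ₗ (B.diamond m).flip y)
      (B.rmul ∘ₗ (B.diamond m).flip x ∘ₗ twist B.gr q) =
      sg R (p * q) • B.rmul ∘ₗ (B.diamond m).flip (x * y) := by
  refine LinearMap.ext fun h => ?_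
  rw [hB.diamond_flip_mul hx]
  simp only [LinearMap.comp_apply, LinearMap.smul_apply, conv_apply, coop]
  induction B.comul h using tensor_induction (𝒜 := B.gr) (ℬ := B.gr) with
  | h0 => simp
  | hadd x y hx hy => simp only [map_add, smul_add, hx, hy]
  | h r s b hb c hc =>
    rw [koszulSwap_hom _ _ hb hc]
    simp only [map_smul, TensorProduct.map_tmul, LinearMap.mul'_apply, LinearMap.comp_apply,
      LinearMap.flip_apply]
    rw [twist_of_mem _ _ hc, twist_of_mem _ _ hb]
    simp only [map_smul, LinearMap.smul_apply, mul_smul_comm]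
    rw [rmul_mul (hB.diamond_mem hb hx) (hB.diamond_mem hc hy)]
    simp only [smul_smul, ← sg_add]
    congr 1
    apply sg_congr
    grind

/-- Since `S(h a) = ± S(a) S(h)`, the part of `h` which acts on the absorbed letter reappears as
`S(h)` acting on the rest of the word, where it can cancel. -/
theorem signedAct_comp_mulR {p : ℤ} {a : B.Red} (ha : a ∈ B.sgr p) :
    signedAct m S ∘ₗ mulR m a =
      LinearMap.mulLeft R (signedAct m S a) ∘ₗ act m ∘ₗ S ∘ₗ twist B.gr p := by
  have ha' : (a : B.carrier) ∈ B.gr (p + 1) := B.mem_sgr.1 ha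
  refine hom_ext (𝒜 := B.gr) fun k h hh => ?_
  simp only [LinearMap.comp_apply, mulR_apply, LinearMap.mulLeft_apply]
  rw [signedAct_of_mem (hB.m_mem _ _ h hh _ ha'), hB.S_m _ _ h hh _ ha', signedAct_of_mem ha',
    twist_of_mem _ _ hh, map_smul, map_smul, map_smul, hB.act_m, smul_mul_assoc, mul_smul_comm]
  simp only [smul_smul, ← sg_add]
  congr 1
  apply sg_congr
  grind

theorem conv_lmul_diamond_act {q : ℤ} {x : B.Cobar} (hx : x ∈ B.cobarGr q) (j : ℤ) :
    conv B.comul (B.lmul ∘ₗ (B.diamond m).flip x ∘ₗ twist B.gr j) (act m ∘ₗ twist B.gr (q + j)) =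
      LinearMap.mulRight R (B.lmul x) ∘ₗ act m ∘ₗ twist B.gr j := by
  have h : LinearMap.mulRight R (B.lmul x) ∘ₗ act m =
      conv B.comul (B.lmul ∘ₗ (B.diamond m).flip x) (act m ∘ₗ twist B.gr q) :=
    LinearMap.ext fun h => hB.isSide_left.act_mul q x hx h
  have h' := congrArg (fun f => f ∘ₗ twist B.gr j) h
  simp only [conv_comp_twist hB.coalg.comul_mem, LinearMap.comp_assoc, twist_comp] at h'
  exact h'.symm

theorem conv_act_S_rmul {i : ℤ} {u : B.Cobar} (hu : u ∈ B.cobarGr i) (j : ℤ) :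
    conv (coop B.gr B.comul) (act m ∘ₗ S ∘ₗ twist B.gr j)
        (B.rmul ∘ₗ (B.diamond m).flip u ∘ₗ twist B.gr j) =
      LinearMap.mulLeft R (B.rmul u) ∘ₗ act m ∘ₗ S ∘ₗ twist B.gr (i + j) := by
  have h := congrArg (fun f => f ∘ₗ twist B.gr j) (hB.conv_act_S_mul hB.isSide_right hu)
  simp only [conv_comp_twist hB.isSide_right.mem, LinearMap.comp_assoc, twist_comp] at h
  exact h

theorem conv_act_S_act_twist (j : ℤ) :
    conv B.comul (act m ∘ₗ S ∘ₗ twist B.gr j) (act m ∘ₗ twist B.gr j) =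
      B.counit.smulRight (1 : Module.End R B.Cobar) := by
  have h := congrArg (fun f => f ∘ₗ twist B.gr j) (hB.conv_rho_act hB.isSide_left)
  simp only [conv_comp_twist hB.coalg.comul_mem, LinearMap.comp_assoc] at h
  rw [h]
  ext1 b
  simp [scalar_twist B.gr B.counit_gr]

/-- The summand of `cyc_diamond` in which `x` is rotated to its first letter. -/
theorem conv_signedAct_lmul_rmul_act {p q i : ℤ} {a : B.Red} (ha : a ∈ B.sgr p) {x u : B.Cobar}
    (hx : x ∈ B.cobarGr q) (hu : u ∈ B.cobarGr i) :
    conv B.comul (conv (coop B.gr B.comul) (conv B.comul (signedAct m S ∘ₗ mulR m a)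
        (B.lmul ∘ₗ (B.diamond m).flip x ∘ₗ twist B.gr p))
        (B.rmul ∘ₗ (B.diamond m).flip u ∘ₗ twist B.gr (p + q)))
        (act m ∘ₗ twist B.gr (i + (p + q))) =
      sg R (q * i) • B.counit.smulRight (signedAct m S a * B.rmul u * B.lmul x) := by
  -- The multiplications by `x` and `u` commute up to sign, so `u` can be brought next to `a` and
  -- `x` next to the final action. The right pair collapses by the module algebra identity, the left
  -- pair by its version for `S` and the opposite coproduct, and then `S(h¹) h²` becomes the counit.
  rw [conv_coop_conv hB.coalg.comul_mem hB.coalg.coassoc _ _ _ q i]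
  · have e1 : (B.lmul ∘ₗ (B.diamond m).flip x ∘ₗ twist B.gr p) ∘ₗ twist B.gr i =
        B.lmul ∘ₗ (B.diamond m).flip x ∘ₗ twist B.gr (p + i) := by
      rw [← twist_comp]; rfl
    have e2 : (B.rmul ∘ₗ (B.diamond m).flip u ∘ₗ twist B.gr (p + q)) ∘ₗ twist B.gr q =
        B.rmul ∘ₗ (B.diamond m).flip u ∘ₗ twist B.gr p := by
      rw [← twist_congr B.gr (k := p + q + q) (l := p) (by grind), ← twist_comp _ (p + q)]; rfl
    rw [conv_smul_left, conv_assoc hB.coalg.coassoc, e1, e2, show i + (p + q) = q + (p + i) by ring,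
      hB.conv_lmul_diamond_act hx, conv_mulRight, hB.signedAct_comp_mulR ha, conv_mulLeft,
      conv_mulLeft, hB.conv_act_S_rmul hu, conv_mulLeft, add_comm p i, hB.conv_act_S_act_twist]
    congr 1
    ext1 h
    simp [mul_assoc]
  · intro r s b hb c hc
    simp only [LinearMap.comp_apply, LinearMap.flip_apply]
    rw [twist_of_mem _ _ hb, twist_of_mem _ _ hc]
    simp only [map_smul, LinearMap.smul_apply, smul_mul_assoc, mul_smul_comm]
    rw [lmul_rmul (hB.diamond_mem hc hx) (hB.diamond_mem hb hu), smul_comm (sg R ((s + q) * _)),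
      smul_comm (sg R ((s + q) * _)), smul_comm (sg R ((p + q) * _))]

/-- Applied to `z`, the left side is the sum of the rotations of `(h¹ ⋄ u)(h² ⋄ x)(h³ ⋄ z)` starting
with a letter of the middle factor. It depends on `h` only through `ε(h)`. The word `u` holds the
letters already passed and makes the induction on `x` possible. -/
theorem cyc_diamond {i j : ℤ} {u x : B.Cobar} (hu : u ∈ B.cobarGr i) (hx : x ∈ B.cobarGr j) :
    conv B.comul (conv (coop B.gr B.comul) (cyc m S ∘ₗ (B.diamond m).flip x)
      (B.rmul ∘ₗ (B.diamond m).flip u ∘ₗ twist B.gr j)) (act m ∘ₗ twist B.gr (i + j)) =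
      B.counit.smulRight (cyc m S x * B.rmul u) := by
  have hco := hB.isSide_right.coassoc
  refine tensorGr_induction (𝒜 := B.sgr) (p := fun j x => ∀ i, ∀ u ∈ B.cobarGr i,
    conv B.comul (conv (coop B.gr B.comul) (cyc m S ∘ₗ (B.diamond m).flip x)
      (B.rmul ∘ₗ (B.diamond m).flip u ∘ₗ twist B.gr j)) (act m ∘ₗ twist B.gr (i + j)) =
      B.counit.smulRight (cyc m S x * B.rmul u)) ?_ ?_ ?_ ?_ ?_ hx i u hu
  · intro i u _
    have : cyc m S ∘ₗ (B.diamond m).flip (1 : B.Cobar) = 0 := by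
      rw [diamond_flip_one]; ext1 h; simp [cyc_one]
    rw [this, conv_zero_left, conv_zero_left, cyc_one, zero_mul, LinearMap.smulRight_zero]
  · intro j i u _
    ext1 h
    simp
  · intro j x _ y _ hx hy i u hu
    rw [map_add, LinearMap.comp_add, conv_add_left, conv_add_left, hx i u hu, hy i u hu, map_add,
      add_mul]
    ext1 h
    simp
  · intro j r x _ hx i u hu
    rw [map_smul, LinearMap.comp_smul, conv_smul_left, conv_smul_left, hx i u hu, map_smul]
    ext1 h
    simp only [LinearMap.smul_apply, LinearMap.smulRight_apply, smul_mul_assoc]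
    rw [smul_comm]
  · intro p q a ha x hx ih i u hu
    have ha' := ι_mem_tensorGr B.sgr ha
    have hua := mul_mem_tensorGr rfl hu ha'
    -- For rotations which do not start with `a`, this letter joins the word `u`, as `(h¹ ⋄ u)(h² ⋄
    -- a)` is `h ⋄ (u a)`. The remaining rotations are `conv_signedAct_lmul_rmul_act`.
    have h1 := ih (i + p) _ hua
    have h2 : conv (coop B.gr B.comul) (B.rmul ∘ₗ (B.diamond m).flip (TensorAlgebra.ι R a) ∘ₗ
          twist B.gr q) (B.rmul ∘ₗ (B.diamond m).flip u ∘ₗ twist B.gr (p + q)) =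
        sg R (i * p) • (B.rmul ∘ₗ (B.diamond m).flip (u * TensorAlgebra.ι R a)) ∘ₗ
          twist B.gr q := by
      rw [← LinearMap.smul_comp, ← hB.conv_rmul_diamond hu ha',
        conv_comp_twist hB.isSide_right.mem]
      simp only [LinearMap.comp_assoc, twist_comp]
    rw [hB.cyc_comp_diamond_flip_ι_mul ha hx, conv_add_left, conv_add_left, hB.conv_signedAct_lmul_rmul_act ha hx hu, conv_smul_left,
      conv_smul_left, conv_assoc hco, h2, conv_smul_right, conv_smul_left, ← add_assoc]
    rw [LinearMap.comp_assoc, h1, cyc_ι_mul ha, twist_of_mem _ _ hx, rmul_mul hu ha', add_mul,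
      mul_assoc, mul_assoc, lmul_rmul hx hu, mul_assoc, map_smul]
    ext1 h
    simp only [LinearMap.add_apply, LinearMap.smul_apply, LinearMap.smulRight_apply, smul_add,
      mul_smul_comm, smul_mul_assoc, smul_smul, mul_comm _ (B.counit h), mul_assoc (sg R (p * q))]
    rw [mul_left_comm (sg R (i * p)), sg_mul_self, mul_one, mul_comm (sg R (p * q))]

/-- The cyclic operators are invariant under the action of `B`. -/
theorem cyc_diamond_one (h : B.carrier) (x : B.Cobar) :
    cyc m S (B.diamond m h x) 1 = B.counit h • cyc m S x 1 := by
  induction x using induction_homogeneous (𝒜 := B.cobarGr) with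
  | h0 => simp
  | hadd x y hx hy => simp only [map_add, LinearMap.add_apply, smul_add, hx, hy]
  | h j x hx =>
    -- With `u = 1`, and evaluated at `z = 1`, only the action of `h` on `x` is left.
    have e := LinearMap.congr_fun (hB.cyc_diamond one_mem_tensorGr hx) h
    have e1 : B.rmul ∘ₗ (B.diamond m).flip 1 ∘ₗ twist B.gr j =
        B.counit.smulRight (1 : Module.End R B.Cobar) := by
      rw [diamond_flip_one]
      ext1 b
      simp [scalar_twist B.gr B.counit_gr, rmul_one]
    rw [e1, conv_one_right hB.isSide_right.counit_right, LinearMap.smulRight_apply, rmul_one,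
      mul_one] at e
    have e2 := LinearMap.congr_fun e 1
    rw [LinearMap.smul_apply] at e2
    rw [← e2, conv_apply]
    conv_lhs => rw [← hB.coalg.counit_right h]
    induction B.comul h with
    | zero => simp
    | add x y hx hy => simp only [map_add, LinearMap.add_apply, hx, hy]
    | tmul a b => simp [act_apply, diamond_one, scalar_twist B.gr B.counit_gr]

theorem signedAct_mem {p q : ℤ} {b : B.carrier} (hb : b ∈ B.gr p) {x : B.Cobar}
    (hx : x ∈ B.cobarGr q) : signedAct m S b x ∈ B.cobarGr (p + q) :=
  hB.diamond_mem (hB.antipode.mem _ _ (twist_mem _ hb)) hx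

theorem cyclicSum_mem {Φ : B.Cobar →ₗ[R] Module.End R B.Cobar} {c : ℤ}
    (hΦ : ∀ p q, ∀ x ∈ B.cobarGr p, ∀ y ∈ B.cobarGr q, Φ x y ∈ B.cobarGr (p + q + c)) (k : ℤ)
    {p q : ℤ} {x y : B.Cobar} (hx : x ∈ B.cobarGr p) (hy : y ∈ B.cobarGr q) :
    cyclicSum m S Φ k x y ∈ B.cobarGr (p + q + c + 1) := by
  refine tensorGr_induction (𝒜 := B.sgr) (p := fun p x => ∀ q, ∀ y ∈ B.cobarGr q,
    cyclicSum m S Φ k x y ∈ B.cobarGr (p + q + c + 1)) ?_ ?_ ?_ ?_ ?_ hx q y hy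
  · intro q y _; rw [cyclicSum_one]; exact zero_mem _
  · intro p q y _; rw [map_zero]; exact zero_mem _
  · intro p x _ x' _ hx hx' q y hy
    rw [map_add]; exact add_mem (hx q y hy) (hx' q y hy)
  · intro p r x _ hx q y hy
    rw [map_smul]; exact Submodule.smul_mem _ _ (hx q y hy)
  · intro i j a ha x hx ih q y hy
    have ha' := ι_mem_tensorGr B.sgr ha
    rw [cyclicSum_ι_mul _ _ ha, twist_of_mem _ _ hx, map_smul, LinearMap.add_apply,
      LinearMap.smul_apply, smul_mul_assoc, LinearMap.smul_apply, Module.End.mul_apply,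
      Module.End.mul_apply, rmul_apply_of_mem hy ha', map_smul]
    refine add_mem ?_ (Submodule.smul_mem _ _ (Submodule.smul_mem _ _ (Submodule.smul_mem _ _ ?_)))
    · have := hB.signedAct_mem (B.mem_sgr.1 ha) (hΦ j q x hx y hy)
      rwa [show i + 1 + (j + q + c) = i + j + q + c + 1 by ring] at this
    · have := ih _ _ (mul_mem_tensorGr rfl hy ha')
      rwa [show j + (q + i) + c + 1 = i + j + q + c + 1 by ring] at this

end IsInvolutiveDGHopf

/-! ### The Connes-Moscovici operator -/

theorem twist_mem_pow (k : ℤ) {n : ℕ} {t : B.Cobar}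
    (ht : t ∈ LinearMap.range (TensorAlgebra.ι R : B.Red →ₗ[R] B.Cobar) ^ n) :
    twist B.cobarGr k t ∈ LinearMap.range (TensorAlgebra.ι R : B.Red →ₗ[R] B.Cobar) ^ n := by
  induction n generalizing t with
  | zero =>
    obtain ⟨r, rfl⟩ := Submodule.mem_one.1 (by simpa using ht)
    rw [Algebra.algebraMap_eq_smul_one, map_smul, twist_one]
    exact Submodule.smul_mem _ _ (by simp)
  | succ n ih =>
    rw [pow_succ'] at ht ⊢
    refine Submodule.mul_induction_on ht ?_ ?_
    · rintro _ ⟨a, rfl⟩ t ht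
      rw [twist_mul, twist_ι]
      exact Submodule.mul_mem_mul ⟨_, rfl⟩ (ih ht)
    · intro x y hx hy
      rw [map_add]; exact add_mem hx hy

theorem rotate_ι_mul {p : ℤ} {a : B.Red} (ha : a ∈ B.sgr p) (t : B.Cobar) :
    B.rotate (TensorAlgebra.ι R a * t) = twist B.cobarGr p t * TensorAlgebra.ι R a := by
  have e : (TensorAlgebra.ι R ∘ₗ TensorAlgebra.ιInv).rTensor B.Cobar
      (deconc R B.Red (TensorAlgebra.ι R a * t)) = TensorAlgebra.ι R a ⊗ₜ[R] t := by
    rw [deconc_ι_mul, map_add, LinearMap.rTensor_tmul, LinearMap.comp_apply, ιInv_one, map_zero,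
      TensorProduct.zero_tmul, zero_add]
    conv_rhs => rw [← deconc_counit_left t]
    induction deconc R B.Red t with
    | zero => simp
    | add x y hx hy => simp only [map_add, TensorProduct.tmul_add, hx, hy]
    | tmul s t => simp [ιInv_ι_mul, TensorProduct.smul_tmul]
  simp only [rotate, LinearMap.comp_apply]
  rw [e, koszulSwap_tmul_left _ _ (ι_mem_tensorGr B.sgr ha), LinearMap.mul'_apply]

theorem absorbFirst_ι_mul (a : B.Red) (t : B.Cobar) :
    B.absorbFirst m S (TensorAlgebra.ι R a * t) = signedAct m S a t := by
  have e := LinearMap.congr_fun (conv_deconc_ι_mul B.lmul (signedAct m S ∘ₗ B.Red.subtype) a t) 1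
  simp only [Module.End.mul_apply, lmul_apply, mul_one, LinearMap.comp_apply,
    Submodule.subtype_apply] at e
  rw [← e, conv_apply, absorbFirst]
  simp only [LinearMap.comp_apply]
  induction deconc R B.Red (TensorAlgebra.ι R a * t) with
  | zero => simp
  | add x y hx hy => simp only [map_add, LinearMap.add_apply, hx, hy]
  | tmul s t => simp [signedAct, parity_eq_twist, act_apply, lmul_apply]

/-- The free word `z` is needed for the induction: one rotation moves the first letter of `t` behind
`z`, and the remaining `n` rotations start with letters of a word of length `n`. -/
theorem cyc_eq_absorbFirst {n : ℕ} {t : B.Cobar}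
    (ht : t ∈ LinearMap.range (TensorAlgebra.ι R : B.Red →ₗ[R] B.Cobar) ^ n) (z : B.Cobar) :
    cyc m S t z = B.absorbFirst m S ((∑ i ∈ Finset.range n, B.rotate ^ i) (t * z)) := by
  induction n generalizing t z with
  | zero =>
    obtain ⟨r, rfl⟩ := Submodule.mem_one.1 (by simpa using ht)
    rw [Algebra.algebraMap_eq_smul_one, map_smul, cyc_one]
    simp
  | succ n ih =>
    rw [pow_succ'] at ht
    refine Submodule.mul_induction_on ht ?_ ?_
    · rintro _ ⟨a, rfl⟩ t ht
      induction a using induction_homogeneous (𝒜 := B.sgr) with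
      | h0 => simp
      | hadd a b ha hb => simp only [map_add, add_mul, LinearMap.add_apply, ha, hb]
      | h p a ha =>
        have ha' := ι_mem_tensorGr B.sgr ha
        have e : B.rmul (TensorAlgebra.ι R a) z = twist B.cobarGr p z * TensorAlgebra.ι R a := by
          induction z using induction_homogeneous (𝒜 := B.cobarGr) with
          | h0 => simp
          | hadd x y hx hy => simp only [map_add, add_mul, hx, hy]
          | h k z hz =>
            rw [rmul_apply_of_mem hz ha', twist_of_mem _ _ hz, smul_mul_assoc, mul_comm]
        rw [cyc_ι_mul ha, LinearMap.add_apply, Module.End.mul_apply, Module.End.mul_apply,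
          ih (twist_mem_pow p ht), lmul_apply, e, Finset.sum_range_succ', pow_zero,
          LinearMap.add_apply, map_add, Module.End.one_apply, mul_assoc, absorbFirst_ι_mul,
          ← mul_assoc, ← twist_mul, ← rotate_ι_mul ha, add_comm]
        simp only [pow_succ, LinearMap.sum_apply, Module.End.mul_apply]
    · intro x y hx hy
      rw [map_add, LinearMap.add_apply, hx, hy, add_mul, map_add, map_add]

/-- When nothing follows `x`, the rotations starting with a letter of `x` are all its cyclic
permutations. -/
theorem connesMoscovici_apply (x : B.Cobar) : B.connesMoscovici m S x = cyc m S x 1 := by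
  have : B.connesMoscovici m S = LinearMap.applyₗ 1 ∘ₗ cyc m S := by
    refine DirectSum.decompose_lhom_ext
      (fun n : ℕ => LinearMap.range (TensorAlgebra.ι R : B.Red →ₗ[R] B.Cobar) ^ n) fun n => ?_
    ext ⟨t, ht⟩
    simp only [connesMoscovici, LinearMap.comp_apply, Submodule.subtype_apply, LinearEquiv.coe_coe,
      DirectSum.decomposeLinearEquiv_apply, LinearMap.applyₗ_apply_apply]
    rw [DirectSum.decompose_of_mem _ ht, ← DirectSum.lof_eq_of R, DirectSum.toModule_lof,
      cyc_eq_absorbFirst ht, mul_one]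
    rfl
  rw [this]; rfl

namespace IsInvolutiveDGHopf

variable (hB : B.IsInvolutiveDGHopf m S)
include hB

/-- Each summand of `cyc x z` is `± S(a) ⋄ w` for a letter `a`, so `ε(S(a)) = ε(a) = 0`. By
`cyc_diamond_one` the operator multiplies such an element by this scalar. -/
theorem connesMoscovici_cyc (x z : B.Cobar) : B.connesMoscovici m S (cyc m S x z) = 0 := by
  induction x using induction_homogeneous (𝒜 := B.cobarGr) with
  | h0 => simp
  | hadd x y hx hy => simp only [map_add, LinearMap.add_apply, hx, hy, add_zero]
  | h k x hx =>
    refine tensorGr_induction (𝒜 := B.sgr)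
      (p := fun k x => ∀ z, B.connesMoscovici m S (cyc m S x z) = 0) ?_ ?_ ?_ ?_ ?_ hx z
    · intro z; rw [cyc_one]; simp
    · intro k z; simp
    · intro k x _ y _ hx hy z; simp only [map_add, LinearMap.add_apply, hx, hy, add_zero]
    · intro k r x _ hx z; simp only [map_smul, LinearMap.smul_apply, hx, smul_zero]
    · intro p q a ha x hx ih z
      rw [cyc_ι_mul ha, twist_of_mem _ _ hx, map_smul, LinearMap.add_apply, map_add, smul_mul_assoc,
        LinearMap.smul_apply, map_smul, Module.End.mul_apply, Module.End.mul_apply, ih, smul_zero,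
        add_zero, connesMoscovici_apply, signedAct, LinearMap.comp_apply, LinearMap.comp_apply,
        act_apply, hB.cyc_diamond_one, hB.counit_S, scalar_twist B.gr B.counit_gr,
        LinearMap.mem_ker.1 a.2, zero_smul]

theorem connesMoscovici_connesMoscovici (x : B.Cobar) :
    B.connesMoscovici m S (B.connesMoscovici m S x) = 0 := by
  rw [connesMoscovici_apply (S := S) x, hB.connesMoscovici_cyc]

theorem cyc_mem {p q : ℤ} {x y : B.Cobar} (hx : x ∈ B.cobarGr p) (hy : y ∈ B.cobarGr q) :
    cyc m S x y ∈ B.cobarGr (p + q + 1) := by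
  have := hB.cyclicSum_mem (Φ := B.lmul) (c := 0)
    (fun p q x hx y hy => mul_mem_tensorGr (add_zero _).symm hx hy) 0 hx hy
  rwa [add_zero] at this

theorem connesMoscovici_mem {p : ℤ} {x : B.Cobar} (hx : x ∈ B.cobarGr p) :
    B.connesMoscovici m S x ∈ B.cobarGr (p + 1) := by
  have := hB.cyc_mem hx one_mem_tensorGr
  rwa [add_zero, ← connesMoscovici_apply] at this

/-- Evaluate `cobarD_cyc` at `1`: left and right multiplication by `x` agree there, and `d 1 = 0`.
-/
theorem cobarD_connesMoscovici (x : B.Cobar) :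
    B.cobarD (B.connesMoscovici m S x) = -B.connesMoscovici m S (B.cobarD x) := by
  induction x using induction_homogeneous (𝒜 := B.cobarGr) with
  | h0 => simp
  | hadd x y hx hy => simp only [map_add, hx, hy, neg_add]
  | h k x hx =>
    have e := LinearMap.congr_fun (hB.cobarD_cyc hx) 1
    simp only [LinearMap.add_apply, LinearMap.sub_apply, LinearMap.smul_apply, Module.End.mul_apply,
      cobarD_one, map_zero, smul_zero, add_zero] at e
    rw [rmul_apply_of_mem one_mem_tensorGr hx, lmul_apply, zero_mul, sg_zero, one_smul, one_mul,
      mul_one, sub_self] at e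
    rw [connesMoscovici_apply, connesMoscovici_apply]
    exact eq_neg_of_add_eq_zero_left e

end IsInvolutiveDGHopf
end DGCoalgData

/-! ### Maps given degree by degree, and induction on the last letter. -/

section

variable {R : Type*} [CommRing R] {M : Type*} [AddCommGroup M] [Module R M]
variable {N : Type*} [AddCommMonoid N] [Module R N]
variable (𝒜 : ℤ → Submodule R M) [DirectSum.Decomposition 𝒜]

/-- The linear map which is `φ k` on the elements of degree `k`. -/
def homLift (φ : ℤ → M →ₗ[R] N) : M →ₗ[R] N :=
  DirectSum.toModule R ℤ N (fun k => φ k ∘ₗ (𝒜 k).subtype) ∘ₗ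
    (DirectSum.decomposeLinearEquiv 𝒜).toLinearMap

theorem homLift_of_mem (φ : ℤ → M →ₗ[R] N) {k : ℤ} {x : M} (hx : x ∈ 𝒜 k) :
    homLift 𝒜 φ x = φ k x := by
  simp only [homLift, LinearMap.comp_apply, LinearEquiv.coe_coe,
    DirectSum.decomposeLinearEquiv_apply, DirectSum.decompose_of_mem 𝒜 hx,
    ← DirectSum.lof_eq_of R, DirectSum.toModule_lof]
  rfl

/-- Every word ends with a letter. -/
theorem words_induction_right {p : TensorAlgebra R M → Prop} (h1 : p 1)
    (hadd : ∀ x y, p x → p y → p (x + y)) (hsmul : ∀ (r : R) x, p x → p (r • x))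
    (hι : ∀ x t, p t → p (t * TensorAlgebra.ι R x)) (t : TensorAlgebra R M) : p t := by
  have key : ∀ s t : TensorAlgebra R M, p t → p (t * s) := by
    intro s
    induction s using TensorAlgebra.induction with
    | algebraMap r => intro t ht; rw [← Algebra.commutes, ← Algebra.smul_def]; exact hsmul r t ht
    | ι x => exact hι x
    | mul a b ha hb => intro t ht; rw [← mul_assoc]; exact hb _ (ha _ ht)
    | add a b ha hb => intro t ht; rw [mul_add]; exact hadd _ _ (ha _ ht) (hb _ ht)
  simpa using key t 1 h1

end

/-! ### Deconcatenation as a convolution with values in `T(M) ⊗ T(M)`. -/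

section

variable {R : Type*} [CommRing R] {M : Type*} [AddCommGroup M] [Module R M]
variable (𝒜 : ℤ → Submodule R M) [DirectSum.Decomposition 𝒜]
variable {A : Type*} [Ring A] [Algebra R A]

/-- The inclusions of the factors of `T(M) ⊗ T(M)`. -/
abbrev inclLeft (R M : Type*) [CommRing R] [AddCommGroup M] [Module R M] :
    TensorAlgebra R M →ₐ[R] TensorAlgebra R M ⊗[R] TensorAlgebra R M :=
  Algebra.TensorProduct.includeLeft

/-- The inclusions of the factors of `T(M) ⊗ T(M)`. -/
abbrev inclRight (R M : Type*) [CommRing R] [AddCommGroup M] [Module R M] :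
    TensorAlgebra R M →ₐ[R] TensorAlgebra R M ⊗[R] TensorAlgebra R M :=
  Algebra.TensorProduct.includeRight

/-- A tensor `a ⊗ b` is the unsigned product `(a ⊗ 1)(1 ⊗ b)`. Hence identities for the coproduct of
a product of words also belong to the convolution calculus. -/
theorem map_comp_deconc_eq_conv (f g : TensorAlgebra R M →ₗ[R] TensorAlgebra R M) :
    TensorProduct.map f g ∘ₗ deconc R M = conv (deconc R M)
      ((inclLeft R M).toLinearMap ∘ₗ f) ((inclRight R M).toLinearMap ∘ₗ g) := by
  refine LinearMap.ext fun x => ?_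
  rw [conv_apply, LinearMap.comp_apply]
  induction deconc R M x with
  | zero => simp
  | add x y hx hy => rw [map_add, map_add, map_add, ← hx, ← hy]
  | tmul a b => simp

theorem deconc_eq_conv : deconc R M = conv (deconc R M)
    (inclLeft R M).toLinearMap (inclRight R M).toLinearMap := by
  simpa using map_comp_deconc_eq_conv (R := R) (M := M) LinearMap.id LinearMap.id

/-- The words are of the form `f(w¹) g(w²) w³` with a single letter in the middle, and a cut lies
before or after that letter. Both the brace product and the bar differential have this shape. -/
theorem deconc_comp_conv_ι (f : TensorAlgebra R M →ₗ[R] TensorAlgebra R M)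
    (g : TensorAlgebra R M →ₗ[R] M) :
    deconc R M ∘ₗ conv (deconc R M) f (conv (deconc R M) (TensorAlgebra.ι R ∘ₗ g) LinearMap.id) =
      conv (deconc R M) (deconc R M ∘ₗ f)
        (conv (deconc R M) ((inclRight R M).toLinearMap ∘ₗ TensorAlgebra.ι R ∘ₗ g)
          (inclRight R M).toLinearMap) +
      conv (deconc R M) ((inclLeft R M).toLinearMap ∘ₗ f)
        (conv (deconc R M) ((inclLeft R M).toLinearMap ∘ₗ TensorAlgebra.ι R ∘ₗ g) (deconc R M)) := by
  refine LinearMap.ext fun x => ?_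
  simp only [LinearMap.comp_apply, LinearMap.add_apply, conv_apply]
  induction deconc R M x with
  | zero => simp
  | add x y hx hy => simp only [map_add, hx, hy]; abel
  | tmul a b =>
    simp only [TensorProduct.map_tmul, LinearMap.mul'_apply, LinearMap.comp_apply, conv_apply]
    induction deconc R M b with
    | zero => simp
    | add x y hx hy => simp only [map_add, mul_add, hx, hy]; abel
    | tmul c d =>
      simp only [TensorProduct.map_tmul, LinearMap.mul'_apply, LinearMap.comp_apply,
        LinearMap.id_apply, AlgHom.toLinearMap_apply]
      rw [← mul_assoc, deconc_mul_ι_mul]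
      congr 1
      · induction deconc R M (f a) with
        | zero => simp
        | add x y hx hy => simp only [map_add, add_mul, hx, hy]
        | tmul y z => simp [mul_assoc]
      · induction deconc R M d with
        | zero => simp
        | add x y hx hy => simp only [map_add, mul_add, hx, hy]
        | tmul y z => simp

variable {T : Type*} [AddCommGroup T] [Module R T] {δ : T →ₗ[R] T ⊗[R] T}
variable (𝒯 : ℤ → Submodule R T) [DirectSum.Decomposition 𝒯]
variable {N : Type*} [AddCommGroup N] [Module R N]

/-- The pairing `a ⊗ b ↦ (x ↦ ∑ (-1)^(|b||x¹|) f(a)(x¹) g(b)(x²))`. -/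
def convPair (δ : T →ₗ[R] T ⊗[R] T) (f g : T →ₗ[R] T →ₗ[R] A) : T ⊗[R] T →ₗ[R] T →ₗ[R] A :=
  TensorProduct.lift (LinearMap.flip (homLift 𝒯 fun q => LinearMap.mk₂ R
    (fun b a => conv δ (f a ∘ₗ twist 𝒯 q) (g b))
    (by intros; rw [map_add, conv_add_right])
    (by intros; rw [map_smul, conv_smul_right])
    (by intros; rw [map_add, LinearMap.add_comp, conv_add_left])
    (by intros; rw [map_smul, LinearMap.smul_comp, conv_smul_left])))

theorem convPair_tmul (f g : T →ₗ[R] T →ₗ[R] A) (a : T) {q : ℤ} {b : T} (hb : b ∈ 𝒯 q) :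
    convPair 𝒯 δ f g (a ⊗ₜ[R] b) = conv δ (f a ∘ₗ twist 𝒯 q) (g b) := by
  rw [convPair, TensorProduct.lift.tmul, LinearMap.flip_apply, homLift_of_mem _ _ hb]
  rfl

end

/-! ### Products on tensor coalgebras defined by brace operations -/

section

variable {R : Type*} [CommRing R] {M : Type*} [AddCommGroup M] [Module R M]
variable (𝒜 : ℤ → Submodule R M) [DirectSum.Decomposition 𝒜]
variable (Ψ : M →ₗ[R] TensorAlgebra R M →ₗ[R] M)

/-- The step `f ↦ (w ↦ ∑ ± f(w¹) ⊗ x{w²} ⊗ w³)` of the recursion for `braceMul`. -/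
def braceMulStep : M →ₗ[R] Module.End R (TensorAlgebra R M →ₗ[R] TensorAlgebra R M) :=
  homLift 𝒜 fun q => LinearMap.mk₂ R
    (fun x f => conv (deconc R M) (f ∘ₗ twist (tensorGr 𝒜) q)
      (conv (deconc R M) (TensorAlgebra.ι R ∘ₗ Ψ x) LinearMap.id))
    (by intros; rw [map_add, LinearMap.comp_add, conv_add_left, conv_add_right])
    (by intros; rw [map_smul, LinearMap.comp_smul, conv_smul_left, conv_smul_right])
    (by intros; rw [LinearMap.add_comp, conv_add_left])
    (by intros; rw [LinearMap.smul_comp, conv_smul_left])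

/-- The product `x₁ ⋯ x_m · w = ∑ ± w¹ x₁{w²} w³ ⋯ x_m{w^{2m}} w^{2m+1}` on the tensor coalgebra
which is defined by the operations `x{w} = Ψ x w`. -/
def braceMul : TensorAlgebra R M →ₗ[R] TensorAlgebra R M →ₗ[R] TensorAlgebra R M :=
  LinearMap.applyₗ (LinearMap.id : TensorAlgebra R M →ₗ[R] TensorAlgebra R M) ∘ₗ
    (MulOpposite.opLinearEquiv R).symm.toLinearMap ∘ₗ
    (TensorAlgebra.lift R
      ((MulOpposite.opLinearEquiv R).toLinearMap ∘ₗ braceMulStep 𝒜 Ψ)).toLinearMap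

theorem braceMul_one : braceMul 𝒜 Ψ 1 = LinearMap.id := by
  simp [braceMul]

variable {𝒜}

theorem braceMul_mul_ι {q : ℤ} {x : M} (hx : x ∈ 𝒜 q) (v : TensorAlgebra R M) :
    braceMul 𝒜 Ψ (v * TensorAlgebra.ι R x) =
      conv (deconc R M) (braceMul 𝒜 Ψ v ∘ₗ twist (tensorGr 𝒜) q)
        (conv (deconc R M) (TensorAlgebra.ι R ∘ₗ Ψ x) LinearMap.id) := by
  simp only [braceMul, LinearMap.comp_apply, AlgHom.toLinearMap_apply, map_mul,
    TensorAlgebra.lift_ι_apply, LinearEquiv.coe_coe, MulOpposite.coe_opLinearEquiv_symm,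
    MulOpposite.coe_opLinearEquiv, MulOpposite.unop_mul, MulOpposite.unop_op,
    LinearMap.applyₗ_apply_apply, Module.End.mul_apply]
  rw [braceMulStep, homLift_of_mem _ _ hx]
  rfl

variable (𝒜) in
/-- Induction on words, adding homogeneous letters on the right. -/
theorem words_induction_right_homogeneous {p : TensorAlgebra R M → Prop} (h1 : p 1)
    (hadd : ∀ x y, p x → p y → p (x + y)) (hsmul : ∀ (r : R) x, p x → p (r • x))
    (hι : ∀ q, ∀ x ∈ 𝒜 q, ∀ t, p t → p (t * TensorAlgebra.ι R x)) (t : TensorAlgebra R M) :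
    p t := by
  refine words_induction_right h1 hadd hsmul (fun x t ht => ?_) t
  induction x using induction_homogeneous (𝒜 := 𝒜) with
  | h0 =>
    have h := hsmul 0 t ht
    rw [zero_smul] at h
    rw [map_zero, mul_zero]
    exact h
  | hadd a b ha hb => rw [map_add, mul_add]; exact hadd _ _ ha hb
  | h q x hx => exact hι q x hx t ht

variable {Ψ}

theorem braceMul_apply_one (hΨ : ∀ x, Ψ x 1 = x) (v : TensorAlgebra R M) :
    braceMul 𝒜 Ψ v 1 = v := by
  induction v using words_induction_right_homogeneous 𝒜 with
  | h1 => rw [braceMul_one]; rfl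
  | hadd x y hx hy => rw [map_add, LinearMap.add_apply, hx, hy]
  | hsmul r x hx => rw [map_smul, LinearMap.smul_apply, hx]
  | hι q a ha v ih =>
    rw [braceMul_mul_ι Ψ ha, conv_apply, deconc_one, TensorProduct.map_tmul, LinearMap.mul'_apply,
      conv_apply, deconc_one, TensorProduct.map_tmul, LinearMap.mul'_apply, LinearMap.comp_apply,
      twist_one, ih, LinearMap.comp_apply, hΨ, LinearMap.id_apply, mul_one]

variable (𝒜) in
theorem algebraMapInv_twist (k : ℤ) (w : TensorAlgebra R M) :
    (TensorAlgebra.algebraMapInv (twist (tensorGr 𝒜) k w) : R) =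
      TensorAlgebra.algebraMapInv w :=
  scalar_twist (𝒜 := tensorGr 𝒜)
    (f := (TensorAlgebra.algebraMapInv : TensorAlgebra R M →ₐ[R] R).toLinearMap)
    (fun _ hk _ hx => algebraMapInv_tensorGr 𝒜 hk hx) k w

theorem algebraMapInv_comp_braceMul_mul_ι (v : TensorAlgebra R M) {q : ℤ} {a : M} (ha : a ∈ 𝒜 q) :
    (TensorAlgebra.algebraMapInv : TensorAlgebra R M →ₐ[R] R).toLinearMap ∘ₗ
      braceMul 𝒜 Ψ (v * TensorAlgebra.ι R a) = 0 := by
  have e : (TensorAlgebra.algebraMapInv : TensorAlgebra R M →ₐ[R] R).toLinearMap ∘ₗ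
      TensorAlgebra.ι R ∘ₗ Ψ a = 0 := by
    ext1 w; simp
  rw [braceMul_mul_ι Ψ ha, comp_conv, comp_conv, e, conv_zero_left, conv_zero_right]

theorem algebraMapInv_braceMul (v w : TensorAlgebra R M) :
    (TensorAlgebra.algebraMapInv (braceMul 𝒜 Ψ v w) : R) =
      TensorAlgebra.algebraMapInv v * TensorAlgebra.algebraMapInv w := by
  induction v using words_induction_right_homogeneous 𝒜 with
  | h1 => rw [braceMul_one, map_one, one_mul]; rfl
  | hadd x y hx hy => rw [map_add, LinearMap.add_apply, map_add, hx, hy, map_add, add_mul]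
  | hsmul r x hx =>
    rw [map_smul, LinearMap.smul_apply, map_smul, hx, map_smul, smul_eq_mul, smul_eq_mul, mul_assoc]
  | hι q a ha v ih =>
    have e := LinearMap.congr_fun (algebraMapInv_comp_braceMul_mul_ι (Ψ := Ψ) v ha) w
    refine Eq.trans e ?_
    simp

theorem ιInv_conv {f g : TensorAlgebra R M →ₗ[R] TensorAlgebra R M} {c : R}
    (hf : ∀ u, (TensorAlgebra.algebraMapInv (f u) : R) = c * TensorAlgebra.algebraMapInv u)
    (hg : ∀ u, (TensorAlgebra.algebraMapInv (g u) : R) = 0) (w : TensorAlgebra R M) :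
    TensorAlgebra.ιInv (conv (deconc R M) f g w) = c • TensorAlgebra.ιInv (g w) := by
  rw [conv_apply]
  conv_rhs => rw [← deconc_counit_left w]
  induction deconc R M w with
  | zero => simp
  | add x y hx hy => simp only [map_add, hx, hy, smul_add]
  | tmul x y => simp [ιInv_mul, hf, hg, mul_smul]

theorem ιInv_conv_left (f : TensorAlgebra R M →ₗ[R] M) (w : TensorAlgebra R M) :
    TensorAlgebra.ιInv (conv (deconc R M) (TensorAlgebra.ι R ∘ₗ f) LinearMap.id w) = f w := by
  rw [conv_apply]
  conv_rhs => rw [← deconc_counit_right w]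
  induction deconc R M w with
  | zero => simp
  | add x y hx hy => simp only [map_add, hx, hy]
  | tmul x y => simp [ιInv_ι_mul]

/-- A product `w¹ x₁{w²} w³ ⋯` is a single letter only if `v` is empty, or if `v` is one letter into
which all of `w` is inserted. This is why the operations with two or more letters on the left
vanish. -/
theorem ιInv_braceMul (v w : TensorAlgebra R M) :
    TensorAlgebra.ιInv (braceMul 𝒜 Ψ v w) =
      (TensorAlgebra.algebraMapInv v : R) • TensorAlgebra.ιInv w + Ψ (TensorAlgebra.ιInv v) w := by
  induction v using words_induction_right_homogeneous 𝒜 with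
  | h1 => rw [braceMul_one]; simp
  | hadd x y hx hy => simp only [map_add, LinearMap.add_apply, hx, hy, add_smul]; abel
  | hsmul r x hx => simp only [map_smul, LinearMap.smul_apply, hx, smul_eq_mul, mul_smul, smul_add]
  | hι q a ha v ih =>
    rw [ιInv_mul_ι, map_smul, LinearMap.smul_apply, braceMul_mul_ι Ψ ha]
    simp only [map_mul, algebraMapInv_ι, mul_zero, zero_smul, zero_add]
    rw [ιInv_conv (g := conv (deconc R M) (TensorAlgebra.ι R ∘ₗ Ψ a) LinearMap.id)
      (c := TensorAlgebra.algebraMapInv v)]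
    · congr 1
      rw [ιInv_conv_left (Ψ a) w]
    · intro u
      rw [LinearMap.comp_apply, algebraMapInv_braceMul, algebraMapInv_twist]
    · intro u
      have e : (TensorAlgebra.algebraMapInv : TensorAlgebra R M →ₐ[R] R).toLinearMap ∘ₗ
          TensorAlgebra.ι R ∘ₗ Ψ a = 0 := by
        ext1 w; simp
      have e' := LinearMap.congr_fun (comp_conv (δ := deconc R M)
        (TensorAlgebra.algebraMapInv : TensorAlgebra R M →ₐ[R] R)
        (TensorAlgebra.ι R ∘ₗ Ψ a) LinearMap.id) u
      rw [e, conv_zero_left] at e'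
      exact e'

variable (𝒜 Ψ) in
/-- `braceMul` is a morphism of coalgebras. -/
theorem deconc_comp_braceMul (x : TensorAlgebra R M) : deconc R M ∘ₗ braceMul 𝒜 Ψ x =
    convPair (tensorGr 𝒜) (deconc R M)
      (LinearMap.llcomp R _ _ _ (inclLeft R M).toLinearMap ∘ₗ braceMul 𝒜 Ψ)
      (LinearMap.llcomp R _ _ _ (inclRight R M).toLinearMap ∘ₗ braceMul 𝒜 Ψ) (deconc R M x) := by
  induction x using words_induction_right_homogeneous 𝒜 with
  | h1 =>
    rw [braceMul_one, LinearMap.comp_id, deconc_one,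
      convPair_tmul (tensorGr 𝒜) _ _ _ (one_mem_tensorGr (𝒜 := 𝒜)),
      LinearMap.comp_apply, LinearMap.comp_apply, braceMul_one, twist_zero]
    exact deconc_eq_conv
  | hadd x y hx hy => rw [map_add, LinearMap.comp_add, hx, hy, map_add, map_add]
  | hsmul r x hx => rw [map_smul, LinearMap.comp_smul, hx, map_smul, map_smul]
  | hι q a ha v ih =>
    rw [braceMul_mul_ι Ψ ha, deconc_comp_conv_ι, ← LinearMap.comp_assoc, ih, deconc_mul_ι,
      map_add, convPair_tmul (tensorGr 𝒜) _ _ _ (one_mem_tensorGr (𝒜 := 𝒜)), twist_zero,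
      LinearMap.comp_id, LinearMap.comp_apply, LinearMap.comp_apply, braceMul_one,
      braceMul_mul_ι Ψ ha]
    congr 1
    · induction deconc R M v using tensor_induction (𝒜 := tensorGr 𝒜) (ℬ := tensorGr 𝒜) with
      | h0 => simp
      | hadd x y hx hy => simp only [map_add, LinearMap.add_comp, conv_add_left, hx, hy]
      | h r s x hx y hy =>
        have hya := mul_mem_tensorGr rfl hy (ι_mem_tensorGr 𝒜 ha)
        rw [convPair_tmul (tensorGr 𝒜) _ _ _ hy, LinearMap.lTensor_tmul, LinearMap.mulRight_apply,
          convPair_tmul (tensorGr 𝒜) _ _ _ hya, conv_comp_twist (fun k x hx => deconc_mem hx),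
          conv_assoc deconc_coassoc]
        simp only [LinearMap.comp_assoc, twist_comp, LinearMap.comp_apply,
          LinearMap.llcomp_apply', braceMul_mul_ι Ψ ha]
        rw [comp_conv, comp_conv, LinearMap.comp_id]
    · rw [LinearMap.llcomp_apply', LinearMap.llcomp_apply', LinearMap.comp_id, comp_conv, comp_conv,
        conv_assoc deconc_coassoc, conv_assoc deconc_coassoc, LinearMap.comp_id, ← deconc_eq_conv]

variable (𝒜 Ψ) in
-- As `braceMul` is a coalgebra map, a convolution evaluated on a product splits along the
-- deconcatenations of both arguments. This is the engine of the inductions on word length below.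
theorem conv_comp_braceMul {A : Type*} [Ring A] [Algebra R A]
    (F G : TensorAlgebra R M →ₗ[R] A) (x : TensorAlgebra R M) :
    conv (deconc R M) F G ∘ₗ braceMul 𝒜 Ψ x = convPair (tensorGr 𝒜) (deconc R M)
      (LinearMap.llcomp R _ _ _ F ∘ₗ braceMul 𝒜 Ψ) (LinearMap.llcomp R _ _ _ G ∘ₗ braceMul 𝒜 Ψ)
      (deconc R M x) := by
  have h : conv (deconc R M) F G ∘ₗ braceMul 𝒜 Ψ x =
    (LinearMap.mul' R A ∘ₗ TensorProduct.map F G) ∘ₗ deconc R M ∘ₗ braceMul 𝒜 Ψ x := rfl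
  rw [h, deconc_comp_braceMul]
  induction deconc R M x using tensor_induction (𝒜 := tensorGr 𝒜) (ℬ := tensorGr 𝒜) with
  | h0 => simp
  | hadd x y hx hy => simp only [map_add, LinearMap.comp_add, hx, hy]
  | h r s x hx y hy =>
    rw [convPair_tmul (tensorGr 𝒜) _ _ _ hy, convPair_tmul (tensorGr 𝒜) _ _ _ hy]
    have e := map_comp_deconc_eq_conv (braceMul 𝒜 Ψ x ∘ₗ twist (tensorGr 𝒜) s) (braceMul 𝒜 Ψ y)
    simp only [LinearMap.comp_apply, LinearMap.llcomp_apply', LinearMap.comp_assoc] at e ⊢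
    rw [← e, conv, ← LinearMap.comp_assoc (deconc R M), ← TensorProduct.map_comp]

end

/-! ### Degrees, associativity and differential of the brace product. -/

section

variable {R : Type*} [CommRing R] {M : Type*} [AddCommGroup M] [Module R M]
variable {𝒜 : ℤ → Submodule R M}

/-- A convolution of maps of degrees `c` and `c'` has degree `c + c'`. -/
theorem conv_mem {A : Type*} [Ring A] [Algebra R A] {𝒞 : ℤ → Submodule R A}
    [SetLike.GradedMul 𝒞] {δ : M →ₗ[R] M ⊗[R] M} (hδ : ∀ k, ∀ x ∈ 𝒜 k, δ x ∈ prodGr 𝒜 𝒜 k)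
    {f g : M →ₗ[R] A} {c c' : ℤ} (hf : ∀ k, ∀ x ∈ 𝒜 k, f x ∈ 𝒞 (k + c))
    (hg : ∀ k, ∀ x ∈ 𝒜 k, g x ∈ 𝒞 (k + c')) {k l : ℤ} (hl : k + c + c' = l) {x : M}
    (hx : x ∈ 𝒜 k) : conv δ f g x ∈ 𝒞 l := by
  rw [conv_apply]
  refine prodGr_induction (P := fun z => LinearMap.mul' R A (TensorProduct.map f g z) ∈ 𝒞 l)
    (by simp) (fun x y hx hy => ?_) (fun p q hpq a ha b hb => ?_) (hδ k x hx)
  · rw [map_add, map_add]; exact add_mem hx hy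
  · rw [TensorProduct.map_tmul, LinearMap.mul'_apply]
    exact (show p + c + (q + c') = l by omega) ▸ SetLike.GradedMul.mul_mem (hf p a ha) (hg q b hb)

variable [DirectSum.Decomposition 𝒜] {Ψ : M →ₗ[R] TensorAlgebra R M →ₗ[R] M}

theorem braceMul_mem (hΨ : ∀ k l, ∀ x ∈ 𝒜 k, ∀ w ∈ tensorGr 𝒜 l, Ψ x w ∈ 𝒜 (k + l)) {p q : ℤ}
    {x y : TensorAlgebra R M} (hx : x ∈ tensorGr 𝒜 p) (hy : y ∈ tensorGr 𝒜 q) :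
    braceMul 𝒜 Ψ x y ∈ tensorGr 𝒜 (p + q) := by
  refine tensorGr_induction_right (𝒜 := 𝒜)
    (p := fun p x => ∀ q, ∀ y ∈ tensorGr 𝒜 q, braceMul 𝒜 Ψ x y ∈ tensorGr 𝒜 (p + q))
    ?_ ?_ ?_ ?_ ?_ hx q y hy
  · intro q y hy
    rw [braceMul_one, zero_add]; exact hy
  · intro k q y _
    simp
  · intro k x y _ _ hx hy q z hz
    rw [map_add]; exact add_mem (hx q z hz) (hy q z hz)
  · intro k r x _ hx q z hz
    rw [map_smul]; exact Submodule.smul_mem _ _ (hx q z hz)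
  · intro q p a ha x _ ih r y hy
    rw [braceMul_mul_ι Ψ ha]
    refine conv_mem (𝒜 := tensorGr 𝒜) (𝒞 := tensorGr 𝒜) (c := p) (c' := q)
      (fun k x hx => deconc_mem hx) (fun k z hz => ?_)
      (fun k z hz => conv_mem (𝒜 := tensorGr 𝒜) (𝒞 := tensorGr 𝒜) (c := q) (c' := 0)
        (fun k x hx => deconc_mem hx) (fun k z hz => ?_) (fun k z hz => by simpa using hz)
        (by omega) hz) (by omega) hy
    · rw [add_comm]; exact ih k _ (twist_mem _ hz)
    · rw [add_comm]; exact ι_mem_tensorGr 𝒜 (hΨ _ _ _ ha _ hz)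

theorem braceMul_twist (hΨ : ∀ k l, ∀ x ∈ 𝒜 k, ∀ w ∈ tensorGr 𝒜 l, Ψ x w ∈ 𝒜 (k + l)) (k : ℤ)
    (x : TensorAlgebra R M) :
    twist (tensorGr 𝒜) k ∘ₗ braceMul 𝒜 Ψ x =
      braceMul 𝒜 Ψ (twist (tensorGr 𝒜) k x) ∘ₗ twist (tensorGr 𝒜) k := by
  induction x using induction_homogeneous (𝒜 := tensorGr 𝒜) with
  | h0 => simp
  | hadd x y hx hy => simp only [map_add, LinearMap.comp_add, LinearMap.add_comp, hx, hy]
  | h p x hx =>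
    refine hom_ext (𝒜 := tensorGr 𝒜) fun q y hy => ?_
    rw [LinearMap.comp_apply, LinearMap.comp_apply, twist_of_mem _ _ hx, twist_of_mem _ _ hy,
      twist_of_mem _ _ (braceMul_mem hΨ hx hy)]
    simp only [map_smul, LinearMap.smul_apply, smul_smul]
    congr 1
    rw [← sg_add]
    exact sg_congr (by grind)

variable (𝒜 Ψ) in
theorem deconc_braceMul : deconc R M ∘ₗ TensorProduct.lift (braceMul 𝒜 Ψ) =
    TensorProduct.map (TensorProduct.lift (braceMul 𝒜 Ψ)) (TensorProduct.lift (braceMul 𝒜 Ψ)) ∘ₗ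
      middleSwap (tensorGr 𝒜) (tensorGr 𝒜) ∘ₗ TensorProduct.map (deconc R M) (deconc R M) := by
  refine TensorProduct.ext' fun x y => ?_
  have h := LinearMap.congr_fun (deconc_comp_braceMul 𝒜 Ψ x) y
  simp only [LinearMap.comp_apply, TensorProduct.lift.tmul, TensorProduct.map_tmul] at h ⊢
  rw [h]
  induction deconc R M x using tensor_induction (𝒜 := tensorGr 𝒜) (ℬ := tensorGr 𝒜) with
  | h0 => simp
  | hadd x y hx hy => simp only [map_add, LinearMap.add_apply, TensorProduct.add_tmul, hx, hy]
  | h r s a ha b hb =>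
    rw [convPair_tmul (tensorGr 𝒜) _ _ _ hb, conv_apply]
    induction deconc R M y using tensor_induction (𝒜 := tensorGr 𝒜) (ℬ := tensorGr 𝒜) with
    | h0 => simp
    | hadd x y hx hy => simp only [map_add, TensorProduct.tmul_add, hx, hy]
    | h t u c hc e he =>
      rw [middleSwap_tmul _ _ _ hb hc, map_smul]
      simp [twist_of_mem _ _ hc]

/-- `braceMul` is associative if `x{w}{u} = x{w u}`. -/
theorem braceMul_assoc (hΨ : ∀ k l, ∀ x ∈ 𝒜 k, ∀ w ∈ tensorGr 𝒜 l, Ψ x w ∈ 𝒜 (k + l))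
    (hA : ∀ x w u, Ψ (Ψ x w) u = Ψ x (braceMul 𝒜 Ψ w u)) (x y z : TensorAlgebra R M) :
    braceMul 𝒜 Ψ (braceMul 𝒜 Ψ x y) z = braceMul 𝒜 Ψ x (braceMul 𝒜 Ψ y z) := by
  -- Induction on the length of the resulting word. By `weightProj_succ` its first letter is
  -- compared through `ιInv_braceMul` and `hA`, and the rest by the induction hypothesis.
  have key : ∀ n x y, weightProj R M n ∘ₗ braceMul 𝒜 Ψ (braceMul 𝒜 Ψ x y) =
      weightProj R M n ∘ₗ braceMul 𝒜 Ψ x ∘ₗ braceMul 𝒜 Ψ y := by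
    intro n
    induction n with
    | zero =>
      intro x y
      ext z
      simp [weightProj_zero, algebraMapInv_braceMul, mul_assoc]
    | succ n ih =>
      intro x y
      have e := LinearMap.congr_fun (deconc_braceMul 𝒜 Ψ) (x ⊗ₜ[R] y)
      simp only [LinearMap.comp_apply, TensorProduct.lift.tmul, TensorProduct.map_tmul] at e
      rw [weightProj_succ, conv_comp_braceMul, e, ← LinearMap.comp_assoc, conv_comp_braceMul]
      induction deconc R M x using tensor_induction (𝒜 := tensorGr 𝒜) (ℬ := tensorGr 𝒜) with
      | h0 => simp
      | hadd x y hx hy =>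
        simp only [map_add, LinearMap.add_comp, TensorProduct.add_tmul, hx, hy]
      | h r s a ha b hb =>
        rw [convPair_tmul (tensorGr 𝒜) _ _ _ hb, conv_comp_braceMul]
        induction deconc R M y using tensor_induction (𝒜 := tensorGr 𝒜) (ℬ := tensorGr 𝒜) with
        | h0 => simp
        | hadd x y hx hy => simp only [map_add, TensorProduct.tmul_add, hx, hy]
        | h t u c hc d hd =>
          rw [middleSwap_tmul _ _ _ hb hc, map_smul, map_smul, TensorProduct.map_tmul,
            TensorProduct.lift.tmul, TensorProduct.lift.tmul,
            convPair_tmul (tensorGr 𝒜) _ _ _ (braceMul_mem hΨ hb hd),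
            convPair_tmul (tensorGr 𝒜) _ _ _ hd]
          simp only [LinearMap.comp_apply, LinearMap.llcomp_apply', LinearMap.comp_assoc]
          rw [← LinearMap.comp_assoc (twist (tensorGr 𝒜) u) (braceMul 𝒜 Ψ c),
            braceMul_twist hΨ, twist_of_mem _ _ hc, ih, LinearMap.comp_assoc, twist_comp]
          simp only [map_smul, LinearMap.smul_comp, LinearMap.comp_smul, conv_smul_left]
          congr 2
          ext v
          simp [ιInv_braceMul, algebraMapInv_braceMul, hA, mul_smul, add_assoc]
  exact weight_ext fun n => LinearMap.congr_fun (key n x y) z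

/-- Both sides are coderivations along the coalgebra map `braceMul`, and such maps are determined by
their projections to letters, where the claim is `hι`. The proof is again an induction on the word
length of the result. -/
theorem braceMul_coder (hΨ : ∀ k l, ∀ x ∈ 𝒜 k, ∀ w ∈ tensorGr 𝒜 l, Ψ x w ∈ 𝒜 (k + l))
    {D : TensorAlgebra R M →ₗ[R] TensorAlgebra R M}
    (hD : deconc R M ∘ₗ D =
      (TensorProduct.map D LinearMap.id + TensorProduct.map (twist (tensorGr 𝒜) 1) D) ∘ₗ deconc R M)
    (hDgr : ∀ k, ∀ x ∈ tensorGr 𝒜 k, D x ∈ tensorGr 𝒜 (k - 1))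
    (hε : ∀ x, (TensorAlgebra.algebraMapInv (D x) : R) = 0)
    (hι : ∀ x y, TensorAlgebra.ιInv (D (braceMul 𝒜 Ψ x y)) =
      TensorAlgebra.ιInv (braceMul 𝒜 Ψ (D x) y) +
        TensorAlgebra.ιInv (braceMul 𝒜 Ψ (twist (tensorGr 𝒜) 1 x) (D y)))
    (x y : TensorAlgebra R M) : D (braceMul 𝒜 Ψ x y) =
      braceMul 𝒜 Ψ (D x) y + braceMul 𝒜 Ψ (twist (tensorGr 𝒜) 1 x) (D y) := by
  have key : ∀ n x, weightProj R M n ∘ₗ D ∘ₗ braceMul 𝒜 Ψ x =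
      weightProj R M n ∘ₗ braceMul 𝒜 Ψ (D x) +
        weightProj R M n ∘ₗ braceMul 𝒜 Ψ (twist (tensorGr 𝒜) 1 x) ∘ₗ D := by
    intro n
    induction n with
    | zero =>
      intro x
      ext z
      simp [weightProj_zero, algebraMapInv_braceMul, hε]
    | succ n ih =>
      intro x
      have e := LinearMap.congr_fun hD x
      have e' := LinearMap.congr_fun (comp_twist_of_mem (𝒜 := tensorGr 𝒜) (δ := deconc R M)
        (fun k x hx => deconc_mem hx) 1) x
      simp only [LinearMap.comp_apply] at e e'
      rw [weightProj_succ, ← LinearMap.comp_assoc, conv_comp_coder hD, LinearMap.add_comp,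
        conv_comp_braceMul, conv_comp_braceMul, conv_comp_braceMul, e, ← LinearMap.comp_assoc,
        conv_comp_braceMul, e']
      induction deconc R M x using tensor_induction (𝒜 := tensorGr 𝒜) (ℬ := tensorGr 𝒜) with
      | h0 => simp
      | hadd x y hx hy =>
        simp only [map_add, LinearMap.add_comp, LinearMap.add_apply] at hx hy ⊢
        linear_combination (norm := module) hx + hy
      | h r s a ha b hb =>
        simp only [LinearMap.add_apply, TensorProduct.map_tmul, LinearMap.id_apply, map_add]
        rw [convPair_tmul (tensorGr 𝒜) _ _ _ hb, convPair_tmul (tensorGr 𝒜) _ _ _ hb,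
          convPair_tmul (tensorGr 𝒜) _ _ _ hb,
          convPair_tmul (tensorGr 𝒜) _ _ _ (hDgr _ _ hb),
          convPair_tmul (tensorGr 𝒜) _ _ _ (twist_mem _ hb), conv_comp_coder hD]
        simp only [LinearMap.comp_apply, LinearMap.llcomp_apply', LinearMap.comp_assoc]
        rw [ih, ← LinearMap.comp_assoc _ (braceMul 𝒜 Ψ a) (twist (tensorGr 𝒜) 1),
          braceMul_twist hΨ, twist_of_mem (tensorGr 𝒜) _ hb]
        simp only [map_smul, LinearMap.smul_comp, conv_smul_right, LinearMap.comp_smul,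
          LinearMap.comp_assoc, twist_comp, conv_add_right]
        have e1 : twist (tensorGr 𝒜) s ∘ₗ D = sg R s • (D ∘ₗ twist (tensorGr 𝒜) s) := by
          refine hom_ext (𝒜 := tensorGr 𝒜) fun k x hx => ?_
          simp only [LinearMap.comp_apply, LinearMap.smul_apply]
          rw [twist_of_mem _ _ hx, twist_of_mem _ _ (hDgr _ _ hx), map_smul, smul_smul, ← sg_add]
          congr 1
          exact sg_congr (by grind)
        have e2 : twist (tensorGr 𝒜) (s - 1) = twist (tensorGr 𝒜) (1 + s) :=
          twist_congr _ (by grind)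
        have e3 : (TensorAlgebra.ι R ∘ₗ TensorAlgebra.ιInv) ∘ₗ D ∘ₗ braceMul 𝒜 Ψ a =
            (TensorAlgebra.ι R ∘ₗ TensorAlgebra.ιInv) ∘ₗ braceMul 𝒜 Ψ (D a) +
            (TensorAlgebra.ι R ∘ₗ TensorAlgebra.ιInv) ∘ₗ
              braceMul 𝒜 Ψ (twist (tensorGr 𝒜) 1 a) ∘ₗ D := by
          ext v
          simp [hι]
        have e4 := congrArg (fun f => f ∘ₗ twist (tensorGr 𝒜) s) e3
        simp only [LinearMap.comp_assoc, LinearMap.add_comp] at e4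
        rw [e1, e2, add_comm s 1]
        simp only [LinearMap.comp_smul, conv_smul_left, smul_smul, ← sg_add]
        rw [e4, conv_add_left, sg_even (e := 1 * s + s) (by grind)]
        module
  refine weight_ext fun n => ?_
  simpa using LinearMap.congr_fun (key n x) y

end

/-! ### Finite sums in convolutions. -/

section

variable {R : Type*} [CommRing R] {C : Type*} [AddCommGroup C] [Module R C]
variable {A : Type*} [Ring A] [Algebra R A] {ι : Type*} (δ : C →ₗ[R] C ⊗[R] C)

theorem conv_smul_sum_right (f : C →ₗ[R] A) (s : Finset ι) (r : ι → R) (g : ι → C →ₗ[R] A) :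
    conv δ f (∑ i ∈ s, r i • g i) = ∑ i ∈ s, r i • conv δ f (g i) := by
  classical
  induction s using Finset.induction_on with
  | empty => simp
  | insert a s ha ih =>
    rw [Finset.sum_insert ha, Finset.sum_insert ha, conv_add_right, conv_smul_right, ih]

theorem conv_smul_sum_left (f : C →ₗ[R] A) (s : Finset ι) (r : ι → R) (g : ι → C →ₗ[R] A) :
    conv δ (∑ i ∈ s, r i • g i) f = ∑ i ∈ s, r i • conv δ (g i) f := by
  classical
  induction s using Finset.induction_on with
  | empty => simp
  | insert a s ha ih =>
    rw [Finset.sum_insert ha, Finset.sum_insert ha, conv_add_left, conv_smul_left, ih]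

/-- Meant for counits `a`, `b` as coefficients: each term may be modified as long as its coefficient
does not notice. -/
theorem smul_add_rearrange {V : Type*} [AddCommGroup V] [Module R V] {a b : R}
    {X X' Y Y' Z Z' W : V} (hX : (a * b) • X = (a * b) • X') (hY : a • Y = a • Y')
    (hZ : b • Z = b • Z') :
    b • (a • X + Z) + (a • Y + W) = (a * b) • X' + a • Y' + b • Z' + W := by
  rw [← hX, ← hY, ← hZ]; module

end

/-! ### The bar construction -/

namespace AugDGAlgData

variable {R : Type u} [CommRing R] (A : AugDGAlgData.{u, v} R)

/-- The counit of the bar construction. -/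
abbrev barCounit : A.Bar →ₗ[R] R := (TensorAlgebra.algebraMapInv : A.Bar →ₐ[R] R).toLinearMap

/-- The projection `s a ↦ a` of the bar construction. -/
def barLetter : A.Bar →ₗ[R] A.carrier := A.Red.subtype ∘ₗ TensorAlgebra.ιInv

theorem coe_toRed (x : A.carrier) : (A.toRed x : A.carrier) = x - A.aug x • 1 := rfl

variable {A}

theorem coe_toRed_of_aug {x : A.carrier} (hx : A.aug x = 0) : (A.toRed x : A.carrier) = x := by
  rw [coe_toRed, hx, zero_smul, sub_zero]

theorem aug_coe (x : A.Red) : A.aug (x : A.carrier) = 0 := x.2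

theorem toRed_mem {k : ℤ} {x : A.carrier} (hx : x ∈ A.gr k) : A.toRed x ∈ A.redGr k := by
  change (A.toRed x : A.carrier) ∈ A.gr k
  rw [coe_toRed]
  by_cases hk : k = 0
  · subst hk
    exact sub_mem hx (Submodule.smul_mem _ _ SetLike.GradedOne.one_mem)
  · rw [A.aug_gr k hk x hx, zero_smul, sub_zero]; exact hx

theorem barLetter_mem {k : ℤ} {w : A.Bar} (hw : w ∈ A.barGr k) : A.barLetter w ∈ A.gr (k - 1) :=
  ιInv_mem (𝒜 := shiftGr A.redGr 1) hw

theorem barLetter_twist (k : ℤ) (w : A.Bar) :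
    A.barLetter (twist A.barGr k w) = sg R k • twist A.gr k (A.barLetter w) := by
  induction w using induction_homogeneous (𝒜 := A.barGr) with
  | h0 => simp
  | hadd x y hx hy => simp only [map_add, hx, hy, smul_add]
  | h l w hw =>
    rw [twist_of_mem _ _ hw, map_smul, twist_of_mem _ _ (barLetter_mem hw), smul_smul, ← sg_add]
    congr 1
    exact sg_congr (by simp only [Int.even_add, Int.even_mul, Int.even_sub, Int.not_even_one]; grind)

namespace IsDGAlgebra

variable (hA : A.IsDGAlgebra)
include hA

/-- The sign `(-1)^(|a|+1)` of the quadratic part is the parity of the suspended letter `s a`, so in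
the bar grading this part is a convolution. -/
theorem coe_barDProj (w : A.Bar) : (A.barDProj w : A.carrier) = -A.d (A.barLetter w) +
    conv (deconc R A.Red) (A.barLetter ∘ₗ twist A.barGr 1) A.barLetter w := by
  have h : ∀ z : A.Bar ⊗[R] A.Bar, ((A.toRed (LinearMap.mul' R A.carrier (TensorProduct.map
      (A.Red.subtype ∘ₗ parity A.redGr ∘ₗ TensorAlgebra.ιInv)
        (A.Red.subtype ∘ₗ TensorAlgebra.ιInv) z)) : A.Red) : A.carrier) =
      - LinearMap.mul' R A.carrier (TensorProduct.map
        (A.barLetter ∘ₗ twist A.barGr 1) A.barLetter z) := by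
    intro z
    induction z with
    | zero => simp
    | add x y hx hy => simp only [map_add, Submodule.coe_add, hx, hy, neg_add]
    | tmul a b =>
      simp only [TensorProduct.map_tmul, LinearMap.mul'_apply, LinearMap.comp_apply]
      rw [coe_toRed_of_aug (by rw [map_mul, Submodule.subtype_apply, aug_coe, zero_mul]),
        ← neg_mul, parity_eq_twist, barLetter_twist]
      congr 1
      rw [sg_odd (by decide), neg_smul, neg_neg, one_smul]
      exact map_twist_zero (𝒜 := A.redGr) (ℬ := A.gr) (f := A.Red.subtype) (fun k x hx => hx) 1 _
  rw [barDProj, LinearMap.sub_apply, LinearMap.neg_apply, Submodule.coe_sub, Submodule.coe_neg]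
  simp only [LinearMap.comp_apply]
  rw [h, sub_neg_eq_add, coe_toRed_of_aug (hA.aug_d _)]
  rfl

theorem barDProj_mem {k : ℤ} {w : A.Bar} (hw : w ∈ A.barGr k) :
    A.barDProj w ∈ shiftGr A.redGr 1 (k - 1) := by
  change (A.barDProj w : A.carrier) ∈ A.gr (k - 1 - 1)
  rw [hA.coe_barDProj]
  refine add_mem (neg_mem (hA.d_mem _ _ (barLetter_mem hw))) ?_
  exact conv_mem (𝒜 := A.barGr) (𝒞 := A.gr) (c := -1) (c' := -1) (fun k x hx => deconc_mem hx)
    (fun k x hx => show A.barLetter (twist A.barGr 1 x) ∈ _ from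
      barLetter_mem (twist_mem (𝒜 := A.barGr) hx)) (fun k x hx => barLetter_mem hx) (by omega) hw

omit hA in
theorem barD_eq_conv : A.barD = conv (deconc R A.Red) (twist A.barGr 1)
    (conv (deconc R A.Red) (TensorAlgebra.ι R ∘ₗ A.barDProj) LinearMap.id) := by
  rw [barD, parity_eq_twist]; rfl

omit hA in
theorem algebraMapInv_comp_ι_barDProj_conv (w : A.Bar) :
    (TensorAlgebra.algebraMapInv (conv (deconc R A.Red) (TensorAlgebra.ι R ∘ₗ A.barDProj)
      LinearMap.id w) : R) = 0 := by
  have e : A.barCounit ∘ₗ TensorAlgebra.ι R ∘ₗ A.barDProj = 0 := by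
    ext1 w; simp
  have e' := LinearMap.congr_fun (comp_conv (δ := deconc R A.Red)
    (TensorAlgebra.algebraMapInv : A.Bar →ₐ[R] R)
    (TensorAlgebra.ι R ∘ₗ A.barDProj) LinearMap.id) w
  rw [e, conv_zero_left] at e'
  exact e'

omit hA in
theorem ιInv_barD (w : A.Bar) : TensorAlgebra.ιInv (A.barD w) = A.barDProj w := by
  rw [barD_eq_conv, ιInv_conv (c := 1) (fun u => by rw [algebraMapInv_twist, one_mul])
    algebraMapInv_comp_ι_barDProj_conv, one_smul, ιInv_conv_left]

omit hA in
theorem algebraMapInv_barD (w : A.Bar) : (TensorAlgebra.algebraMapInv (A.barD w) : R) = 0 := by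
  have e : A.barCounit ∘ₗ conv (deconc R A.Red) (TensorAlgebra.ι R ∘ₗ A.barDProj)
      LinearMap.id = 0 := LinearMap.ext algebraMapInv_comp_ι_barDProj_conv
  have e' := LinearMap.congr_fun (comp_conv (δ := deconc R A.Red)
    (TensorAlgebra.algebraMapInv : A.Bar →ₐ[R] R) (twist A.barGr 1)
    (conv (deconc R A.Red) (TensorAlgebra.ι R ∘ₗ A.barDProj) LinearMap.id)) w
  rw [e, conv_zero_right] at e'
  rw [barD_eq_conv]
  exact e'

theorem barD_mem (k : ℤ) (w : A.Bar) (hw : w ∈ A.barGr k) : A.barD w ∈ A.barGr (k - 1) := by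
  rw [barD_eq_conv]
  refine conv_mem (𝒜 := A.barGr) (𝒞 := A.barGr) (c := 0) (c' := -1) (fun k x hx => deconc_mem hx)
    (fun k x hx => by rw [add_zero]; exact twist_mem (𝒜 := A.barGr) hx) (fun k x hx => ?_) (by omega) hw
  refine conv_mem (𝒜 := A.barGr) (𝒞 := A.barGr) (c := -1) (c' := 0) (fun k x hx => deconc_mem hx)
    (fun k x hx => ι_mem_tensorGr _ (hA.barDProj_mem hx)) (fun k x hx => by simpa using hx)
    (by omega) hx

omit hA in
theorem deconc_comp_barD : deconc R A.Red ∘ₗ A.barD =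
    (TensorProduct.map A.barD LinearMap.id + TensorProduct.map (twist A.barGr 1) A.barD) ∘ₗ
      deconc R A.Red := by
  have e : deconc R A.Red ∘ₗ twist A.barGr 1 =
      conv (deconc R A.Red) ((inclLeft R A.Red).toLinearMap ∘ₗ twist A.barGr 1)
        ((inclRight R A.Red).toLinearMap ∘ₗ twist A.barGr 1) := by
    rw [comp_twist_of_mem (𝒜 := A.barGr) (fun k x hx => deconc_mem hx), map_comp_deconc_eq_conv]
  rw [LinearMap.add_comp, map_comp_deconc_eq_conv, map_comp_deconc_eq_conv, barD_eq_conv,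
    deconc_comp_conv_ι, e, comp_conv, comp_conv, comp_conv, comp_conv,
    conv_assoc deconc_coassoc, LinearMap.comp_id, LinearMap.comp_id, conv_assoc deconc_coassoc,
    conv_assoc deconc_coassoc, ← deconc_eq_conv, add_comm]

end IsDGAlgebra

/-! ### Brace operations on differential graded algebras -/

variable (A) in
/-- The restriction of brace operations to the augmentation ideal. -/
def redBrace (Φ : A.carrier →ₗ[R] A.Bar →ₗ[R] A.carrier) : A.Red →ₗ[R] A.Bar →ₗ[R] A.Red :=
  LinearMap.llcomp R _ _ _ A.toRed ∘ₗ Φ ∘ₗ A.Red.subtype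

variable (A) in
/-- The product on the bar construction which is defined by brace operations. -/
def barMul (Φ : A.carrier →ₗ[R] A.Bar →ₗ[R] A.carrier) : A.Bar →ₗ[R] A.Bar →ₗ[R] A.Bar :=
  braceMul (shiftGr A.redGr 1) (A.redBrace Φ)

variable (A) in
/-- Operations `x{w}` of degree `0`, for `w` in the bar construction, which are compatible with the
product and the augmentation. -/
structure IsPreBrace (Φ : A.carrier →ₗ[R] A.Bar →ₗ[R] A.carrier) : Prop where
  mem : ∀ k l, ∀ x ∈ A.gr k, ∀ w ∈ A.barGr l, Φ x w ∈ A.gr (k + l)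
  mul : ∀ x, ∀ l, ∀ y ∈ A.gr l,
    Φ (x * y) = conv (deconc R A.Red) (Φ x ∘ₗ twist A.barGr l) (Φ y)
  unit : ∀ x, Φ x 1 = x
  aug : ∀ x w, A.aug (Φ x w) = A.aug x * A.barCounit w

variable (A) in
/-- The properties of operations `x{w}` which make the bar construction a DG-bialgebra. -/
structure IsBrace (Φ : A.carrier →ₗ[R] A.Bar →ₗ[R] A.carrier) : Prop extends A.IsPreBrace Φ where
  assoc : ∀ x w u, Φ (Φ x w) u = Φ x (A.barMul Φ w u)
  hirsch : ∀ k, ∀ y ∈ A.gr k, A.d ∘ₗ Φ y = Φ (A.d y) +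
    conv (deconc R A.Red) (A.barLetter ∘ₗ twist A.barGr k) (Φ y) -
    sg R k • conv (deconc R A.Red) (Φ y ∘ₗ twist A.barGr 1) A.barLetter +
    sg R k • (Φ y ∘ₗ A.barD)

namespace IsPreBrace

variable {Φ : A.carrier →ₗ[R] A.Bar →ₗ[R] A.carrier} (hΦ : A.IsPreBrace Φ)
include hΦ

theorem coe_redBrace (x : A.Red) (w : A.Bar) : (A.redBrace Φ x w : A.carrier) = Φ x w :=
  coe_toRed_of_aug (by rw [LinearMap.comp_apply, hΦ.aug, Submodule.subtype_apply, aug_coe, zero_mul])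

theorem redBrace_mem (k l : ℤ) (x : A.Red) (hx : x ∈ shiftGr A.redGr 1 k) (w : A.Bar)
    (hw : w ∈ A.barGr l) : A.redBrace Φ x w ∈ shiftGr A.redGr 1 (k + l) := by
  change (A.redBrace Φ x w : A.carrier) ∈ A.gr (k + l - 1)
  rw [hΦ.coe_redBrace, add_sub_right_comm]
  exact hΦ.mem _ _ _ hx _ hw

theorem barLetter_barMul (x w : A.Bar) :
    A.barLetter (A.barMul Φ x w) = A.barCounit x • A.barLetter w + Φ (A.barLetter x) w := by
  have e := congrArg A.Red.subtype (ιInv_braceMul (𝒜 := shiftGr A.redGr 1) (Ψ := A.redBrace Φ) x w)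
  refine e.trans ?_
  rw [map_add, map_smul]
  exact congrArg (fun z => _ + z) (hΦ.coe_redBrace _ _)

theorem barLetter_twist_comp_barMul (s : ℤ) (a : A.Bar) :
    (A.barLetter ∘ₗ twist A.barGr 1) ∘ₗ A.barMul Φ a ∘ₗ twist A.barGr s =
      A.barCounit a • (A.barLetter ∘ₗ twist A.barGr (s + 1)) +
        Φ (A.barLetter (twist A.barGr 1 a)) ∘ₗ twist A.barGr (s + 1) := by
  have e := braceMul_twist (𝒜 := shiftGr A.redGr 1) (Ψ := A.redBrace Φ) hΦ.redBrace_mem 1 a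
  ext w
  have e' := LinearMap.congr_fun e (twist A.barGr s w)
  simp only [LinearMap.comp_apply] at e'
  simp only [LinearMap.comp_apply, LinearMap.add_apply, LinearMap.smul_apply]
  rw [barMul, e', twist_twist, add_comm 1 s]
  have e2 := hΦ.barLetter_barMul (twist A.barGr 1 a) (twist A.barGr (s + 1) w)
  rw [barMul] at e2
  rw [e2, barCounit, AlgHom.toLinearMap_apply, algebraMapInv_twist]
  rfl

/-- The quadratic part of the differential of a product in the bar construction. -/
theorem conv_barLetter_comp_barMul {l : ℤ} {x : A.Bar} (hx : x ∈ A.barGr l) :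
    conv (deconc R A.Red) (A.barLetter ∘ₗ twist A.barGr 1) A.barLetter ∘ₗ A.barMul Φ x =
      A.barCounit x • conv (deconc R A.Red) (A.barLetter ∘ₗ twist A.barGr 1) A.barLetter +
      conv (deconc R A.Red) (A.barLetter ∘ₗ twist A.barGr (l + 1)) (Φ (A.barLetter x)) +
      conv (deconc R A.Red) (Φ (A.barLetter (twist A.barGr 1 x)) ∘ₗ twist A.barGr 1) A.barLetter +
      Φ (conv (deconc R A.Red) (A.barLetter ∘ₗ twist A.barGr 1) A.barLetter x) := by
  -- With `∑ aᵢ ⊗ bᵢ` the deconcatenation of `x`, each factor of the quadratic part is evaluated by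
  -- `barLetter_barMul`, which has two summands. The four products are the four terms of the claim;
  -- the last is a brace of a product, by multiplicativity of `Φ`.
  obtain ⟨n, a, b, r, s, hrs, ha, hb, hz⟩ := exists_expansion (deconc_mem hx)
  have hl := deconc_counit_left x
  have hr := deconc_counit_right x
  rw [barMul, conv_comp_braceMul, conv_apply, hz]
  rw [hz] at hl hr
  simp only [map_sum, LinearMap.rTensor_tmul, LinearMap.lTensor_tmul, TensorProduct.lid_tmul,
    TensorProduct.rid_tmul] at hl hr
  have hε : A.barCounit x = ∑ i, A.barCounit (a i) * A.barCounit (b i) := by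
    conv_lhs => rw [← hl]
    simp
  have h2 : conv (deconc R A.Red) (A.barLetter ∘ₗ twist A.barGr (l + 1)) (Φ (A.barLetter x)) =
      ∑ i, A.barCounit (a i) •
        conv (deconc R A.Red) (A.barLetter ∘ₗ twist A.barGr (l + 1)) (Φ (A.barLetter (b i))) := by
    rw [← conv_smul_sum_right]
    congr 1
    conv_lhs => rw [← hl]
    simp
  have h3 : conv (deconc R A.Red) (Φ (A.barLetter (twist A.barGr 1 x)) ∘ₗ twist A.barGr 1)
      A.barLetter = ∑ i, A.barCounit (b i) • conv (deconc R A.Red)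
        (Φ (A.barLetter (twist A.barGr 1 (a i))) ∘ₗ twist A.barGr 1) A.barLetter := by
    rw [← conv_smul_sum_left]
    congr 1
    conv_lhs => rw [← hr]
    ext; simp
  rw [hε, h2, h3, Finset.sum_smul, map_sum, map_sum, map_sum, map_sum, ← Finset.sum_add_distrib,
    ← Finset.sum_add_distrib, ← Finset.sum_add_distrib]
  refine Finset.sum_congr rfl fun i _ => ?_
  rw [convPair_tmul A.barGr _ _ _ (hb i)]
  have e := hΦ.barLetter_twist_comp_barMul (s i) (a i)
  have e' : A.barLetter ∘ₗ A.barMul Φ (b i) =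
      A.barCounit (b i) • A.barLetter + Φ (A.barLetter (b i)) :=
    LinearMap.ext fun w => hΦ.barLetter_barMul _ _
  simp only [barMul] at e e'
  simp only [LinearMap.comp_apply, LinearMap.llcomp_apply', LinearMap.comp_assoc,
    TensorProduct.map_tmul, LinearMap.mul'_apply] at e ⊢
  have ht : twist A.barGr (s i - 1) = twist A.barGr (s i + 1) := twist_congr _ (by grind)
  rw [e, e', hΦ.mul _ _ _ (barLetter_mem (hb i)), ht]
  simp only [conv_add_left, conv_add_right, conv_smul_left, conv_smul_right]
  -- A counit is nonzero only in degree `0`. Where it occurs the degree of the other factor is thus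
  -- known, and the twists by `s i` become the twists in the claim.
  have hεa : r i ≠ 0 → A.barCounit (a i) = 0 := fun h => algebraMapInv_tensorGr _ h (ha i)
  have hεb : s i ≠ 0 → A.barCounit (b i) = 0 := fun h => algebraMapInv_tensorGr _ h (hb i)
  have hi := hrs i
  refine LinearMap.ext fun w => ?_
  simp only [LinearMap.add_apply, LinearMap.smul_apply]
  refine smul_add_rearrange ?_ ?_ ?_
  · by_cases h : s i = 0
    · rw [h, zero_add]
    · rw [hεb h, mul_zero, zero_smul, zero_smul]
  · by_cases h : r i = 0
    · rw [show s i = l by omega]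
    · rw [hεa h, zero_smul, zero_smul]
  · by_cases h : s i = 0
    · rw [h, zero_add]
    · rw [hεb h, zero_smul, zero_smul]

end IsPreBrace

namespace IsBrace

variable {Φ : A.carrier →ₗ[R] A.Bar →ₗ[R] A.carrier} (hΦ : A.IsBrace Φ)
include hΦ

/-- After `braceMul_coder` only the projection to letters is left. There the linear part of the bar
differential contributes `d(x{y})`, the quadratic part `conv_barLetter_comp_barMul`, and the Hirsch
formula matches them. -/
theorem barD_barMul (hA : A.IsDGAlgebra) (x y : A.Bar) : A.barD (A.barMul Φ x y) =
    A.barMul Φ (A.barD x) y + A.barMul Φ (parity A.barGr x) (A.barD y) := by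
  rw [parity_eq_twist]
  refine braceMul_coder hΦ.redBrace_mem IsDGAlgebra.deconc_comp_barD hA.barD_mem
    IsDGAlgebra.algebraMapInv_barD (fun x y => ?_) x y
  refine Subtype.ext ?_
  change A.barLetter (A.barD (A.barMul Φ x y)) = A.barLetter (A.barMul Φ (A.barD x) y) +
    A.barLetter (A.barMul Φ (twist A.barGr 1 x) (A.barD y))
  have hp : ∀ w, A.barLetter (A.barD w) = -A.d (A.barLetter w) +
      conv (deconc R A.Red) (A.barLetter ∘ₗ twist A.barGr 1) A.barLetter w := fun w => by
    rw [← hA.coe_barDProj, ← IsDGAlgebra.ιInv_barD]; rfl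
  rw [hΦ.barLetter_barMul, hΦ.barLetter_barMul, hp, hp, hp]
  induction x using induction_homogeneous (𝒜 := A.barGr) with
  | h0 => simp
  | hadd x x' hx hx' =>
    simp only [map_add, map_neg, LinearMap.neg_apply, LinearMap.add_apply, add_smul] at hx hx' ⊢
    linear_combination (norm := module) hx + hx'
  | h l x hx =>
    have e := LinearMap.congr_fun (hΦ.conv_barLetter_comp_barMul hx) y
    have e2 := LinearMap.congr_fun (hΦ.hirsch _ _ (barLetter_mem hx)) y
    have ht : twist A.barGr (l - 1) = twist A.barGr (l + 1) := twist_congr _ (by grind)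
    have h1 : A.barCounit (twist A.barGr 1 x) = A.barCounit x := algebraMapInv_twist _ _ _
    have h0 : A.barCounit (A.barD x) = 0 := IsDGAlgebra.algebraMapInv_barD _
    rw [h0, h1, hΦ.barLetter_barMul]
    have hs : sg R (l - 1) = - sg R (1 * l) := by
      rw [one_mul, sg_sub, sg_odd (e := 1) (by decide)]; ring
    rw [twist_of_mem A.barGr 1 hx] at e ⊢
    simp only [LinearMap.comp_apply, LinearMap.add_apply, LinearMap.smul_apply, map_smul, map_add,
      map_neg, LinearMap.sub_apply, LinearMap.neg_apply, LinearMap.smul_comp, conv_smul_left, hs, ht,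
      neg_smul] at e e2 ⊢
    rw [e, e2]
    module

/-- Brace operations on a connected DG-algebra make it a homotopy G-algebra. -/
theorem isHomotopyGAlgebra (hA : A.IsDGAlgebra) (hA' : A.IsConnected) :
    A.IsHomotopyGAlgebra (A.barMul Φ) where
  dgAlgebra := hA
  connected := hA'
  mem p q x hx y hy := braceMul_mem hΦ.redBrace_mem hx hy
  one_mu x := by rw [barMul, braceMul_one]; rfl
  mu_one x := braceMul_apply_one (fun y => Subtype.ext (by rw [hΦ.coe_redBrace, hΦ.unit])) x
  assoc x y z := braceMul_assoc hΦ.redBrace_mem (fun x w u => Subtype.ext (by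
    rw [hΦ.coe_redBrace, hΦ.coe_redBrace, hΦ.coe_redBrace, hΦ.assoc]; rfl)) x y z
  comul := deconc_braceMul _ _
  counit x y := algebraMapInv_braceMul x y
  d_mu x y := hΦ.barD_barMul hA x y
  E_eq_zero i j hi _ x hx y _ := by
    rw [barMul, ιInv_braceMul, algebraMapInv_of_weight (by omega) hx,
      ιInv_of_weight (by omega) hx, map_zero, LinearMap.zero_apply, zero_smul, add_zero]

end IsBrace

end AugDGAlgData

namespace DGCoalgData

variable {R : Type u} [CommRing R] {B : DGCoalgData.{u, v} R}
  {m : B.carrier ⊗[R] B.carrier →ₗ[R] B.carrier} {S : B.carrier →ₗ[R] B.carrier}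

/-! ### The cobar construction as a DG-algebra -/

theorem twist_comp_letter : twist B.cobarGr 1 ∘ₗ B.letter = -(B.letter ∘ₗ twist B.gr 1) := by
  refine hom_ext (𝒜 := B.gr) fun k x hx => ?_
  rw [LinearMap.comp_apply, LinearMap.neg_apply, LinearMap.comp_apply, twist_of_mem _ _ hx,
    twist_of_mem _ _ (letter_mem hx), map_smul, ← neg_smul]
  congr 1
  rw [mul_sub, sg_sub, sg_odd (e := 1 * 1) (by decide)]; ring

namespace IsDGCoalgebra

/-- On letters the three parts vanish by `d² = 0`, by the coderivation property and by
coassociativity, all in convolution form. The square of an odd derivation is a derivation, so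
letters suffice. -/
theorem cobarD_cobarD (hB : B.IsDGCoalgebra) (x : B.Cobar) : B.cobarD (B.cobarD x) = 0 := by
  have hl : B.cobarD ∘ₗ B.letter = -(B.letter ∘ₗ B.d) +
      conv B.comul (B.letter ∘ₗ twist B.gr 1) B.letter :=
    LinearMap.ext fun b => cobarD_letter hB b
  have h1 : B.cobarD ∘ₗ B.cobarD ∘ₗ B.letter = 0 := by
    have hdd : B.d ∘ₗ B.d = 0 := LinearMap.ext hB.d_d
    have hl' : ∀ f : B.carrier →ₗ[R] B.carrier, B.cobarD ∘ₗ B.letter ∘ₗ f =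
      -(B.letter ∘ₗ B.d ∘ₗ f) + conv B.comul (B.letter ∘ₗ twist B.gr 1) B.letter ∘ₗ f := fun f => by
      rw [← LinearMap.comp_assoc, hl]; rfl
    have ht : twist B.cobarGr 1 ∘ₗ B.letter ∘ₗ twist B.gr 1 = -B.letter := by
      rw [← LinearMap.comp_assoc, twist_comp_letter, LinearMap.neg_comp, LinearMap.comp_assoc,
        twist_comp, twist_congr (k := 1 + 1) (l := 0) B.gr (by decide), twist_zero,
        LinearMap.comp_id]
    have hd := twist_comp_twist_d hB 1
    rw [sg_odd (by decide)] at hd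
    rw [hl, LinearMap.comp_add, LinearMap.comp_neg, d_conv, ht, hl', hl', hl, hdd,
      conv_comp_d hB, conv_comp_twist hB.comul_mem, LinearMap.comp_assoc, LinearMap.comp_assoc,
      twist_comp, twist_congr (k := 1 + 1) (l := 0) B.gr (by decide), twist_zero,
      LinearMap.comp_id, hd]
    simp only [LinearMap.comp_smul, conv_add_left, conv_add_right, conv_neg_left, conv_neg_right,
      conv_smul_left, conv_assoc hB.coassoc, LinearMap.comp_zero]
    module
  induction x using words_induction with
  | h1 => rw [cobarD_one, map_zero]
  | hadd x y hx hy => rw [map_add, map_add, hx, hy, add_zero]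
  | hsmul r x hx => rw [map_smul, map_smul, hx, smul_zero]
  | hι a x hx =>
    induction a using induction_homogeneous (𝒜 := B.sgr) with
    | h0 => simp
    | hadd a b ha hb => rw [map_add, add_mul, map_add, map_add, ha, hb, add_zero]
    | h p a hp =>
      have ha := LinearMap.congr_fun h1 (a : B.carrier)
      simp only [LinearMap.comp_apply, letter_coe, LinearMap.zero_apply] at ha
      have hι := ι_mem_tensorGr B.sgr hp
      rw [cobarD_flip_mul _ _ hι, map_add, map_smul, cobarD_flip_mul _ _ hι,
        cobarD_flip_mul _ _ (cobarD_mem hB hι), ha, hx, sg_sub, sg_odd (e := 1) (by decide)]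
      simp

theorem algebraMapInv_cobarD (hB : B.IsDGCoalgebra) (x : B.Cobar) :
    (TensorAlgebra.algebraMapInv (B.cobarD x) : R) = 0 := by
  have hl : ∀ b, (TensorAlgebra.algebraMapInv (B.letter b) : R) = 0 := fun b => algebraMapInv_ι _
  induction x using words_induction with
  | h1 => rw [cobarD_one, map_zero]
  | hadd x y hx hy => rw [map_add, map_add, hx, hy, add_zero]
  | hsmul r x hx => rw [map_smul, map_smul, hx, smul_zero]
  | hι a x hx =>
    have e := LinearMap.congr_fun (comp_conv (δ := B.comul)
      (TensorAlgebra.algebraMapInv : B.Cobar →ₐ[R] R) (B.letter ∘ₗ twist B.gr 1) B.letter) a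
    rw [show (TensorAlgebra.algebraMapInv : B.Cobar →ₐ[R] R).toLinearMap ∘ₗ B.letter = 0 from
      LinearMap.ext hl, conv_zero_right] at e
    have e' : (TensorAlgebra.algebraMapInv (conv B.comul (B.letter ∘ₗ twist B.gr 1) B.letter a) : R)
      = 0 := e
    have ha : (TensorAlgebra.algebraMapInv (B.cobarD (TensorAlgebra.ι R a)) : R) = 0 := by
      rw [← letter_coe, cobarD_letter hB, map_add, map_neg, hl, e', neg_zero, add_zero]
    rw [cobarD_mul, map_add, map_mul, map_mul, ha, hx]
    simp

theorem cobar_isDGAlgebra (hB : B.IsDGCoalgebra) : B.cobar.IsDGAlgebra where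
  d_mem k x hx := cobarD_mem hB hx
  d_d := hB.cobarD_cobarD
  leibniz x y := by rw [parity_eq_twist]; exact cobarD_mul _ x y
  aug_d := hB.algebraMapInv_cobarD

end IsDGCoalgebra

theorem IsReduced.cobar_isConnected (hB : B.IsReduced 1) : B.cobar.IsConnected where
  neg _ hk := CobarCoproduct.IsReduced.cobarGr_neg hB hk
  zero := CobarCoproduct.IsReduced.cobarGr_zero le_rfl hB

/-! ### The brace operations on the cobar construction -/

variable (m) in
theorem letterBrace_apply (a : B.Red) : B.letterBrace m a =
    B.cobar.barCounit.smulRight (TensorAlgebra.ι R a) +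
      B.diamond m (a : B.carrier) ∘ₗ B.singleLetter := rfl

theorem brace_one : B.brace m 1 = B.cobar.barCounit.smulRight (1 : B.Cobar) := by
  ext1 w
  simp [brace, Algebra.algebraMap_eq_smul_one]

theorem brace_mul_ι {q : ℤ} {a : B.Red} (ha : a ∈ B.sgr q) (x : B.Cobar) :
    B.brace m (x * TensorAlgebra.ι R a) = conv (deconc R B.cobar.Red)
      (B.brace m x ∘ₗ twist B.cobar.barGr q) (B.letterBrace m a) := by
  ext1 w
  simp only [brace, LinearMap.comp_apply, AlgHom.toLinearMap_apply, map_mul,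
    TensorAlgebra.lift_ι_apply, LinearEquiv.coe_coe, MulOpposite.coe_opLinearEquiv_symm,
    MulOpposite.coe_opLinearEquiv, MulOpposite.unop_mul, MulOpposite.unop_op,
    LinearMap.applyₗ_apply_apply, Module.End.mul_apply]
  rw [conv_apply, braceStep]
  simp only [LinearMap.mk₂_apply, LinearMap.comp_apply]
  induction deconc R B.cobar.Red w with
  | zero => simp
  | add x y hx hy => simp only [map_add, hx, hy]
  | tmul y z =>
    simp only [LinearMap.rTensor_tmul, LinearMap.comp_apply, LinearMap.flip_apply,
      TensorProduct.mk_apply, LinearEquiv.coe_coe]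
    rw [koszulSign_tmul _ _ _ ha]
    simp

theorem brace_ι (a : B.Red) : B.brace m (TensorAlgebra.ι R a) = B.letterBrace m a := by
  induction a using induction_homogeneous (𝒜 := B.sgr) with
  | h0 => simp
  | hadd a b ha hb => rw [map_add, map_add, map_add, ha, hb]
  | h q a ha =>
    have e := brace_mul_ι (m := m) ha 1
    have e1 : B.cobar.barCounit.smulRight (1 : B.Cobar) ∘ₗ twist B.cobar.barGr q =
        B.cobar.barCounit.smulRight (1 : B.Cobar) := by
      ext1 w
      exact congrArg (fun r : R => r • (1 : B.Cobar)) (algebraMapInv_twist _ q w)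
    rw [one_mul, brace_one, e1, conv_one_left deconc_counit_left] at e
    rw [e]
    ext1; simp

/-- The brace operations are multiplicative. -/
theorem brace_mul (x : B.Cobar) {l : ℤ} {y : B.Cobar} (hy : y ∈ B.cobarGr l) :
    B.brace m (x * y) = conv (deconc R B.cobar.Red)
      (B.brace m x ∘ₗ twist B.cobar.barGr l) (B.brace m y) := by
  refine tensorGr_induction_right (𝒜 := B.sgr) (p := fun l y => B.brace m (x * y) =
    conv (deconc R B.cobar.Red) (B.brace m x ∘ₗ twist B.cobar.barGr l) (B.brace m y))
    ?_ ?_ ?_ ?_ ?_ hy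
  · rw [mul_one, brace_one, conv_one_right deconc_counit_right, twist_zero]
    ext1; simp
  · intro k; simp
  · intro k y _ z _ hy hz
    rw [mul_add, map_add, map_add, hy, hz, conv_add_right]
  · intro k r y _ hy
    rw [mul_smul_comm, map_smul, map_smul, hy, conv_smul_right]
  · intro q k a ha y hy ih
    rw [← mul_assoc, brace_mul_ι ha, ih, brace_mul_ι ha,
      conv_comp_twist (𝒜 := B.cobar.barGr) (fun k x hx => deconc_mem hx),
      conv_assoc deconc_coassoc, LinearMap.comp_assoc, twist_comp]

theorem singleLetter_one : B.singleLetter 1 = 0 := by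
  change B.cobar.Red.subtype (TensorAlgebra.ιInv 1) = 0
  rw [ιInv_one]; rfl

theorem brace_apply_one (x : B.Cobar) : B.brace m x 1 = x := by
  induction x using words_induction_right_homogeneous B.sgr with
  | h1 => rw [brace_one]; simp
  | hadd x y hx hy => rw [map_add, LinearMap.add_apply, hx, hy]
  | hsmul r x hx => rw [map_smul, LinearMap.smul_apply, hx]
  | hι q a ha x ih =>
    rw [brace_mul_ι ha, conv_apply, deconc_one, TensorProduct.map_tmul, LinearMap.mul'_apply,
      LinearMap.comp_apply, twist_one, ih, letterBrace_apply]
    simp [singleLetter_one]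

theorem algebraMapInv_diamond (h : B.carrier) (x : B.Cobar) :
    (TensorAlgebra.algebraMapInv (B.diamond m h x) : R) =
      B.counit h * TensorAlgebra.algebraMapInv x := by
  have key : ∀ x : B.Cobar, (TensorAlgebra.algebraMapInv : B.Cobar →ₐ[R] R).toLinearMap ∘ₗ
      (B.diamond m).flip x = (TensorAlgebra.algebraMapInv x : R) • B.counit := by
    intro x
    induction x using words_induction with
    | h1 => rw [diamond_flip_one]; ext1; simp
    | hadd x y hx hy => rw [map_add, LinearMap.comp_add, hx, hy, map_add, add_smul]
    | hsmul r x hx => rw [map_smul, LinearMap.comp_smul, hx, map_smul, smul_eq_mul, mul_smul]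
    | hι a x hx =>
      rw [map_mul TensorAlgebra.algebraMapInv, algebraMapInv_ι, zero_mul, zero_smul]
      induction a using induction_homogeneous (𝒜 := B.sgr) with
      | h0 => simp
      | hadd a b ha hb => rw [map_add, add_mul, map_add, LinearMap.comp_add, ha, hb, add_zero]
      | h q a ha =>
        have e : (TensorAlgebra.algebraMapInv : B.Cobar →ₐ[R] R).toLinearMap ∘ₗ
            B.letter ∘ₗ mulR m a = 0 := LinearMap.ext fun b => algebraMapInv_ι _
        rw [diamond_ι_mul ha, comp_conv, e, conv_zero_left]
  rw [mul_comm]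
  exact LinearMap.congr_fun (key x) h

theorem algebraMapInv_brace (x : B.Cobar) (w : B.cobar.Bar) :
    (TensorAlgebra.algebraMapInv (B.brace m x w) : R) =
      TensorAlgebra.algebraMapInv x * B.cobar.barCounit w := by
  induction x using words_induction_right_homogeneous B.sgr with
  | h1 => rw [brace_one]; simp
  | hadd x y hx hy => rw [map_add, LinearMap.add_apply, map_add, hx, hy, map_add, add_mul]
  | hsmul r x hx =>
    rw [map_smul, LinearMap.smul_apply, map_smul, hx, map_smul, smul_eq_mul, smul_eq_mul, mul_assoc]
  | hι q a ha x ih =>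
    have e : (TensorAlgebra.algebraMapInv : B.Cobar →ₐ[R] R).toLinearMap ∘ₗ
        B.letterBrace m a = 0 := by
      ext1 w
      have ha0 : B.counit (a : B.carrier) = 0 := a.2
      simp [letterBrace_apply, algebraMapInv_ι, algebraMapInv_diamond, ha0]
    have e' := LinearMap.congr_fun (comp_conv (δ := deconc R B.cobar.Red)
      (TensorAlgebra.algebraMapInv : B.Cobar →ₐ[R] R) (B.brace m x ∘ₗ twist B.cobar.barGr q)
      (B.letterBrace m a)) w
    rw [e, conv_zero_right] at e'
    rw [brace_mul_ι ha, map_mul, algebraMapInv_ι, mul_zero, zero_mul]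
    exact e'


variable {R : Type u} [CommRing R] {B : DGCoalgData.{u, v} R}
  {m : B.carrier ⊗[R] B.carrier →ₗ[R] B.carrier} {S : B.carrier →ₗ[R] B.carrier}

theorem coe_toRed_of_counit {x : B.carrier} (hx : B.counit x = 0) :
    (B.toRed x : B.carrier) = x := by
  rw [coe_toRed, hx, zero_smul, sub_zero]

theorem singleLetter_mem {k : ℤ} {w : B.cobar.Bar} (hw : w ∈ B.cobar.barGr k) :
    B.singleLetter w ∈ B.cobarGr (k - 1) := AugDGAlgData.barLetter_mem hw

namespace IsInvolutiveDGHopf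

variable (hB : B.IsInvolutiveDGHopf m S)
include hB

theorem letterBrace_mem {k l : ℤ} {a : B.Red} (ha : a ∈ B.sgr k) {w : B.cobar.Bar}
    (hw : w ∈ B.cobar.barGr l) : B.letterBrace m a w ∈ B.cobarGr (k + l) := by
  rw [letterBrace_apply]
  refine add_mem ?_ ?_
  · rw [LinearMap.smulRight_apply]
    by_cases hl : l = 0
    · rw [hl, add_zero]; exact Submodule.smul_mem _ _ (ι_mem_tensorGr _ ha)
    · rw [show B.cobar.barCounit w = 0 from algebraMapInv_tensorGr _ hl hw, zero_smul]
      exact zero_mem _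
  · have := hB.diamond_mem (B.mem_sgr.1 ha) (singleLetter_mem hw)
    rwa [show k + 1 + (l - 1) = k + l by ring] at this

theorem brace_mem (k l : ℤ) (x : B.Cobar) (hx : x ∈ B.cobarGr k) (w : B.cobar.Bar)
    (hw : w ∈ B.cobar.barGr l) : B.brace m x w ∈ B.cobarGr (k + l) := by
  refine tensorGr_induction_right (𝒜 := B.sgr) (p := fun k x => ∀ l, ∀ w ∈ B.cobar.barGr l,
    B.brace m x w ∈ B.cobarGr (k + l)) ?_ ?_ ?_ ?_ ?_ hx l w hw
  · intro l w hw
    rw [brace_one, LinearMap.smulRight_apply, zero_add]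
    by_cases hl : l = 0
    · rw [hl]; exact Submodule.smul_mem _ _ (one_mem_tensorGr (𝒜 := B.sgr))
    · rw [show B.cobar.barCounit w = 0 from algebraMapInv_tensorGr _ hl hw, zero_smul]
      exact zero_mem _
  · intro k l w _; simp
  · intro k x _ y _ hx hy l w hw
    rw [map_add]; exact add_mem (hx l w hw) (hy l w hw)
  · intro k r x _ hx l w hw
    rw [map_smul]; exact Submodule.smul_mem _ _ (hx l w hw)
  · intro q k a ha x _ ih l w hw
    rw [brace_mul_ι ha]
    refine conv_mem (𝒜 := B.cobar.barGr) (𝒞 := B.cobarGr) (c := k) (c' := q)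
      (fun k x hx => deconc_mem hx) (fun l w hw => ?_) (fun l w hw => ?_) (by omega) hw
    · rw [add_comm]; exact ih _ _ (twist_mem (𝒜 := B.cobar.barGr) hw)
    · rw [add_comm]; exact hB.letterBrace_mem ha hw

theorem isPreBrace_brace : B.cobar.IsPreBrace (B.brace m) where
  mem := hB.brace_mem
  mul x _ _ hy := brace_mul x hy
  unit := brace_apply_one
  aug := algebraMapInv_brace

/-- The action of `B` on a convolution. -/
theorem diamond_comp_conv {h : B.carrier} {n : ℕ} {a b : Fin n → B.carrier} {s : Fin n → ℤ}
    (hb : ∀ i, b i ∈ B.gr (s i)) (hh : B.comul h = ∑ i, a i ⊗ₜ[R] b i) {c : ℤ}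
    {f : B.cobar.Bar →ₗ[R] B.Cobar} (hf : ∀ k, ∀ w ∈ B.cobar.barGr k, f w ∈ B.cobarGr (k + c))
    (g : B.cobar.Bar →ₗ[R] B.Cobar) :
    B.diamond m h ∘ₗ conv (deconc R B.cobar.Red) f g = ∑ i, sg R (c * s i) •
      conv (deconc R B.cobar.Red) (B.diamond m (a i) ∘ₗ f ∘ₗ twist B.cobar.barGr (s i))
        (B.diamond m (b i) ∘ₗ g) := by
  refine LinearMap.ext fun w => ?_
  simp only [LinearMap.comp_apply, LinearMap.sum_apply, LinearMap.smul_apply, conv_apply]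
  induction deconc R B.cobar.Red w using tensor_induction
    (𝒜 := B.cobar.barGr) (ℬ := B.cobar.barGr) with
  | h0 => simp
  | hadd x y hx hy => simp only [map_add, hx, hy, smul_add, Finset.sum_add_distrib]
  | h k l x hx y hy =>
    simp only [TensorProduct.map_tmul, LinearMap.mul'_apply, LinearMap.comp_apply]
    have e := LinearMap.congr_fun (hB.diamond_flip_mul (hf k x hx) (g y)) h
    rw [LinearMap.flip_apply] at e
    rw [e, conv_apply, hh, map_sum, map_sum]
    refine Finset.sum_congr rfl fun i _ => ?_
    rw [TensorProduct.map_tmul, LinearMap.mul'_apply, LinearMap.comp_apply,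
      twist_of_mem _ _ (hb i), twist_of_mem _ _ hx]
    simp only [map_smul, LinearMap.flip_apply, smul_mul_assoc, mul_smul_comm, smul_smul]
    rw [← sg_add]
    congr 1
    exact sg_congr (by simp only [Int.even_add, Int.even_mul]; grind)

/-- Inserting a word into the letter of `h a` is `(h a) ⋄ y = h ⋄ (a ⋄ y)`, that is, associativity
of the action. -/
theorem brace_diamond_ι (h : B.carrier) (a : B.Red) :
    B.brace m (B.diamond m h (TensorAlgebra.ι R a)) = B.diamond m h ∘ₗ B.letterBrace m a := by
  have h0 : B.counit (m (h ⊗ₜ[R] (a : B.carrier))) = 0 := by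
    rw [hB.counit_m, show B.counit (a : B.carrier) = 0 from a.2, mul_zero]
  rw [hB.diamond_ι, letter, LinearMap.comp_apply, brace_ι]
  ext1 w
  simp only [letterBrace_apply, LinearMap.add_apply, LinearMap.comp_apply,
    LinearMap.smulRight_apply, map_add, map_smul]
  rw [coe_toRed_of_counit h0, hB.diamond_m, hB.diamond_ι]
  rfl

/-- The brace operations commute with the action of `B`. -/
theorem brace_diamond (h : B.carrier) (y : B.Cobar) :
    B.brace m (B.diamond m h y) = B.diamond m h ∘ₗ B.brace m y := by
  induction y using induction_homogeneous (𝒜 := B.cobarGr) with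
  | h0 => simp
  | hadd x y hx hy => simp only [map_add, LinearMap.comp_add, hx, hy]
  | h k y hy =>
    refine tensorGr_induction_right (𝒜 := B.sgr) (p := fun k y => ∀ h,
      B.brace m (B.diamond m h y) = B.diamond m h ∘ₗ B.brace m y) ?_ ?_ ?_ ?_ ?_ hy h
    · intro h
      rw [diamond_one, map_smul, brace_one]
      ext1 w
      simp [diamond_one, smul_comm (B.counit h)]
    · intro k h; simp
    · intro k x _ y _ hx hy h
      simp only [map_add, LinearMap.comp_add, hx, hy]
    · intro k r x _ hx h
      simp only [map_smul, LinearMap.comp_smul, hx]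
    · intro q k a ha y hy ih h
      induction h using induction_homogeneous (𝒜 := B.gr) with
      | h0 => simp
      | hadd x y hx hy => simp only [map_add, LinearMap.add_apply, LinearMap.add_comp, hx, hy]
      | h p h hh =>
        -- Two coproducts occur, that of `h` and the deconcatenation of the inserted word. Expanding
        -- the first as a finite sum leaves a convolution over the second only.
        obtain ⟨n, x, y', r, s, hrs, hx, hy', hz⟩ := exists_expansion (hB.coalg.comul_mem p h hh)
        have hc : ∀ l, ∀ w ∈ B.cobar.barGr l, (B.brace m y ∘ₗ twist B.cobar.barGr q) w ∈
            B.cobarGr (l + k) := fun l w hw => by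
          rw [add_comm]; exact hB.brace_mem _ _ _ hy _ (twist_mem (𝒜 := B.cobar.barGr) hw)
        have e := LinearMap.congr_fun (hB.diamond_flip_mul hy (TensorAlgebra.ι R a)) h
        rw [LinearMap.flip_apply] at e
        rw [brace_mul_ι ha, hB.diamond_comp_conv hy' hz hc, e, conv_apply, hz]
        simp only [map_sum]
        refine Finset.sum_congr rfl fun i _ => ?_
        have hya := hB.diamond_mem (hy' i) (ι_mem_tensorGr B.sgr ha)
        rw [TensorProduct.map_tmul, LinearMap.mul'_apply, LinearMap.comp_apply,
          twist_of_mem _ _ (hy' i)]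
        simp only [map_smul, LinearMap.flip_apply, mul_smul_comm]
        rw [brace_mul _ hya, ih, hB.brace_diamond_ι, LinearMap.comp_assoc, LinearMap.comp_assoc,
          twist_comp, add_comm q]

/-- For a single letter this is the compatibility of the braces with the action (`brace_diamond`).
It extends to words because the braces are multiplicative and the bar product is a coalgebra map. -/
theorem brace_brace (x : B.Cobar) (w u : B.cobar.Bar) :
    B.brace m (B.brace m x w) u = B.brace m x (B.cobar.barMul (B.brace m) w u) := by
  have hp := hB.isPreBrace_brace
  have hε : ∀ w u, B.cobar.barCounit (B.cobar.barMul (B.brace m) w u) =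
      B.cobar.barCounit w * B.cobar.barCounit u := fun w u => algebraMapInv_braceMul w u
  have hletter : ∀ (a : B.Red) (w : B.cobar.Bar), B.brace m (B.letterBrace m a w) =
      B.letterBrace m a ∘ₗ B.cobar.barMul (B.brace m) w := by
    intro a w
    ext1 u
    have e := hp.barLetter_barMul w u
    change B.singleLetter _ = B.cobar.barCounit w • B.singleLetter u +
      B.brace m (B.singleLetter w) u at e
    rw [LinearMap.comp_apply, letterBrace_apply]
    simp only [LinearMap.add_apply, LinearMap.smulRight_apply, LinearMap.comp_apply, map_add,
      map_smul, LinearMap.smul_apply]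
    rw [hB.brace_diamond, brace_ι, letterBrace_apply, e, hε]
    simp only [LinearMap.add_apply, LinearMap.smulRight_apply, LinearMap.comp_apply, map_add,
      map_smul]
    module
  suffices h : ∀ w, B.brace m (B.brace m x w) = B.brace m x ∘ₗ B.cobar.barMul (B.brace m) w from
    LinearMap.congr_fun (h w) u
  induction x using words_induction_right_homogeneous B.sgr with
  | h1 =>
    intro w
    refine LinearMap.ext fun u => ?_
    rw [brace_one, LinearMap.comp_apply, LinearMap.smulRight_apply, LinearMap.smulRight_apply,
      map_smul, LinearMap.smul_apply, brace_one, LinearMap.smulRight_apply, smul_smul, hε]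
  | hadd x y hx hy => intro w; rw [map_add, LinearMap.add_apply, map_add, hx, hy]; rfl
  | hsmul r x hx => intro w; rw [map_smul, LinearMap.smul_apply, map_smul, hx]; rfl
  | hι q a ha x ih =>
    intro w
    have hbm : B.cobar.barMul (B.brace m) =
      braceMul (shiftGr B.cobar.redGr 1) (B.cobar.redBrace (B.brace m)) := rfl
    rw [brace_mul_ι ha, hbm, conv_comp_braceMul, conv_apply]
    induction deconc R B.cobar.Red w using tensor_induction
      (𝒜 := B.cobar.barGr) (ℬ := B.cobar.barGr) with
    | h0 => simp
    | hadd x y hx hy => simp only [map_add, hx, hy]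
    | h k l y hy z hz =>
      rw [convPair_tmul B.cobar.barGr _ _ _ hz, TensorProduct.map_tmul, LinearMap.mul'_apply,
        brace_mul _ (hB.letterBrace_mem ha hz), hletter, LinearMap.comp_apply, ih]
      have et := braceMul_twist (𝒜 := shiftGr B.cobar.redGr 1) (Ψ := B.cobar.redBrace (B.brace m))
        hp.redBrace_mem q y
      simp only [LinearMap.comp_apply, LinearMap.llcomp_apply', LinearMap.comp_assoc]
      rw [← LinearMap.comp_assoc _ (braceMul (shiftGr B.cobar.redGr 1) (B.cobar.redBrace (B.brace m)) y)
        (twist B.cobar.barGr q), et, LinearMap.comp_assoc, twist_comp]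
      rfl

end IsInvolutiveDGHopf

/-! ### The Hirsch formula for the braces on `ΩB`. -/

variable {R : Type u} [CommRing R] {B : DGCoalgData.{u, v} R}
  {m : B.carrier ⊗[R] B.carrier →ₗ[R] B.carrier} {S : B.carrier →ₗ[R] B.carrier}

section

variable {C : Type*} [AddCommGroup C] [Module R C] {𝒯 : ℤ → Submodule R C}
  [DirectSum.Decomposition 𝒯] {δ : C →ₗ[R] C ⊗[R] C} {A : Type*} [Ring A] [Algebra R A]

/-- The Hirsch formula for a product. -/
theorem comp_conv_of_hirsch
    (hδ : (TensorProduct.assoc R C C C).toLinearMap ∘ₗ δ.rTensor C ∘ₗ δ = δ.lTensor C ∘ₗ δ)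
    (hδ' : ∀ k, ∀ x ∈ 𝒯 k, δ x ∈ prodGr 𝒯 𝒯 k) {D : C →ₗ[R] C}
    (hD : δ ∘ₗ D = (TensorProduct.map D LinearMap.id + TensorProduct.map (twist 𝒯 1) D) ∘ₗ δ)
    (hD' : ∀ k, ∀ x ∈ 𝒯 k, D x ∈ 𝒯 (k - 1)) {d σ : A →ₗ[R] A}
    (hd : ∀ x y, d (x * y) = d x * y + σ x * d y) {k q : ℤ} {p f f' g g' : C →ₗ[R] A}
    (hf : d ∘ₗ f = f' + conv δ (p ∘ₗ twist 𝒯 k) f - sg R k • conv δ (f ∘ₗ twist 𝒯 1) p +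
      sg R k • (f ∘ₗ D))
    (hg : d ∘ₗ g = g' + conv δ (p ∘ₗ twist 𝒯 q) g - sg R q • conv δ (g ∘ₗ twist 𝒯 1) p +
      sg R q • (g ∘ₗ D)) (hσ : σ ∘ₗ f = sg R k • (f ∘ₗ twist 𝒯 1)) :
    d ∘ₗ conv δ (f ∘ₗ twist 𝒯 q) g =
      conv δ (f' ∘ₗ twist 𝒯 q) g + sg R k • conv δ (f ∘ₗ twist 𝒯 (q - 1)) g' +
      conv δ (p ∘ₗ twist 𝒯 (k + q)) (conv δ (f ∘ₗ twist 𝒯 q) g) -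
      sg R (k + q) • conv δ (conv δ (f ∘ₗ twist 𝒯 q) g ∘ₗ twist 𝒯 1) p +
      sg R (k + q) • (conv δ (f ∘ₗ twist 𝒯 q) g ∘ₗ D) := by
  have e2 : twist 𝒯 q ∘ₗ D = sg R q • (D ∘ₗ twist 𝒯 q) := by
    refine hom_ext (𝒜 := 𝒯) fun l w hw => ?_
    rw [LinearMap.comp_apply, LinearMap.smul_apply, LinearMap.comp_apply, twist_of_mem _ _ hw,
      twist_of_mem _ _ (hD' _ _ hw), map_smul, smul_smul, ← sg_add]
    congr 1
    exact sg_congr (by grind)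
  -- The terms in which `p` stands between `f` and `g` come from both formulas, with opposite signs,
  -- and cancel.
  rw [der_comp_conv hd, ← LinearMap.comp_assoc, hf, ← LinearMap.comp_assoc, hσ, hg,
    conv_comp_coder hD]
  simp only [LinearMap.add_comp, LinearMap.sub_comp, LinearMap.smul_comp, LinearMap.comp_assoc,
    twist_comp, conv_add_left, conv_add_right, conv_sub_left, conv_sub_right, conv_smul_left,
    conv_smul_right, conv_comp_twist hδ', conv_assoc hδ, e2, LinearMap.comp_smul]
  rw [twist_congr (k := q - 1) (l := 1 + q) 𝒯 (by grind), add_comm q 1, sg_add]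
  have hq : sg R q * sg R q = 1 := by rw [← sg_add, sg_even ⟨q, rfl⟩]
  linear_combination (norm := module) (-sg R k * (hq : sg R q * sg R q = 1)) •
    conv δ (f ∘ₗ D ∘ₗ twist 𝒯 q) g

end

theorem sg_eq_neg {a b : ℤ} (h : ¬Even (a + b)) : sg R a = -sg R b := by
  rw [sg_congr (a := a) (b := b + 1) (by grind), sg_add, sg_odd (e := 1) (by decide), mul_neg,
    mul_one]

theorem add_add_sub_add_sub_add {V : Type*} [AddCommGroup V] (a b x y z : V) :
    a + b + x - y + y - x + z = a + b + z := by abel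

variable (m) in
/-- The extension `h ↦ (w ↦ ε(w) s⁻¹ h + h ⋄ w)` of `letterBrace` to the elements of `B`. -/
def extBrace : B.carrier →ₗ[R] B.cobar.Bar →ₗ[R] B.Cobar :=
  LinearMap.smulRightₗ B.cobar.barCounit ∘ₗ B.letter +
    (LinearMap.llcomp R _ _ _).flip B.singleLetter ∘ₗ B.diamond m

theorem extBrace_apply (h : B.carrier) : extBrace m h =
    B.cobar.barCounit.smulRight (B.letter h) + B.diamond m h ∘ₗ B.singleLetter := rfl

theorem barCounit_smulRight_comp_twist (x : B.Cobar) (k : ℤ) :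
    B.cobar.barCounit.smulRight x ∘ₗ twist B.cobar.barGr k = B.cobar.barCounit.smulRight x :=
  LinearMap.ext fun w => congrArg (fun r : R => r • x) (algebraMapInv_twist _ k w)

theorem conv_barCounit_left (x : B.Cobar) (f : B.cobar.Bar →ₗ[R] B.Cobar) :
    conv (deconc R B.cobar.Red) (B.cobar.barCounit.smulRight x) f = LinearMap.mulLeft R x ∘ₗ f :=
  conv_one_left deconc_counit_left x f

theorem conv_barCounit_right (x : B.Cobar) (f : B.cobar.Bar →ₗ[R] B.Cobar) :
    conv (deconc R B.cobar.Red) f (B.cobar.barCounit.smulRight x) = LinearMap.mulRight R x ∘ₗ f :=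
  conv_one_right deconc_counit_right x f

theorem conv_extBrace (x y : B.carrier) (k : ℤ) : conv (deconc R B.cobar.Red)
      (extBrace m x ∘ₗ twist B.cobar.barGr k) (extBrace m y) =
    B.cobar.barCounit.smulRight (B.letter x * B.letter y) +
      LinearMap.mulLeft R (B.letter x) ∘ₗ B.diamond m y ∘ₗ B.singleLetter +
      LinearMap.mulRight R (B.letter y) ∘ₗ B.diamond m x ∘ₗ B.singleLetter ∘ₗ
        twist B.cobar.barGr k +
      conv (deconc R B.cobar.Red) (B.diamond m x ∘ₗ B.singleLetter ∘ₗ twist B.cobar.barGr k)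
        (B.diamond m y ∘ₗ B.singleLetter) := by
  rw [extBrace_apply, extBrace_apply, LinearMap.add_comp, barCounit_smulRight_comp_twist,
    conv_add_left, conv_barCounit_left, conv_add_right, conv_barCounit_right, LinearMap.comp_add]
  have e : LinearMap.mulLeft R (B.letter x) ∘ₗ B.cobar.barCounit.smulRight (B.letter y) =
      B.cobar.barCounit.smulRight (B.letter x * B.letter y) := by ext1; simp
  rw [e, add_assoc, add_assoc, add_assoc]
  rfl

theorem brace_ι_eq (a : B.Red) : B.brace m (TensorAlgebra.ι R a) = extBrace m a := by
  rw [brace_ι, letterBrace_apply, extBrace_apply, letter_coe]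

theorem singleLetter_barD (hB : B.IsDGCoalgebra) (w : B.cobar.Bar) :
    B.singleLetter (B.cobar.barD w) = -B.cobarD (B.singleLetter w) +
      conv (deconc R B.cobar.Red) (B.singleLetter ∘ₗ twist B.cobar.barGr 1) B.singleLetter w := by
  have h := hB.cobar_isDGAlgebra.coe_barDProj w
  rw [← AugDGAlgData.IsDGAlgebra.ιInv_barD] at h
  exact h

namespace IsInvolutiveDGHopf

variable (hB : B.IsInvolutiveDGHopf m S)
include hB

theorem brace_letter (h : B.carrier) :
    B.brace m (B.letter h) = extBrace m h - B.counit h • B.singleLetter := by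
  have e : extBrace m B.one = B.singleLetter := by
    ext1 w
    have := LinearMap.congr_fun hB.act_one (B.singleLetter w)
    rw [extBrace_apply, letter_one]
    simpa [act_apply] using this
  rw [letter, LinearMap.comp_apply, brace_ι_eq, coe_toRed, map_sub, map_smul, e]

/-- Passing from the letters in the coproduct of `a` to `extBrace` costs counit corrections
(`brace_letter`). Summed over the coproduct, they are the two boundary terms of the Hirsch formula.
-/
theorem brace_cobarD_ι {q : ℤ} {a : B.Red} {n : ℕ} {x y : Fin n → B.carrier}
    {r s : Fin n → ℤ} (hrs : ∀ i, r i + s i = q + 1) (hx : ∀ i, x i ∈ B.gr (r i))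
    (hy : ∀ i, y i ∈ B.gr (s i)) (hz : B.comul a = ∑ i, x i ⊗ₜ[R] y i) :
    B.brace m (B.cobarD (TensorAlgebra.ι R a)) = -extBrace m (B.d a) +
      ∑ i, sg R (r i) • conv (deconc R B.cobar.Red)
        (extBrace m (x i) ∘ₗ twist B.cobar.barGr (s i - 1)) (extBrace m (y i)) +
      sg R q • conv (deconc R B.cobar.Red)
        (B.brace m (TensorAlgebra.ι R a) ∘ₗ twist B.cobar.barGr 1) B.singleLetter -
      conv (deconc R B.cobar.Red) (B.singleLetter ∘ₗ twist B.cobar.barGr q)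
        (B.brace m (TensorAlgebra.ι R a)) := by
  have hr := hB.coalg.counit_right a
  have hl := hB.coalg.counit_left a
  rw [hz] at hr hl
  simp only [map_sum, LinearMap.rTensor_tmul, LinearMap.lTensor_tmul, TensorProduct.lid_tmul,
    TensorProduct.rid_tmul] at hr hl
  have ha0 : B.counit (a : B.carrier) = 0 := a.2
  have hcx : ∀ i, r i ≠ 0 → B.counit (x i) = 0 := fun i h => B.counit_gr _ h _ (hx i)
  have hcy : ∀ i, s i ≠ 0 → B.counit (y i) = 0 := fun i h => B.counit_gr _ h _ (hy i)
  -- Only summands with `s i = 0` have `ε(y i) ≠ 0`. Then `r i = q + 1`, the sign is constant, and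
  -- `∑ ε(y i) x i = a`.
  have h1 : ∑ i, B.counit (y i) • sg R (r i) • conv (deconc R B.cobar.Red)
      (extBrace m (x i) ∘ₗ twist B.cobar.barGr (s i - 1)) B.singleLetter =
      -(sg R q • conv (deconc R B.cobar.Red)
        (B.brace m (TensorAlgebra.ι R a) ∘ₗ twist B.cobar.barGr 1) B.singleLetter) := by
    have : ∀ i, B.counit (y i) • sg R (r i) • conv (deconc R B.cobar.Red)
        (extBrace m (x i) ∘ₗ twist B.cobar.barGr (s i - 1)) B.singleLetter =
        sg R (q + 1) • B.counit (y i) • conv (deconc R B.cobar.Red)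
          (extBrace m (x i) ∘ₗ twist B.cobar.barGr 1) B.singleLetter := by
      intro i
      by_cases h : s i = 0
      · rw [h, show r i = q + 1 by have := hrs i; omega,
          twist_congr (k := 0 - 1) (l := 1) B.cobar.barGr (by decide), smul_comm]
      · rw [hcy i h, zero_smul, zero_smul, smul_zero]
    rw [Finset.sum_congr rfl fun i _ => this i, ← Finset.smul_sum, ← conv_smul_sum_left,
      brace_ι_eq, show sg R (q + 1) = -sg R q by rw [sg_add, sg_odd (e := 1) (by decide)]; ring,
      neg_smul]
    congr 3
    conv_rhs => rw [← hr]
    ext; simp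
  have h2 : ∑ i, B.counit (x i) • sg R (r i) • conv (deconc R B.cobar.Red)
      (B.singleLetter ∘ₗ twist B.cobar.barGr (s i - 1)) (extBrace m (y i)) =
      conv (deconc R B.cobar.Red) (B.singleLetter ∘ₗ twist B.cobar.barGr q)
        (B.brace m (TensorAlgebra.ι R a)) := by
    have : ∀ i, B.counit (x i) • sg R (r i) • conv (deconc R B.cobar.Red)
        (B.singleLetter ∘ₗ twist B.cobar.barGr (s i - 1)) (extBrace m (y i)) =
        B.counit (x i) • conv (deconc R B.cobar.Red)
          (B.singleLetter ∘ₗ twist B.cobar.barGr q) (extBrace m (y i)) := by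
      intro i
      by_cases h : r i = 0
      · rw [h, show s i - 1 = q by have := hrs i; omega, sg_zero, one_smul]
      · rw [hcx i h, zero_smul, zero_smul]
    rw [Finset.sum_congr rfl fun i _ => this i, ← conv_smul_sum_right, brace_ι_eq]
    congr 1
    conv_rhs => rw [← hl]
    simp
  have h3 : ∑ i, (B.counit (x i) * B.counit (y i)) • sg R (r i) • conv (deconc R B.cobar.Red)
      (B.singleLetter ∘ₗ twist B.cobar.barGr (s i - 1)) B.singleLetter = 0 := by
    have : ∀ i, (B.counit (x i) * B.counit (y i)) • sg R (r i) • conv (deconc R B.cobar.Red)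
        (B.singleLetter ∘ₗ twist B.cobar.barGr (s i - 1)) B.singleLetter =
        (B.counit (x i) * B.counit (y i)) • conv (deconc R B.cobar.Red)
        (B.singleLetter ∘ₗ twist B.cobar.barGr (0 - 1)) B.singleLetter := by
      intro i
      by_cases h : r i = 0
      · by_cases h' : s i = 0
        · rw [h, h', sg_zero, one_smul]
        · rw [hcy i h', mul_zero, zero_smul, zero_smul]
      · rw [hcx i h, zero_mul, zero_smul, zero_smul]
    have h0 : ∑ i, B.counit (x i) * B.counit (y i) = 0 := by
      rw [← ha0]
      conv_rhs => rw [← hl]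
      simp
    rw [Finset.sum_congr rfl fun i _ => this i, ← Finset.sum_smul, h0, zero_smul]
  have e1 : B.cobarD (TensorAlgebra.ι R a) = -B.letter (B.d a) +
      ∑ i, sg R (r i) • (B.letter (x i) * B.letter (y i)) := by
    rw [← letter_coe, cobarD_letter hB.coalg, conv_apply, hz, map_sum, map_sum]
    congr 1
    refine Finset.sum_congr rfl fun i _ => ?_
    rw [TensorProduct.map_tmul, LinearMap.mul'_apply, LinearMap.comp_apply,
      twist_of_mem _ _ (hx i), map_smul, smul_mul_assoc, one_mul]
  rw [e1, map_add, map_neg, hB.brace_letter, hB.coalg.counit_d, zero_smul, sub_zero, map_sum]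
  have h4 : ∀ i, B.brace m (sg R (r i) • (B.letter (x i) * B.letter (y i))) =
      sg R (r i) • conv (deconc R B.cobar.Red)
        (extBrace m (x i) ∘ₗ twist B.cobar.barGr (s i - 1)) (extBrace m (y i)) -
      B.counit (y i) • sg R (r i) • conv (deconc R B.cobar.Red)
        (extBrace m (x i) ∘ₗ twist B.cobar.barGr (s i - 1)) B.singleLetter -
      B.counit (x i) • sg R (r i) • conv (deconc R B.cobar.Red)
        (B.singleLetter ∘ₗ twist B.cobar.barGr (s i - 1)) (extBrace m (y i)) +
      (B.counit (x i) * B.counit (y i)) • sg R (r i) • conv (deconc R B.cobar.Red)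
        (B.singleLetter ∘ₗ twist B.cobar.barGr (s i - 1)) B.singleLetter := by
    intro i
    rw [map_smul, brace_mul _ (letter_mem (hy i)), hB.brace_letter, hB.brace_letter]
    simp only [LinearMap.sub_comp, LinearMap.smul_comp, conv_sub_left, conv_sub_right,
      conv_smul_left, conv_smul_right]
    refine LinearMap.ext fun w => ?_
    simp only [LinearMap.sub_apply, LinearMap.add_apply, LinearMap.smul_apply]
    module
  rw [Finset.sum_congr rfl fun i _ => h4 i, Finset.sum_add_distrib, Finset.sum_sub_distrib,
    Finset.sum_sub_distrib, h1, h2, h3]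
  abel

/-- On one letter the left side is the differential of `ε(w) s⁻¹a + a ⋄ y`, with `y` the one-letter
part of `w`. The formula for `d(a ⋄ y)` supplies the mixed terms, and the quadratic part of the bar
differential those with two inserted letters. -/
theorem brace_hirsch_ι {q : ℤ} {a : B.Red} (ha : a ∈ B.sgr q) :
    B.cobarD ∘ₗ B.brace m (TensorAlgebra.ι R a) = B.brace m (B.cobarD (TensorAlgebra.ι R a)) +
      conv (deconc R B.cobar.Red) (B.singleLetter ∘ₗ twist B.cobar.barGr q)
        (B.brace m (TensorAlgebra.ι R a)) -
      sg R q • conv (deconc R B.cobar.Red)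
        (B.brace m (TensorAlgebra.ι R a) ∘ₗ twist B.cobar.barGr 1) B.singleLetter +
      sg R q • (B.brace m (TensorAlgebra.ι R a) ∘ₗ B.cobar.barD) := by
  have ha' := B.mem_sgr.1 ha
  obtain ⟨n, x, y, r, s, hrs, hx, hy, hz⟩ := exists_expansion (hB.coalg.comul_mem _ _ ha')
  rw [hB.brace_cobarD_ι hrs hx hy hz]
  refine hom_ext (𝒜 := B.cobar.barGr) fun l w hw => ?_
  have hP := singleLetter_mem hw
  have e1 := LinearMap.congr_fun (hB.cobarD_comp_diamond_flip hP) a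
  have e2 := cobarD_letter hB.coalg a
  have e3 := LinearMap.congr_fun (hB.diamond_comp_conv (c := -1) hy hz
    (f := B.singleLetter ∘ₗ twist B.cobar.barGr 1)
    (fun k w hw => singleLetter_mem (twist_mem (𝒜 := B.cobar.barGr) hw)) B.singleLetter) w
  simp only [LinearMap.comp_apply, LinearMap.add_apply, LinearMap.sub_apply, LinearMap.neg_apply,
    LinearMap.smul_apply, LinearMap.flip_apply, conv_apply _ _ _ (a : B.carrier),
    twist_of_mem _ _ ha', map_smul] at e1 e2
  rw [hz] at e1 e2
  simp only [map_sum, TensorProduct.map_tmul, LinearMap.mul'_apply, LinearMap.comp_apply,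
    LinearMap.flip_apply] at e1 e2
  -- The boundary terms in the claim cancel those of `brace_cobarD_ι`. What remains is the sum of
  -- products of extended braces.
  rw [add_add_sub_add_sub_add]
  have hεD : B.cobar.barCounit (B.cobar.barD w) = 0 :=
    AugDGAlgData.IsDGAlgebra.algebraMapInv_barD w
  -- Each product of two extended braces has four parts: no insertion, insertion on the right, on
  -- the left, or in both factors. The last part is `a` acting on a product of two inserted letters,
  -- by the module algebra identity `e3`.
  have hsum : ∑ i, sg R (r i) • conv (deconc R B.cobar.Red)
        (extBrace m (x i) ∘ₗ twist B.cobar.barGr (s i - 1)) (extBrace m (y i)) w =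
      B.cobar.barCounit w • ∑ i, B.letter (twist B.gr 1 (x i)) * B.letter (y i) +
      ∑ i, B.letter (twist B.gr 1 (x i)) * B.diamond m (y i) (B.singleLetter w) -
      sg R (l - 1) • sg R (1 * (q + 1)) • ∑ i, B.diamond m (x i) (B.singleLetter w) *
        B.letter (twist B.gr (l - 1) (y i)) -
      sg R q • B.diamond m a (conv (deconc R B.cobar.Red)
        (B.singleLetter ∘ₗ twist B.cobar.barGr 1) B.singleLetter w) := by
    rw [LinearMap.comp_apply, LinearMap.sum_apply] at e3
    rw [e3, Finset.smul_sum, Finset.smul_sum, Finset.smul_sum, Finset.smul_sum,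
      ← Finset.sum_add_distrib, ← Finset.sum_sub_distrib, ← Finset.sum_sub_distrib]
    refine Finset.sum_congr rfl fun i _ => ?_
    rw [conv_extBrace, twist_of_mem _ _ (hx i), twist_of_mem _ _ (hy i)]
    simp only [LinearMap.add_apply, LinearMap.smul_apply, LinearMap.comp_apply,
      LinearMap.smulRight_apply, LinearMap.mulLeft_apply, LinearMap.mulRight_apply, LinearMap.comp_assoc, twist_comp]
    rw [twist_of_mem _ _ hw, twist_congr (k := 1 + s i) (l := s i - 1) B.cobar.barGr (by grind)]
    simp only [map_smul, smul_mul_assoc, mul_smul_comm, smul_add, smul_smul, ← sg_add]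
    have h := hrs i
    rw [sg_eq_neg (a := l - 1 + (1 * (q + 1) + (l - 1) * s i)) (b := r i + (s i - 1) * l) (by
        rw [← h]
        simp only [Int.even_add, Int.even_mul, Int.even_sub, Int.not_even_one]; grind),
      sg_eq_neg (a := q + -1 * s i) (b := r i) (by grind), mul_comm (B.cobar.barCounit w), one_mul]
    module
  simp only [LinearMap.add_apply, LinearMap.neg_apply, LinearMap.smul_apply, LinearMap.sum_apply,
    LinearMap.comp_apply]
  rw [hsum, brace_ι_eq, extBrace_apply, extBrace_apply]
  simp only [LinearMap.add_apply, LinearMap.comp_apply, LinearMap.smulRight_apply, map_add, map_smul]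
  rw [e1, e2, singleLetter_barD hB.coalg, hεD, map_add, map_neg, one_mul,
    show sg R (q + 1) = -sg R q by rw [sg_add, sg_odd (e := 1) (by decide)]; ring]
  module

/-- The Hirsch formula. -/
theorem brace_hirsch (k : ℤ) (y : B.Cobar) (hy : y ∈ B.cobarGr k) :
    B.cobarD ∘ₗ B.brace m y = B.brace m (B.cobarD y) +
      conv (deconc R B.cobar.Red) (B.singleLetter ∘ₗ twist B.cobar.barGr k) (B.brace m y) -
      sg R k • conv (deconc R B.cobar.Red) (B.brace m y ∘ₗ twist B.cobar.barGr 1) B.singleLetter +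
      sg R k • (B.brace m y ∘ₗ B.cobar.barD) := by
  refine tensorGr_induction_right (𝒜 := B.sgr) (p := fun k y =>
    B.cobarD ∘ₗ B.brace m y = B.brace m (B.cobarD y) +
      conv (deconc R B.cobar.Red) (B.singleLetter ∘ₗ twist B.cobar.barGr k) (B.brace m y) -
      sg R k • conv (deconc R B.cobar.Red) (B.brace m y ∘ₗ twist B.cobar.barGr 1) B.singleLetter +
      sg R k • (B.brace m y ∘ₗ B.cobar.barD)) ?_ ?_ ?_ ?_ ?_ hy
  · rw [brace_one, barCounit_smulRight_comp_twist, conv_barCounit_left, conv_barCounit_right,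
      cobarD_one, map_zero, twist_zero]
    refine LinearMap.ext fun w => ?_
    have hεD : B.cobar.barCounit (B.cobar.barD w) = 0 :=
      AugDGAlgData.IsDGAlgebra.algebraMapInv_barD w
    simp only [LinearMap.comp_apply, LinearMap.add_apply, LinearMap.sub_apply, LinearMap.smul_apply,
      LinearMap.smulRight_apply, LinearMap.mulLeft_apply, LinearMap.mulRight_apply, map_smul,
      cobarD_one, hεD, LinearMap.zero_apply, LinearMap.id_apply, sg_zero]
    simp
  · intro k; simp
  · intro k x _ y _ hx hy
    simp only [map_add, LinearMap.comp_add, LinearMap.add_comp, conv_add_left, conv_add_right,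
      smul_add, hx, hy]
    abel
  · intro k r x _ hx
    simp only [map_smul, LinearMap.comp_smul, LinearMap.smul_comp, conv_smul_left, conv_smul_right,
      hx, smul_add, smul_sub]
    rw [smul_comm r, smul_comm r]
  · intro q k a ha x hx ih
    have hA := hB.coalg.cobar_isDGAlgebra
    have hι := ι_mem_tensorGr B.sgr ha
    have e1 : twist B.cobarGr 1 ∘ₗ B.brace m x = sg R k • (B.brace m x ∘ₗ twist B.cobar.barGr 1) := by
      refine hom_ext (𝒜 := B.cobar.barGr) fun l w hw => ?_
      rw [LinearMap.comp_apply, LinearMap.smul_apply, LinearMap.comp_apply, twist_of_mem _ _ hw,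
        twist_of_mem _ _ (hB.brace_mem _ _ _ hx _ hw), map_smul, smul_smul, ← sg_add]
      congr 1
      exact sg_congr (by grind)
    rw [brace_mul _ hι, cobarD_flip_mul _ _ hx, map_add, map_smul, brace_mul _ hι,
      brace_mul _ (cobarD_mem hB.coalg hι)]
    exact comp_conv_of_hirsch (𝒯 := B.cobar.barGr) deconc_coassoc (fun k x hx => deconc_mem hx)
      AugDGAlgData.IsDGAlgebra.deconc_comp_barD hA.barD_mem (fun x y => B.cobarD_mul x y) ih
      (hB.brace_hirsch_ι ha) e1

theorem isBrace_brace : B.cobar.IsBrace (B.brace m) where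
  toIsPreBrace := hB.isPreBrace_brace
  assoc := hB.brace_brace
  hirsch := hB.brace_hirsch

theorem isHomotopyGAlgebra_cobar : B.cobar.IsHomotopyGAlgebra (B.cobar.barMul (B.brace m)) :=
  hB.isBrace_brace.isHomotopyGAlgebra hB.coalg.cobar_isDGAlgebra hB.reduced.cobar_isConnected

end IsInvolutiveDGHopf

/-! ### The operation `E_{1,1}` on `ΩB`. -/

variable {R : Type u} [CommRing R] {B : DGCoalgData.{u, v} R}
  {m : B.carrier ⊗[R] B.carrier →ₗ[R] B.carrier} {S : B.carrier →ₗ[R] B.carrier}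

theorem conv_deconc_ι {M A : Type*} [AddCommGroup M] [Module R M] [Ring A] [Algebra R A]
    (f g : TensorAlgebra R M →ₗ[R] A) (x : M) : conv (deconc R M) f g (TensorAlgebra.ι R x) =
      f 1 * g (TensorAlgebra.ι R x) + f (TensorAlgebra.ι R x) * g 1 := by
  rw [conv_apply, ← mul_one (TensorAlgebra.ι R x), deconc_ι_mul, deconc_one]
  simp

variable (m) in
/-- The operation `x{y} = E_{1,1}(x; y)` as `y ↦ (x ↦ x{y})`. -/
def insertion : B.Cobar →ₗ[R] B.Cobar →ₗ[R] B.Cobar :=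
  (B.brace m).flip ∘ₗ TensorAlgebra.ι R ∘ₗ B.cobar.toRed

theorem insertion_apply (x y : B.Cobar) :
    insertion m y x = B.brace m x (TensorAlgebra.ι R (B.cobar.toRed y)) := rfl

theorem ι_toRed_mem {q : ℤ} {y : B.Cobar} (hy : y ∈ B.cobarGr q) :
    TensorAlgebra.ι R (B.cobar.toRed y) ∈ B.cobar.barGr (q + 1) := by
  refine ι_mem_tensorGr _ ?_
  have := AugDGAlgData.toRed_mem (A := B.cobar) hy
  rw [shiftGr, add_sub_cancel_right]
  exact this

theorem singleLetter_ι (z : B.cobar.Red) : B.singleLetter (TensorAlgebra.ι R z) = B.cobar.Red.subtype z :=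
  congrArg B.cobar.Red.subtype (TensorAlgebra.ι_leftInverse z)

theorem subtype_toRed (y : B.Cobar) : B.cobar.Red.subtype (B.cobar.toRed y) =
    y - (TensorAlgebra.algebraMapInv y : R) • (1 : B.Cobar) := rfl

theorem insertion_one (y : B.Cobar) : insertion m y 1 = 0 := by
  rw [insertion_apply, brace_one, LinearMap.smulRight_apply]
  rw [show B.cobar.barCounit (TensorAlgebra.ι R (B.cobar.toRed y)) = 0 from algebraMapInv_ι _,
    zero_smul]

/-- A single letter is primitive for deconcatenation, so `y` goes into exactly one of the two
factors. -/
theorem insertion_mul {q l : ℤ} (x : B.Cobar) {x' y : B.Cobar} (hy : y ∈ B.cobarGr q)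
    (hx' : x' ∈ B.cobarGr l) : insertion m y (x * x') =
      x * insertion m y x' + sg R (l * (q + 1)) • (insertion m y x * x') := by
  rw [insertion_apply, brace_mul _ hx', conv_deconc_ι, LinearMap.comp_apply, LinearMap.comp_apply,
    twist_of_mem _ _ (ι_toRed_mem hy), twist_one, brace_apply_one, brace_apply_one, map_smul,
    smul_mul_assoc]
  rfl

theorem insertion_letter (y : B.Cobar) (h : B.carrier) :
    insertion m y (B.letter h) = B.diamond m h y - B.counit h • B.diamond m B.one y := by
  rw [insertion_apply, letter, LinearMap.comp_apply, brace_ι_eq, extBrace_apply,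
    LinearMap.add_apply, LinearMap.smulRight_apply, LinearMap.comp_apply, singleLetter_ι, subtype_toRed,
    show B.cobar.barCounit (TensorAlgebra.ι R (B.cobar.toRed y)) = 0 from algebraMapInv_ι _,
    zero_smul, zero_add, coe_toRed]
  simp only [map_sub, map_smul, LinearMap.sub_apply, LinearMap.smul_apply, diamond_one]
  rw [B.counit_one]
  module

theorem barD_ι_toRed (hB : B.IsDGCoalgebra) (y : B.Cobar) :
    B.cobar.barD (TensorAlgebra.ι R (B.cobar.toRed y)) =
      -TensorAlgebra.ι R (B.cobar.toRed (B.cobarD y)) := by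
  have hA := hB.cobar_isDGAlgebra
  have hl : B.cobar.barLetter 1 = 0 := singleLetter_one
  have h1 : B.cobar.barDProj 1 = 0 := Subtype.ext (by
    rw [hA.coe_barDProj, conv_apply, deconc_one]
    simp [hl])
  have h2 : B.cobar.barDProj (TensorAlgebra.ι R (B.cobar.toRed y)) =
      -B.cobar.toRed (B.cobarD y) := Subtype.ext (by
    rw [hA.coe_barDProj, conv_deconc_ι, LinearMap.comp_apply, twist_one, hl, zero_mul, mul_zero,
      add_zero, add_zero]
    change -B.cobarD (B.singleLetter _) = -B.cobar.Red.subtype (B.cobar.toRed (B.cobarD y))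
    rw [singleLetter_ι]
    rw [subtype_toRed, subtype_toRed, hB.algebraMapInv_cobarD, map_sub, map_smul, cobarD_one,
      smul_zero, sub_zero, zero_smul, sub_zero]
    rfl)
  rw [AugDGAlgData.IsDGAlgebra.barD_eq_conv, conv_deconc_ι, conv_deconc_ι, conv_apply, deconc_one,
    TensorProduct.map_tmul, LinearMap.mul'_apply, LinearMap.comp_apply, h1,
    LinearMap.comp_apply, h2, twist_one]
  simp

namespace IsInvolutiveDGHopf

variable (hB : B.IsInvolutiveDGHopf m S)
include hB

theorem insertion_letter (y : B.Cobar) (h : B.carrier) :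
    insertion m y (B.letter h) = B.diamond m h y - B.counit h • y := by
  rw [DGCoalgData.insertion_letter, ← act_apply (m := m) B.one, hB.act_one, Module.End.one_apply]

theorem insertion_mem {p q : ℤ} {x y : B.Cobar} (hx : x ∈ B.cobarGr p) (hy : y ∈ B.cobarGr q) :
    insertion m y x ∈ B.cobarGr (p + (q + 1)) :=
  hB.brace_mem _ _ _ hx _ (ι_toRed_mem hy)

/-- The Hirsch formula at a word of length one: `E_{1,1}` is a homotopy for graded commutativity of
the product. -/
theorem cobarD_insertion {p q : ℤ} {x y : B.Cobar} (hx : x ∈ B.cobarGr p) (hy : y ∈ B.cobarGr q) :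
    B.cobarD (insertion m y x) = insertion m y (B.cobarD x) -
      sg R p • insertion m (B.cobarD y) x + sg R (p * (q + 1)) • (y * x) - sg R p • (x * y) := by
  -- The Hirsch formula involves the reduced part of `y`. The scalar part is nonzero only for `q =
  -- 0`, and then it drops out of the signed commutator.
  have e1 : ∀ z : B.Cobar, z = y - (TensorAlgebra.algebraMapInv y : R) • (1 : B.Cobar) →
      sg R (p * (q + 1)) • (z * x) - sg R p • (x * z) =
      sg R (p * (q + 1)) • (y * x) - sg R p • (x * y) := by
    rintro z rfl
    by_cases h : q = 0
    · subst h
      simp [mul_sub, sub_mul, smul_sub]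
    · rw [algebraMapInv_tensorGr B.sgr h hy]
      simp
  have e2 := LinearMap.congr_fun (hB.brace_hirsch p x hx)
    (TensorAlgebra.ι R (B.cobar.toRed y))
  simp only [LinearMap.add_apply, LinearMap.sub_apply, LinearMap.smul_apply, LinearMap.comp_apply,
    conv_deconc_ι, barD_ι_toRed hB.coalg, twist_one, singleLetter_one, zero_mul, mul_zero, zero_add,
    add_zero, brace_apply_one, singleLetter_ι, twist_of_mem _ _ (ι_toRed_mem hy), map_neg,
    map_smul] at e2
  have e3 : ∀ z : B.Cobar, z = B.cobar.Red.subtype (B.cobar.toRed y) →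
      B.cobarD (insertion m y x) = insertion m y (B.cobarD x) + sg R (p * (q + 1)) • z * x -
        sg R p • (x * z) + sg R p • -insertion m (B.cobarD y) x := by
    rintro z rfl
    exact e2
  obtain ⟨z, hz⟩ : ∃ z : B.Cobar, z = B.cobar.Red.subtype (B.cobar.toRed y) := ⟨_, rfl⟩
  rw [e3 z hz, add_sub_assoc _ _ (sg R p • (x * y)), ← e1 z (hz.trans (subtype_toRed y)),
    smul_mul_assoc, smul_neg]
  abel

end IsInvolutiveDGHopf

/-! ### Rotations combined with an insertion. -/

variable {R : Type u} [CommRing R] {B : DGCoalgData.{u, v} R}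
  {m : B.carrier ⊗[R] B.carrier →ₗ[R] B.carrier} {S : B.carrier →ₗ[R] B.carrier}

variable (m S) in
/-- `cyclicSum` as a linear map. -/
def cyclicSumHom (k : ℤ) : (B.Cobar →ₗ[R] Module.End R B.Cobar) →ₗ[R]
    B.Cobar →ₗ[R] Module.End R B.Cobar where
  toFun Φ := cyclicSum m S Φ k
  map_add' Φ Ψ := by simp only [cyclicSum, conv_add_left, conv_add_right]
  map_smul' r Φ := by
    simp only [cyclicSum, conv_smul_left, conv_smul_right, RingHom.id_apply]

theorem cyclicSumHom_apply (k : ℤ) (Φ : B.Cobar →ₗ[R] Module.End R B.Cobar) :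
    cyclicSumHom m S k Φ = cyclicSum m S Φ k := rfl

variable (m S) in
/-- The sum over the cyclic permutations of a word `x z` which start with a letter of `x`, and over
the insertions of `y` in one of the other letters of `x`. -/
def insCyc (k : ℤ) (y : B.Cobar) : B.Cobar →ₗ[R] Module.End R B.Cobar :=
  cyclicSum m S (B.lmul ∘ₗ insertion m y) k

theorem insCyc_letter (k : ℤ) (y : B.Cobar) (h : B.carrier) : insCyc m S k y (B.letter h) = 0 := by
  have key : ∀ a : B.Red, insCyc m S k y (TensorAlgebra.ι R a) = 0 := by
    intro a
    induction a using induction_homogeneous (𝒜 := B.sgr) with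
    | h0 => simp
    | hadd x y hx hy => simp only [map_add, hx, hy, add_zero]
    | h p a ha =>
      have := cyclicSum_ι_mul (m := m) (S := S) (B.lmul ∘ₗ insertion m y) k ha 1
      rwa [mul_one, twist_one, cyclicSum_one, zero_mul, smul_zero, add_zero, LinearMap.comp_apply,
        insertion_one, map_zero, mul_zero] at this
  exact key _

/-- The induction step of `cobarD_insCyc` with all operators replaced by letters of an abstract
algebra. The signs depend only on the parities of `j`, `l`, `q`; in each of the eight cases a fixed
combination of the hypotheses works. -/
theorem insCyc_leibniz {E : Type*} [Ring E] [Algebra R E] (j l q : ℤ)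
    {D Lxy Lay Ldxy Lxdy La Ra Rda Ca Cda I Idx I' Cx Lx Ly : E}
    (h1 : D * Ca + Cda + sg R j • (Ca * D) = Ra - La)
    (h2 : D * Lxy = Ldxy - sg R l • Lxdy + sg R (l * (q + 1)) • (Ly * Lx) - sg R l • (Lx * Ly) +
      sg R (l + (q + 1)) • (Lxy * D))
    (h3 : D * Ra = Rda + sg R j • (Ra * D)) (h4 : Ly * Ra = sg R (q * j) • (Ra * Ly))
    (h5 : Lxy * Ra = sg R ((l + (q + 1)) * j) • (Ra * Lxy))
    (ih : D * I + Idx - sg R l • I' + sg R (l + (q + 1)) • (I * D) =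
      sg R ((l + 1) * (q + 1)) • (Ly * Cx) - Lxy + sg R l • (Cx * Ly)) :
    D * (Ca * Lxy + sg R (j * (l + (q + 1))) • (I * Ra)) +
        (Cda * Lxy + sg R (l * (q + 1)) •
          ((sg R ((j + 1) * (q + 1)) • (Ly * Ca) - Lay + sg R j • (Ca * Ly)) * Lx) +
          sg R ((j - 1) * (l + (q + 1))) • (I * Rda) +
          sg R j • (Ca * Ldxy + sg R (j * (l - 1 + (q + 1))) • (Idx * Ra))) -
        sg R (j + l) • (Ca * Lxdy + sg R (j * (l + q)) • (I' * Ra)) +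
        sg R (j + l + (q + 1)) • ((Ca * Lxy + sg R (j * (l + (q + 1))) • (I * Ra)) * D) =
      sg R ((j + l + 1) * (q + 1)) • (Ly * (Ca * Lx + sg R (j * l) • (Cx * Ra))) -
        (La * Lxy + sg R (l * (q + 1)) • (Lay * Lx)) +
        sg R (j + l) • ((Ca * Lx + sg R (j * l) • (Cx * Ra)) * Ly) := by
  have hj : Even j ∨ ¬Even j := em _
  have hl : Even l ∨ ¬Even l := em _
  have hq : Even q ∨ ¬Even q := em _
  have e1 := congrArg (fun z => z * Lxy) h1
  have e2 := congrArg (fun z => sg R j • (Ca * z)) h2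
  have e3 := congrArg (fun z => sg R (j * (l + (q + 1)) + (l + (q + 1))) • (I * z)) h3
  have e4 := congrArg (fun z => sg R (j * (l + (q + 1)) + l) • (Cx * z)) h4
  have e5 := congrArg (fun z => sg R (j * (l + (q + 1))) • z) h5
  have e6 := congrArg (fun z => sg R (j * (l + (q + 1))) • (z * Ra)) ih
  clear h1 h2 h3 h4 h5 ih
  rcases hj with hj | hj <;> rcases hl with hl | hl <;> rcases hq with hq | hq <;>
  · simp only [sg_ite, Int.even_add, Int.even_mul, Int.even_sub, Int.not_even_one, hj, hl, hq,
      iff_true, iff_false, not_true, not_false_iff, if_true, if_false, or_true, or_false, or_self,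
      mul_add, add_mul, mul_sub, sub_mul, one_smul, neg_smul, mul_assoc, mul_neg, neg_mul] at *
    linear_combination (norm := abel) e1 - e2 + e6 - e3 + e4 - e5

namespace IsInvolutiveDGHopf

variable (hB : B.IsInvolutiveDGHopf m S)
include hB

/-- The insertion takes place to the right of the starting letter, since earlier letters are only
rotated to the end. The three terms are: start in `x` and insert in `x'`, both in `x`, both in `x'`.
-/
theorem insCyc_mul {p l q : ℤ} {x x' y : B.Cobar} (hx : x ∈ B.cobarGr p) (hx' : x' ∈ B.cobarGr l)
    (hy : y ∈ B.cobarGr q) : insCyc m S (q + 1) y (x * x') =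
      cyc m S x * B.lmul (insertion m y x') +
      sg R (l * (q + 1)) • (insCyc m S (q + 1) y x * B.lmul x') +
      sg R (p * (l + (q + 1))) • (insCyc m S (q + 1) y x' * B.rmul x) := by
  have e : (B.lmul ∘ₗ insertion m y) ∘ₗ LinearMap.mulRight R x' =
      LinearMap.mulRight R (B.lmul (insertion m y x')) ∘ₗ B.lmul +
      sg R (l * (q + 1)) • (LinearMap.mulRight R (B.lmul x') ∘ₗ B.lmul ∘ₗ insertion m y) := by
    refine LinearMap.ext fun z => ?_
    simp only [LinearMap.comp_apply, LinearMap.add_apply, LinearMap.smul_apply,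
      LinearMap.mulRight_apply]
    rw [insertion_mul _ hy hx', map_add, map_smul, lmul_mul, lmul_mul]
  have e1 := cyclicSum_comp_mulRight (m := m) (S := S) B.lmul 0 hx (hB.insertion_mem hx' hy)
  rw [zero_add, add_comm l] at e1
  rw [insCyc, cyclicSum_mul _ _ hx hx', e, ← cyclicSumHom_apply, map_add, map_smul,
    cyclicSumHom_apply, cyclicSumHom_apply, LinearMap.add_apply, LinearMap.smul_apply, e1, cyclicSum_comp_mulRight _ _ hx hx']
  rfl

/-- A single letter leaves no room for an insertion, so only the quadratic part `s⁻¹a¹ · s⁻¹a²`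
contributes: start with `a¹` and insert into `a²`. By `conv_act_S_mul` the sum `∑ S(a¹) ⋄ ((a² ⋄ y)
· )` is `± y · (S(a) ⋄ )`; the other terms are counit corrections. -/
theorem insCyc_cobarD_ι {p q : ℤ} {a : B.Red} (ha : a ∈ B.sgr p) {y : B.Cobar}
    (hy : y ∈ B.cobarGr q) : insCyc m S (q + 1) y (B.cobarD (TensorAlgebra.ι R a)) =
      sg R ((p + 1) * (q + 1)) • (B.lmul y * cyc m S (TensorAlgebra.ι R a)) -
      B.lmul (insertion m y (TensorAlgebra.ι R a)) +
      sg R p • (cyc m S (TensorAlgebra.ι R a) * B.lmul y) := by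
  have ha' : (a : B.carrier) ∈ B.gr (p + 1) := B.mem_sgr.1 ha
  have e0 : B.counit a = 0 := a.2
  have e1 : cyc m S (TensorAlgebra.ι R a) = sg R (p + 1) • act m (S a) := by
    rw [← letter_coe, hB.cyc_letter, e0, zero_smul, sub_zero, signedAct_of_mem ha']
  have e2 : conv B.comul (act m ∘ₗ S) (B.lmul ∘ₗ (B.diamond m).flip y) a =
      sg R (q * (p + 1)) • (B.lmul y * act m (S a)) := by
    rw [hB.conv_act_S_mul hB.isSide_left hy]
    simp only [LinearMap.comp_apply, LinearMap.mulLeft_apply]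
    rw [twist_of_mem _ _ ha', map_smul, map_smul, mul_smul_comm]
  have e3 : insCyc m S (q + 1) y (conv B.comul (B.letter ∘ₗ twist B.gr 1) B.letter a) =
      conv B.comul (act m ∘ₗ S) (B.lmul ∘ₗ (B.diamond m).flip y) a -
      B.lmul (B.diamond m (TensorProduct.lid R _ (B.counit.rTensor _ (B.comul a))) y) -
      act m (S (TensorProduct.rid R _ (B.counit.lTensor _ (B.comul a)))) * B.lmul y +
      B.counit (TensorProduct.lid R _ (B.counit.rTensor _ (B.comul a))) • B.lmul y := by
    rw [conv_apply, conv_apply]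
    generalize B.comul (a : B.carrier) = z
    induction z using tensor_induction (𝒜 := B.gr) (ℬ := B.gr) with
    | h0 => simp
    | hadd x y hx hy => simp only [map_add, LinearMap.add_apply, add_mul, add_smul, hx, hy]; abel
    | h r s b hb c hc =>
      simp only [TensorProduct.map_tmul, LinearMap.mul'_apply, LinearMap.comp_apply,
        LinearMap.rTensor_tmul, LinearMap.lTensor_tmul, TensorProduct.lid_tmul,
        TensorProduct.rid_tmul, LinearMap.flip_apply]
      rw [twist_of_mem _ _ hb, map_smul, smul_mul_assoc, map_smul,
        hB.insCyc_mul (letter_mem hb) (letter_mem hc) hy, insCyc_letter, insCyc_letter,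
        hB.insertion_letter, hB.cyc_letter, signedAct_of_mem hb]
      have fb : sg R (1 * r) * B.counit b = B.counit b := by
        by_cases hr : r = 0
        · subst hr; simp
        · rw [B.counit_gr r hr b hb, mul_zero]
      have f1 : sg R (1 * r) * sg R r = 1 := by rw [one_mul, sg_mul_self]
      simp only [map_sub, map_smul, LinearMap.smul_apply, mul_sub, sub_mul, smul_mul_assoc,
        mul_smul_comm, zero_mul, smul_zero, add_zero, smul_eq_mul]
      simp only [one_mul (B.lmul _)]
      linear_combination (norm := module) f1 • (act m (S b) * B.lmul (B.diamond m c y)) -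
        (B.counit c * f1) • (act m (S b) * B.lmul y) - fb • B.lmul (B.diamond m c y) +
        (B.counit c * fb) • B.lmul y
  rw [← letter_coe, cobarD_letter hB.coalg, map_add, map_neg, insCyc_letter, neg_zero, zero_add, e3,
    hB.coalg.counit_left, hB.coalg.counit_right, e0, e2, letter_coe, e1, ← letter_coe,
    hB.insertion_letter, e0, zero_smul, zero_smul, sub_zero, add_zero, mul_smul_comm,
    smul_mul_assoc]
  simp only [smul_smul, ← sg_add]
  rw [sg_congr (a := (p + 1) * (q + 1) + (p + 1)) (b := q * (p + 1)) (by
      simp only [Int.even_add, Int.even_mul, Int.not_even_one]; grind),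
    sg_odd (e := p + (p + 1)) (by grind)]
  module

/-- Induction on words. The base is `insCyc_cobarD_ι`; a further letter brings in the boundary of
`cyc` on that letter and the boundary of the insertion into the rest, `cobarD_cyc_ι` and
`cobarD_insertion`. -/
theorem cobarD_insCyc {p q : ℤ} {x y : B.Cobar} (hx : x ∈ B.cobarGr p) (hy : y ∈ B.cobarGr q) :
    (B.cobarD : Module.End R B.Cobar) * insCyc m S (q + 1) y x +
        insCyc m S (q + 1) y (B.cobarD x) - sg R p • insCyc m S q (B.cobarD y) x +
        sg R (p + (q + 1)) • (insCyc m S (q + 1) y x * B.cobarD) =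
      sg R ((p + 1) * (q + 1)) • (B.lmul y * cyc m S x) - B.lmul (insertion m y x) +
      sg R p • (cyc m S x * B.lmul y) := by
  refine tensorGr_induction (𝒜 := B.sgr) (p := fun p x =>
    (B.cobarD : Module.End R B.Cobar) * insCyc m S (q + 1) y x +
        insCyc m S (q + 1) y (B.cobarD x) - sg R p • insCyc m S q (B.cobarD y) x +
        sg R (p + (q + 1)) • (insCyc m S (q + 1) y x * B.cobarD) =
      sg R ((p + 1) * (q + 1)) • (B.lmul y * cyc m S x) - B.lmul (insertion m y x) +
      sg R p • (cyc m S x * B.lmul y)) ?_ ?_ ?_ ?_ ?_ hx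
  · have h1 : ∀ k (y : B.Cobar), insCyc m S k y 1 = 0 := fun k y => cyclicSum_one _ _
    simp [h1, cyc_one, cobarD_one, insertion_one]
  · simp
  · intro k x _ x' _ hx hx'
    generalize (k + 1) * (q + 1) = e at hx hx' ⊢
    simp only [map_add, mul_add, add_mul, smul_add]
    linear_combination (norm := module) hx + hx'
  · intro k r x _ hx
    simp only [map_smul, smul_mul_assoc, mul_smul_comm]
    generalize (k + 1) * (q + 1) = e at hx ⊢
    linear_combination (norm := module) r • hx
  · intro j l a ha x hx ih
    have ha' := ι_mem_tensorGr B.sgr ha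
    have hda := cobarD_mem hB.coalg ha'
    have hdx := cobarD_mem hB.coalg hx
    have hdy := cobarD_mem hB.coalg hy
    have e0 : ∀ k (y : B.Cobar), insCyc m S k y (TensorAlgebra.ι R a) = 0 := fun k y => by
      rw [← letter_coe, insCyc_letter]
    have h1 := hB.cobarD_cyc_ι ha
    have h2 := cobarD_lmul (hB.insertion_mem hx hy)
    rw [hB.cobarD_insertion hx hy] at h2
    have h3 := cobarD_rmul hB.coalg ha'
    have h4 := lmul_rmul hy ha'
    have h5 := lmul_rmul (hB.insertion_mem hx hy) ha'
    have h6 := hB.insCyc_cobarD_ι ha hy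
    have h7 := hB.insCyc_mul ha' hx hdy
    rw [sub_add_cancel, e0] at h7
    rw [h7, cobarD_flip_mul _ _ ha', map_add, map_smul, hB.insCyc_mul ha' hx hy,
      hB.insCyc_mul hda hx hy, hB.insCyc_mul ha' hdx hy, cyc_mul ha' hx, insertion_mul _ hy hx,
      h6, e0]
    have h1 := insCyc_leibniz (Lay := B.lmul (insertion m y (TensorAlgebra.ι R a))) j l q h1
      (by simpa only [map_add, map_sub, map_smul, lmul_mul] using h2)
      h3 h4 h5 ih
    simp only [map_add, map_smul, lmul_mul, zero_mul, smul_zero, add_zero]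
    exact h1

end IsInvolutiveDGHopf

/-! ### The homotopy between the bracket and the deviation of `Δ`. -/

variable {R : Type u} [CommRing R] {B : DGCoalgData.{u, v} R}
  {m : B.carrier ⊗[R] B.carrier →ₗ[R] B.carrier} {S : B.carrier →ₗ[R] B.carrier}

variable (m S) in
/-- The bilinear map `(y, x) ↦ insCyc y x 1`, where `insCyc` is shifted by the degree of `s y`. -/
def insertedCyc : B.Cobar →ₗ[R] B.Cobar →ₗ[R] B.Cobar :=
  homLift B.cobarGr fun q =>
    LinearMap.llcomp R _ _ _ (LinearMap.applyₗ (1 : B.Cobar)) ∘ₗ cyclicSumHom m S (q + 1) ∘ₗ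
      LinearMap.llcomp R _ _ _ B.lmul ∘ₗ insertion m

theorem insertedCyc_of_mem {q : ℤ} {y : B.Cobar} (hy : y ∈ B.cobarGr q) (x : B.Cobar) :
    insertedCyc m S y x = insCyc m S (q + 1) y x 1 := by
  rw [insertedCyc, homLift_of_mem _ _ hy]
  rfl

variable (m S) in
/-- The homotopy for the bracket:
`H(a; b) = -I(b; a) + Δ(a){b} + (-1)^((|a|+1)(|b|+1)) I(a; b)` for `I = insertedCyc`. -/
def bracketHomotopy : B.Cobar →ₗ[R] B.Cobar →ₗ[R] B.Cobar :=
  -(insertedCyc m S).flip + (insertion m).flip ∘ₗ B.connesMoscovici m S +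
    homLift B.cobarGr fun p =>
      sg R (p + 1) • (LinearMap.lcomp R B.Cobar (twist B.cobarGr (p + 1)) ∘ₗ insertedCyc m S)

theorem bracketHomotopy_of_mem {p q : ℤ} {a b : B.Cobar} (ha : a ∈ B.cobarGr p)
    (hb : b ∈ B.cobarGr q) : bracketHomotopy m S a b =
      -insCyc m S (q + 1) b a 1 + insertion m b (B.connesMoscovici m S a) +
        sg R ((p + 1) * (q + 1)) • insCyc m S (p + 1) a b 1 := by
  simp only [bracketHomotopy, LinearMap.add_apply, LinearMap.neg_apply, LinearMap.flip_apply,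
    LinearMap.comp_apply]
  rw [homLift_of_mem _ _ ha, insertedCyc_of_mem hb, LinearMap.smul_apply, LinearMap.comp_apply,
    LinearMap.smul_apply, LinearMap.lcomp_apply, twist_of_mem _ _ hb, map_smul,
    insertedCyc_of_mem ha, smul_smul, ← sg_add]
  congr 2
  exact sg_congr (by simp only [Int.even_add, Int.even_mul, Int.not_even_one]; grind)

namespace IsInvolutiveDGHopf

variable (hB : B.IsInvolutiveDGHopf m S)
include hB

theorem insCyc_mem (k : ℤ) {p q r : ℤ} {x y z : B.Cobar} (hx : x ∈ B.cobarGr p)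
    (hy : y ∈ B.cobarGr q) (hz : z ∈ B.cobarGr r) :
    insCyc m S k y x z ∈ B.cobarGr (p + r + (q + 1) + 1) := by
  refine hB.cyclicSum_mem (fun p' q' x hx z hz => ?_) k hx hz
  exact mul_mem_tensorGr (by ring) (hB.insertion_mem hx hy) hz

theorem bracketHomotopy_mem {p q : ℤ} {a b : B.Cobar} (ha : a ∈ B.cobarGr p)
    (hb : b ∈ B.cobarGr q) : bracketHomotopy m S a b ∈ B.cobarGr (p + q + 2) := by
  rw [bracketHomotopy_of_mem ha hb]
  have h1 := hB.insCyc_mem (q + 1) ha hb one_mem_tensorGr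
  have h2 := hB.insCyc_mem (p + 1) hb ha one_mem_tensorGr
  have h3 := hB.insertion_mem (hB.connesMoscovici_mem ha) hb
  rw [show p + 0 + (q + 1) + 1 = p + q + 2 by ring] at h1
  rw [show q + 0 + (p + 1) + 1 = p + q + 2 by ring] at h2
  rw [show p + 1 + (q + 1) = p + q + 2 by ring] at h3
  exact add_mem (add_mem (neg_mem h1) h3) (Submodule.smul_mem _ _ h2)

-- The value of `cyc_mul` at `1`. The deviation of `Δ` from a derivation is thus expressed by `cyc a
-- b` and `cyc b a`, which are boundary terms of `insCyc`.
omit hB in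
theorem connesMoscovici_mul {p q : ℤ} {x y : B.Cobar} (hx : x ∈ B.cobarGr p)
    (hy : y ∈ B.cobarGr q) : B.connesMoscovici m S (x * y) =
      cyc m S x y + sg R (p * q) • cyc m S y x := by
  rw [connesMoscovici_apply, cyc_mul hx hy]
  simp only [LinearMap.add_apply, LinearMap.smul_apply, Module.End.mul_apply, lmul_apply, mul_one]
  rw [rmul_apply_of_mem one_mem_tensorGr hx, zero_mul, sg_zero, one_smul, one_mul]

theorem cobarD_insCyc_one {p q : ℤ} {x y : B.Cobar} (hx : x ∈ B.cobarGr p)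
    (hy : y ∈ B.cobarGr q) :
    B.cobarD (insCyc m S (q + 1) y x 1) + insCyc m S (q + 1) y (B.cobarD x) 1 -
        sg R p • insCyc m S q (B.cobarD y) x 1 =
      sg R ((p + 1) * (q + 1)) • (y * B.connesMoscovici m S x) - insertion m y x +
      sg R p • cyc m S x y := by
  have h := LinearMap.congr_fun (hB.cobarD_insCyc hx hy) 1
  simpa [lmul_apply, cobarD_one, ← connesMoscovici_apply] using h

/-- The boundaries of the two terms `insCyc` in `H` give both halves of the bracket, both parts of
`Δ(a b)`, the product `a Δ(b)`, and a product `b Δ(a)` in the wrong order. The boundary of `Δ(a){b}`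
replaces the latter by `Δ(a) b`. -/
theorem bracket_eq {p q : ℤ} {a b : B.Cobar} (ha : a ∈ B.cobarGr p) (hb : b ∈ B.cobarGr q) :
    insertion m b a - sg R ((p + 1) * (q + 1)) • insertion m a b =
      sg R p • (B.connesMoscovici m S (a * b) - B.connesMoscovici m S a * b -
        sg R p • (a * B.connesMoscovici m S b)) +
      (B.cobarD (bracketHomotopy m S a b) + bracketHomotopy m S (B.cobarD a) b -
        sg R p • bracketHomotopy m S a (B.cobarD b)) := by
  have hda := cobarD_mem hB.coalg ha
  have hdb := cobarD_mem hB.coalg hb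
  have h1 := hB.cobarD_insCyc_one ha hb
  have h2 := hB.cobarD_insCyc_one hb ha
  have h3 := hB.cobarD_insertion (hB.connesMoscovici_mem ha) hb
  rw [hB.cobarD_connesMoscovici] at h3
  rw [bracketHomotopy_of_mem ha hb, bracketHomotopy_of_mem hda hb, bracketHomotopy_of_mem ha hdb,
    connesMoscovici_mul ha hb]
  simp only [map_add, map_neg, map_smul, sub_add_cancel] at *
  have h2' := congrArg (fun z => sg R ((p + 1) * (q + 1)) • z) h2
  have hp : Even p ∨ ¬Even p := em _
  have hq : Even q ∨ ¬Even q := em _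
  clear ha hb hda hdb h2
  rcases hp with hp | hp <;> rcases hq with hq | hq <;>
  · simp only [sg_ite, Int.even_add, Int.even_mul, Int.not_even_one, hp, hq,
      iff_false, not_true, not_false_iff, if_true, if_false, or_true, or_false, or_self,
      one_smul, neg_smul] at *
    -- The coefficients mirror the three summands of `H`, in the four cases for the parities of `p`
    -- and `q`.
    linear_combination (norm := abel) h1 - h2' - h3

theorem singleLetter_barMul_ι (x : B.cobar.Red) (w : B.cobar.Bar) :
    B.singleLetter (B.cobar.barMul (B.brace m) (TensorAlgebra.ι R x) w) =
      B.brace m (B.cobar.Red.subtype x) w := by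
  have h := hB.isPreBrace_brace.barLetter_barMul (TensorAlgebra.ι R x) w
  rw [show B.cobar.barCounit (TensorAlgebra.ι R x) = 0 from algebraMapInv_ι _, zero_smul,
    zero_add] at h
  exact h.trans (congrArg (fun z => B.brace m z w) (singleLetter_ι x))

/-- The scalar part of `a`, which the definition of `E11` removes, does not matter: insertion into
`1` is zero. -/
theorem E11_barMul_brace (a b : B.Cobar) :
    B.cobar.E11 (B.cobar.barMul (B.brace m)) a b = insertion m b a := by
  have h := hB.singleLetter_barMul_ι (B.cobar.toRed a) (TensorAlgebra.ι R (B.cobar.toRed b))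
  refine h.trans ?_
  rw [subtype_toRed, ← insertion_apply, map_sub, map_smul, insertion_one, smul_zero, sub_zero]

theorem cobarIsHomotopyBVAlgebra : B.CobarIsHomotopyBVAlgebra m S := by
  refine ⟨B.cobar.barMul (B.brace m), bracketHomotopy m S, hB.singleLetter_barMul_ι, ?_⟩
  exact
    { hB.isHomotopyGAlgebra_cobar with
      Δ_mem := fun _ _ hx => hB.connesMoscovici_mem hx
      d_Δ := hB.cobarD_connesMoscovici
      Δ_Δ := hB.connesMoscovici_connesMoscovici
      H_mem := fun _ _ _ ha _ hb => hB.bracketHomotopy_mem ha hb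
      bracket := fun p q a ha b hb => by
        have h := hB.bracket_eq ha hb
        simp only [← units_smul_eq_sg] at h
        exact (congrArg₂ (fun x y : B.Cobar => x - Int.negOnePow ((p + 1) * (q + 1)) • y)
          (hB.E11_barMul_brace a b) (hB.E11_barMul_brace b a)).trans h }

end IsInvolutiveDGHopf

/-! ### Application to `Ω(C_{≤n})`. -/

variable {R : Type u} [CommRing R]

/-- The cobar construction of a homotopy G-coalgebra, with an involutive antipode. -/
theorem IsHomotopyGCoalgebra.isInvolutiveDGHopf {D : DGCoalgData.{u, v} R}
    {nabla : D.CobarCoproduct} (hD : D.IsHomotopyGCoalgebra nabla) {i : ℕ} (hi : 2 ≤ i)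
    (hred : D.IsReduced i) {N : ℕ} (hF : ∀ m, N < m → nabla.F m = 0)
    (hS : ∀ x : D.Red, nabla.antipode N (nabla.antipode N (TensorAlgebra.ι R x)) =
      TensorAlgebra.ι R x) :
    (D.cobarCoalg nabla).IsInvolutiveDGHopf (LinearMap.mul' R D.Cobar) (nabla.antipode N) where
  coalg := hD.bialgebra
  -- Here `i ≥ 2` is used: the letters have degree at least `2`, so the cobar construction has no
  -- elements of degree `1` and its own cobar construction is connected.
  reduced :=
    { neg := fun _ hk => CobarCoproduct.IsReduced.cobarGr_neg hred hk
      zero := CobarCoproduct.IsReduced.cobarGr_zero (by omega) hred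
      pos := fun _ h1 h2 => CobarCoproduct.IsReduced.cobarGr_pos hred (by omega) (by omega) }
  m_mem _ _ _ ha _ hb := mul_mem_tensorGr rfl ha hb
  m_assoc a b c := mul_assoc (G := D.Cobar) a b c
  one_m a := one_mul (M := D.Cobar) a
  m_one a := mul_one (M := D.Cobar) a
  counit_m := map_mul (TensorAlgebra.algebraMapInv : D.Cobar →ₐ[R] R)
  comul_m a b := toLin_mul nabla a b
  d_m a b := D.cobarD_mul a b
  antipode := CobarCoproduct.isAntipode hD hF
  S_m _ q a ha b hb := by
    have h := CobarCoproduct.antipode_mul (N := N) hD.toIsHirsch (k := q) a hb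
    rw [twist_of_mem _ _ (CobarCoproduct.antipode_mem hD.toIsHirsch ha), mul_smul_comm,
      mul_comm q] at h
    exact h
  S_S := CobarCoproduct.antipode_antipode hD.toIsHirsch hS

end DGCoalgData
end DoubleCobar

/-- Let `C` be an `i`-reduced homotopy G-coalgebra, `i ≥ 2`, such that `O_k = 0` whenever
`k i ≤ n - 1` (`k ≥ 2`). Then the homotopy G-coalgebra structure of `C` restricts to `C_{≤ n}`, the
antipode `S` of `Ω(C_{≤ n})` is involutive, and `Ω²(C_{≤ n})`, with the standard operations
`E_{1,k}` on the cobar construction of a bialgebra and with the Connes-Moscovici operator, is a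
homotopy BV-algebra. -/
theorem mainTheorem8 {R : Type u} [CommRing R] (C : DoubleCobar.DGCoalgData.{u, v} R)
    (nabla : C.CobarCoproduct) (hC : C.IsHomotopyGCoalgebra nabla)
    (i : ℕ) (hi : 2 ≤ i) (hred : C.IsReduced i) (n : ℕ)
    (hO : ∀ k : ℕ, 2 ≤ k → (k : ℤ) * (i : ℤ) ≤ (n : ℤ) - 1 → nabla.obstruction k = 0) :
    (C.trunc n).IsHomotopyGCoalgebra (nabla.trunc n) ∧
    C.PreservesTrunc nabla n ∧
    ∃ S : (C.trunc n).Cobar →ₗ[R] (C.trunc n).Cobar,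
      ((C.trunc n).cobarCoalg (nabla.trunc n)).IsAntipode
        (LinearMap.mul' R (C.trunc n).Cobar) S ∧
      S ∘ₗ S = LinearMap.id ∧
      ((C.trunc n).cobarCoalg (nabla.trunc n)).CobarIsHomotopyBVAlgebra
        (LinearMap.mul' R (C.trunc n).Cobar) S := by
  have hT := DoubleCobar.DGCoalgData.isHomotopyGCoalgebra_trunc hC n
  -- Since `C_{≤n}` has no elements of degree above `n`, the bound `N = n` cuts off no component of
  -- the antipode.
  have hF := DoubleCobar.DGCoalgData.F_eq_zero_of_bounded hT.toIsHirsch (N := n)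
    fun k hk => DoubleCobar.DGCoalgData.trunc_gr_eq_bot C n hk
  have hS := DoubleCobar.DGCoalgData.trunc_obstruction hC hred n hO
  have hB := hT.isInvolutiveDGHopf hi (hred.trunc n) hF hS
  exact ⟨hT, DoubleCobar.DGCoalgData.preservesTrunc hC.toIsHirsch n, _, hB.antipode,
    LinearMap.ext hB.S_S, hB.cobarIsHomotopyBVAlgebra⟩
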